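/- **Definitions.** Fix a set of atoms with an involution $a\mapsto\bar a$ such that $\bar a\neq a$ for all $a$. Formulae are built from the units $\mathsf f,\mathsf t$ and atoms by disjunction $[\alpha.\beta]$ and conjunction $(\alpha.\beta)$. An $\mathsf{SKS}$ *derivation* is a chain of inference steps, each an instance of a rule inside a context. The structural rules are $\mathsf{ai}{\downarrow}\colon\mathsf t\to[a.\bar a]$, $\mathsf{ai}{\uparrow}\colon(a.\bar a)\to\mathsf f$, $\mathsf{aw}{\downarrow}\colon\mathsf f\to a$, $\mathsf{aw}{\uparrow}\colon a\to\mathsf t$, $\mathsf{ac}{\downarrow}\colon[a.a]\to a$, $\mathsf{ac}{\uparrow}\colon a\to(a.a)$. The logical rules are switch $(\alpha.[\beta.\gamma])\to[(\alpha.\beta).\gamma]$, medial $[(\alpha.\beta).(\gamma.\delta)]\to([\alpha.\gamma].[\beta.\delta])$, and the rule $=$, which replaces one side of an equation by the other, for commutativity and associativity of both connectives, $[\alpha.\mathsf f]=\alpha$, $(\alpha.\mathsf t)=\alpha$, $[\mathsf t.\mathsf t]=\mathsf t$ and $(\mathsf f.\mathsf f)=\mathsf f$. An *atomic flow* is a finite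 directed acyclic graph whose vertices are labelled by $\mathsf{ai}{\downarrow}$ (interaction), $\mathsf{ai}{\uparrow}$ (cointeraction), $\mathsf{aw}{\downarrow},\mathsf{aw}{\uparrow}$ ((co)weakening), $\mathsf{ac}{\downarrow},\mathsf{ac}{\uparrow}$ ((co)contraction), with, respectively, $0,2,0,1,2,1$ upper (incoming) and $2,0,1,0,1,2$ lower (outgoing) edges; edges without a vertex above (below) are the upper (lower) edges of the flow; and a *polarity assignment* must exist, i.e. a map from edges to $\{-,+\}$ that is constant on the edges of each (co)contraction and takes both values on the edges of each (co)interaction. Every derivation has an associated flow, unique up to isomorphism: vertices are its structural steps, edges trace its atom occurrences, and its upper (lower) edges are the atom occurrences of the premiss (conclusion). A *path* is a sequence of consecutive edges that only goes down or only goes up. An *$\mathsf{ai}$-path* is a path, or is composed of two $\mathsf{ai}$-paths that meet at an interaction or cointeraction vertex, the two edges at the joint being different. An *$\mathsf{ai}$-cycle* is an $\mathsf{ai}$-path from a vertex to itself in which no edge appears twice. A *simple edge* goes from an interaction to a cointeraction; an $\mathsf{ai}$-cycle is *fragile* if it contains a simple edge; a flow is *cycle-free* if it has no $\mathsf{ai}$-cycle.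 The system $\mathsf c$ has three local rules on flows: (i) a contraction of edges $1,2$ whose lower edge enters a cointeraction with edge $3$ is replaced by a cocontraction of $3$ whose two lower edges enter two cointeractions, one with $1$ and one with $2$; (ii) the same rule upside down; (iii) a contraction of edges $1,2$ whose lower edge enters a cocontraction into edges $3,4$ is replaced by cocontractions of $1$ and of $2$, contractions into $3$ and into $4$, and one edge from each of these cocontractions to each of these contractions. The relation $\to_{\mathsf{bc}}$ between flows (with a bijection between their upper edges and one between their lower edges) is defined inductively. If $B$ has no fragile cycle, then $B\to_{\mathsf{bc}}B$. Suppose that $B$ has a simple edge $1$ that belongs to an $\mathsf{ai}$-cycle, let $2$ be the other edge of its interaction and $3$ the other edge of its cointeraction. Let $B'$ be $B$ without the edge $1$ and the cointeraction, with the interaction replaced by a weakening on $2$, so that $3$ is a lower edge of $B'$; let $B''$ be $B$ without the edge $1$ and the interaction, with the cointeraction replaced by a coweakening on $3$, so that $2$ is an upper edge of $B''$. If $B'\to_{\mathsf{bc}}D'$ and $B''\to_{\mathsf{bc}}D''$, then $B\to_{\mathsf{bc}}C$, where $C$ is composed of $D'$ and $D''$ by identifying the lower edge $3$ of $D'$ with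 the upper edge $2$ of $D''$, joining the two copies of each upper edge of $B$ by a cocontraction below a new upper edge, and joining the two copies of each lower edge of $B$ by a contraction above a new lower edge. *Algorithm $\mathsf{BC}$*, on a derivation $\Phi_0$ with flow $A_0$: (1) choose a polarity assignment for $A_0$ and apply rules of $\mathsf c$ to negative contraction and cocontraction vertices that belong to $\mathsf{ai}$-cycles (polarities being kept), until no such vertex is left; this gives a flow $A_1$ and a derivation $\Phi_1$ with flow $A_1$; (2) output a derivation $\Phi_2$ whose flow $A_2$ is such that $A_1\to_{\mathsf{bc}}A_2$. **Theorem.** Given any $\mathsf{SKS}$ derivation, algorithm $\mathsf{BC}$ produces a derivation with the same premiss and conclusion whose atomic flow is cycle-free. In detail, let $\Phi_0$ be an $\mathsf{SKS}$ derivation. It has an associated atomic flow, and for every flow $A_0$ associated with $\Phi_0$ and every polarity assignment for $A_0$: 1. there is no infinite chain of reductions as in step (1) from $A_0$, and after finitely many of them a further one is possible whenever some negative contraction or cocontraction vertex belongs to an $\mathsf{ai}$-cycle; 2. for every result $A_1$ of step (1), all $\mathsf{ai}$-cycles of $A_1$ are fragile, and there is a derivation $\Phi_1$ with flow $A_1$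 and with the premiss and conclusion of $\Phi_0$; 3. for every result $A_1$ of step (1) there is a flow $A_2$ with $A_1\to_{\mathsf{bc}}A_2$; every such $A_2$ is cycle-free, and for every $\Phi_1$ as in 2 there is a derivation $\Phi_2$ with flow $A_2$ and with the premiss and conclusion of $\Phi_0$. -/

import Mathlib

namespace AtomicFlows

universe u v

/-! ## Formulae and derivations -/

/-- A set of atoms with its duality, an involution that has no fixed point. -/
class DualAtoms (X : Type u) where
  bar : X → X
  bar_bar : ∀ a, bar (bar a) = a
  bar_ne : ∀ a, bar a ≠ a

open DualAtoms (bar)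

/-- Formulae over a set `X` of atoms: units, atoms, disjunctions and conjunctions. -/
inductive Formula (X : Type u) : Type u
  | ff : Formula X
  | tt : Formula X
  | atom (a : X) : Formula X
  | or (α β : Formula X) : Formula X
  | and (α β : Formula X) : Formula X

namespace Formula

/-- Renaming of the atoms. -/
def map {X : Type u} {Y : Type v} (f : X → Y) : Formula X → Formula Y
  | ff => ff
  | tt => tt
  | atom a => atom (f a)
  | or α β => or (α.map f) (β.map f)
  | and α β => and (α.map f) (β.map f)

/-- The atom occurrences of a formula, from left to right. -/
def atoms {X : Type u} : Formula X → List X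
  | ff => []
  | tt => []
  | atom a => [a]
  | or α β => α.atoms ++ β.atoms
  | and α β => α.atoms ++ β.atoms

end Formula

open Formula (ff tt atom or and)

/-- Instances of the logical rules switch and medial and of the rule `=`: its premiss and conclusion
are opposite sides of one of the equations for commutativity, associativity and units.
`Logical α β` is the type of the instances with premiss `α` and conclusion `β`. -/
inductive Logical {X : Type u} : Formula X → Formula X → Type u
  | switch (α β γ : Formula X) : Logical (and α (or β γ)) (or (and α β) γ)
  | medial (α β γ δ : Formula X) :
      Logical (or (and α β) (and γ δ)) (and (or α γ) (or β δ))
  | orComm (α β : Formula X) : Logical (or α β) (or β α)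
  | andComm (α β : Formula X) : Logical (and α β) (and β α)
  | orAssoc (α β γ : Formula X) : Logical (or (or α β) γ) (or α (or β γ))
  | orAssocInv (α β γ : Formula X) : Logical (or α (or β γ)) (or (or α β) γ)
  | andAssoc (α β γ : Formula X) : Logical (and (and α β) γ) (and α (and β γ))
  | andAssocInv (α β γ : Formula X) : Logical (and α (and β γ)) (and (and α β) γ)
  | orFalse (α : Formula X) : Logical (or α ff) α
  | orFalseInv (α : Formula X) : Logical α (or α ff)
  | andTrue (α : Formula X) : Logical (and α tt) α
  | andTrueInv (α : Formula X) : Logical α (and α tt)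
  | orTrueTrue : Logical (or tt tt) tt
  | orTrueTrueInv : Logical tt (or tt tt)
  | andFalseFalse : Logical (and ff ff) ff
  | andFalseFalseInv : Logical ff (and ff ff)

/-- Instances of the structural rules of SKS, which are atomic. -/
inductive Structural {X : Type u} [DualAtoms X] : Formula X → Formula X → Type u
  | aiDown (a : X) : Structural tt (or (atom a) (atom (bar a)))
  | aiUp (a : X) : Structural (and (atom a) (atom (bar a))) ff
  | awDown (a : X) : Structural ff (atom a)
  | awUp (a : X) : Structural (atom a) tt
  | acDown (a : X) : Structural (or (atom a) (atom a)) (atom a)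
  | acUp (a : X) : Structural (atom a) (and (atom a) (atom a))

/-- Inference steps: a rule instance inside a context. `S` is the family of the structural rule
instances; the last four constructors build the context. -/
inductive Step {X : Type u} (S : Formula X → Formula X → Type u) :
    Formula X → Formula X → Type u
  | structural {α β : Formula X} (r : S α β) : Step S α β
  | logical {α β : Formula X} (r : Logical α β) : Step S α β
  | orLeft {α β : Formula X} (s : Step S α β) (γ : Formula X) : Step S (or α γ) (or β γ)
  | orRight (γ : Formula X) {α β : Formula X} (s : Step S α β) : Step S (or γ α) (or γ β)
  | andLeft {α β : Formula X} (s : Step S α β) (γ : Formula X) : Step S (and α γ) (and β γ)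
  | andRight (γ : Formula X) {α β : Formula X} (s : Step S α β) : Step S (and γ α) (and γ β)

/-- Chains of inference steps. -/
inductive Chain {X : Type u} (S : Formula X → Formula X → Type u) :
    Formula X → Formula X → Type u
  | nil (α : Formula X) : Chain S α α
  | cons {α β γ : Formula X} (s : Step S α β) (c : Chain S β γ) : Chain S α γ

/-- SKS derivations. -/
structure SKSDerivation (X : Type u) [DualAtoms X] where
  premiss : Formula X
  conclusion : Formula X
  steps : Chain (Structural (X := X)) premiss conclusion

/-! ## Atomic flows -/

/-- The six labels of vertices. -/
inductive Label
  | aiDown | aiUp | awDown | awUp | acDown | acUp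
  deriving DecidableEq

namespace Label

/-- The number of lower edges of a vertex with the given label. -/
def lowerCard : Label → ℕ
  | aiDown => 2 | aiUp => 0 | awDown => 1 | awUp => 0 | acDown => 1 | acUp => 2

/-- The number of upper edges of a vertex with the given label. -/
def upperCard : Label → ℕ
  | aiDown => 0 | aiUp => 2 | awDown => 0 | awUp => 1 | acDown => 2 | acUp => 1

/-- Interaction and cointeraction. -/
def IsInteraction (l : Label) : Prop := l = aiDown ∨ l = aiUp

/-- Contraction and cocontraction. -/
def IsContraction (l : Label) : Prop := l = acDown ∨ l = acUp

/-- The label upside down. -/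
def flip : Label → Label
  | aiDown => aiUp | aiUp => aiDown | awDown => awUp | awUp => awDown
  | acDown => acUp | acUp => acDown

end Label

/-- The two polarities. -/
inductive Polarity
  | neg | pos

/-- The data of an atomic flow whose upper edges are named by the elements of `I` and whose lower
edges are named by the elements of `J`. The special vertex `⊤` above the upper edges is split into
one end `Sum.inr i` for every name, and likewise the special vertex `⊥`; so the one-to-one maps
between the upper (lower) edges of two flows that belong to a reduction are given by the names. -/
structure FlowGraph (I J : Type) where
  /-- vertices -/
  V : Type
  /-- edges -/
  E : Type
  label : V → Label
  up : E → V ⊕ I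
  lo : E → V ⊕ J

namespace FlowGraph

variable {I J : Type}

/-- The set of lower edges of a vertex. -/
def lowerEdges (A : FlowGraph I J) (ν : A.V) : Set A.E := {ε | A.up ε = Sum.inl ν}

/-- The set of upper edges of a vertex. -/
def upperEdges (A : FlowGraph I J) (ν : A.V) : Set A.E := {ε | A.lo ε = Sum.inl ν}

/-- The set of edges of a vertex. -/
def edgesAt (A : FlowGraph I J) (ν : A.V) : Set A.E := A.lowerEdges ν ∪ A.upperEdges ν

/-- The edge `ε'` starts at the vertex where the edge `ε` ends. -/
def Below (A : FlowGraph I J) (ε ε' : A.E) : Prop :=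
  ∃ ν : A.V, A.lo ε = Sum.inl ν ∧ A.up ε' = Sum.inl ν

/-- Polarity assignments. -/
def IsPolarity (A : FlowGraph I J) (π : A.E → Polarity) : Prop :=
  ∀ ν : A.V,
    ((A.label ν).IsContraction →
      π '' A.edgesAt ν = {Polarity.neg} ∨ π '' A.edgesAt ν = {Polarity.pos}) ∧
    ((A.label ν).IsInteraction → π '' A.edgesAt ν = {Polarity.neg, Polarity.pos})

/-- Isomorphisms of flows; they keep the names of the upper and lower edges. -/
structure Iso (A B : FlowGraph I J) where
  vert : A.V ≃ B.V
  edge : A.E ≃ B.E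
  label_vert : ∀ ν, B.label (vert ν) = A.label ν
  up_edge : ∀ ε, B.up (edge ε) = Sum.map vert id (A.up ε)
  lo_edge : ∀ ε, B.lo (edge ε) = Sum.map vert id (A.lo ε)

/-- The graph upside down. -/
def flip (A : FlowGraph I J) : FlowGraph J I where
  V := A.V
  E := A.E
  label ν := (A.label ν).flip
  up := A.lo
  lo := A.up

/-! ### Paths and cycles -/

/-- `A.IsDownPath ν l ν'`: the list `l` of edges is a path that goes down from `ν` to `ν'`. -/
inductive IsDownPath (A : FlowGraph I J) : A.V → List A.E → A.V → Prop
  | single {ν ν' : A.V} {ε : A.E} (hu : A.up ε = Sum.inl ν) (hl : A.lo ε = Sum.inl ν') :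
      IsDownPath A ν [ε] ν'
  | cons {ν μ ν' : A.V} {ε : A.E} {l : List A.E} (hu : A.up ε = Sum.inl ν)
      (hl : A.lo ε = Sum.inl μ) (h : IsDownPath A μ l ν') : IsDownPath A ν (ε :: l) ν'

/-- Paths from `ν` to `ν'`: they only go down or only go up. -/
def IsPath (A : FlowGraph I J) (ν : A.V) (l : List A.E) (ν' : A.V) : Prop :=
  A.IsDownPath ν l ν' ∨ A.IsDownPath ν' l.reverse ν

/-- ai-paths from `ν` to `ν'`: paths joined at interaction and cointeraction vertices, where the
edge before and the edge after the joint are different. -/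
inductive IsAiPath (A : FlowGraph I J) : A.V → List A.E → A.V → Prop
  | path {ν ν' : A.V} {l : List A.E} (h : A.IsPath ν l ν') : IsAiPath A ν l ν'
  | join {ν μ ν' : A.V} {l l' : List A.E} (hμ : (A.label μ).IsInteraction)
      (h : IsAiPath A ν l μ) (h' : IsAiPath A μ l' ν') (hne : l.getLast? ≠ l'.head?) :
      IsAiPath A ν (l ++ l') ν'

/-- ai-cycles: ai-paths from a vertex to itself in which no edge appears twice. -/
def IsAiCycle (A : FlowGraph I J) (l : List A.E) : Prop :=
  (∃ ν : A.V, A.IsAiPath ν l ν) ∧ l.Nodup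

/-- Simple edges: from an interaction to a cointeraction vertex. -/
def IsSimpleEdge (A : FlowGraph I J) (ε : A.E) : Prop :=
  ∃ ν ν' : A.V, A.up ε = Sum.inl ν ∧ A.label ν = Label.aiDown ∧
    A.lo ε = Sum.inl ν' ∧ A.label ν' = Label.aiUp

/-- Fragile cycles: ai-cycles that contain a simple edge. -/
def IsFragileCycle (A : FlowGraph I J) (l : List A.E) : Prop :=
  A.IsAiCycle l ∧ ∃ ε ∈ l, A.IsSimpleEdge ε

/-- Flows without ai-cycles. -/
def CycleFree (A : FlowGraph I J) : Prop := ∀ l, ¬ A.IsAiCycle l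

/-- The edge belongs to an ai-cycle. -/
def EdgeOnCycle (A : FlowGraph I J) (ε : A.E) : Prop := ∃ l, A.IsAiCycle l ∧ ε ∈ l

/-- The vertex belongs to an ai-cycle. -/
def VertexOnCycle (A : FlowGraph I J) (ν : A.V) : Prop := ∃ ε ∈ A.edgesAt ν, A.EdgeOnCycle ε

end FlowGraph

/-- Atomic flows with upper edges named by `I` and lower edges named by `J`. -/
structure AtomicFlow (I J : Type) extends FlowGraph I J where
  finite_V : Finite V
  finite_E : Finite E
  /-- every name in `I` is the name of exactly one upper edge -/
  upper_named : ∀ i : I, ∃! ε, up ε = Sum.inr i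
  /-- every name in `J` is the name of exactly one lower edge -/
  lower_named : ∀ j : J, ∃! ε, lo ε = Sum.inr j
  card_lower : ∀ ν, (toFlowGraph.lowerEdges ν).ncard = (label ν).lowerCard
  card_upper : ∀ ν, (toFlowGraph.upperEdges ν).ncard = (label ν).upperCard
  acyclic : ∀ ε, ¬ Relation.TransGen toFlowGraph.Below ε ε
  polarizable : ∃ π, toFlowGraph.IsPolarity π

/-- Atomic flows with a polarity assignment. -/
structure PolarizedFlow (I J : Type) extends AtomicFlow I J where
  polarity : E → Polarity
  isPolarity : toFlowGraph.IsPolarity polarity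

/-! ## The atomic flow of a derivation -/

section Association

variable {X : Type u} [DualAtoms X] {I J : Type}

/-- Structural rule instances whose atom occurrences are decorated with edges of `A` and which are
placed at a vertex of `A` with the corresponding label; an atom occurrence in the premiss of the
instance is an upper edge of the vertex, one in the conclusion is a lower edge. -/
inductive Decorated (X : Type u) [DualAtoms X] (A : FlowGraph I J) :
    Formula (X × A.E) → Formula (X × A.E) → Type u
  | aiDown (ν : A.V) (a : X) (ε₁ ε₂ : A.E) (hν : A.label ν = Label.aiDown) (hne : ε₁ ≠ ε₂)
      (h₁ : A.up ε₁ = Sum.inl ν) (h₂ : A.up ε₂ = Sum.inl ν) :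
      Decorated X A tt (or (atom (a, ε₁)) (atom (bar a, ε₂)))
  | aiUp (ν : A.V) (a : X) (ε₁ ε₂ : A.E) (hν : A.label ν = Label.aiUp) (hne : ε₁ ≠ ε₂)
      (h₁ : A.lo ε₁ = Sum.inl ν) (h₂ : A.lo ε₂ = Sum.inl ν) :
      Decorated X A (and (atom (a, ε₁)) (atom (bar a, ε₂))) ff
  | awDown (ν : A.V) (a : X) (ε : A.E) (hν : A.label ν = Label.awDown)
      (h : A.up ε = Sum.inl ν) :
      Decorated X A ff (atom (a, ε))
  | awUp (ν : A.V) (a : X) (ε : A.E) (hν : A.label ν = Label.awUp)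
      (h : A.lo ε = Sum.inl ν) :
      Decorated X A (atom (a, ε)) tt
  | acDown (ν : A.V) (a : X) (ε₁ ε₂ ε₃ : A.E) (hν : A.label ν = Label.acDown) (hne : ε₁ ≠ ε₂)
      (h₁ : A.lo ε₁ = Sum.inl ν) (h₂ : A.lo ε₂ = Sum.inl ν) (h₃ : A.up ε₃ = Sum.inl ν) :
      Decorated X A (or (atom (a, ε₁)) (atom (a, ε₂))) (atom (a, ε₃))
  | acUp (ν : A.V) (a : X) (ε₁ ε₂ ε₃ : A.E) (hν : A.label ν = Label.acUp) (hne : ε₂ ≠ ε₃)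
      (h₁ : A.lo ε₁ = Sum.inl ν) (h₂ : A.up ε₂ = Sum.inl ν) (h₃ : A.up ε₃ = Sum.inl ν) :
      Decorated X A (atom (a, ε₁)) (and (atom (a, ε₂)) (atom (a, ε₃)))

/-- Forget the decoration of a formula. -/
def Formula.erase {E : Type} (φ : Formula (X × E)) : Formula X := φ.map Prod.fst

/-- Forget the decoration of a structural rule instance. -/
def Decorated.erase {A : FlowGraph I J} {φ ψ : Formula (X × A.E)} :
    Decorated X A φ ψ → Structural φ.erase ψ.erase
  | .aiDown _ a _ _ _ _ _ _ => .aiDown a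
  | .aiUp _ a _ _ _ _ _ _ => .aiUp a
  | .awDown _ a _ _ _ => .awDown a
  | .awUp _ a _ _ _ => .awUp a
  | .acDown _ a _ _ _ _ _ _ _ _ => .acDown a
  | .acUp _ a _ _ _ _ _ _ _ _ => .acUp a

/-- The vertex at which a decorated structural rule instance is placed. -/
def Decorated.vertex {A : FlowGraph I J} {φ ψ : Formula (X × A.E)} :
    Decorated X A φ ψ → A.V
  | .aiDown ν _ _ _ _ _ _ _ => ν
  | .aiUp ν _ _ _ _ _ _ _ => ν
  | .awDown ν _ _ _ _ => ν
  | .awUp ν _ _ _ _ => ν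
  | .acDown ν _ _ _ _ _ _ _ _ _ => ν
  | .acUp ν _ _ _ _ _ _ _ _ _ => ν

/-- Forget the decoration of a logical rule instance. -/
def Logical.erase {E : Type} {φ ψ : Formula (X × E)} :
    Logical φ ψ → Logical φ.erase ψ.erase
  | .switch α β γ => .switch α.erase β.erase γ.erase
  | .medial α β γ δ => .medial α.erase β.erase γ.erase δ.erase
  | .orComm α β => .orComm α.erase β.erase
  | .andComm α β => .andComm α.erase β.erase
  | .orAssoc α β γ => .orAssoc α.erase β.erase γ.erase
  | .orAssocInv α β γ => .orAssocInv α.erase β.erase γ.erase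
  | .andAssoc α β γ => .andAssoc α.erase β.erase γ.erase
  | .andAssocInv α β γ => .andAssocInv α.erase β.erase γ.erase
  | .orFalse α => .orFalse α.erase
  | .orFalseInv α => .orFalseInv α.erase
  | .andTrue α => .andTrue α.erase
  | .andTrueInv α => .andTrueInv α.erase
  | .orTrueTrue => .orTrueTrue
  | .orTrueTrueInv => .orTrueTrueInv
  | .andFalseFalse => .andFalseFalse
  | .andFalseFalseInv => .andFalseFalseInv

/-- Forget the decoration of an inference step. -/
def Step.erase {A : FlowGraph I J} {φ ψ : Formula (X × A.E)} :
    Step (Decorated X A) φ ψ → Step (Structural (X := X)) φ.erase ψ.erase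
  | .structural r => .structural r.erase
  | .logical r => .logical r.erase
  | .orLeft s γ => .orLeft s.erase γ.erase
  | .orRight γ s => .orRight γ.erase s.erase
  | .andLeft s γ => .andLeft s.erase γ.erase
  | .andRight γ s => .andRight γ.erase s.erase

/-- The vertex of an inference step, if the step is structural. -/
def Step.vertices {A : FlowGraph I J} {φ ψ : Formula (X × A.E)} :
    Step (Decorated X A) φ ψ → List A.V
  | .structural r => [r.vertex]
  | .logical _ => []
  | .orLeft s _ => s.vertices
  | .orRight _ s => s.vertices
  | .andLeft s _ => s.vertices
  | .andRight _ s => s.vertices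

/-- Forget the decoration of a chain of inference steps. -/
def Chain.erase {A : FlowGraph I J} {φ ψ : Formula (X × A.E)} :
    Chain (Decorated X A) φ ψ → Chain (Structural (X := X)) φ.erase ψ.erase
  | .nil α => .nil α.erase
  | .cons s c => .cons s.erase c.erase

/-- The vertices of the structural steps of a chain, in order. -/
def Chain.vertices {A : FlowGraph I J} {φ ψ : Formula (X × A.E)} :
    Chain (Decorated X A) φ ψ → List A.V
  | .nil _ => []
  | .cons s c => s.vertices ++ c.vertices

/-- `Φ.HasFlow A`: the flow `A` is associated with the derivation `Φ`. All atom occurrences of `Φ`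
can be decorated with edges of `A`, so that logical steps and contexts keep the decoration of their
atoms, structural steps correspond one-to-one to the vertices of `A`, the atom occurrences of the
premiss correspond one-to-one to the upper edges of `A` and those of the conclusion to the lower
edges of `A`. This determines `A` up to isomorphism and names of upper and lower edges. -/
def SKSDerivation.HasFlow (Φ : SKSDerivation X) (A : AtomicFlow I J) : Prop :=
  ∃ (φ ψ : Formula (X × A.E)) (c : Chain (Decorated X A.toFlowGraph) φ ψ),
    Φ = ⟨φ.erase, ψ.erase, c.erase⟩ ∧
    c.vertices.Nodup ∧ (∀ ν, ν ∈ c.vertices) ∧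
    (φ.atoms.map Prod.snd).Nodup ∧
    (∀ ε, ε ∈ φ.atoms.map Prod.snd ↔ ∃ i, A.up ε = Sum.inr i) ∧
    (ψ.atoms.map Prod.snd).Nodup ∧
    (∀ ε, ε ∈ ψ.atoms.map Prod.snd ↔ ∃ j, A.lo ε = Sum.inr j)

/-- Two derivations have the same premiss and the same conclusion. -/
def SKSDerivation.SameEnds (Φ Ψ : SKSDerivation X) : Prop :=
  Φ.premiss = Ψ.premiss ∧ Φ.conclusion = Ψ.conclusion

end Association

/-! ## Rewriting by the system c -/

/-- A context for a subgraph with upper edges `P` and lower edges `Q` inside a flow: the vertices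
and edges outside of the subgraph and the ends where the edges of the subgraph are attached. -/
structure FlowContext (P Q I J : Type) where
  V : Type
  E : Type
  label : V → Label
  up : E → V ⊕ I
  lo : E → V ⊕ J
  attachUp : P → V ⊕ I
  attachLo : Q → V ⊕ J

/-- The graph obtained by putting `A` into the context `K`. -/
def FlowContext.plug {P Q I J : Type} (K : FlowContext P Q I J) (A : FlowGraph P Q) :
    FlowGraph I J where
  V := A.V ⊕ K.V
  E := A.E ⊕ K.E
  label := Sum.elim A.label K.label
  up := Sum.elim
    (fun ε => Sum.elim (fun ν => Sum.inl (Sum.inl ν))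
      (fun p => Sum.map Sum.inr id (K.attachUp p)) (A.up ε))
    (fun ε => Sum.map Sum.inr id (K.up ε))
  lo := Sum.elim
    (fun ε => Sum.elim (fun ν => Sum.inl (Sum.inl ν))
      (fun q => Sum.map Sum.inr id (K.attachLo q)) (A.lo ε))
    (fun ε => Sum.map Sum.inr id (K.lo ε))

/-- Left-hand side of contraction over cointeraction: the contraction `0` of the upper edges `0`
and `1` has the lower edge `3`, which ends with the upper edge `2` in the cointeraction `1`. -/
def ciLeft : FlowGraph (Fin 3) (Fin 0) where
  V := Fin 2
  E := Fin 4
  label := ![.acDown, .aiUp]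
  up := ![.inr 0, .inr 1, .inr 2, .inl 0]
  lo := ![.inl 0, .inl 0, .inl 1, .inl 1]

/-- Right-hand side of contraction over cointeraction: the cocontraction `0` of the upper edge `2`
has the lower edges `3` and `4`, which end in the cointeractions `1` and `2` with the upper edges
`0` and `1`. -/
def ciRight : FlowGraph (Fin 3) (Fin 0) where
  V := Fin 3
  E := Fin 5
  label := ![.acUp, .aiUp, .aiUp]
  up := ![.inr 0, .inr 1, .inr 2, .inl 0, .inl 0]
  lo := ![.inl 1, .inl 2, .inl 0, .inl 1, .inl 2]

/-- Left-hand side of contraction over cocontraction: the contraction `0` of the upper edges `0`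
and `1` and the cocontraction `1` with the lower edges `2` and `3` are joined by the edge `4`. -/
def ccLeft : FlowGraph (Fin 2) (Fin 2) where
  V := Fin 2
  E := Fin 5
  label := ![.acDown, .acUp]
  up := ![.inr 0, .inr 1, .inl 1, .inl 1, .inl 0]
  lo := ![.inl 0, .inl 0, .inr 0, .inr 1, .inl 1]

/-- Right-hand side of contraction over cocontraction: each of the cocontractions `0` and `1` of
the upper edges is joined by an edge to each of the contractions `2` and `3` above the lower
edges. -/
def ccRight : FlowGraph (Fin 2) (Fin 2) where
  V := Fin 4
  E := Fin 8
  label := ![.acUp, .acUp, .acDown, .acDown]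
  up := ![.inr 0, .inr 1, .inl 2, .inl 3, .inl 0, .inl 0, .inl 1, .inl 1]
  lo := ![.inl 0, .inl 1, .inr 0, .inr 1, .inl 2, .inl 3, .inl 2, .inl 3]

/-- The three reduction rules of the flow rewriting system c: contraction over cointeraction, its
dual interaction over cocontraction, and contraction over cocontraction. -/
inductive CRule : {P Q : Type} → FlowGraph P Q → FlowGraph P Q → Prop
  | ci : CRule ciLeft ciRight
  | ic : CRule ciLeft.flip ciRight.flip
  | cc : CRule ccLeft ccRight

/-- A negative contraction or cocontraction vertex that belongs to an ai-cycle. -/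
def PolarizedFlow.IsNegativeOnCycle {I J : Type} (A : PolarizedFlow I J) (ν : A.V) : Prop :=
  (A.label ν).IsContraction ∧ (∀ ε ∈ A.edgesAt ν, A.polarity ε = Polarity.neg) ∧
    A.VertexOnCycle ν

/-- One reduction by a rule of c over a negative contraction or cocontraction vertex that belongs
to an ai-cycle. A subgraph `L` of `A`, which contains such a vertex, is replaced by `R`. The edges
outside of the subgraph and its upper and lower edges keep their polarities. -/
def NegativeCStep {I J : Type} (A B : PolarizedFlow I J) : Prop :=
  ∃ (P Q : Type) (L R : FlowGraph P Q) (K : FlowContext P Q I J)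
    (f : (K.plug L).Iso A.toFlowGraph) (g : (K.plug R).Iso B.toFlowGraph),
    CRule L R ∧
    (∃ ν : L.V, A.IsNegativeOnCycle (f.vert (Sum.inl ν))) ∧
    (∀ ε : K.E, B.polarity (g.edge (Sum.inr ε)) = A.polarity (f.edge (Sum.inr ε))) ∧
    (∀ (p : P) (ε : L.E) (ε' : R.E), L.up ε = Sum.inr p → R.up ε' = Sum.inr p →
      B.polarity (g.edge (Sum.inl ε')) = A.polarity (f.edge (Sum.inl ε))) ∧
    (∀ (q : Q) (ε : L.E) (ε' : R.E), L.lo ε = Sum.inr q → R.lo ε' = Sum.inr q →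
      B.polarity (g.edge (Sum.inl ε')) = A.polarity (f.edge (Sum.inl ε)))

/-! ## The reduction bc -/

section BreakCycles

variable {I J : Type}

/-- The flow `B` with an evidenced simple edge, where `A` is the rest of it: a new edge goes from a
new interaction vertex `false` to a new cointeraction vertex `true`; the other edge of the
interaction is the upper edge `none` of `A` and the other edge of the cointeraction is the lower
edge `none` of `A`. -/
def FlowGraph.withSimpleEdge (A : FlowGraph (Option I) (Option J)) : FlowGraph I J where
  V := A.V ⊕ Bool
  E := A.E ⊕ Unit
  label := Sum.elim A.label (fun b => if b then Label.aiUp else Label.aiDown)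
  up := Sum.elim
    (fun ε => Sum.elim (fun ν => Sum.inl (Sum.inl ν))
      (fun o => o.elim (Sum.inl (Sum.inr false)) Sum.inr) (A.up ε))
    (fun _ => Sum.inl (Sum.inr false))
  lo := Sum.elim
    (fun ε => Sum.elim (fun ν => Sum.inl (Sum.inl ν))
      (fun o => o.elim (Sum.inl (Sum.inr true)) Sum.inr) (A.lo ε))
    (fun _ => Sum.inl (Sum.inr true))

/-- The flow `B'`: a new weakening vertex is put on the upper edge `none` of `A`. -/
def FlowGraph.withWeakening (A : FlowGraph (Option I) (Option J)) :
    FlowGraph I (Option J) where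
  V := A.V ⊕ Unit
  E := A.E
  label := Sum.elim A.label (fun _ => Label.awDown)
  up ε := Sum.elim (fun ν => Sum.inl (Sum.inl ν))
    (fun o => o.elim (Sum.inl (Sum.inr ())) Sum.inr) (A.up ε)
  lo ε := Sum.map Sum.inl id (A.lo ε)

/-- The flow `B''`: a new coweakening vertex is put on the lower edge `none` of `A`. -/
def FlowGraph.withCoweakening (A : FlowGraph (Option I) (Option J)) :
    FlowGraph (Option I) J where
  V := A.V ⊕ Unit
  E := A.E
  label := Sum.elim A.label (fun _ => Label.awUp)
  up ε := Sum.map Sum.inl id (A.up ε)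
  lo ε := Sum.elim (fun ν => Sum.inl (Sum.inl ν))
    (fun o => o.elim (Sum.inl (Sum.inr ())) Sum.inr) (A.lo ε)

/-- The upper edge with a given name. -/
noncomputable def AtomicFlow.upperEdge (A : AtomicFlow I J) (i : I) : A.E := (A.upper_named i).choose

/-- The flow `C` composed of `D₁` above `D₂`. The lower edge `none` of `D₁` is identified with the
upper edge `none` of `D₂` (only the former is kept as an element of the set of edges). For every
`i : I` a new upper edge ends in a new cocontraction, whose lower edges are the upper edges `i` of
`D₁` and of `D₂`; for every `j : J` a new lower edge starts in a new contraction, whose upper edges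
are the lower edges `j` of `D₁` and of `D₂`. -/
noncomputable def AtomicFlow.stack (D₁ : AtomicFlow I (Option J)) (D₂ : AtomicFlow (Option I) J) :
    FlowGraph I J where
  V := (D₁.V ⊕ D₂.V) ⊕ (I ⊕ J)
  E := (D₁.E ⊕ {ε : D₂.E // D₂.up ε ≠ Sum.inr none}) ⊕ (I ⊕ J)
  label := Sum.elim (Sum.elim D₁.label D₂.label)
    (Sum.elim (fun _ => Label.acUp) (fun _ => Label.acDown))
  up
    | .inl (.inl ε) =>
      match D₁.up ε with
      | .inl ν => .inl (.inl (.inl ν))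
      | .inr i => .inl (.inr (.inl i))
    | .inl (.inr ⟨ε, hε⟩) =>
      match h : D₂.up ε with
      | .inl ν => .inl (.inl (.inr ν))
      | .inr (some i) => .inl (.inr (.inl i))
      | .inr none => absurd h hε
    | .inr (.inl i) => .inr i
    | .inr (.inr j) => .inl (.inr (.inr j))
  lo
    | .inl (.inl ε) =>
      match D₁.lo ε with
      | .inl ν => .inl (.inl (.inl ν))
      | .inr (some j) => .inl (.inr (.inr j))
      | .inr none =>
        match D₂.lo (D₂.upperEdge none) with
        | .inl ν => .inl (.inl (.inr ν))
        | .inr j => .inl (.inr (.inr j))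
    | .inl (.inr ⟨ε, _⟩) =>
      match D₂.lo ε with
      | .inl ν => .inl (.inl (.inr ν))
      | .inr j => .inl (.inr (.inr j))
    | .inr (.inl i) => .inl (.inr (.inl i))
    | .inr (.inr j) => .inr j

/-- The reduction bc, on flows up to isomorphism. In the case `step`, the simple edge that is
evidenced in `B` belongs to an ai-cycle of `B`. -/
inductive BreakCycles : {I J : Type} → AtomicFlow I J → AtomicFlow I J → Prop
  | done {I J : Type} {B C : AtomicFlow I J} (h : ∀ l, ¬ B.IsFragileCycle l)
      (f : B.toFlowGraph.Iso C.toFlowGraph) : BreakCycles B C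
  | step {I J : Type} {B C : AtomicFlow I J} (A : FlowGraph (Option I) (Option J))
      {B₁ D₁ : AtomicFlow I (Option J)} {B₂ D₂ : AtomicFlow (Option I) J}
      (f : A.withSimpleEdge.Iso B.toFlowGraph) (hcycle : B.EdgeOnCycle (f.edge (Sum.inr ())))
      (f₁ : A.withWeakening.Iso B₁.toFlowGraph) (f₂ : A.withCoweakening.Iso B₂.toFlowGraph)
      (h₁ : BreakCycles B₁ D₁) (h₂ : BreakCycles B₂ D₂)
      (g : (D₁.stack D₂).Iso C.toFlowGraph) : BreakCycles B C

end BreakCycles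

end AtomicFlows

open AtomicFlows

/-! Throughout, a polarity assignment is used to orient ai-paths: positive edges are traversed
downwards and negative edges upwards. At an interaction or cointeraction exactly one edge then
arrives and one leaves, so every ai-path is a directed walk, in one of its two directions, and the
edges on ai-cycles are the edges on cycles of the relation `FlowGraph.Next` of succession
(`FlowGraph.edgeOnCycle_iff`, `FlowGraph.cycleFree_iff`).

*Fragility.* A cycle has a negative edge, because otherwise it only goes down. If no negative
contraction or cocontraction is on a cycle, then such an edge leads from an interaction to a
cointeraction (`PolarizedFlow.isFragileCycle`).

*Step (1).* If a negative (co)contraction is on a cycle, then a lowest negative contraction on a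
cycle sits on a cocontraction or a cointeraction, or, in the absence of contractions, a highest
cocontraction sits below an interaction; each of these pairs is a redex
(`PolarizedFlow.exists_negativeCStep`). The reduction terminates (`not_exists_chain_negativeCStep`)
because it decreases the number of negative contractions and cocontractions plus three times the
number of downward paths from a negative contraction to a negative cocontraction. These paths are
not counted directly: any function on edges that bounds the number of paths to cocontractions
(`FlowGraph.IsPotential`) serves for the measure, and it can be carried over along a reduction.

*Breaking cycles.* The flow `C` in a step of bc consists of two flows `D'` and `D''` that share a
single edge, surrounded by contractions and cocontractions whose new edges cannot lie on a cycle. So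
rank functions for `D'` and `D''`, shifted to agree on the shared edge, combine to one for `C`, and
`C` is cycle-free (`BreakCycles.cycleFree`). For the induction, breaking a simple edge creates no
cycle and keeps the remaining ones fragile. The recursion ends because every call deletes an edge;
the composed flow has a polarity assignment because the two polarities of the shared edge agree,
both being opposite to that of the deleted edge (`exists_breakCycles`).

*Derivations.* A derivation with flow `A` is represented as a derivation on formulae whose atoms are
the edges of `A`, together with the multiset of the vertices of its structural steps (`Der`,
`FlowGraph.Derivable`); the two notions are translated into each other by
`SKSDerivation.HasFlow.derivable` and `FlowGraph.Derivable.exists_hasFlow`. Changes of the flow then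
become substitutions for edges. For the system c, the edge between the two vertices of the redex is
replaced by the disjunction or conjunction of two other edges, and the right-hand side of the rule
is derived by switch or medial (`NegativeCStep.derivable`). For bc, the simple edge is replaced by
true or by false, and the second atom of the vertex that disappears is moved by switch out of its
context into the conclusion or into the premiss (`FlowGraph.Derivable.withSimpleEdge`); the two
derivations `α → [β.a]` and `(α.a) → β` obtained in this way are composed to
`α → (α.α) → ([β.a].α) → [β.(α.a)] → [β.β] → β` (`FlowGraph.Derivable.stack`,
`BreakCycles.derivable`).

Finally, every derivation has a flow (`SKSDerivation.exists_hasFlow`): its atom occurrences are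
decorated with edges from the conclusion upwards, each structural step adding a vertex on top of the
flow. A polarity assignment comes from a choice of one atom in each dual pair. -/

namespace AtomicFlows

universe u v w

open AtomicFlows.DualAtoms (bar)
open AtomicFlows.Formula (ff tt atom or and)

/-! ### Substitution in formulae -/

namespace Formula

variable {X : Type u} {Y : Type v} {Z : Type w}

/-- Substitution of formulae for atoms. -/
def subst (σ : X → Formula Y) : Formula X → Formula Y
  | ff => ff
  | tt => tt
  | atom a => σ a
  | or α β => or (α.subst σ) (β.subst σ)
  | and α β => and (α.subst σ) (β.subst σ)

theorem subst_congr {σ τ : X → Formula Y} {α : Formula X} (h : ∀ a ∈ α.atoms, σ a = τ a) :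
    α.subst σ = α.subst τ := by
  induction α with
  | ff => rfl
  | tt => rfl
  | atom a => exact h a (by simp [atoms])
  | or α β iα iβ | and α β iα iβ =>
    simp only [atoms, List.mem_append] at h
    simp only [subst]
    rw [iα fun a ha => h a (.inl ha), iβ fun a ha => h a (.inr ha)]

theorem subst_atom (f : X → Y) (α : Formula X) : α.subst (fun a => atom (f a)) = α.map f := by
  induction α with
  | ff => rfl
  | tt => rfl
  | atom a => rfl
  | or α β iα iβ | and α β iα iβ => simp only [subst, map, iα, iβ]

theorem subst_map (f : X → Y) (σ : Y → Formula Z) (α : Formula X) :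
    (α.map f).subst σ = α.subst (fun a => σ (f a)) := by
  induction α with
  | ff => rfl
  | tt => rfl
  | atom a => rfl
  | or α β iα iβ | and α β iα iβ => simp only [subst, map, iα, iβ]

theorem map_map (f : X → Y) (g : Y → Z) (α : Formula X) :
    (α.map f).map g = α.map (fun a => g (f a)) := by
  induction α with
  | ff => rfl
  | tt => rfl
  | atom a => rfl
  | or α β iα iβ | and α β iα iβ => simp only [map, iα, iβ]

theorem map_congr {f g : X → Y} {α : Formula X} (h : ∀ a ∈ α.atoms, f a = g a) :
    α.map f = α.map g := by
  rw [← subst_atom, ← subst_atom]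
  exact subst_congr fun a ha => by rw [h a ha]

theorem map_id (α : Formula X) : α.map (fun a => a) = α := by
  induction α with
  | ff => rfl
  | tt => rfl
  | atom a => rfl
  | or α β iα iβ | and α β iα iβ => simp only [map, iα, iβ]

theorem atoms_map (f : X → Y) (α : Formula X) : (α.map f).atoms = α.atoms.map f := by
  induction α with
  | ff => rfl
  | tt => rfl
  | atom a => rfl
  | or α β iα iβ | and α β iα iβ => simp only [map, atoms, iα, iβ, List.map_append]

/-- The renamings along `f` are the formulae over the range of `f`. -/
theorem exists_map_eq (f : X → Y) {β : Formula Y} (h : ∀ b ∈ β.atoms, ∃ a, f a = b) :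
    ∃ α : Formula X, α.map f = β := by
  induction β with
  | ff => exact ⟨ff, rfl⟩
  | tt => exact ⟨tt, rfl⟩
  | atom b =>
    obtain ⟨a, ha⟩ := h b (by simp [atoms])
    exact ⟨atom a, by rw [map, ha]⟩
  | or α β iα iβ =>
    simp only [atoms, List.mem_append] at h
    obtain ⟨α', rfl⟩ := iα fun a ha => h a (.inl ha)
    obtain ⟨β', rfl⟩ := iβ fun a ha => h a (.inr ha)
    exact ⟨or α' β', rfl⟩
  | and α β iα iβ =>
    simp only [atoms, List.mem_append] at h
    obtain ⟨α', rfl⟩ := iα fun a ha => h a (.inl ha)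
    obtain ⟨β', rfl⟩ := iβ fun a ha => h a (.inr ha)
    exact ⟨and α' β', rfl⟩

/-- Every name occurs exactly once in the formula. -/
def IsLinear (α : Formula X) : Prop := α.atoms.Nodup ∧ ∀ a, a ∈ α.atoms

end Formula

/-- Instances of logical rules are closed under substitution. -/
def Logical.subst {X : Type u} {Y : Type v} (σ : X → Formula Y) {α β : Formula X} :
    Logical α β → Logical (α.subst σ) (β.subst σ)
  | .switch _ _ _ => .switch _ _ _
  | .medial _ _ _ _ => .medial _ _ _ _
  | .orComm _ _ => .orComm _ _
  | .andComm _ _ => .andComm _ _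
  | .orAssoc _ _ _ => .orAssoc _ _ _
  | .orAssocInv _ _ _ => .orAssocInv _ _ _
  | .andAssoc _ _ _ => .andAssoc _ _ _
  | .andAssocInv _ _ _ => .andAssocInv _ _ _
  | .orFalse _ => .orFalse _
  | .orFalseInv _ => .orFalseInv _
  | .andTrue _ => .andTrue _
  | .andTrueInv _ => .andTrueInv _
  | .orTrueTrue => .orTrueTrue
  | .orTrueTrueInv => .orTrueTrueInv
  | .andFalseFalse => .andFalseFalse
  | .andFalseFalseInv => .andFalseFalseInv

/-- Instances of logical rules are closed under renaming. -/
def Logical.map {X : Type u} {Y : Type v} (f : X → Y) {α β : Formula X} :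
    Logical α β → Logical (α.map f) (β.map f)
  | .switch _ _ _ => .switch _ _ _
  | .medial _ _ _ _ => .medial _ _ _ _
  | .orComm _ _ => .orComm _ _
  | .andComm _ _ => .andComm _ _
  | .orAssoc _ _ _ => .orAssoc _ _ _
  | .orAssocInv _ _ _ => .orAssocInv _ _ _
  | .andAssoc _ _ _ => .andAssoc _ _ _
  | .andAssocInv _ _ _ => .andAssocInv _ _ _
  | .orFalse _ => .orFalse _
  | .orFalseInv _ => .orFalseInv _
  | .andTrue _ => .andTrue _
  | .andTrueInv _ => .andTrueInv _
  | .orTrueTrue => .orTrueTrue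
  | .orTrueTrueInv => .orTrueTrueInv
  | .andFalseFalse => .andFalseFalse
  | .andFalseFalseInv => .andFalseFalseInv

/-- Logical rules neither create nor destroy atom occurrences. -/
theorem Logical.atoms_perm {X : Type u} {α β : Formula X} (r : Logical α β) :
    α.atoms.Perm β.atoms := by
  cases r <;> simp only [Formula.atoms, List.append_assoc, List.append_nil, List.Perm.refl]
  case medial =>
    refine List.Perm.append_left _ ?_
    rw [← List.append_assoc, ← List.append_assoc]
    exact List.Perm.append_right _ List.perm_append_comm
  all_goals exact List.perm_append_comm

/-! ### Derivability over the edges of a flow -/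

section Derivability

variable {X : Type u} [DualAtoms X]

/-- Structural rule instances at the vertex `ν` on formulae whose atoms are edges of `A`; the map
`κ` sends every edge to the atom of `X` that it traces. -/
inductive VertexStep {I J : Type} (A : FlowGraph I J) (κ : A.E → X) (ν : A.V) :
    Formula A.E → Formula A.E → Prop
  | aiDown (ε₁ ε₂ : A.E) (hν : A.label ν = Label.aiDown) (hne : ε₁ ≠ ε₂)
      (h₁ : A.up ε₁ = Sum.inl ν) (h₂ : A.up ε₂ = Sum.inl ν) (hκ : κ ε₂ = bar (κ ε₁)) :
      VertexStep A κ ν tt (or (atom ε₁) (atom ε₂))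
  | aiUp (ε₁ ε₂ : A.E) (hν : A.label ν = Label.aiUp) (hne : ε₁ ≠ ε₂)
      (h₁ : A.lo ε₁ = Sum.inl ν) (h₂ : A.lo ε₂ = Sum.inl ν) (hκ : κ ε₂ = bar (κ ε₁)) :
      VertexStep A κ ν (and (atom ε₁) (atom ε₂)) ff
  | awDown (ε : A.E) (hν : A.label ν = Label.awDown) (h : A.up ε = Sum.inl ν) :
      VertexStep A κ ν ff (atom ε)
  | awUp (ε : A.E) (hν : A.label ν = Label.awUp) (h : A.lo ε = Sum.inl ν) :
      VertexStep A κ ν (atom ε) tt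
  | acDown (ε₁ ε₂ ε₃ : A.E) (hν : A.label ν = Label.acDown) (hne : ε₁ ≠ ε₂)
      (h₁ : A.lo ε₁ = Sum.inl ν) (h₂ : A.lo ε₂ = Sum.inl ν) (h₃ : A.up ε₃ = Sum.inl ν)
      (hκ₁ : κ ε₁ = κ ε₃) (hκ₂ : κ ε₂ = κ ε₃) :
      VertexStep A κ ν (or (atom ε₁) (atom ε₂)) (atom ε₃)
  | acUp (ε₁ ε₂ ε₃ : A.E) (hν : A.label ν = Label.acUp) (hne : ε₂ ≠ ε₃)
      (h₁ : A.lo ε₁ = Sum.inl ν) (h₂ : A.up ε₂ = Sum.inl ν) (h₃ : A.up ε₃ = Sum.inl ν)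
      (hκ₁ : κ ε₂ = κ ε₁) (hκ₂ : κ ε₃ = κ ε₁) :
      VertexStep A κ ν (atom ε₁) (and (atom ε₂) (atom ε₃))

/-- `Der A κ φ m ψ`: there is a derivation from `φ` to `ψ` on formulae whose atoms are edges of `A`,
and `m` is the multiset of the vertices of its structural steps. -/
inductive Der {I J : Type} (A : FlowGraph I J) (κ : A.E → X) :
    Formula A.E → Multiset A.V → Formula A.E → Prop
  | refl (φ : Formula A.E) : Der A κ φ 0 φ
  | trans {φ ψ χ : Formula A.E} {m m' : Multiset A.V} (h : Der A κ φ m ψ) (h' : Der A κ ψ m' χ) :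
      Der A κ φ (m + m') χ
  | logical {φ ψ : Formula A.E} (r : Logical φ ψ) : Der A κ φ 0 ψ
  | structural {ν : A.V} {φ ψ : Formula A.E} (r : VertexStep A κ ν φ ψ) : Der A κ φ {ν} ψ
  | orLeft {φ ψ : Formula A.E} {m : Multiset A.V} (h : Der A κ φ m ψ) (χ : Formula A.E) :
      Der A κ (or φ χ) m (or ψ χ)
  | orRight (χ : Formula A.E) {φ ψ : Formula A.E} {m : Multiset A.V} (h : Der A κ φ m ψ) :
      Der A κ (or χ φ) m (or χ ψ)
  | andLeft {φ ψ : Formula A.E} {m : Multiset A.V} (h : Der A κ φ m ψ) (χ : Formula A.E) :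
      Der A κ (and φ χ) m (and ψ χ)
  | andRight (χ : Formula A.E) {φ ψ : Formula A.E} {m : Multiset A.V} (h : Der A κ φ m ψ) :
      Der A κ (and χ φ) m (and χ ψ)

namespace Der

variable {I J I' J' : Type} {A : FlowGraph I J} {κ : A.E → X} {B : FlowGraph I' J'} {κ' : B.E → X}
  {φ φ' ψ ψ' χ : Formula A.E} {m m' : Multiset A.V} {ν : A.V}

theorem trans_logical (h : Der A κ φ m ψ) (r : Logical ψ χ) : Der A κ φ m χ := by
  simpa using h.trans (.logical r)

theorem logical_trans (r : Logical φ ψ) (h : Der A κ ψ m χ) : Der A κ φ m χ := by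
  simpa using (Der.logical r).trans h

theorem trans_zero (h : Der A κ φ m ψ) (h' : Der A κ ψ 0 χ) : Der A κ φ m χ := by
  simpa using h.trans h'

theorem zero_trans (h : Der A κ φ 0 ψ) (h' : Der A κ ψ m χ) : Der A κ φ m χ := by
  simpa using h.trans h'

theorem or_mono (h : Der A κ φ m ψ) (h' : Der A κ φ' m' ψ') :
    Der A κ (or φ φ') (m + m') (or ψ ψ') := (h.orLeft _).trans (h'.orRight _)

theorem and_mono (h : Der A κ φ m ψ) (h' : Der A κ φ' m' ψ') :
    Der A κ (and φ φ') (m + m') (and ψ ψ') := (h.andLeft _).trans (h'.andRight _)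

theorem or_right_comm : Der A κ (or (or φ ψ) χ) 0 (or (or φ χ) ψ) :=
  .logical_trans (.orAssoc _ _ _) <| .zero_trans (.orRight _ (.logical (.orComm _ _))) <|
    .logical (.orAssocInv _ _ _)

theorem and_right_comm : Der A κ (and (and φ ψ) χ) 0 (and (and φ χ) ψ) :=
  .logical_trans (.andAssoc _ _ _) <| .zero_trans (.andRight _ (.logical (.andComm _ _))) <|
    .logical (.andAssocInv _ _ _)

theorem and_or_left : Der A κ (and (or φ ψ) χ) 0 (or (and φ χ) ψ) :=
  .logical_trans (.andComm _ _) <| .logical_trans (.switch _ _ _) <|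
    .orLeft (.logical (.andComm _ _)) _

/-- The vertices of a derivation are those of structural steps. -/
theorem exists_vertexStep (h : Der A κ φ m ψ) (hν : ν ∈ m) :
    ∃ φ' ψ', VertexStep A κ ν φ' ψ' := by
  induction h with
  | refl => simp at hν
  | logical => simp at hν
  | trans _ _ ih ih' => exact (Multiset.mem_add.1 hν).elim ih ih'
  | structural r => rw [Multiset.mem_singleton.1 hν]; exact ⟨_, _, r⟩
  | orLeft _ _ ih | orRight _ _ ih | andLeft _ _ ih | andRight _ _ ih => exact ih hν

/-- A substitution that turns every structural step into a derivation turns every derivation into a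
derivation. -/
theorem subst {σ : A.E → Formula B.E} {τ : A.V → Multiset B.V} (h : Der A κ φ m ψ)
    (H : ∀ ν ∈ m, ∀ φ ψ, VertexStep A κ ν φ ψ → Der B κ' (φ.subst σ) (τ ν) (ψ.subst σ)) :
    Der B κ' (φ.subst σ) (m.bind τ) (ψ.subst σ) := by
  induction h with
  | refl => simpa using Der.refl _
  | logical r => simpa using Der.logical (r.subst σ)
  | trans _ _ ih ih' =>
    rw [Multiset.add_bind]
    exact (ih fun ν hν => H ν (Multiset.mem_add.2 (.inl hν))).trans
      (ih' fun ν hν => H ν (Multiset.mem_add.2 (.inr hν)))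
  | @structural ν _ _ r => rw [Multiset.singleton_bind]; exact H ν (by simp) _ _ r
  | orLeft _ _ ih => exact (ih H).orLeft _
  | orRight _ _ ih => exact (ih H).orRight _
  | andLeft _ _ ih => exact (ih H).andLeft _
  | andRight _ _ ih => exact (ih H).andRight _

/-- If the substitution turns the step at `μ` into a derivation with an additional disjunct `ω` in
its conclusion, then by switch this disjunct can be moved out of the context of the step and be kept
until the end of the derivation. -/
theorem subst_or {σ : A.E → Formula B.E} {τ : A.V → Multiset B.V} {μ : A.V} {ω : Formula B.E}
    (h : Der A κ φ m ψ) (hm : m.Nodup) (hμ : μ ∈ m)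
    (H : ∀ ν ∈ m, ν ≠ μ → ∀ φ ψ, VertexStep A κ ν φ ψ → Der B κ' (φ.subst σ) (τ ν) (ψ.subst σ))
    (Hμ : ∀ φ ψ, VertexStep A κ μ φ ψ → Der B κ' (φ.subst σ) (τ μ) (or (ψ.subst σ) ω)) :
    Der B κ' (φ.subst σ) (m.bind τ) (or (ψ.subst σ) ω) := by
  induction h with
  | refl => simp at hμ
  | logical r => simp at hμ
  | trans h h' ih ih' =>
    rw [Multiset.add_bind]
    obtain ⟨h₁, h₂, h₃⟩ := Multiset.nodup_add.1 hm
    have hd : ∀ {a}, a ∈ _ → a ∉ _ := Multiset.disjoint_left.1 h₃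
    rcases Multiset.mem_add.1 hμ with hμ | hμ
    · refine (ih h₁ hμ fun ν hν => H ν (Multiset.mem_add.2 (.inl hν))).trans (.orLeft ?_ _)
      exact h'.subst fun ν hν => H ν (Multiset.mem_add.2 (.inr hν)) (fun e => hd hμ (e ▸ hν))
    · refine Der.trans ?_ (ih' h₂ hμ fun ν hν => H ν (Multiset.mem_add.2 (.inr hν)))
      exact h.subst fun ν hν => H ν (Multiset.mem_add.2 (.inl hν)) (fun e => hd hν (e ▸ hμ))
  | @structural ν _ _ r =>
    rw [Multiset.singleton_bind]
    obtain rfl := Multiset.mem_singleton.1 hμ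
    exact Hμ _ _ r
  | orLeft _ _ ih => exact ((ih hm hμ H).orLeft _).trans_zero or_right_comm
  | orRight _ _ ih => exact ((ih hm hμ H).orRight _).trans_logical (.orAssocInv _ _ _)
  | andLeft _ _ ih => exact ((ih hm hμ H).andLeft _).trans_zero and_or_left
  | andRight _ _ ih => exact ((ih hm hμ H).andRight _).trans_logical (.switch _ _ _)

/-- The dual of `Der.subst_or`: a conjunct that is needed at the step at `μ` is added to the premiss
of the derivation. -/
theorem and_subst {σ : A.E → Formula B.E} {τ : A.V → Multiset B.V} {μ : A.V} {ω : Formula B.E}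
    (h : Der A κ φ m ψ) (hm : m.Nodup) (hμ : μ ∈ m)
    (H : ∀ ν ∈ m, ν ≠ μ → ∀ φ ψ, VertexStep A κ ν φ ψ → Der B κ' (φ.subst σ) (τ ν) (ψ.subst σ))
    (Hμ : ∀ φ ψ, VertexStep A κ μ φ ψ → Der B κ' (and (φ.subst σ) ω) (τ μ) (ψ.subst σ)) :
    Der B κ' (and (φ.subst σ) ω) (m.bind τ) (ψ.subst σ) := by
  induction h with
  | refl => simp at hμ
  | logical r => simp at hμ
  | trans h h' ih ih' =>
    rw [Multiset.add_bind]
    obtain ⟨h₁, h₂, h₃⟩ := Multiset.nodup_add.1 hm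
    have hd : ∀ {a}, a ∈ _ → a ∉ _ := Multiset.disjoint_left.1 h₃
    rcases Multiset.mem_add.1 hμ with hμ | hμ
    · refine (ih h₁ hμ fun ν hν => H ν (Multiset.mem_add.2 (.inl hν))).trans ?_
      exact h'.subst fun ν hν => H ν (Multiset.mem_add.2 (.inr hν)) (fun e => hd hμ (e ▸ hν))
    · refine Der.trans (.andLeft ?_ _) (ih' h₂ hμ fun ν hν => H ν (Multiset.mem_add.2 (.inr hν)))
      exact h.subst fun ν hν => H ν (Multiset.mem_add.2 (.inl hν)) (fun e => hd hν (e ▸ hμ))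
  | @structural ν _ _ r =>
    rw [Multiset.singleton_bind]
    obtain rfl := Multiset.mem_singleton.1 hμ
    exact Hμ _ _ r
  | orLeft _ _ ih => exact and_or_left.zero_trans ((ih hm hμ H).orLeft _)
  | orRight _ _ ih =>
    exact .zero_trans (.andLeft (.logical (.orComm _ _)) _) <| and_or_left.zero_trans <|
      ((ih hm hμ H).orLeft _).trans_logical (.orComm _ _)
  | andLeft _ _ ih => exact and_right_comm.zero_trans ((ih hm hμ H).andLeft _)
  | andRight _ _ ih => exact .logical_trans (.andAssoc _ _ _) ((ih hm hμ H).andRight _)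

end Der

/-- A substitution that renames the edges of the vertex `ν` one-to-one to edges of a vertex with the
same label preserves the structural rule instances at `ν`. -/
theorem VertexStep.subst {I J I' J' : Type} {A : FlowGraph I J} {κ : A.E → X}
    {B : FlowGraph I' J'} {κ' : B.E → X} {σ : A.E → Formula B.E} {ν : A.V} {ν' : B.V}
    (hν : B.label ν' = A.label ν) (f : A.E → B.E)
    (hup : ∀ ε, A.up ε = Sum.inl ν → σ ε = atom (f ε) ∧ B.up (f ε) = Sum.inl ν' ∧ κ' (f ε) = κ ε)
    (hlo : ∀ ε, A.lo ε = Sum.inl ν → σ ε = atom (f ε) ∧ B.lo (f ε) = Sum.inl ν' ∧ κ' (f ε) = κ ε)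
    (hf : Set.InjOn f (A.edgesAt ν)) {φ ψ : Formula A.E} (h : VertexStep A κ ν φ ψ) :
    VertexStep B κ' ν' (φ.subst σ) (ψ.subst σ) := by
  cases h with
  | aiDown ε₁ ε₂ hl hne h₁ h₂ hκ =>
    obtain ⟨s₁, u₁, k₁⟩ := hup _ h₁
    obtain ⟨s₂, u₂, k₂⟩ := hup _ h₂
    simp only [Formula.subst, s₁, s₂]
    exact .aiDown _ _ (hν.trans hl) (fun e => hne (hf (.inl h₁) (.inl h₂) e)) u₁ u₂
      (by rw [k₁, k₂, hκ])
  | aiUp ε₁ ε₂ hl hne h₁ h₂ hκ =>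
    obtain ⟨s₁, u₁, k₁⟩ := hlo _ h₁
    obtain ⟨s₂, u₂, k₂⟩ := hlo _ h₂
    simp only [Formula.subst, s₁, s₂]
    exact .aiUp _ _ (hν.trans hl) (fun e => hne (hf (.inr h₁) (.inr h₂) e)) u₁ u₂
      (by rw [k₁, k₂, hκ])
  | awDown ε hl h =>
    obtain ⟨s, u, k⟩ := hup _ h
    simp only [Formula.subst, s]
    exact .awDown _ (hν.trans hl) u
  | awUp ε hl h =>
    obtain ⟨s, u, k⟩ := hlo _ h
    simp only [Formula.subst, s]
    exact .awUp _ (hν.trans hl) u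
  | acDown ε₁ ε₂ ε₃ hl hne h₁ h₂ h₃ hκ₁ hκ₂ =>
    obtain ⟨s₁, u₁, k₁⟩ := hlo _ h₁
    obtain ⟨s₂, u₂, k₂⟩ := hlo _ h₂
    obtain ⟨s₃, u₃, k₃⟩ := hup _ h₃
    simp only [Formula.subst, s₁, s₂, s₃]
    exact .acDown _ _ _ (hν.trans hl) (fun e => hne (hf (.inr h₁) (.inr h₂) e)) u₁ u₂ u₃
      (by rw [k₁, k₃, hκ₁]) (by rw [k₂, k₃, hκ₂])
  | acUp ε₁ ε₂ ε₃ hl hne h₁ h₂ h₃ hκ₁ hκ₂ =>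
    obtain ⟨s₁, u₁, k₁⟩ := hlo _ h₁
    obtain ⟨s₂, u₂, k₂⟩ := hup _ h₂
    obtain ⟨s₃, u₃, k₃⟩ := hup _ h₃
    simp only [Formula.subst, s₁, s₂, s₃]
    exact .acUp _ _ _ (hν.trans hl) (fun e => hne (hf (.inl h₂) (.inl h₃) e)) u₁ u₂ u₃
      (by rw [k₁, k₂, hκ₁]) (by rw [k₁, k₃, hκ₂])

end Derivability

/-! ### From derivability to derivations and back -/

/-- The map `κ` gives the atoms by which the edges are accompanied in the formula `φ`. -/
def Agrees {X : Type u} {E : Type} (κ : E → X) (φ : Formula (X × E)) : Prop :=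
  ∀ x ∈ φ.atoms, κ x.2 = x.1

theorem Agrees.left {X : Type u} {E : Type} {κ : E → X}
    {α β φ : Formula (X × E)} (h : Agrees κ φ)
    (e : φ.atoms = α.atoms ++ β.atoms) : Agrees κ α :=
  fun x hx => h x (by rw [e]; exact List.mem_append_left _ hx)

theorem Agrees.right {X : Type u} {E : Type} {κ : E → X}
    {α β φ : Formula (X × E)} (h : Agrees κ φ)
    (e : φ.atoms = α.atoms ++ β.atoms) : Agrees κ β :=
  fun x hx => h x (by rw [e]; exact List.mem_append_right _ hx)

section Decoration

variable {X : Type u} [DualAtoms X] {I J : Type} {A : FlowGraph I J}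

theorem Chain.exists_append {φ ψ χ : Formula (X × A.E)} (c : Chain (Decorated X A) φ ψ)
    (c' : Chain (Decorated X A) ψ χ) :
    ∃ d : Chain (Decorated X A) φ χ, d.vertices = c.vertices ++ c'.vertices := by
  induction c with
  | nil => exact ⟨c', rfl⟩
  | cons s c ih =>
    obtain ⟨d, hd⟩ := ih c'
    exact ⟨.cons s d, by simp only [Chain.vertices, hd, List.append_assoc]⟩

/-- Chains can be put into any context that single steps can be put into. -/
theorem Chain.exists_context {F : Formula (X × A.E) → Formula (X × A.E)}
    (hF : ∀ {φ ψ} (s : Step (Decorated X A) φ ψ),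
      ∃ s' : Step (Decorated X A) (F φ) (F ψ), s'.vertices = s.vertices)
    {φ ψ : Formula (X × A.E)} (c : Chain (Decorated X A) φ ψ) :
    ∃ d : Chain (Decorated X A) (F φ) (F ψ), d.vertices = c.vertices := by
  induction c with
  | nil φ => exact ⟨.nil _, rfl⟩
  | cons s c ih =>
    obtain ⟨d, hd⟩ := ih
    obtain ⟨s', hs⟩ := hF s
    exact ⟨.cons s' d, by simp only [Chain.vertices, hd, hs]⟩

theorem VertexStep.exists_decorated {κ : A.E → X} {ν : A.V} {φ ψ : Formula A.E}
    (h : VertexStep A κ ν φ ψ) :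
    ∃ r : Decorated X A (φ.map fun ε => (κ ε, ε)) (ψ.map fun ε => (κ ε, ε)), r.vertex = ν := by
  cases h with
  | aiDown ε₁ ε₂ hl hne h₁ h₂ hκ =>
    change ∃ r : Decorated X A tt (or (atom (κ ε₁, ε₁)) (atom (κ ε₂, ε₂))), r.vertex = ν
    rw [hκ]
    exact ⟨.aiDown ν _ _ _ hl hne h₁ h₂, rfl⟩
  | aiUp ε₁ ε₂ hl hne h₁ h₂ hκ =>
    change ∃ r : Decorated X A (and (atom (κ ε₁, ε₁)) (atom (κ ε₂, ε₂))) ff, r.vertex = ν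
    rw [hκ]
    exact ⟨.aiUp ν _ _ _ hl hne h₁ h₂, rfl⟩
  | awDown ε hl h => exact ⟨.awDown ν _ _ hl h, rfl⟩
  | awUp ε hl h => exact ⟨.awUp ν _ _ hl h, rfl⟩
  | acDown ε₁ ε₂ ε₃ hl hne h₁ h₂ h₃ hκ₁ hκ₂ =>
    change ∃ r : Decorated X A (or (atom (κ ε₁, ε₁)) (atom (κ ε₂, ε₂))) (atom (κ ε₃, ε₃)),
      r.vertex = ν
    rw [hκ₁, hκ₂]
    exact ⟨.acDown ν _ _ _ _ hl hne h₁ h₂ h₃, rfl⟩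
  | acUp ε₁ ε₂ ε₃ hl hne h₁ h₂ h₃ hκ₁ hκ₂ =>
    change ∃ r : Decorated X A (atom (κ ε₁, ε₁)) (and (atom (κ ε₂, ε₂)) (atom (κ ε₃, ε₃))),
      r.vertex = ν
    rw [hκ₁, hκ₂]
    exact ⟨.acUp ν _ _ _ _ hl hne h₁ h₂ h₃, rfl⟩

/-- A derivation on edges, decorated with the atoms that the edges trace, is a decorated chain. -/
theorem Der.exists_chain {κ : A.E → X} {φ ψ : Formula A.E} {m : Multiset A.V}
    (h : Der A κ φ m ψ) :
    ∃ c : Chain (Decorated X A) (φ.map fun ε => (κ ε, ε)) (ψ.map fun ε => (κ ε, ε)),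
      (c.vertices : Multiset A.V) = m := by
  induction h with
  | refl φ => exact ⟨.nil _, rfl⟩
  | trans _ _ ih ih' =>
    obtain ⟨c, rfl⟩ := ih
    obtain ⟨c', rfl⟩ := ih'
    obtain ⟨d, hd⟩ := c.exists_append c'
    exact ⟨d, by rw [hd, Multiset.coe_add]⟩
  | logical r => exact ⟨.cons (.logical (r.map _)) (.nil _), rfl⟩
  | structural r =>
    obtain ⟨d, hd⟩ := r.exists_decorated
    exact ⟨.cons (.structural d) (.nil _), by simp [Chain.vertices, Step.vertices, hd]⟩
  | orLeft _ χ ih =>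
    obtain ⟨c, rfl⟩ := ih
    obtain ⟨d, hd⟩ := c.exists_context (F := fun φ => or φ (χ.map fun ε => (κ ε, ε)))
      fun s => ⟨.orLeft s _, rfl⟩
    exact ⟨d, congrArg _ hd⟩
  | orRight χ _ ih =>
    obtain ⟨c, rfl⟩ := ih
    obtain ⟨d, hd⟩ := c.exists_context (F := fun φ => or (χ.map fun ε => (κ ε, ε)) φ)
      fun s => ⟨.orRight _ s, rfl⟩
    exact ⟨d, congrArg _ hd⟩
  | andLeft _ χ ih =>
    obtain ⟨c, rfl⟩ := ih
    obtain ⟨d, hd⟩ := c.exists_context (F := fun φ => and φ (χ.map fun ε => (κ ε, ε)))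
      fun s => ⟨.andLeft s _, rfl⟩
    exact ⟨d, congrArg _ hd⟩
  | andRight χ _ ih =>
    obtain ⟨c, rfl⟩ := ih
    obtain ⟨d, hd⟩ := c.exists_context (F := fun φ => and (χ.map fun ε => (κ ε, ε)) φ)
      fun s => ⟨.andRight _ s, rfl⟩
    exact ⟨d, congrArg _ hd⟩

theorem Decorated.vertexStep {κ : A.E → X} {φ ψ : Formula (X × A.E)} (r : Decorated X A φ ψ)
    (hφ : Agrees κ φ) (hψ : Agrees κ ψ) :
    VertexStep A κ r.vertex (φ.map Prod.snd) (ψ.map Prod.snd) := by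
  cases r <;> simp [Agrees, Formula.atoms] at hφ hψ
  case aiDown a e₁ e₂ hν hne h₁ h₂ => exact .aiDown _ _ hν hne h₁ h₂ (by rw [hψ.1, hψ.2])
  case aiUp a e₁ e₂ hν hne h₁ h₂ => exact .aiUp _ _ hν hne h₁ h₂ (by rw [hφ.1, hφ.2])
  case awDown a e hν h => exact .awDown _ hν h
  case awUp a e hν h => exact .awUp _ hν h
  case acDown a e₁ e₂ e₃ hν hne h₁ h₂ h₃ =>
    exact .acDown _ _ _ hν hne h₁ h₂ h₃ (by rw [hφ.1, hψ]) (by rw [hφ.2, hψ])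
  case acUp a e₁ e₂ e₃ hν hne h₁ h₂ h₃ =>
    exact .acUp _ _ _ hν hne h₁ h₂ h₃ (by rw [hφ, hψ.1]) (by rw [hφ, hψ.2])

theorem Step.der {κ : A.E → X} {φ ψ : Formula (X × A.E)} (s : Step (Decorated X A) φ ψ)
    (hφ : Agrees κ φ) (hψ : Agrees κ ψ) :
    Der A κ (φ.map Prod.snd) s.vertices (ψ.map Prod.snd) := by
  induction s with
  | structural r => exact .structural (r.vertexStep hφ hψ)
  | logical r => exact .logical (r.map _)
  | orLeft s γ ih => exact (ih (hφ.left rfl) (hψ.left rfl)).orLeft _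
  | orRight γ s ih => exact (ih (hφ.right rfl) (hψ.right rfl)).orRight _
  | andLeft s γ ih => exact (ih (hφ.left rfl) (hψ.left rfl)).andLeft _
  | andRight γ s ih => exact (ih (hφ.right rfl) (hψ.right rfl)).andRight _

/-- An atom occurrence in the conclusion of a step either is there already in the premiss, or its
edge is a lower edge of the vertex of the step. -/
theorem Step.mem_atoms {φ ψ : Formula (X × A.E)} (s : Step (Decorated X A) φ ψ) {x : X × A.E}
    (hx : x ∈ ψ.atoms) : x ∈ φ.atoms ∨ ∃ ν ∈ s.vertices, A.up x.2 = Sum.inl ν := by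
  induction s with
  | structural r =>
    right
    cases r <;> simp [Formula.atoms] at hx <;> refine ⟨_, List.mem_singleton.2 rfl, ?_⟩
    all_goals first
      | (subst hx; assumption)
      | (rcases hx with rfl | rfl <;> assumption)
  | logical r => exact .inl (r.atoms_perm.mem_iff.2 hx)
  | orLeft s γ ih | andLeft s γ ih =>
    rcases List.mem_append.1 hx with hx | hx
    · exact (ih hx).imp (List.mem_append_left _) id
    · exact .inl (List.mem_append_right _ hx)
  | orRight γ s ih | andRight γ s ih =>
    rcases List.mem_append.1 hx with hx | hx
    · exact .inl (List.mem_append_left _ hx)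
    · exact (ih hx).imp (List.mem_append_right _) id

/-- The atoms of the lower edges of the vertex of a step can be prescribed by the step. -/
theorem Step.exists_agrees {φ ψ : Formula (X × A.E)} (s : Step (Decorated X A) φ ψ) (κ : A.E → X)
    (hφ : Agrees κ φ) (hd : ∀ x ∈ φ.atoms, ∀ ν ∈ s.vertices, A.up x.2 ≠ Sum.inl ν) :
    ∃ κ' : A.E → X, (∀ ε, (∀ ν ∈ s.vertices, A.up ε ≠ Sum.inl ν) → κ' ε = κ ε) ∧
      Agrees κ' ψ := by
  classical
  induction s with
  | structural r =>
    cases r with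
    | aiDown ν a e₁ e₂ hν hne h₁ h₂ =>
      refine ⟨Function.update (Function.update κ e₁ a) e₂ (bar a), fun ε hε => ?_, ?_⟩
      · have hε' := hε ν (List.mem_singleton.2 rfl)
        rw [Function.update_of_ne (by rintro rfl; exact hε' h₂),
          Function.update_of_ne (by rintro rfl; exact hε' h₁)]
      · simp [Agrees, Formula.atoms, hne]
    | aiUp => exact ⟨κ, fun _ _ => rfl, by simp [Agrees, Formula.atoms]⟩
    | awUp => exact ⟨κ, fun _ _ => rfl, by simp [Agrees, Formula.atoms]⟩
    | awDown ν a e hν h =>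
      refine ⟨Function.update κ e a, fun ε hε => ?_, by simp [Agrees, Formula.atoms]⟩
      have hε' := hε ν (List.mem_singleton.2 rfl)
      rw [Function.update_of_ne (by rintro rfl; exact hε' h)]
    | acDown ν a e₁ e₂ e₃ hν hne h₁ h₂ h₃ =>
      refine ⟨Function.update κ e₃ a, fun ε hε => ?_, by simp [Agrees, Formula.atoms]⟩
      have hε' := hε ν (List.mem_singleton.2 rfl)
      rw [Function.update_of_ne (by rintro rfl; exact hε' h₃)]
    | acUp ν a e₁ e₂ e₃ hν hne h₁ h₂ h₃ =>
      refine ⟨Function.update (Function.update κ e₂ a) e₃ a, fun ε hε => ?_, ?_⟩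
      · have hε' := hε ν (List.mem_singleton.2 rfl)
        rw [Function.update_of_ne (by rintro rfl; exact hε' h₃),
          Function.update_of_ne (by rintro rfl; exact hε' h₂)]
      · simp [Agrees, Formula.atoms, hne]
  | logical r => exact ⟨κ, fun _ _ => rfl, fun x hx => hφ x (r.atoms_perm.mem_iff.2 hx)⟩
  | orLeft s γ ih | andLeft s γ ih =>
    obtain ⟨κ', h, h'⟩ := ih (hφ.left rfl) fun x hx => hd x (List.mem_append_left _ hx)
    refine ⟨κ', h, fun x hx => (List.mem_append.1 hx).elim (h' x) fun hx => ?_⟩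
    rw [h _ (hd x (List.mem_append_right _ hx))]
    exact hφ.right rfl x hx
  | orRight γ s ih | andRight γ s ih =>
    obtain ⟨κ', h, h'⟩ := ih (hφ.right rfl) fun x hx => hd x (List.mem_append_right _ hx)
    refine ⟨κ', h, fun x hx => (List.mem_append.1 hx).elim (fun hx => ?_) (h' x)⟩
    rw [h _ (hd x (List.mem_append_left _ hx))]
    exact hφ.left rfl x hx

/-- In a chain that visits every vertex at most once, every edge always traces the same atom, since
its occurrences have their origin either in the premiss or in the step at its upper vertex. -/
theorem Chain.exists_der {φ ψ : Formula (X × A.E)} (c : Chain (Decorated X A) φ ψ) (κ : A.E → X)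
    (hc : c.vertices.Nodup) (hφ : Agrees κ φ)
    (hd : ∀ x ∈ φ.atoms, ∀ ν ∈ c.vertices, A.up x.2 ≠ Sum.inl ν) :
    ∃ κ' : A.E → X, (∀ ε, (∀ ν ∈ c.vertices, A.up ε ≠ Sum.inl ν) → κ' ε = κ ε) ∧
      Agrees κ' ψ ∧ Der A κ' (φ.map Prod.snd) c.vertices (ψ.map Prod.snd) := by
  induction c generalizing κ with
  | nil φ => exact ⟨κ, fun _ _ => rfl, hφ, .refl _⟩
  | @cons φ φ' ψ s c ih =>
    simp only [Chain.vertices, List.nodup_append, List.mem_append] at hc hd ⊢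
    obtain ⟨κ₁, h₁, h₁'⟩ := s.exists_agrees κ hφ fun x hx ν hν => hd x hx ν (.inl hν)
    obtain ⟨κ₂, h₂, h₂', hder⟩ := ih κ₁ hc.2.1 h₁' fun x hx ν hν => by
      rcases s.mem_atoms hx with hx | ⟨μ, hμ, e⟩
      · exact hd x hx ν (.inr hν)
      · rw [e]
        rintro h
        exact hc.2.2 μ hμ ν hν (Sum.inl_injective h)
    refine ⟨κ₂, fun ε hε => ?_, h₂', ?_⟩
    · rw [h₂ ε fun ν hν => hε ν (.inr hν), h₁ ε fun ν hν => hε ν (.inl hν)]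
    · rw [← Multiset.coe_add]
      refine (s.der (fun x hx => ?_) fun x hx => ?_).trans hder
      · rw [h₂ _ fun ν hν => hd x hx ν (.inr hν), h₁ _ fun ν hν => hd x hx ν (.inl hν)]
        exact hφ x hx
      · rw [h₂ _ fun ν hν => ?_]
        · exact h₁' x hx
        rcases s.mem_atoms hx with hx | ⟨μ, hμ, e⟩
        · exact hd x hx ν (.inr hν)
        · rw [e]
          rintro h
          exact hc.2.2 μ hμ ν hν (Sum.inl_injective h)

theorem Step.nonempty_of_mem {φ ψ : Formula (X × A.E)} (s : Step (Decorated X A) φ ψ) {ν : A.V}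
    (hν : ν ∈ s.vertices) : Nonempty X := by
  induction s with
  | structural r => cases r <;> exact ⟨by assumption⟩
  | logical r => simp [Step.vertices] at hν
  | orLeft s γ ih | andLeft s γ ih | orRight γ s ih | andRight γ s ih => exact ih hν

theorem Chain.nonempty_of_mem {φ ψ : Formula (X × A.E)} (c : Chain (Decorated X A) φ ψ) {ν : A.V}
    (hν : ν ∈ c.vertices) : Nonempty X := by
  induction c with
  | nil => simp [Chain.vertices] at hν
  | cons s c ih => exact (List.mem_append.1 hν).elim s.nonempty_of_mem ih

/-- `A.Derivable kI α kJ β`: there is a derivation whose structural steps are the vertices of `A`.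
Its premiss `α` and its conclusion `β` are given by the names of the upper and lower edges of `A`,
and `kI` and `kJ` tell of which atoms these edges are the occurrences. -/
def FlowGraph.Derivable (A : FlowGraph I J) (kI : I → X) (α : Formula I) (kJ : J → X)
    (β : Formula J) : Prop :=
  ∃ (κ : A.E → X) (u : I → A.E) (d : J → A.E) (m : Multiset A.V),
    (∀ i, A.up (u i) = Sum.inr i) ∧ (∀ j, A.lo (d j) = Sum.inr j) ∧
    (∀ i, κ (u i) = kI i) ∧ (∀ j, κ (d j) = kJ j) ∧
    m.Nodup ∧ (∀ ν, ν ∈ m) ∧ Der A κ (α.map u) m (β.map d)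

end Decoration

section HasFlow

variable {X : Type u} [DualAtoms X] {I J : Type} {A : AtomicFlow I J}

theorem AtomicFlow.exists_upper (A : AtomicFlow I J) :
    ∃ u : I → A.E, ∀ ε i, A.up ε = Sum.inr i ↔ ε = u i := by
  choose u hu hu' using A.upper_named
  exact ⟨u, fun ε i => ⟨fun h => hu' i ε h, fun h => h ▸ hu i⟩⟩

theorem AtomicFlow.exists_lower (A : AtomicFlow I J) :
    ∃ d : J → A.E, ∀ ε j, A.lo ε = Sum.inr j ↔ ε = d j := by
  choose u hu hu' using A.lower_named
  exact ⟨u, fun ε i => ⟨fun h => hu' i ε h, fun h => h ▸ hu i⟩⟩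

/-- A formula over names of edges is linear if the edges in it are, without repetition, all edges
that have a name. -/
theorem Formula.isLinear_of_map {E N : Type} {f : N → E} {α : Formula N} {p : E → N → Prop}
    (hf : ∀ ε n, p ε n ↔ ε = f n) (hp : ∀ ε n n', p ε n → p ε n' → n = n')
    (hn : (α.map f).atoms.Nodup) (hm : ∀ ε, ε ∈ (α.map f).atoms ↔ ∃ n, p ε n) : α.IsLinear := by
  rw [Formula.atoms_map] at hn hm
  refine ⟨hn.of_map, fun n => ?_⟩
  obtain ⟨n', h, e⟩ := List.mem_map.1 ((hm (f n)).2 ⟨n, (hf _ _).2 rfl⟩)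
  rwa [hp _ _ _ ((hf _ n).2 rfl) ((hf _ _).2 e.symm)]

/-- The associated flows of derivations in terms of derivability. -/
theorem SKSDerivation.HasFlow.derivable {Φ : SKSDerivation X} (h : Φ.HasFlow A) :
    ∃ (α : Formula I) (β : Formula J) (kI : I → X) (kJ : J → X), α.IsLinear ∧ β.IsLinear ∧
      Φ.premiss = α.map kI ∧ Φ.conclusion = β.map kJ ∧ A.Derivable kI α kJ β := by
  classical
  obtain ⟨φ, ψ, c, rfl, hn, hm, hφn, hφ, hψn, hψ⟩ := h
  obtain ⟨u, hu⟩ := A.exists_upper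
  obtain ⟨d, hd⟩ := A.exists_lower
  rw [← Formula.atoms_map] at hφn hψn
  simp only [← Formula.atoms_map] at hφ hψ
  -- the atoms of the edges in the premiss determine those of all other edges along the chain
  obtain ⟨κ₀, hκ₀⟩ : ∃ κ₀ : A.E → X, Agrees κ₀ φ := by
    by_cases hE : IsEmpty A.E
    · exact ⟨fun ε => hE.elim ε, fun x => hE.elim x.2⟩
    obtain ⟨ε⟩ := not_isEmpty_iff.1 hE
    have : Nonempty X := by
      rcases h : A.up ε with ν | i
      · exact c.nonempty_of_mem (hm ν)
      · have := (hφ ε).2 ⟨i, h⟩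
        rw [Formula.atoms_map] at this
        obtain ⟨x, -, -⟩ := List.mem_map.1 this
        exact ⟨x.1⟩
    rw [Formula.atoms_map] at hφn
    have hinj := List.inj_on_of_nodup_map hφn
    refine ⟨fun ε => if h : ∃ x ∈ φ.atoms, x.2 = ε then h.choose.1 else Classical.arbitrary X,
      fun x hx => ?_⟩
    have h : ∃ y ∈ φ.atoms, y.2 = x.2 := ⟨x, hx, rfl⟩
    simp only [dif_pos h]
    rw [hinj h.choose_spec.1 hx h.choose_spec.2]
  obtain ⟨κ, hκ, hκψ, hder⟩ := c.exists_der κ₀ hn hκ₀ fun x hx ν hν => by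
    obtain ⟨i, hi⟩ := (hφ x.2).1 (by rw [Formula.atoms_map]; exact List.mem_map_of_mem hx)
    simp [hi]
  have hκφ : Agrees κ φ := fun x hx => by
    rw [hκ _ fun ν hν => ?_]
    · exact hκ₀ x hx
    obtain ⟨i, hi⟩ := (hφ x.2).1 (by rw [Formula.atoms_map]; exact List.mem_map_of_mem hx)
    simp [hi]
  obtain ⟨α, hα⟩ := Formula.exists_map_eq u (β := φ.map Prod.snd) fun ε hε => by
    obtain ⟨i, hi⟩ := (hφ ε).1 hε
    exact ⟨i, ((hu _ _).1 hi).symm⟩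
  obtain ⟨β, hβ⟩ := Formula.exists_map_eq d (β := ψ.map Prod.snd) fun ε hε => by
    obtain ⟨i, hi⟩ := (hψ ε).1 hε
    exact ⟨i, ((hd _ _).1 hi).symm⟩
  have erase_eq : ∀ χ : Formula (X × A.E), Agrees κ χ → χ.erase = (χ.map Prod.snd).map κ := by
    intro χ hχ
    rw [Formula.map_map]
    exact Formula.map_congr fun x hx => (hχ x hx).symm
  refine ⟨α, β, fun i => κ (u i), fun j => κ (d j), ?_, ?_, ?_, ?_, κ, u, d, c.vertices,
    fun i => (hu _ _).2 rfl, fun j => (hd _ _).2 rfl, fun _ => rfl, fun _ => rfl, hn, hm, ?_⟩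
  · rw [← hα] at hφn hφ
    exact Formula.isLinear_of_map hu (fun ε n n' h h' => Sum.inr_injective (h.symm.trans h')) hφn hφ
  · rw [← hβ] at hψn hψ
    exact Formula.isLinear_of_map hd (fun ε n n' h h' => Sum.inr_injective (h.symm.trans h')) hψn hψ
  · rw [← Formula.map_map, hα]
    exact erase_eq φ hκφ
  · rw [← Formula.map_map, hβ]
    exact erase_eq ψ hκψ
  · rw [hα, hβ]
    exact hder

/-- The converse of `SKSDerivation.HasFlow.derivable`. -/
theorem FlowGraph.Derivable.exists_hasFlow {α : Formula I} {β : Formula J} {kI : I → X}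
    {kJ : J → X} (h : A.Derivable kI α kJ β) (hα : α.IsLinear) (hβ : β.IsLinear) :
    ∃ Φ : SKSDerivation X, Φ.premiss = α.map kI ∧ Φ.conclusion = β.map kJ ∧ Φ.HasFlow A := by
  obtain ⟨κ, u, d, m, hu, hd, hκI, hκJ, hn, hm, h⟩ := h
  obtain ⟨c, rfl⟩ := h.exists_chain
  have edges : ∀ χ : Formula A.E, (χ.map fun ε => (κ ε, ε)).atoms.map Prod.snd = χ.atoms := by
    intro χ
    rw [Formula.atoms_map, List.map_map]
    exact List.map_id _
  have hinju : Function.Injective u := fun i i' e =>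
    Sum.inr_injective ((hu i).symm.trans (e ▸ hu i'))
  have hinjd : Function.Injective d := fun i i' e =>
    Sum.inr_injective ((hd i).symm.trans (e ▸ hd i'))
  refine ⟨⟨_, _, c.erase⟩, ?_, ?_, _, _, c, rfl, hn, hm, ?_, ?_, ?_, ?_⟩
  · simp only [Formula.erase, Formula.map_map, hκI]
  · simp only [Formula.erase, Formula.map_map, hκJ]
  · rw [edges, Formula.atoms_map]
    exact hα.1.map hinju
  · intro ε
    rw [edges, Formula.atoms_map, List.mem_map]
    constructor
    · rintro ⟨i, -, rfl⟩
      exact ⟨i, hu i⟩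
    · rintro ⟨i, hi⟩
      exact ⟨i, hα.2 i, (A.upper_named i).unique (hu i) hi⟩
  · rw [edges, Formula.atoms_map]
    exact hβ.1.map hinjd
  · intro ε
    rw [edges, Formula.atoms_map, List.mem_map]
    constructor
    · rintro ⟨i, -, rfl⟩
      exact ⟨i, hd i⟩
    · rintro ⟨i, hi⟩
      exact ⟨i, hβ.2 i, (A.lower_named i).unique (hd i) hi⟩

end HasFlow

/-! ### Ranks -/

/-- An acyclic relation on a finite type is strictly increasing for some rank, namely for the number
of predecessors. -/
theorem exists_rank {E : Type} [Finite E] {R : E → E → Prop} (h : ∀ ε, ¬ Relation.TransGen R ε ε) :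
    ∃ r : E → ℕ, ∀ a b, R a b → r a < r b := by
  refine ⟨fun b => {x | Relation.TransGen R x b}.ncard, fun a b hab => Set.ncard_lt_ncard ?_⟩
  refine ⟨fun x hx => hx.tail hab, fun hsub => h a (hsub ?_)⟩
  exact Relation.TransGen.single hab

theorem not_transGen_self {E α : Type} [Preorder α] {R : E → E → Prop} (r : E → α)
    (h : ∀ a b, R a b → r a < r b) (ε : E) : ¬ Relation.TransGen R ε ε := by
  have key : ∀ a b, Relation.TransGen R a b → r a < r b := by
    intro a b hab
    induction hab with
    | single hab => exact h _ _ hab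
    | tail _ hbc ih => exact ih.trans (h _ _ hbc)
  exact fun hε => lt_irrefl _ (key ε ε hε)

/-! ### Flows -/

namespace FlowGraph

variable {I J : Type}

/-- The properties of an atomic flow apart from the existence of a polarity assignment. -/
structure IsFlow (A : FlowGraph I J) : Prop where
  finite_V : Finite A.V
  finite_E : Finite A.E
  upper_named : ∀ i : I, ∃! ε, A.up ε = Sum.inr i
  lower_named : ∀ j : J, ∃! ε, A.lo ε = Sum.inr j
  card_lower : ∀ ν, (A.lowerEdges ν).ncard = (A.label ν).lowerCard
  card_upper : ∀ ν, (A.upperEdges ν).ncard = (A.label ν).upperCard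
  acyclic : ∀ ε, ¬ Relation.TransGen A.Below ε ε

theorem _root_.AtomicFlows.AtomicFlow.isFlow (A : AtomicFlow I J) : A.toFlowGraph.IsFlow :=
  ⟨A.finite_V, A.finite_E, A.upper_named, A.lower_named, A.card_lower, A.card_upper, A.acyclic⟩

/-- A flow from its properties. -/
def IsFlow.toAtomicFlow {A : FlowGraph I J} (h : A.IsFlow) (hπ : ∃ π, A.IsPolarity π) :
    AtomicFlow I J :=
  ⟨A, h.finite_V, h.finite_E, h.upper_named, h.lower_named, h.card_lower, h.card_upper,
    h.acyclic, hπ⟩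

namespace IsFlow

variable {A : FlowGraph I J} (h : A.IsFlow) {ν : A.V} {ε ε' : A.E}
include h

theorem exists_rank : ∃ r : A.E → ℕ, ∀ a b, A.Below a b → r a < r b :=
  have := h.finite_E
  AtomicFlows.exists_rank h.acyclic

theorem up_ne (hν : (A.label ν).lowerCard = 0) (ε : A.E) : A.up ε ≠ Sum.inl ν := by
  have := h.finite_E
  have h0 := h.card_lower ν
  rw [hν, Set.ncard_eq_zero] at h0
  exact fun e => (h0 ▸ (show ε ∈ A.lowerEdges ν from e) : ε ∈ (∅ : Set A.E)).elim

theorem lo_ne (hν : (A.label ν).upperCard = 0) (ε : A.E) : A.lo ε ≠ Sum.inl ν := by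
  have := h.finite_E
  have h0 := h.card_upper ν
  rw [hν, Set.ncard_eq_zero] at h0
  exact fun e => (h0 ▸ (show ε ∈ A.upperEdges ν from e) : ε ∈ (∅ : Set A.E)).elim

theorem exists_lower_single (hν : (A.label ν).lowerCard = 1) :
    ∃ ε₁, ∀ ε, A.up ε = Sum.inl ν ↔ ε = ε₁ := by
  have h0 := h.card_lower ν
  rw [hν, Set.ncard_eq_one] at h0
  obtain ⟨ε₁, e⟩ := h0
  exact ⟨ε₁, fun ε => Set.ext_iff.1 e ε⟩

theorem exists_upper_single (hν : (A.label ν).upperCard = 1) :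
    ∃ ε₁, ∀ ε, A.lo ε = Sum.inl ν ↔ ε = ε₁ := by
  have h0 := h.card_upper ν
  rw [hν, Set.ncard_eq_one] at h0
  obtain ⟨ε₁, e⟩ := h0
  exact ⟨ε₁, fun ε => Set.ext_iff.1 e ε⟩

theorem exists_lower_pair (hν : (A.label ν).lowerCard = 2) :
    ∃ ε₁ ε₂, ε₁ ≠ ε₂ ∧ ∀ ε, A.up ε = Sum.inl ν ↔ ε = ε₁ ∨ ε = ε₂ := by
  have h0 := h.card_lower ν
  rw [hν, Set.ncard_eq_two] at h0
  obtain ⟨ε₁, ε₂, hne, e⟩ := h0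
  exact ⟨ε₁, ε₂, hne, fun ε => Set.ext_iff.1 e ε⟩

theorem exists_upper_pair (hν : (A.label ν).upperCard = 2) :
    ∃ ε₁ ε₂, ε₁ ≠ ε₂ ∧ ∀ ε, A.lo ε = Sum.inl ν ↔ ε = ε₁ ∨ ε = ε₂ := by
  have h0 := h.card_upper ν
  rw [hν, Set.ncard_eq_two] at h0
  obtain ⟨ε₁, ε₂, hne, e⟩ := h0
  exact ⟨ε₁, ε₂, hne, fun ε => Set.ext_iff.1 e ε⟩

theorem not_below_self (ε : A.E) : ¬ A.Below ε ε := fun e => h.acyclic ε (.single e)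

/-- Only contractions and cocontractions have both upper and lower edges. -/
theorem isContraction (hl : A.lo ε = Sum.inl ν) (hu : A.up ε' = Sum.inl ν) :
    (A.label ν).IsContraction := by
  have h1 := fun e => h.up_ne (ν := ν) e ε'
  have h2 := fun e => h.lo_ne (ν := ν) e ε
  cases hν : A.label ν <;> simp_all [Label.lowerCard, Label.upperCard, Label.IsContraction]

end IsFlow

/-! ### Polarities and the orientation of ai-paths -/

namespace IsPolarity

variable {A : FlowGraph I J} {π : A.E → Polarity} (hπ : A.IsPolarity π) {ν : A.V} {ε ε' : A.E}
include hπ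

theorem eq_of_isContraction (hν : (A.label ν).IsContraction) (hε : ε ∈ A.edgesAt ν)
    (hε' : ε' ∈ A.edgesAt ν) : π ε = π ε' := by
  have h1 := Set.mem_image_of_mem π hε
  have h2 := Set.mem_image_of_mem π hε'
  rcases (hπ ν).1 hν with e | e <;> rw [e] at h1 h2 <;> exact h1.trans h2.symm

/-- The two edges of an interaction have different polarities. -/
theorem eq_of_aiDown (h : A.IsFlow) (hν : A.label ν = Label.aiDown) (hε : A.up ε = Sum.inl ν)
    (hε' : A.up ε' = Sum.inl ν) (e : π ε = π ε') : ε = ε' := by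
  obtain ⟨ε₁, ε₂, -, h₁⟩ := h.exists_lower_pair (ν := ν) (by rw [hν]; rfl)
  have hlo := h.lo_ne (ν := ν) (by rw [hν]; rfl)
  have h₂ := (hπ ν).2 (.inl hν)
  have h₃ : A.edgesAt ν = {ε₁, ε₂} := by
    ext x
    simp [edgesAt, lowerEdges, upperEdges, hlo, h₁]
  rw [h₃, Set.image_pair] at h₂
  have hn : Polarity.neg ∈ ({π ε₁, π ε₂} : Set Polarity) := by rw [h₂]; simp
  have hp : Polarity.pos ∈ ({π ε₁, π ε₂} : Set Polarity) := by rw [h₂]; simp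
  simp only [Set.mem_insert_iff, Set.mem_singleton_iff] at hn hp
  rcases (h₁ _).1 hε with rfl | rfl <;> rcases (h₁ _).1 hε' with rfl | rfl <;> grind

/-- The two edges of a cointeraction have different polarities. -/
theorem eq_of_aiUp (h : A.IsFlow) (hν : A.label ν = Label.aiUp) (hε : A.lo ε = Sum.inl ν)
    (hε' : A.lo ε' = Sum.inl ν) (e : π ε = π ε') : ε = ε' := by
  obtain ⟨ε₁, ε₂, -, h₁⟩ := h.exists_upper_pair (ν := ν) (by rw [hν]; rfl)
  have hlo := h.up_ne (ν := ν) (by rw [hν]; rfl)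
  have h₂ := (hπ ν).2 (.inr hν)
  have h₃ : A.edgesAt ν = {ε₁, ε₂} := by
    ext x
    simp [edgesAt, lowerEdges, upperEdges, hlo, h₁]
  rw [h₃, Set.image_pair] at h₂
  have hn : Polarity.neg ∈ ({π ε₁, π ε₂} : Set Polarity) := by rw [h₂]; simp
  have hp : Polarity.pos ∈ ({π ε₁, π ε₂} : Set Polarity) := by rw [h₂]; simp
  simp only [Set.mem_insert_iff, Set.mem_singleton_iff] at hn hp
  rcases (h₁ _).1 hε with rfl | rfl <;> rcases (h₁ _).1 hε' with rfl | rfl <;> grind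

/-- Polarities are constant along paths. -/
theorem eq_of_below (h : A.IsFlow) (hb : A.Below ε ε') : π ε = π ε' := by
  obtain ⟨ν, hl, hu⟩ := hb
  exact hπ.eq_of_isContraction (h.isContraction hl hu) (.inr hl) (.inl hu)

end IsPolarity

/-- The end from which an edge starts, if positive edges are traversed downwards and negative edges
upwards. -/
def src (A : FlowGraph I J) (π : A.E → Polarity) (ε : A.E) : A.V ⊕ (I ⊕ J) :=
  match π ε with
  | .pos => Sum.map id Sum.inl (A.up ε)
  | .neg => Sum.map id Sum.inr (A.lo ε)

/-- The end to which an edge leads, if positive edges are traversed downwards and negative edges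
upwards. -/
def tgt (A : FlowGraph I J) (π : A.E → Polarity) (ε : A.E) : A.V ⊕ (I ⊕ J) :=
  match π ε with
  | .pos => Sum.map id Sum.inr (A.lo ε)
  | .neg => Sum.map id Sum.inl (A.up ε)

/-- Succession of edges on an ai-path that goes down on positive edges and up on negative edges. -/
def Next (A : FlowGraph I J) (π : A.E → Polarity) (ε ε' : A.E) : Prop :=
  (π ε = .pos ∧ π ε' = .pos ∧ A.Below ε ε') ∨
  (π ε = .neg ∧ π ε' = .neg ∧ A.Below ε' ε) ∨
  (π ε = .neg ∧ π ε' = .pos ∧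
    ∃ ν, A.label ν = Label.aiDown ∧ A.up ε = Sum.inl ν ∧ A.up ε' = Sum.inl ν) ∨
  (π ε = .pos ∧ π ε' = .neg ∧
    ∃ ν, A.label ν = Label.aiUp ∧ A.lo ε = Sum.inl ν ∧ A.lo ε' = Sum.inl ν)

/-- Directed walks: ai-paths that go down on positive edges and up on negative edges. -/
inductive Walk (A : FlowGraph I J) (π : A.E → Polarity) : A.V → List A.E → A.V → Prop
  | single {ν ν' : A.V} {ε : A.E} (hs : A.src π ε = Sum.inl ν) (ht : A.tgt π ε = Sum.inl ν') :
      Walk A π ν [ε] ν'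
  | cons {ν μ ν' : A.V} {ε : A.E} {l : List A.E} (hs : A.src π ε = Sum.inl ν)
      (ht : A.tgt π ε = Sum.inl μ) (h : Walk A π μ l ν') : Walk A π ν (ε :: l) ν'

section Orientation

variable {A : FlowGraph I J} {π : A.E → Polarity} {ν μ ν' : A.V} {ε ε' : A.E} {l l' : List A.E}

theorem src_pos (h : π ε = .pos) : A.src π ε = Sum.inl ν ↔ A.up ε = Sum.inl ν := by
  simp only [src, h]
  cases A.up ε <;> simp

theorem src_neg (h : π ε = .neg) : A.src π ε = Sum.inl ν ↔ A.lo ε = Sum.inl ν := by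
  simp only [src, h]
  cases A.lo ε <;> simp

theorem tgt_pos (h : π ε = .pos) : A.tgt π ε = Sum.inl ν ↔ A.lo ε = Sum.inl ν := by
  simp only [tgt, h]
  cases A.lo ε <;> simp

theorem tgt_neg (h : π ε = .neg) : A.tgt π ε = Sum.inl ν ↔ A.up ε = Sum.inl ν := by
  simp only [tgt, h]
  cases A.up ε <;> simp

theorem Next.exists_vertex (h : A.Next π ε ε') :
    ∃ ν, A.tgt π ε = Sum.inl ν ∧ A.src π ε' = Sum.inl ν := by
  rcases h with ⟨h, h', ν, h₁, h₂⟩ | ⟨h, h', ν, h₁, h₂⟩ | ⟨h, h', ν, -, h₁, h₂⟩ |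
    ⟨h, h', ν, -, h₁, h₂⟩
  · exact ⟨ν, (tgt_pos h).2 h₁, (src_pos h').2 h₂⟩
  · exact ⟨ν, (tgt_neg h).2 h₂, (src_neg h').2 h₁⟩
  · exact ⟨ν, (tgt_neg h).2 h₁, (src_pos h').2 h₂⟩
  · exact ⟨ν, (tgt_pos h).2 h₁, (src_neg h').2 h₂⟩

/-- Two edges succeed one another as soon as one leads to the vertex from which the other starts: a
change of the polarity at a vertex is only possible at an interaction or a cointeraction, and the
two edges are not the same there. -/
theorem next_of_vertex (hA : A.IsFlow) (hπ : A.IsPolarity π) (ht : A.tgt π ε = Sum.inl ν)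
    (hs : A.src π ε' = Sum.inl ν) : A.Next π ε ε' := by
  rcases h : π ε with _ | _ <;> rcases h' : π ε' with _ | _
  · exact .inr (.inl ⟨h, h', ν, (src_neg h').1 hs, (tgt_neg h).1 ht⟩)
  · rw [tgt_neg h] at ht
    rw [src_pos h'] at hs
    refine .inr (.inr (.inl ⟨h, h', ν, ?_, ht, hs⟩))
    have hc : ¬ (A.label ν).IsContraction := fun hc => by
      have := hπ.eq_of_isContraction hc (.inl ht) (.inl hs)
      simp [h, h'] at this
    have h0 := fun e => hA.up_ne (ν := ν) e ε ht
    have h1 : (A.label ν).lowerCard ≠ 1 := fun e => by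
      obtain ⟨ε₁, h₁⟩ := hA.exists_lower_single e
      rw [(h₁ _).1 ht, ← (h₁ _).1 hs, h'] at h
      cases h
    cases hν : A.label ν <;> simp_all [Label.lowerCard, Label.IsContraction]
  · rw [tgt_pos h] at ht
    rw [src_neg h'] at hs
    refine .inr (.inr (.inr ⟨h, h', ν, ?_, ht, hs⟩))
    have hc : ¬ (A.label ν).IsContraction := fun hc => by
      have := hπ.eq_of_isContraction hc (.inr ht) (.inr hs)
      simp [h, h'] at this
    have h0 := fun e => hA.lo_ne (ν := ν) e ε ht
    have h1 : (A.label ν).upperCard ≠ 1 := fun e => by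
      obtain ⟨ε₁, h₁⟩ := hA.exists_upper_single e
      rw [(h₁ _).1 ht, ← (h₁ _).1 hs, h'] at h
      cases h
    cases hν : A.label ν <;> simp_all [Label.upperCard, Label.IsContraction]
  · exact .inl ⟨h, h', ν, (tgt_pos h).1 ht, (src_pos h').1 hs⟩

/-- At an interaction or cointeraction exactly one edge arrives and exactly one edge leaves. -/
theorem eq_of_tgt_eq (hA : A.IsFlow) (hπ : A.IsPolarity π) (hν : (A.label ν).IsInteraction)
    (h : A.tgt π ε = Sum.inl ν) (h' : A.tgt π ε' = Sum.inl ν) : ε = ε' := by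
  rcases hν with hν | hν
  · have lo := fun x => hA.lo_ne (ν := ν) (by rw [hν]; rfl) x
    rcases e : π ε with _ | _ <;> rcases e' : π ε' with _ | _ <;>
      simp only [tgt_neg, tgt_pos, e, e', lo] at h h'
    exact hπ.eq_of_aiDown hA hν h h' (e.trans e'.symm)
  · have up := fun x => hA.up_ne (ν := ν) (by rw [hν]; rfl) x
    rcases e : π ε with _ | _ <;> rcases e' : π ε' with _ | _ <;>
      simp only [tgt_neg, tgt_pos, e, e', up] at h h'
    exact hπ.eq_of_aiUp hA hν h h' (e.trans e'.symm)

theorem eq_of_src_eq (hA : A.IsFlow) (hπ : A.IsPolarity π) (hν : (A.label ν).IsInteraction)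
    (h : A.src π ε = Sum.inl ν) (h' : A.src π ε' = Sum.inl ν) : ε = ε' := by
  rcases hν with hν | hν
  · have lo := fun x => hA.lo_ne (ν := ν) (by rw [hν]; rfl) x
    rcases e : π ε with _ | _ <;> rcases e' : π ε' with _ | _ <;>
      simp only [src_neg, src_pos, e, e', lo] at h h'
    exact hπ.eq_of_aiDown hA hν h h' (e.trans e'.symm)
  · have up := fun x => hA.up_ne (ν := ν) (by rw [hν]; rfl) x
    rcases e : π ε with _ | _ <;> rcases e' : π ε' with _ | _ <;>
      simp only [src_neg, src_pos, e, e', up] at h h'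
    exact hπ.eq_of_aiUp hA hν h h' (e.trans e'.symm)

namespace Walk

theorem append (h : A.Walk π ν l μ) (h' : A.Walk π μ l' ν') : A.Walk π ν (l ++ l') ν' := by
  induction h with
  | single hs ht => exact .cons hs ht h'
  | cons hs ht _ ih => exact .cons hs ht (ih h')

theorem exists_head (h : A.Walk π ν l ν') : ∃ ε, l.head? = some ε ∧ A.src π ε = Sum.inl ν := by
  cases h with
  | single hs ht => exact ⟨_, rfl, hs⟩
  | cons hs ht _ => exact ⟨_, rfl, hs⟩

theorem exists_getLast (h : A.Walk π ν l ν') :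
    ∃ ε, l.getLast? = some ε ∧ A.tgt π ε = Sum.inl ν' := by
  induction h with
  | single hs ht => exact ⟨_, rfl, ht⟩
  | cons hs ht _ ih =>
    obtain ⟨ε, h, h'⟩ := ih
    exact ⟨ε, by rw [List.getLast?_cons, h]; rfl, h'⟩

/-- The edges of a walk are connected among one another, and to every edge that starts where the
walk ends. -/
theorem transGen_of_src (hA : A.IsFlow) (hπ : A.IsPolarity π) (h : A.Walk π ν l ν')
    (hε : ε ∈ l) (hε' : A.src π ε' = Sum.inl ν') :
    Relation.TransGen (fun a b => A.Next π a b ∧ a ∈ l ∧ (b ∈ l ∨ b = ε')) ε ε' := by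
  induction h generalizing ε with
  | single hs ht =>
    obtain rfl := List.mem_singleton.1 hε
    exact .single ⟨next_of_vertex hA hπ ht hε', List.mem_singleton.2 rfl, .inr rfl⟩
  | @cons ν₀ μ ν' ε₀ l hs ht h ih =>
    have key : ∀ {ε}, ε ∈ l →
        Relation.TransGen (fun a b => A.Next π a b ∧ a ∈ ε₀ :: l ∧ (b ∈ ε₀ :: l ∨ b = ε'))
          ε ε' := by
      intro ε hε
      refine Relation.TransGen.mono (fun a b hab => ?_) _ _ (ih hε hε')
      exact ⟨hab.1, List.mem_cons_of_mem _ hab.2.1, hab.2.2.imp (List.mem_cons_of_mem _) id⟩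
    rcases List.mem_cons.1 hε with rfl | hε
    · obtain ⟨ε₁, h₁, h₁'⟩ := h.exists_head
      have h₁ := List.mem_of_mem_head? h₁
      exact .head ⟨next_of_vertex hA hπ ht h₁', List.mem_cons_self,
        .inl (List.mem_cons_of_mem _ h₁)⟩ (key h₁)
    · exact key hε

theorem eq_or_transGen (hA : A.IsFlow) (hπ : A.IsPolarity π) (h : A.Walk π ν l ν')
    (hε : ε ∈ l) (hε' : l.head? = some ε') :
    Relation.ReflTransGen (A.Next π) ε' ε := by
  induction h generalizing ε ε' with
  | single hs ht =>
    obtain rfl := List.mem_singleton.1 hε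
    obtain rfl : _ = ε' := Option.some_injective _ hε'
    exact .refl
  | cons hs ht h ih =>
    obtain rfl : _ = ε' := Option.some_injective _ hε'
    rcases List.mem_cons.1 hε with rfl | hε
    · exact .refl
    · obtain ⟨ε₁, h₁, h₁'⟩ := h.exists_head
      exact .head (next_of_vertex hA hπ ht h₁') (ih hε h₁)

theorem exists_of_append {s : List A.E} (h : A.Walk π ν (s ++ ε :: l) ν') :
    ∃ μ, A.Walk π μ (ε :: l) ν' := by
  induction s generalizing ν with
  | nil => exact ⟨ν, h⟩
  | cons x s ih =>
    generalize hl : s ++ ε :: l = l' at ih h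
    have e : (x :: s) ++ ε :: l = x :: l' := by simp [← hl]
    rw [e] at h
    cases h with
    | single => simp at hl
    | cons _ _ h => exact ih h

end Walk

theorem IsDownPath.append_single (h : A.IsDownPath ν l μ) (hu : A.up ε = Sum.inl μ)
    (hl : A.lo ε = Sum.inl ν') : A.IsDownPath ν (l ++ [ε]) ν' := by
  induction h with
  | single hu' hl' => exact .cons hu' hl' (.single hu hl)
  | cons hu' hl' _ ih => exact .cons hu' hl' (ih hu)

theorem IsDownPath.exists_head (h : A.IsDownPath ν l ν') :
    ∃ ε, l.head? = some ε ∧ A.up ε = Sum.inl ν := by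
  cases h with
  | single hu hl => exact ⟨_, rfl, hu⟩
  | cons hu hl _ => exact ⟨_, rfl, hu⟩

theorem IsDownPath.exists_getLast (h : A.IsDownPath ν l ν') :
    ∃ ε, l.getLast? = some ε ∧ A.lo ε = Sum.inl ν' := by
  induction h with
  | single hu hl => exact ⟨_, rfl, hl⟩
  | cons hu hl _ ih =>
    obtain ⟨ε, h, h'⟩ := ih
    exact ⟨ε, by rw [List.getLast?_cons, h]; rfl, h'⟩

/-- A downward path is traversed downwards if it is positive, and upwards if it is negative. -/
theorem IsDownPath.walk (hA : A.IsFlow) (hπ : A.IsPolarity π) (h : A.IsDownPath ν l ν') :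
    (A.Walk π ν l ν' ∧ ∀ ε ∈ l, π ε = .pos) ∨
      (A.Walk π ν' l.reverse ν ∧ ∀ ε ∈ l, π ε = .neg) := by
  induction h with
  | @single ν ν' ε hu hl =>
    rcases e : π ε with _ | _
    · exact .inr ⟨.single ((src_neg e).2 hl) ((tgt_neg e).2 hu), by simpa using e⟩
    · exact .inl ⟨.single ((src_pos e).2 hu) ((tgt_pos e).2 hl), by simpa using e⟩
  | @cons ν μ ν' ε l hu hl h ih =>
    obtain ⟨ε', h₁, h₂⟩ := h.exists_head
    have h₁ := List.mem_of_mem_head? h₁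
    have e := hπ.eq_of_below hA ⟨μ, hl, h₂⟩
    rcases ih with ⟨hw, hp⟩ | ⟨hw, hp⟩
    · rw [hp _ h₁] at e
      exact .inl ⟨.cons ((src_pos e).2 hu) ((tgt_pos e).2 hl) hw, List.forall_mem_cons.2 ⟨e, hp⟩⟩
    · rw [hp _ h₁] at e
      refine .inr ⟨?_, List.forall_mem_cons.2 ⟨e, hp⟩⟩
      rw [List.reverse_cons]
      exact hw.append (.single ((src_neg e).2 hl) ((tgt_neg e).2 hu))

/-- An ai-path is a directed walk in one of the two directions. -/
theorem IsAiPath.walk (hA : A.IsFlow) (hπ : A.IsPolarity π) (h : A.IsAiPath ν l ν') :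
    A.Walk π ν l ν' ∨ A.Walk π ν' l.reverse ν := by
  induction h with
  | path h =>
    rcases h with h | h
    · exact (h.walk hA hπ).imp And.left And.left
    · rcases h.walk hA hπ with h | h
      · exact .inr h.1
      · rw [List.reverse_reverse] at h
        exact .inl h.1
  | @join ν μ ν' l l' hμ h h' hne ih ih' =>
    rcases ih with ih | ih <;> rcases ih' with ih' | ih'
    · exact .inl (ih.append ih')
    · obtain ⟨ε, h₁, h₂⟩ := ih.exists_getLast
      obtain ⟨ε', h₁', h₂'⟩ := ih'.exists_getLast
      rw [List.getLast?_reverse] at h₁'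
      rw [h₁, h₁', eq_of_tgt_eq hA hπ hμ h₂ h₂'] at hne
      exact (hne rfl).elim
    · obtain ⟨ε, h₁, h₂⟩ := ih.exists_head
      obtain ⟨ε', h₁', h₂'⟩ := ih'.exists_head
      rw [List.head?_reverse] at h₁
      rw [h₁, h₁', eq_of_src_eq hA hπ hμ h₂ h₂'] at hne
      exact (hne rfl).elim
    · rw [List.reverse_append]
      exact .inr (ih'.append ih)

theorem IsAiPath.ne_nil (h : A.IsAiPath ν l ν') : l ≠ [] := by
  induction h with
  | path h =>
    rintro rfl
    rcases h with h | h <;> cases h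
  | join _ _ _ _ ih => simp [ih]

/-- An ai-path that begins with a downward edge can be prolonged upwards. -/
theorem IsAiPath.cons_down (hA : A.IsFlow) (h : A.IsAiPath μ l ν') (hl : l.head? = some ε')
    (h' : A.up ε' = Sum.inl μ) (hε : A.lo ε = Sum.inl μ) (hε' : A.up ε = Sum.inl ν) :
    A.IsAiPath ν (ε :: l) ν' := by
  induction h with
  | path h =>
    rcases h with h | h
    · exact .path (.inl (.cons hε' hε h))
    · obtain ⟨x, h₁, h₂⟩ := h.exists_getLast
      rw [List.getLast?_reverse, hl] at h₁
      obtain rfl := Option.some_injective _ h₁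
      exact (hA.not_below_self _ ⟨_, h₂, h'⟩).elim
  | join hμ h₁ h₂ hne ih _ =>
    rw [List.head?_append_of_ne_nil _ h₁.ne_nil] at hl
    refine IsAiPath.join hμ (ih hl h' hε) h₂ ?_
    obtain ⟨x, hx⟩ := Option.isSome_iff_exists.1 (List.getLast?_isSome.2 h₁.ne_nil)
    rwa [List.getLast?_cons, hx, Option.getD_some, ← hx]

/-- An ai-path that begins with an upward edge can be prolonged downwards. -/
theorem IsAiPath.cons_up (hA : A.IsFlow) (h : A.IsAiPath μ l ν') (hl : l.head? = some ε')
    (h' : A.lo ε' = Sum.inl μ) (hε : A.up ε = Sum.inl μ) (hε' : A.lo ε = Sum.inl ν) :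
    A.IsAiPath ν (ε :: l) ν' := by
  induction h with
  | path h =>
    rcases h with h | h
    · obtain ⟨x, h₁, h₂⟩ := h.exists_head
      rw [hl] at h₁
      obtain rfl := Option.some_injective _ h₁
      exact (hA.not_below_self _ ⟨_, h', h₂⟩).elim
    · refine .path (.inr ?_)
      rw [List.reverse_cons]
      exact h.append_single hε hε'
  | join hμ h₁ h₂ hne ih _ =>
    rw [List.head?_append_of_ne_nil _ h₁.ne_nil] at hl
    refine IsAiPath.join hμ (ih hl h' hε) h₂ ?_
    obtain ⟨x, hx⟩ := Option.isSome_iff_exists.1 (List.getLast?_isSome.2 h₁.ne_nil)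
    rwa [List.getLast?_cons, hx, Option.getD_some, ← hx]

/-- The converse of `IsAiPath.walk` needs that no edge is repeated, since the two edges at a joint
of an ai-path have to be different. -/
theorem Walk.isAiPath (hA : A.IsFlow) (hπ : A.IsPolarity π) (h : A.Walk π ν l ν')
    (hn : l.Nodup) : A.IsAiPath ν l ν' := by
  have one : ∀ {ν ν' ε}, A.src π ε = Sum.inl ν → A.tgt π ε = Sum.inl ν' → A.IsAiPath ν [ε] ν' := by
    intro ν ν' ε hs ht
    rcases e : π ε with _ | _
    · exact .path (.inr (.single ((tgt_neg e).1 ht) ((src_neg e).1 hs)))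
    · exact .path (.inl (.single ((src_pos e).1 hs) ((tgt_pos e).1 ht)))
  induction h with
  | single hs ht => exact one hs ht
  | @cons ν μ ν' ε l hs ht h ih =>
    obtain ⟨hε, hn⟩ := List.nodup_cons.1 hn
    obtain ⟨ε', h₁, h₂⟩ := h.exists_head
    have ih := ih hn
    rcases next_of_vertex hA hπ ht h₂ with ⟨e, e', -⟩ | ⟨e, e', -⟩ | ⟨e, e', μ', hμ, hu, -⟩ |
      ⟨e, e', μ', hμ, hu, -⟩
    · exact ih.cons_down hA h₁ ((src_pos e').1 h₂) ((tgt_pos e).1 ht) ((src_pos e).1 hs)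
    · exact ih.cons_up hA h₁ ((src_neg e').1 h₂) ((tgt_neg e).1 ht) ((src_neg e).1 hs)
    all_goals
      refine IsAiPath.join (l := [ε]) ?_ (one hs ht) ih ?_
      · first
        | rw [← tgt_neg e, ht, Sum.inl.injEq] at hu
        | rw [← tgt_pos e, ht, Sum.inl.injEq] at hu
        subst hu
        simp [Label.IsInteraction, hμ]
      · rw [h₁]
        rintro h
        obtain rfl : ε = ε' := by simpa using h
        exact hε (List.mem_of_mem_head? h₁)

/-- The edges of ai-cycles are the edges on cycles of the relation `Next`. -/
theorem edgeOnCycle_iff (hA : A.IsFlow) (hπ : A.IsPolarity π) :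
    A.EdgeOnCycle ε ↔ Relation.TransGen (A.Next π) ε ε := by
  constructor
  · rintro ⟨l, ⟨⟨ν, h⟩, -⟩, hε⟩
    have key : ∀ {l}, A.Walk π ν l ν → ε ∈ l → Relation.TransGen (A.Next π) ε ε := by
      intro l h hε
      obtain ⟨ε', h₁, h₂⟩ := h.exists_head
      exact (Relation.TransGen.mono (fun _ _ h => h.1) _ _
        (h.transGen_of_src hA hπ hε h₂)).trans_left (h.eq_or_transGen hA hπ hε h₁)
    rcases h.walk hA hπ with h | h
    · exact key h hε
    · exact key h (List.mem_reverse.2 hε)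
  · intro h
    have key : ∀ {ε b}, Relation.ReflTransGen (A.Next π) ε b → ∀ {ν ν'},
        A.src π ε = Sum.inl ν → A.tgt π b = Sum.inl ν' →
        ∃ l, A.Walk π ν l ν' ∧ l.Nodup ∧ l.head? = some ε := by
      intro ε b h ν ν' hs ht
      induction h using Relation.ReflTransGen.head_induction_on generalizing ν with
      | refl => exact ⟨[b], .single hs ht, by simp, rfl⟩
      | @head a c hac _ ih =>
        obtain ⟨μ, h₁, h₂⟩ := hac.exists_vertex
        obtain ⟨l, hl, hn, -⟩ := ih h₂
        by_cases ha : a ∈ l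
        · -- a detour that returns to the edge `a` is cut off
          obtain ⟨s, t, rfl⟩ := List.append_of_mem ha
          obtain ⟨μ', h⟩ := hl.exists_of_append
          obtain ⟨x, hx, hx'⟩ := h.exists_head
          obtain rfl := Option.some_injective _ hx
          obtain rfl := Sum.inl_injective (hs.symm.trans hx')
          exact ⟨_, h, hn.of_append_right, rfl⟩
        · exact ⟨a :: l, .cons hs h₁ hl, List.nodup_cons.2 ⟨ha, hn⟩, rfl⟩
    obtain ⟨b, h₁, h₂⟩ := Relation.TransGen.tail'_iff.1 h
    obtain ⟨ν, ht, hs⟩ := h₂.exists_vertex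
    obtain ⟨l, hl, hn, hε⟩ := key h₁ hs ht
    exact ⟨l, ⟨⟨ν, hl.isAiPath hA hπ hn⟩, hn⟩, List.mem_of_mem_head? hε⟩

/-- An ai-cycle gives rise to a cycle of `Next` within its edges. -/
theorem IsAiCycle.exists_transGen (hA : A.IsFlow) (hπ : A.IsPolarity π) (h : A.IsAiCycle l) :
    ∃ ε ∈ l, Relation.TransGen (fun a b => A.Next π a b ∧ a ∈ l ∧ b ∈ l) ε ε := by
  obtain ⟨⟨ν, h⟩, -⟩ := h
  have key : ∀ {l}, A.Walk π ν l ν →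
      ∃ ε ∈ l, Relation.TransGen (fun a b => A.Next π a b ∧ a ∈ l ∧ b ∈ l) ε ε := by
    intro l h
    obtain ⟨ε, h₁, h₂⟩ := h.exists_head
    have h₁ := List.mem_of_mem_head? h₁
    refine ⟨ε, h₁, Relation.TransGen.mono (fun a b hab => ?_) _ _
      (h.transGen_of_src hA hπ h₁ h₂)⟩
    exact ⟨hab.1, hab.2.1, hab.2.2.elim id fun e => e ▸ h₁⟩
  rcases h.walk hA hπ with h | h
  · exact key h
  · simpa using key h

/-- Cycle-freeness in terms of succession: the existence of a rank along directed walks. -/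
theorem cycleFree_iff (hA : A.IsFlow) (hπ : A.IsPolarity π) :
    A.CycleFree ↔ ∀ ε, ¬ Relation.TransGen (A.Next π) ε ε := by
  constructor
  · intro h ε hε
    obtain ⟨l, hl, -⟩ := (edgeOnCycle_iff hA hπ).2 hε
    exact h l hl
  · intro h l hl
    obtain ⟨ε, -, hε⟩ := hl.exists_transGen hA hπ
    exact h ε (Relation.TransGen.mono (fun _ _ h => h.1) _ _ hε)

theorem exists_next_of_transGen (h : Relation.TransGen (A.Next π) ε ε) :
    ∃ ε', A.Next π ε ε' ∧ Relation.TransGen (A.Next π) ε' ε' := by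
  obtain ⟨b, h₁, h₂⟩ := Relation.TransGen.head'_iff.1 h
  exact ⟨b, h₁, Relation.TransGen.tail' h₂ h₁⟩

theorem exists_prev_of_transGen (h : Relation.TransGen (A.Next π) ε ε) :
    ∃ ε', A.Next π ε' ε ∧ Relation.TransGen (A.Next π) ε' ε' := by
  obtain ⟨b, h₁, h₂⟩ := Relation.TransGen.tail'_iff.1 h
  exact ⟨b, h₂, Relation.TransGen.head' h₂ h₁⟩

/-- On a cycle, a negative edge comes from below: from a contraction, a cocontraction or a
cointeraction. -/
theorem lo_of_transGen (hA : A.IsFlow) (h : Relation.TransGen (A.Next π) ε ε) (hε : π ε = .neg) :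
    ∃ ν, A.lo ε = Sum.inl ν ∧ ((A.label ν).IsContraction ∨ A.label ν = Label.aiUp) := by
  obtain ⟨ε', h', -⟩ := exists_prev_of_transGen h
  rcases h' with ⟨-, e, -⟩ | ⟨-, -, ν, h₁, h₂⟩ | ⟨-, e, -⟩ | ⟨-, -, ν, h₁, -, h₂⟩
  · simp [hε] at e
  · exact ⟨ν, h₁, .inl (hA.isContraction h₁ h₂)⟩
  · simp [hε] at e
  · exact ⟨ν, h₂, .inr h₁⟩

theorem up_of_transGen (hA : A.IsFlow) (h : Relation.TransGen (A.Next π) ε ε) (hε : π ε = .neg) :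
    ∃ ν, A.up ε = Sum.inl ν ∧ ((A.label ν).IsContraction ∨ A.label ν = Label.aiDown) := by
  obtain ⟨ε', h', -⟩ := exists_next_of_transGen h
  rcases h' with ⟨e, -⟩ | ⟨-, -, ν, h₁, h₂⟩ | ⟨-, -, ν, h₁, h₂, -⟩ | ⟨e, -⟩
  · simp [hε] at e
  · exact ⟨ν, h₂, .inl (hA.isContraction h₁ h₂)⟩
  · exact ⟨ν, h₂, .inr h₁⟩
  · simp [hε] at e

end Orientation

end FlowGraph

/-- In the absence of negative contractions and cocontractions on ai-cycles, every ai-cycle is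
fragile: it cannot consist of positive edges only, since these all go down, and a negative edge on
it is simple. -/
theorem PolarizedFlow.isFragileCycle {I J : Type} {A : PolarizedFlow I J}
    (h : ¬ ∃ ν, A.IsNegativeOnCycle ν) {l : List A.E} (hl : A.IsAiCycle l) :
    A.IsFragileCycle l := by
  refine ⟨hl, ?_⟩
  have hA := A.isFlow
  by_cases hneg : ∃ ε ∈ l, A.polarity ε = Polarity.neg
  · obtain ⟨ε, hε, hn⟩ := hneg
    have hcyc : A.EdgeOnCycle ε := ⟨l, hl, hε⟩
    have ht := (FlowGraph.edgeOnCycle_iff hA A.isPolarity).1 hcyc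
    have key : ∀ ν, ε ∈ A.edgesAt ν → ¬ (A.label ν).IsContraction := fun ν hν hc =>
      h ⟨ν, hc, fun ε' hε' => (A.isPolarity.eq_of_isContraction hc hε' hν).trans hn, ε, hν, hcyc⟩
    obtain ⟨ν, h₁, h₂⟩ := FlowGraph.up_of_transGen hA ht hn
    obtain ⟨ν', h₁', h₂'⟩ := FlowGraph.lo_of_transGen hA ht hn
    exact ⟨ε, hε, ν, ν', h₁, h₂.resolve_left (key ν (.inl h₁)), h₁',
      h₂'.resolve_left (key ν' (.inr h₁'))⟩
  · push Not at hneg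
    obtain ⟨ε, -, hε⟩ := hl.exists_transGen hA A.isPolarity
    refine (hA.acyclic ε (Relation.TransGen.mono ?_ _ _ hε)).elim
    rintro a b ⟨hab | hab | hab | hab, ha, hb⟩
    · exact hab.2.2
    · exact (hneg _ ha hab.1).elim
    · exact (hneg _ ha hab.1).elim
    · exact (hneg _ hb hab.2.1).elim

/-! ### Isomorphisms and duality of flows -/

namespace FlowGraph

variable {I J : Type}

namespace Iso

variable {A B : FlowGraph I J}

protected def refl (A : FlowGraph I J) : A.Iso A where
  vert := Equiv.refl _
  edge := Equiv.refl _
  label_vert _ := rfl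
  up_edge ε := by cases h : A.up ε <;> simp [h]
  lo_edge ε := by cases h : A.lo ε <;> simp [h]

/-- The inverse isomorphism. -/
def symm (f : A.Iso B) : B.Iso A where
  vert := f.vert.symm
  edge := f.edge.symm
  label_vert ν := by rw [← f.label_vert, Equiv.apply_symm_apply]
  up_edge ε := by
    have h := f.up_edge (f.edge.symm ε)
    rw [Equiv.apply_symm_apply] at h
    rw [h]
    cases A.up (f.edge.symm ε) <;> simp
  lo_edge ε := by
    have h := f.lo_edge (f.edge.symm ε)
    rw [Equiv.apply_symm_apply] at h
    rw [h]
    cases A.lo (f.edge.symm ε) <;> simp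

variable (f : A.Iso B)

theorem up_inl {ε : A.E} {ν : A.V} :
    B.up (f.edge ε) = Sum.inl (f.vert ν) ↔ A.up ε = Sum.inl ν := by
  rw [f.up_edge]
  cases A.up ε <;> simp

theorem up_inr {ε : A.E} {i : I} : B.up (f.edge ε) = Sum.inr i ↔ A.up ε = Sum.inr i := by
  rw [f.up_edge]
  cases A.up ε <;> simp

theorem lo_inl {ε : A.E} {ν : A.V} :
    B.lo (f.edge ε) = Sum.inl (f.vert ν) ↔ A.lo ε = Sum.inl ν := by
  rw [f.lo_edge]
  cases A.lo ε <;> simp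

theorem lo_inr {ε : A.E} {j : J} : B.lo (f.edge ε) = Sum.inr j ↔ A.lo ε = Sum.inr j := by
  rw [f.lo_edge]
  cases A.lo ε <;> simp

theorem lowerEdges_vert (ν : A.V) : B.lowerEdges (f.vert ν) = f.edge '' A.lowerEdges ν := by
  ext ε
  obtain ⟨ε, rfl⟩ := f.edge.surjective ε
  simp [lowerEdges, f.up_inl]

theorem upperEdges_vert (ν : A.V) : B.upperEdges (f.vert ν) = f.edge '' A.upperEdges ν := by
  ext ε
  obtain ⟨ε, rfl⟩ := f.edge.surjective ε
  simp [upperEdges, f.lo_inl]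

theorem edgesAt_vert (ν : A.V) : B.edgesAt (f.vert ν) = f.edge '' A.edgesAt ν := by
  rw [edgesAt, edgesAt, f.lowerEdges_vert, f.upperEdges_vert, Set.image_union]

theorem below_iff {ε ε' : A.E} : B.Below (f.edge ε) (f.edge ε') ↔ A.Below ε ε' := by
  constructor
  · rintro ⟨ν, h, h'⟩
    obtain ⟨ν, rfl⟩ := f.vert.surjective ν
    exact ⟨ν, f.lo_inl.1 h, f.up_inl.1 h'⟩
  · rintro ⟨ν, h, h'⟩
    exact ⟨_, f.lo_inl.2 h, f.up_inl.2 h'⟩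

end Iso

theorem IsFlow.of_iso {A B : FlowGraph I J} (h : A.IsFlow) (f : A.Iso B) : B.IsFlow where
  finite_V := have := h.finite_V; Finite.of_equiv _ f.vert
  finite_E := have := h.finite_E; Finite.of_equiv _ f.edge
  upper_named i := (f.edge.existsUnique_congr fun ε => f.up_inr.symm).1 (h.upper_named i)
  lower_named i := (f.edge.existsUnique_congr fun ε => f.lo_inr.symm).1 (h.lower_named i)
  card_lower ν := by
    obtain ⟨ν, rfl⟩ := f.vert.surjective ν
    rw [f.lowerEdges_vert, f.label_vert, Set.ncard_image_of_injective _ f.edge.injective,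
      h.card_lower]
  card_upper ν := by
    obtain ⟨ν, rfl⟩ := f.vert.surjective ν
    rw [f.upperEdges_vert, f.label_vert, Set.ncard_image_of_injective _ f.edge.injective,
      h.card_upper]
  acyclic := by
    obtain ⟨r, hr⟩ := h.exists_rank
    refine not_transGen_self (fun ε => r (f.edge.symm ε)) fun a b hab => hr _ _ ?_
    rw [← f.below_iff]
    simpa using hab

theorem IsPolarity.comp_iso {A B : FlowGraph I J} {π : B.E → Polarity} (hπ : B.IsPolarity π)
    (f : A.Iso B) : A.IsPolarity (π ∘ f.edge) := by
  intro ν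
  have h := hπ (f.vert ν)
  rwa [f.label_vert, f.edgesAt_vert, ← Set.image_comp] at h

/-- A criterion for polarity assignments. -/
theorem IsFlow.isPolarity {A : FlowGraph I J} (h : A.IsFlow) {π : A.E → Polarity}
    (hc : ∀ ν, (A.label ν).IsContraction → ∀ ε ∈ A.edgesAt ν, ∀ ε' ∈ A.edgesAt ν, π ε = π ε')
    (hi : ∀ ν, (A.label ν).IsInteraction → ∃ ε ∈ A.edgesAt ν, ∃ ε' ∈ A.edgesAt ν, π ε ≠ π ε') :
    A.IsPolarity π := by
  refine fun ν => ⟨fun hν => ?_, fun hν => ?_⟩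
  · obtain ⟨ε, hε⟩ : (A.edgesAt ν).Nonempty := by
      rcases hν with hν | hν
      · obtain ⟨ε, hε⟩ := h.exists_lower_single (ν := ν) (by rw [hν]; rfl)
        exact ⟨ε, .inl ((hε ε).2 rfl)⟩
      · obtain ⟨ε, hε⟩ := h.exists_upper_single (ν := ν) (by rw [hν]; rfl)
        exact ⟨ε, .inr ((hε ε).2 rfl)⟩
    have key : π '' A.edgesAt ν = {π ε} := by
      ext x
      constructor
      · rintro ⟨ε', hε', rfl⟩
        exact hc ν hν _ hε' _ hε
      · rintro rfl
        exact ⟨ε, hε, rfl⟩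
    rw [key]
    cases π ε <;> simp
  · obtain ⟨ε, hε, ε', hε', hne⟩ := hi ν hν
    ext x
    constructor
    · rintro -
      cases x <;> simp
    · rintro -
      rcases e : π ε with _ | _ <;> rcases e' : π ε' with _ | _ <;> rcases x with _ | _ <;>
        first
        | exact ⟨ε, hε, e⟩
        | exact ⟨ε', hε', e'⟩
        | exact (hne (e.trans e'.symm)).elim

theorem IsFlow.flip {A : FlowGraph I J} (h : A.IsFlow) : A.flip.IsFlow where
  finite_V := h.finite_V
  finite_E := h.finite_E
  upper_named := h.lower_named
  lower_named := h.upper_named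
  card_lower ν := (h.card_upper ν).trans
    (by cases e : A.label ν <;> simp [FlowGraph.flip, e] <;> rfl)
  card_upper ν := (h.card_lower ν).trans
    (by cases e : A.label ν <;> simp [FlowGraph.flip, e] <;> rfl)
  acyclic := by
    obtain ⟨r, hr⟩ := h.exists_rank
    refine not_transGen_self (fun ε => -(r ε : ℤ)) fun a b hab => ?_
    obtain ⟨ν, h₁, h₂⟩ := hab
    have := hr b a ⟨ν, h₂, h₁⟩
    omega

theorem isPolarity_flip {A : FlowGraph I J} {π : A.E → Polarity} :
    A.flip.IsPolarity π ↔ A.IsPolarity π := by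
  refine forall_congr' fun ν => ?_
  have e : A.flip.edgesAt ν = A.edgesAt ν := Set.union_comm _ _
  have e₁ : (A.flip.label ν).IsContraction ↔ (A.label ν).IsContraction := by
    cases e : A.label ν <;> simp [FlowGraph.flip, e, Label.flip, Label.IsContraction]
  have e₂ : (A.flip.label ν).IsInteraction ↔ (A.label ν).IsInteraction := by
    cases e : A.label ν <;> simp [FlowGraph.flip, e, Label.flip, Label.IsInteraction]
  rw [e, e₁, e₂]
  exact Iff.rfl

/-- Injective maps between graphs that preserve ends map ai-paths to ai-paths. -/
theorem IsAiPath.map {I' J' : Type} {A : FlowGraph I J} {B : FlowGraph I' J'} (f : A.V → B.V)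
    (g : A.E → B.E) (hg : Function.Injective g)
    (hl : ∀ ν, (A.label ν).IsInteraction → (B.label (f ν)).IsInteraction)
    (hu : ∀ ε ν, A.up ε = Sum.inl ν → B.up (g ε) = Sum.inl (f ν))
    (hlo : ∀ ε ν, A.lo ε = Sum.inl ν → B.lo (g ε) = Sum.inl (f ν))
    {ν ν' : A.V} {l : List A.E} (h : A.IsAiPath ν l ν') :
    B.IsAiPath (f ν) (l.map g) (f ν') := by
  have down : ∀ {ν ν' l}, A.IsDownPath ν l ν' → B.IsDownPath (f ν) (l.map g) (f ν') := by
    intro ν ν' l h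
    induction h with
    | single h h' => exact .single (hu _ _ h) (hlo _ _ h')
    | cons h h' _ ih => exact .cons (hu _ _ h) (hlo _ _ h') ih
  induction h with
  | path h =>
    refine .path (h.imp down fun h => ?_)
    rw [← List.map_reverse]
    exact down h
  | join hμ h₁ h₂ hne ih ih' =>
    rw [List.map_append]
    refine .join (hl _ hμ) ih ih' ?_
    rw [List.getLast?_map, List.head?_map]
    exact fun e => hne (Option.map_injective hg e)

theorem IsAiCycle.map {I' J' : Type} {A : FlowGraph I J} {B : FlowGraph I' J'} (f : A.V → B.V)
    (g : A.E → B.E) (hg : Function.Injective g)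
    (hl : ∀ ν, (A.label ν).IsInteraction → (B.label (f ν)).IsInteraction)
    (hu : ∀ ε ν, A.up ε = Sum.inl ν → B.up (g ε) = Sum.inl (f ν))
    (hlo : ∀ ε ν, A.lo ε = Sum.inl ν → B.lo (g ε) = Sum.inl (f ν)) {l : List A.E}
    (h : A.IsAiCycle l) : B.IsAiCycle (l.map g) := by
  obtain ⟨⟨ν, h⟩, hn⟩ := h
  exact ⟨⟨_, h.map f g hg hl hu hlo⟩, hn.map hg⟩

/-- The condition on the set of the polarities of the edges of a vertex with the given label in a
polarity assignment. -/
def _root_.AtomicFlows.Label.Admits (l : Label) (s : Set Polarity) : Prop :=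
  (l.IsContraction → s = {Polarity.neg} ∨ s = {Polarity.pos}) ∧
    (l.IsInteraction → s = {Polarity.neg, Polarity.pos})

/-- The values of `f` and `g` on the upper and lower edges of two graphs, with the same names of
these edges, are the same. -/
def SameBoundary {P Q : Type} {α : Type*} {L R : FlowGraph P Q} (f : L.E → α) (g : R.E → α) :
    Prop :=
  (∀ p ε ε', L.up ε = Sum.inr p → R.up ε' = Sum.inr p → g ε' = f ε) ∧
  (∀ q ε ε', L.lo ε = Sum.inr q → R.lo ε' = Sum.inr q → g ε' = f ε)

/-- The local conditions under which the replacement of a subgraph `L` by `R` preserves flows. For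
acyclicity, ranks of edges have to be carried over. -/
structure Replaces {P Q : Type} (L R : FlowGraph P Q) : Prop where
  left : L.IsFlow
  right : R.IsFlow
  rank : ∀ r : L.E → ℤ, (∀ a b, L.Below a b → r a < r b) →
    ∃ r' : R.E → ℤ, (∀ a b, R.Below a b → r' a < r' b) ∧ SameBoundary r r'
  polarity : ∀ π, L.IsPolarity π → ∃ π', R.IsPolarity π' ∧ SameBoundary π π'

theorem Replaces.flip {P Q : Type} {L R : FlowGraph P Q} (h : L.Replaces R) :
    L.flip.Replaces R.flip where
  left := h.left.flip
  right := h.right.flip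
  rank r hr := by
    obtain ⟨r', h₁, h₂, h₃⟩ := h.rank (fun ε => - r ε) fun a b ⟨ν, h, h'⟩ => by
      exact neg_lt_neg (hr b a ⟨ν, h', h⟩)
    refine ⟨fun ε => - r' ε, fun a b ⟨ν, h, h'⟩ => neg_lt_neg (h₁ b a ⟨ν, h', h⟩), ?_, ?_⟩
    · exact fun p ε ε' h h' => neg_eq_iff_eq_neg.2 (h₃ p ε ε' h h')
    · exact fun p ε ε' h h' => neg_eq_iff_eq_neg.2 (h₂ p ε ε' h h')
  polarity π hπ := by
    obtain ⟨π', h₁, h₂, h₃⟩ := h.polarity π (isPolarity_flip.1 hπ)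
    exact ⟨π', isPolarity_flip.2 h₁, h₃, h₂⟩

end FlowGraph

/-! ### Subgraphs in contexts -/

namespace FlowContext

open FlowGraph

variable {P Q I J : Type} (K : FlowContext P Q I J) {L R : FlowGraph P Q}

theorem plug_up_inl_inl {ε : L.E} {ν : L.V} :
    (K.plug L).up (Sum.inl ε) = Sum.inl (Sum.inl ν) ↔ L.up ε = Sum.inl ν := by
  rcases h : L.up ε with ν' | p
  · simp [plug, h]
  · cases h' : K.attachUp p <;> simp [plug, h, h']

theorem plug_lo_inl_inl {ε : L.E} {ν : L.V} :
    (K.plug L).lo (Sum.inl ε) = Sum.inl (Sum.inl ν) ↔ L.lo ε = Sum.inl ν := by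
  rcases h : L.lo ε with ν' | p
  · simp [plug, h]
  · cases h' : K.attachLo p <;> simp [plug, h, h']

theorem plug_up_inr_inl {ε : K.E} {ν : L.V} :
    (K.plug L).up (Sum.inr ε) ≠ Sum.inl (Sum.inl ν) := by
  cases h : K.up ε <;> simp [plug, h]

theorem plug_lo_inr_inl {ε : K.E} {ν : L.V} :
    (K.plug L).lo (Sum.inr ε) ≠ Sum.inl (Sum.inl ν) := by
  cases h : K.lo ε <;> simp [plug, h]

theorem exists_inl_of_plug_up {ε : (K.plug L).E} {ν : L.V}
    (h : (K.plug L).up ε = Sum.inl (Sum.inl ν)) : ∃ ε₀, ε = Sum.inl ε₀ ∧ L.up ε₀ = Sum.inl ν := by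
  rcases ε with ε | ε
  · exact ⟨ε, rfl, K.plug_up_inl_inl.1 h⟩
  · exact (K.plug_up_inr_inl h).elim

theorem exists_inl_of_plug_lo {ε : (K.plug L).E} {ν : L.V}
    (h : (K.plug L).lo ε = Sum.inl (Sum.inl ν)) : ∃ ε₀, ε = Sum.inl ε₀ ∧ L.lo ε₀ = Sum.inl ν := by
  rcases ε with ε | ε
  · exact ⟨ε, rfl, K.plug_lo_inl_inl.1 h⟩
  · exact (K.plug_lo_inr_inl h).elim

/-- The ends outside of the subgraph are the same for all subgraphs: they are determined by the
names of the edges of the subgraph. -/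
theorem exists_of_plug_up {ε : (K.plug L).E} {x : K.V ⊕ I}
    (h : (K.plug L).up ε = Sum.map Sum.inr id x) :
    (∃ ε₀ p, ε = Sum.inl ε₀ ∧ L.up ε₀ = Sum.inr p ∧ K.attachUp p = x) ∨
      ∃ ε₀, ε = Sum.inr ε₀ ∧ K.up ε₀ = x := by
  have hinj : Function.Injective (Sum.map (Sum.inr : K.V → L.V ⊕ K.V) (id : I → I)) :=
    Sum.map_injective.2 ⟨Sum.inr_injective, Function.injective_id⟩
  rcases ε with ε | ε
  · rcases h' : L.up ε with ν | p
    · cases x <;> simp [plug, h'] at h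
    · refine .inl ⟨ε, p, rfl, h', hinj (.trans ?_ h)⟩
      simp [plug, h']
  · exact .inr ⟨ε, rfl, hinj h⟩

theorem exists_of_plug_lo {ε : (K.plug L).E} {x : K.V ⊕ J}
    (h : (K.plug L).lo ε = Sum.map Sum.inr id x) :
    (∃ ε₀ q, ε = Sum.inl ε₀ ∧ L.lo ε₀ = Sum.inr q ∧ K.attachLo q = x) ∨
      ∃ ε₀, ε = Sum.inr ε₀ ∧ K.lo ε₀ = x := by
  have hinj : Function.Injective (Sum.map (Sum.inr : K.V → L.V ⊕ K.V) (id : J → J)) :=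
    Sum.map_injective.2 ⟨Sum.inr_injective, Function.injective_id⟩
  rcases ε with ε | ε
  · rcases h' : L.lo ε with ν | p
    · cases x <;> simp [plug, h'] at h
    · refine .inl ⟨ε, p, rfl, h', hinj (.trans ?_ h)⟩
      simp [plug, h']
  · exact .inr ⟨ε, rfl, hinj h⟩

theorem plug_up_of_inr {ε : L.E} {p : P} (h : L.up ε = Sum.inr p) :
    (K.plug L).up (Sum.inl ε) = Sum.map Sum.inr id (K.attachUp p) := by simp [plug, h]

theorem plug_lo_of_inr {ε : L.E} {q : Q} (h : L.lo ε = Sum.inr q) :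
    (K.plug L).lo (Sum.inl ε) = Sum.map Sum.inr id (K.attachLo q) := by simp [plug, h]

/-- The edges of `K.plug L` whose upper end is the given end outside of `L` correspond to those of
`K.plug R`. -/
theorem ncard_up_eq (hL : L.IsFlow) (hR : R.IsFlow) (x : K.V ⊕ I) :
    {ε | (K.plug L).up ε = Sum.map Sum.inr id x}.ncard =
      {ε | (K.plug R).up ε = Sum.map Sum.inr id x}.ncard := by
  have key : ∀ {L : FlowGraph P Q}, L.IsFlow →
      {ε | (K.plug L).up ε = Sum.map Sum.inr id x}.ncard =
        {y : P ⊕ K.E | Sum.elim K.attachUp K.up y = x}.ncard := by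
    intro L hL
    choose u hu hu' using hL.upper_named
    have hinj : Function.Injective u := fun p p' e =>
    Sum.inr_injective ((hu p).symm.trans (e ▸ hu p'))
    rw [← Set.ncard_image_of_injective (f := Sum.map u (id : K.E → K.E)) _
      (Sum.map_injective.2 ⟨hinj, Function.injective_id⟩)]
    congr 1
    ext ε
    constructor
    · intro h
      rcases K.exists_of_plug_up h with ⟨ε₀, p, rfl, h₁, h₂⟩ | ⟨ε₀, rfl, h₁⟩
      · exact ⟨Sum.inl p, h₂, congrArg Sum.inl (hu' p ε₀ h₁).symm⟩
      · exact ⟨Sum.inr ε₀, h₁, rfl⟩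
    · rintro ⟨p | ε₀, h, rfl⟩
      · exact (K.plug_up_of_inr (hu p)).trans (congrArg _ h)
      · exact congrArg (Sum.map Sum.inr id) h
  rw [key hL, key hR]

theorem ncard_lo_eq (hL : L.IsFlow) (hR : R.IsFlow) (x : K.V ⊕ J) :
    {ε | (K.plug L).lo ε = Sum.map Sum.inr id x}.ncard =
      {ε | (K.plug R).lo ε = Sum.map Sum.inr id x}.ncard := by
  have key : ∀ {L : FlowGraph P Q}, L.IsFlow →
      {ε | (K.plug L).lo ε = Sum.map Sum.inr id x}.ncard =
        {y : Q ⊕ K.E | Sum.elim K.attachLo K.lo y = x}.ncard := by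
    intro L hL
    choose u hu hu' using hL.lower_named
    have hinj : Function.Injective u := fun p p' e =>
    Sum.inr_injective ((hu p).symm.trans (e ▸ hu p'))
    rw [← Set.ncard_image_of_injective (f := Sum.map u (id : K.E → K.E)) _
      (Sum.map_injective.2 ⟨hinj, Function.injective_id⟩)]
    congr 1
    ext ε
    constructor
    · intro h
      rcases K.exists_of_plug_lo h with ⟨ε₀, p, rfl, h₁, h₂⟩ | ⟨ε₀, rfl, h₁⟩
      · exact ⟨Sum.inl p, h₂, congrArg Sum.inl (hu' p ε₀ h₁).symm⟩
      · exact ⟨Sum.inr ε₀, h₁, rfl⟩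
    · rintro ⟨p | ε₀, h, rfl⟩
      · exact (K.plug_lo_of_inr (hu p)).trans (congrArg _ h)
      · exact congrArg (Sum.map Sum.inr id) h
  rw [key hL, key hR]

/-- Every edge of `K.plug R` with an upper end outside of `R` has a counterpart in `K.plug L`. -/
theorem exists_up_counterpart (hL : L.IsFlow) {α : Type*} {f : L.E → α} {g : R.E → α} {k : K.E → α}
    (hfg : SameBoundary f g) {ε : (K.plug R).E} {x : K.V ⊕ I}
    (h : (K.plug R).up ε = Sum.map Sum.inr id x) :
    ∃ ε' : (K.plug L).E, (K.plug L).up ε' = Sum.map Sum.inr id x ∧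
      Sum.elim f k ε' = Sum.elim g k ε := by
  rcases K.exists_of_plug_up h with ⟨ε₀, p, rfl, h₁, h₂⟩ | ⟨ε₀, rfl, h₁⟩
  · obtain ⟨ε₁, h₃, -⟩ := hL.upper_named p
    exact ⟨Sum.inl ε₁, by rw [K.plug_up_of_inr h₃, h₂], (hfg.1 _ _ _ h₃ h₁).symm⟩
  · exact ⟨Sum.inr ε₀, congrArg (Sum.map Sum.inr id) h₁, rfl⟩

theorem exists_lo_counterpart (hL : L.IsFlow) {α : Type*} {f : L.E → α} {g : R.E → α} {k : K.E → α}
    (hfg : SameBoundary f g) {ε : (K.plug R).E} {x : K.V ⊕ J}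
    (h : (K.plug R).lo ε = Sum.map Sum.inr id x) :
    ∃ ε' : (K.plug L).E, (K.plug L).lo ε' = Sum.map Sum.inr id x ∧
      Sum.elim f k ε' = Sum.elim g k ε := by
  rcases K.exists_of_plug_lo h with ⟨ε₀, p, rfl, h₁, h₂⟩ | ⟨ε₀, rfl, h₁⟩
  · obtain ⟨ε₁, h₃, -⟩ := hL.lower_named p
    exact ⟨Sum.inl ε₁, by rw [K.plug_lo_of_inr h₃, h₂], (hfg.2 _ _ _ h₃ h₁).symm⟩
  · exact ⟨Sum.inr ε₀, congrArg (Sum.map Sum.inr id) h₁, rfl⟩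

theorem plug_lowerEdges_inl (ν : L.V) :
    (K.plug L).lowerEdges (Sum.inl ν) = Sum.inl '' L.lowerEdges ν := by
  ext ε
  constructor
  · intro h
    obtain ⟨ε₀, rfl, h'⟩ := K.exists_inl_of_plug_up h
    exact ⟨ε₀, h', rfl⟩
  · rintro ⟨ε₀, h, rfl⟩
    exact K.plug_up_inl_inl.2 h

theorem plug_upperEdges_inl (ν : L.V) :
    (K.plug L).upperEdges (Sum.inl ν) = Sum.inl '' L.upperEdges ν := by
  ext ε
  constructor
  · intro h
    obtain ⟨ε₀, rfl, h'⟩ := K.exists_inl_of_plug_lo h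
    exact ⟨ε₀, h', rfl⟩
  · rintro ⟨ε₀, h, rfl⟩
    exact K.plug_lo_inl_inl.2 h

theorem plug_edgesAt_inl (ν : L.V) :
    (K.plug L).edgesAt (Sum.inl ν) = Sum.inl '' L.edgesAt ν :=
  (congrArg₂ Union.union (K.plug_lowerEdges_inl ν) (K.plug_upperEdges_inl ν)).trans
    (Set.image_union _ _ _).symm

theorem existsUnique_iff_ncard {α : Type*} {p : α → Prop} : (∃! a, p a) ↔ {a | p a}.ncard = 1 := by
  rw [Set.ncard_eq_one]
  constructor
  · rintro ⟨a, ha, h⟩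
    exact ⟨a, Set.ext fun b => ⟨fun hb => h b hb, fun hb => (Set.mem_singleton_iff.1 hb) ▸ ha⟩⟩
  · rintro ⟨a, h⟩
    exact ⟨a, (Set.ext_iff.1 h a).2 rfl, fun b hb => (Set.ext_iff.1 h b).1 hb⟩

/-- Replacing a subgraph keeps the numbers of edges at the vertices of the context, and the
acyclicity, because there is a rank on the replacement that agrees with that of the subgraph on the
boundary. -/
theorem isFlow_plug (h : L.Replaces R) (hK : (K.plug L).IsFlow) : (K.plug R).IsFlow where
  finite_V := by
    have := h.right.finite_V
    have : Finite (L.V ⊕ K.V) := hK.finite_V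
    have := Finite.of_injective (Sum.inr : K.V → L.V ⊕ K.V) Sum.inr_injective
    exact inferInstanceAs (Finite (R.V ⊕ K.V))
  finite_E := by
    have := h.right.finite_E
    have : Finite (L.E ⊕ K.E) := hK.finite_E
    have := Finite.of_injective (Sum.inr : K.E → L.E ⊕ K.E) Sum.inr_injective
    exact inferInstanceAs (Finite (R.E ⊕ K.E))
  upper_named i := by
    have := existsUnique_iff_ncard.1 (hK.upper_named i)
    exact existsUnique_iff_ncard.2 ((K.ncard_up_eq h.left h.right (Sum.inr i)).symm.trans this)
  lower_named i := by
    have := existsUnique_iff_ncard.1 (hK.lower_named i)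
    exact existsUnique_iff_ncard.2 ((K.ncard_lo_eq h.left h.right (Sum.inr i)).symm.trans this)
  card_lower ν := by
    rcases ν with ν | ν
    · exact (congrArg Set.ncard (K.plug_lowerEdges_inl ν)).trans <|
        (Set.ncard_image_of_injective _ Sum.inl_injective).trans (h.right.card_lower ν)
    · exact (K.ncard_up_eq h.left h.right (Sum.inl ν)).symm.trans (hK.card_lower (Sum.inr ν))
  card_upper ν := by
    rcases ν with ν | ν
    · exact (congrArg Set.ncard (K.plug_upperEdges_inl ν)).trans <|
        (Set.ncard_image_of_injective _ Sum.inl_injective).trans (h.right.card_upper ν)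
    · exact (K.ncard_lo_eq h.left h.right (Sum.inl ν)).symm.trans (hK.card_upper (Sum.inr ν))
  acyclic := by
    obtain ⟨r, hr⟩ := hK.exists_rank
    obtain ⟨r', hr', hb⟩ := h.rank (fun ε => r (Sum.inl ε)) fun a b ⟨ν, h₁, h₂⟩ =>
      Int.ofNat_lt.2 (hr _ _ ⟨Sum.inl ν, K.plug_lo_inl_inl.2 h₁, K.plug_up_inl_inl.2 h₂⟩)
    have e : ∀ ε : (K.plug L).E,
        Sum.elim (fun ε => (r (Sum.inl ε) : ℤ)) (fun ε => r (Sum.inr ε)) ε = r ε := by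
      rintro (ε | ε) <;> rfl
    refine not_transGen_self (Sum.elim r' fun ε => (r (Sum.inr ε) : ℤ)) ?_
    rintro a b ⟨ν | ν, h₁, h₂⟩
    · obtain ⟨a, rfl, ha⟩ := K.exists_inl_of_plug_lo h₁
      obtain ⟨b, rfl, hb⟩ := K.exists_inl_of_plug_up h₂
      exact hr' a b ⟨ν, ha, hb⟩
    · obtain ⟨a', h₁', ha⟩ := K.exists_lo_counterpart h.left (k := fun ε => (r (Sum.inr ε) : ℤ)) hb
        (x := Sum.inl ν) h₁
      obtain ⟨b', h₂', hb⟩ := K.exists_up_counterpart h.left (k := fun ε => (r (Sum.inr ε) : ℤ)) hb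
        (x := Sum.inl ν) h₂
      rw [← ha, ← hb, e, e]
      exact Int.ofNat_lt.2 (hr _ _ ⟨Sum.inr ν, h₁', h₂'⟩)

theorem _root_.AtomicFlows.FlowGraph.SameBoundary.symm {α : Type*} {f : L.E → α} {g : R.E → α}
    (h : SameBoundary f g) :
    SameBoundary g f :=
  ⟨fun p ε ε' e e' => (h.1 p ε' ε e' e).symm, fun p ε ε' e e' => (h.2 p ε' ε e' e).symm⟩

/-- Polarity assignments of the context and of the replacement that agree on the boundary combine.
-/
theorem isPolarity_plug (hL : L.IsFlow) (hR : R.IsFlow) {π : L.E → Polarity} {π' : R.E → Polarity}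
    {k : K.E → Polarity} (h : SameBoundary π π') (hπ' : R.IsPolarity π')
    (hπ : (K.plug L).IsPolarity (Sum.elim π k)) : (K.plug R).IsPolarity (Sum.elim π' k) := by
  rintro (ν | ν)
  · have key : Sum.elim π' k '' (K.plug R).edgesAt (Sum.inl ν) = π' '' R.edgesAt ν :=
      (congrArg _ (K.plug_edgesAt_inl ν)).trans (Set.image_comp _ _ _).symm
    exact (congrArg (Label.Admits (R.label ν)) key).mpr (hπ' ν)
  · have key : Sum.elim π' k '' (K.plug R).edgesAt (Sum.inr ν) =
        Sum.elim π k '' (K.plug L).edgesAt (Sum.inr ν) := by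
      refine Set.Subset.antisymm ?_ ?_
      · rintro _ ⟨ε, hε | hε, rfl⟩
        · obtain ⟨ε', h₁, h₂⟩ := K.exists_up_counterpart hL (k := k) h (x := Sum.inl ν) hε
          exact ⟨ε', .inl h₁, h₂⟩
        · obtain ⟨ε', h₁, h₂⟩ := K.exists_lo_counterpart hL (k := k) h (x := Sum.inl ν) hε
          exact ⟨ε', .inr h₁, h₂⟩
      · rintro _ ⟨ε, hε | hε, rfl⟩
        · obtain ⟨ε', h₁, h₂⟩ := K.exists_up_counterpart hR (k := k) (SameBoundary.symm h)
            (x := Sum.inl ν) hε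
          exact ⟨ε', .inl h₁, h₂⟩
        · obtain ⟨ε', h₁, h₂⟩ := K.exists_lo_counterpart hR (k := k) (SameBoundary.symm h)
            (x := Sum.inl ν) hε
          exact ⟨ε', .inr h₁, h₂⟩
    exact (congrArg (Label.Admits (K.label ν)) key).mpr (hπ (Sum.inr ν))

theorem isPolarity_of_plug {π : L.E → Polarity} {k : K.E → Polarity}
    (hπ : (K.plug L).IsPolarity (Sum.elim π k)) : L.IsPolarity π := by
  intro ν
  have key : Sum.elim π k '' (K.plug L).edgesAt (Sum.inl ν) = π '' L.edgesAt ν :=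
    (congrArg _ (K.plug_edgesAt_inl ν)).trans (Set.image_comp _ _ _).symm
  exact (congrArg (Label.Admits (L.label ν)) key).mp (hπ (Sum.inl ν))

end FlowContext

/-! ### The rules of the system c preserve flows -/

theorem ncard_fiber {n : ℕ} {α : Type*} [DecidableEq α] (f : Fin n → α) (c : α) :
    {ε | f ε = c}.ncard = (Finset.univ.filter fun ε => f ε = c).card := by
  rw [← Set.ncard_coe_finset]
  congr 1
  ext
  simp

open FlowGraph

/-- Flows that are given by lists: every end has the number of edges that it should have. -/
theorem isFlow_of_fin {n m p q : ℕ} {label : Fin n → Label} {up : Fin m → Fin n ⊕ Fin p}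
    {lo : Fin m → Fin n ⊕ Fin q}
    (hup : ∀ x, (Finset.univ.filter fun ε => up ε = x).card =
      Sum.elim (fun ν => (label ν).lowerCard) (fun _ => 1) x)
    (hlo : ∀ x, (Finset.univ.filter fun ε => lo ε = x).card =
      Sum.elim (fun ν => (label ν).upperCard) (fun _ => 1) x)
    (r : Fin m → ℕ) (hr : ∀ a b ν, lo a = Sum.inl ν → up b = Sum.inl ν → r a < r b) :
    (FlowGraph.mk (Fin n) (Fin m) label up lo).IsFlow where
  finite_V := inferInstanceAs (Finite (Fin n))
  finite_E := inferInstanceAs (Finite (Fin m))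
  upper_named i := FlowContext.existsUnique_iff_ncard.2 ((ncard_fiber up _).trans (hup (Sum.inr i)))
  lower_named i := FlowContext.existsUnique_iff_ncard.2 ((ncard_fiber lo _).trans (hlo (Sum.inr i)))
  card_lower ν := (ncard_fiber up _).trans (hup (Sum.inl ν))
  card_upper ν := (ncard_fiber lo _).trans (hlo (Sum.inl ν))
  acyclic := not_transGen_self r fun a b ⟨ν, h₁, h₂⟩ => hr a b ν h₁ h₂

theorem ciLeft_isFlow : ciLeft.IsFlow :=
  isFlow_of_fin (by decide) (by decide) ![0, 0, 0, 1] (by decide)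

theorem ciRight_isFlow : ciRight.IsFlow :=
  isFlow_of_fin (by decide) (by decide) ![0, 0, 0, 1, 1] (by decide)

theorem ccLeft_isFlow : ccLeft.IsFlow :=
  isFlow_of_fin (by decide) (by decide) ![0, 0, 2, 2, 1] (by decide)

theorem ccRight_isFlow : ccRight.IsFlow :=
  isFlow_of_fin (by decide) (by decide) ![0, 0, 2, 2, 1, 1, 1, 1] (by decide)

/-- The upper ends of the edges of `ciLeft`. Like the abbreviations below, it has types on which
statements about all edges are decidable by evaluation. -/
abbrev ciLeftUp : Fin 4 → Fin 2 ⊕ Fin 3 := ciLeft.up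

/-- The lower ends of the edges of `ciLeft`. -/
abbrev ciLeftLo : Fin 4 → Fin 2 ⊕ Fin 0 := ciLeft.lo

/-- The upper ends of the edges of `ciRight`. -/
abbrev ciRightUp : Fin 5 → Fin 3 ⊕ Fin 3 := ciRight.up

/-- The lower ends of the edges of `ciRight`. -/
abbrev ciRightLo : Fin 5 → Fin 3 ⊕ Fin 0 := ciRight.lo

/-- The upper ends of the edges of `ccLeft`. -/
abbrev ccLeftUp : Fin 5 → Fin 2 ⊕ Fin 2 := ccLeft.up

/-- The lower ends of the edges of `ccLeft`. -/
abbrev ccLeftLo : Fin 5 → Fin 2 ⊕ Fin 2 := ccLeft.lo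

/-- The upper ends of the edges of `ccRight`. -/
abbrev ccRightUp : Fin 8 → Fin 4 ⊕ Fin 2 := ccRight.up

/-- The lower ends of the edges of `ccRight`. -/
abbrev ccRightLo : Fin 8 → Fin 4 ⊕ Fin 2 := ccRight.lo

/-- The first three edges on both sides are the ones that belong to the context. -/
theorem ci_boundary {α : Type*} {f : ciLeft.E → α} {g : ciRight.E → α}
    (h₀ : g (0 : Fin 5) = f (0 : Fin 4)) (h₁ : g (1 : Fin 5) = f (1 : Fin 4))
    (h₂ : g (2 : Fin 5) = f (2 : Fin 4)) : SameBoundary f g := by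
  refine ⟨fun p ε ε' h h' => ?_, fun q => q.elim0⟩
  have key : ∀ (p : Fin 3) (ε : Fin 4) (ε' : Fin 5), ciLeftUp ε = Sum.inr p →
      ciRightUp ε' = Sum.inr p → (ε = 0 ∧ ε' = 0) ∨ (ε = 1 ∧ ε' = 1) ∨ (ε = 2 ∧ ε' = 2) := by decide
  rcases key p ε ε' h h' with ⟨rfl, rfl⟩ | ⟨rfl, rfl⟩ | ⟨rfl, rfl⟩ <;> assumption

/-- The first four edges on both sides are the ones that belong to the context. -/
theorem cc_boundary {α : Type*} {f : ccLeft.E → α} {g : ccRight.E → α}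
    (h₀ : g (0 : Fin 8) = f (0 : Fin 5)) (h₁ : g (1 : Fin 8) = f (1 : Fin 5))
    (h₂ : g (2 : Fin 8) = f (2 : Fin 5)) (h₃ : g (3 : Fin 8) = f (3 : Fin 5)) :
    SameBoundary f g := by
  constructor
  · intro p ε ε' h h'
    have key : ∀ (p : Fin 2) (ε : Fin 5) (ε' : Fin 8), ccLeftUp ε = Sum.inr p →
        ccRightUp ε' = Sum.inr p → (ε = 0 ∧ ε' = 0) ∨ (ε = 1 ∧ ε' = 1) := by decide
    rcases key p ε ε' h h' with ⟨rfl, rfl⟩ | ⟨rfl, rfl⟩ <;> assumption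
  · intro p ε ε' h h'
    have key : ∀ (p : Fin 2) (ε : Fin 5) (ε' : Fin 8), ccLeftLo ε = Sum.inr p →
        ccRightLo ε' = Sum.inr p → (ε = 2 ∧ ε' = 2) ∨ (ε = 3 ∧ ε' = 3) := by decide
    rcases key p ε ε' h h' with ⟨rfl, rfl⟩ | ⟨rfl, rfl⟩ <;> assumption

theorem ci_replaces : ciLeft.Replaces ciRight where
  left := ciLeft_isFlow
  right := ciRight_isFlow
  rank r hr := by
    refine ⟨(![r (0 : Fin 4), r (1 : Fin 4), r (2 : Fin 4), r (2 : Fin 4) + 1, r (2 : Fin 4) + 1] :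
      Fin 5 → ℤ), ?_, ci_boundary rfl rfl rfl⟩
    rintro a b ⟨ν, h, h'⟩
    have key : ∀ (a b : Fin 5) (ν : Fin 3), ciRightLo a = Sum.inl ν → ciRightUp b = Sum.inl ν →
        a = 2 ∧ (b = 3 ∨ b = 4) := by decide
    obtain ⟨rfl, rfl | rfl⟩ := key a b ν h h' <;> exact Int.lt_succ _
  polarity π hπ := by
    refine ⟨(![π (0 : Fin 4), π (1 : Fin 4), π (2 : Fin 4), π (2 : Fin 4), π (2 : Fin 4)] :
      Fin 5 → Polarity), ciRight_isFlow.isPolarity ?_ ?_, ci_boundary rfl rfl rfl⟩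
    · -- all edges of the cocontraction have the polarity of the edge `2`
      intro ν hν ε hε ε' hε'
      have key : ∀ (ν : Fin 3) (ε : Fin 5), (![.acUp, .aiUp, .aiUp] : Fin 3 → Label) ν = .acUp →
          ciRightUp ε = Sum.inl ν ∨ ciRightLo ε = Sum.inl ν → ε = 2 ∨ ε = 3 ∨ ε = 4 := by decide
      have hν : (![.acUp, .aiUp, .aiUp] : Fin 3 → Label) ν = .acUp := by
        revert ν
        show ∀ ν : Fin 3, _
        intro ν
        fin_cases ν <;> simp [ciRight, Label.IsContraction]
      obtain rfl | rfl | rfl := key ν ε hν hε <;> obtain rfl | rfl | rfl := key ν ε' hν hε' <;> rfl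
    · have c₀ : π (0 : Fin 4) = π (3 : Fin 4) :=
        hπ.eq_of_isContraction (ν := (0 : Fin 2)) (.inl rfl) (.inr rfl) (.inl rfl)
      have c₁ : π (1 : Fin 4) = π (3 : Fin 4) :=
        hπ.eq_of_isContraction (ν := (0 : Fin 2)) (.inl rfl) (.inr rfl) (.inl rfl)
      have c₂ : π (2 : Fin 4) ≠ π (3 : Fin 4) := fun e =>
        absurd (hπ.eq_of_aiUp ciLeft_isFlow (ν := (1 : Fin 2)) rfl rfl rfl e)
          (by decide : (2 : Fin 4) ≠ 3)
      show ∀ ν : Fin 3, _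
      intro ν hν
      fin_cases ν
      · simp [ciRight, Label.IsInteraction] at hν
      · exact ⟨(0 : Fin 5), .inr rfl, (3 : Fin 5), .inr rfl, fun e => c₂ (e.symm.trans c₀)⟩
      · exact ⟨(1 : Fin 5), .inr rfl, (4 : Fin 5), .inr rfl, fun e => c₂ (e.symm.trans c₁)⟩

theorem cc_replaces : ccLeft.Replaces ccRight where
  left := ccLeft_isFlow
  right := ccRight_isFlow
  rank r hr := by
    refine ⟨(![r (0 : Fin 5), r (1 : Fin 5), r (2 : Fin 5), r (3 : Fin 5), r (4 : Fin 5),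
      r (4 : Fin 5), r (4 : Fin 5), r (4 : Fin 5)] : Fin 8 → ℤ), ?_, cc_boundary rfl rfl rfl rfl⟩
    have h₀ : r (0 : Fin 5) < r (4 : Fin 5) := hr _ _ ⟨(0 : Fin 2), rfl, rfl⟩
    have h₁ : r (1 : Fin 5) < r (4 : Fin 5) := hr _ _ ⟨(0 : Fin 2), rfl, rfl⟩
    have h₂ : r (4 : Fin 5) < r (2 : Fin 5) := hr _ _ ⟨(1 : Fin 2), rfl, rfl⟩
    have h₃ : r (4 : Fin 5) < r (3 : Fin 5) := hr _ _ ⟨(1 : Fin 2), rfl, rfl⟩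
    rintro a b ⟨ν, h, h'⟩
    have key : ∀ (a b : Fin 8) (ν : Fin 4), ccRightLo a = Sum.inl ν → ccRightUp b = Sum.inl ν →
        (a = 0 ∧ (b = 4 ∨ b = 5)) ∨ (a = 1 ∧ (b = 6 ∨ b = 7)) ∨ (b = 2 ∧ (a = 4 ∨ a = 6)) ∨
          (b = 3 ∧ (a = 5 ∨ a = 7)) := by decide
    obtain ⟨rfl, rfl | rfl⟩ | ⟨rfl, rfl | rfl⟩ | ⟨rfl, rfl | rfl⟩ | ⟨rfl, rfl | rfl⟩ :=
      key a b ν h h' <;> assumption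
  polarity π hπ := by
    have c₀ : π (0 : Fin 5) = π (4 : Fin 5) :=
      hπ.eq_of_isContraction (ν := (0 : Fin 2)) (.inl rfl) (.inr rfl) (.inl rfl)
    have c₁ : π (1 : Fin 5) = π (4 : Fin 5) :=
      hπ.eq_of_isContraction (ν := (0 : Fin 2)) (.inl rfl) (.inr rfl) (.inl rfl)
    have c₂ : π (2 : Fin 5) = π (4 : Fin 5) :=
      hπ.eq_of_isContraction (ν := (1 : Fin 2)) (.inr rfl) (.inl rfl) (.inr rfl)
    have c₃ : π (3 : Fin 5) = π (4 : Fin 5) :=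
      hπ.eq_of_isContraction (ν := (1 : Fin 2)) (.inr rfl) (.inl rfl) (.inr rfl)
    refine ⟨fun _ => π (4 : Fin 5), ccRight_isFlow.isPolarity (fun _ _ _ _ _ _ => rfl) ?_,
      cc_boundary c₀.symm c₁.symm c₂.symm c₃.symm⟩
    show ∀ ν : Fin 4, _
    intro ν hν
    fin_cases ν <;> simp [ccRight, Label.IsInteraction] at hν

theorem CRule.replaces {P Q : Type} {L R : FlowGraph P Q} (h : CRule L R) : L.Replaces R := by
  cases h with
  | ci => exact ci_replaces
  | ic => exact ci_replaces.flip
  | cc => exact cc_replaces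

/-! ### Reducibility of negative contractions on cycles -/

section Context

variable {I J P Q : Type} {A : FlowGraph I J} {L : FlowGraph P Q}

/-- If a flow `L` is mapped one-to-one into a flow `A`, then `A` is `L` in a context. Since a vertex
of `L` and its image have the same label, the image has no edges apart from those of `L`. -/
theorem exists_context (hA : A.IsFlow) (hL : L.IsFlow) (fv : L.V → A.V) (fe : L.E → A.E)
    (hfv : Function.Injective fv) (hfe : Function.Injective fe)
    (hl : ∀ ν, A.label (fv ν) = L.label ν)
    (hup : ∀ ε ν, L.up ε = Sum.inl ν → A.up (fe ε) = Sum.inl (fv ν))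
    (hlo : ∀ ε ν, L.lo ε = Sum.inl ν → A.lo (fe ε) = Sum.inl (fv ν)) :
    ∃ (K : FlowContext P Q I J) (f : (K.plug L).Iso A), ∀ ν, f.vert (Sum.inl ν) = fv ν := by
  have := hA.finite_E
  -- by comparing cardinalities, the edges at the image of a vertex of `L` are images of edges
  have up' : ∀ a ν, A.up a = Sum.inl (fv ν) → ∃ ε, fe ε = a ∧ L.up ε = Sum.inl ν := by
    intro a ν ha
    have hsub : fe '' L.lowerEdges ν ⊆ A.lowerEdges (fv ν) := by
      rintro _ ⟨ε, hε, rfl⟩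
      exact hup ε ν hε
    have heq := Set.eq_of_subset_of_ncard_le hsub (by
      rw [Set.ncard_image_of_injective _ hfe, hA.card_lower, hL.card_lower, hl])
    have ha' : a ∈ A.lowerEdges (fv ν) := ha
    rw [← heq] at ha'
    obtain ⟨ε, h, h'⟩ := ha'
    exact ⟨ε, h', h⟩
  have lo' : ∀ a ν, A.lo a = Sum.inl (fv ν) → ∃ ε, fe ε = a ∧ L.lo ε = Sum.inl ν := by
    intro a ν ha
    have hsub : fe '' L.upperEdges ν ⊆ A.upperEdges (fv ν) := by
      rintro _ ⟨ε, hε, rfl⟩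
      exact hlo ε ν hε
    have heq := Set.eq_of_subset_of_ncard_le hsub (by
      rw [Set.ncard_image_of_injective _ hfe, hA.card_upper, hL.card_upper, hl])
    have ha' : a ∈ A.upperEdges (fv ν) := ha
    rw [← heq] at ha'
    obtain ⟨ε, h, h'⟩ := ha'
    exact ⟨ε, h', h⟩
  -- ends of `A` that are not vertices of `L`
  have lift : ∀ {M : Type} (x : A.V ⊕ M), (∀ ν, x ≠ Sum.inl (fv ν)) →
      ∃ y : {v // v ∉ Set.range fv} ⊕ M, Sum.map Subtype.val id y = x := by
    rintro M (v | i) h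
    · exact ⟨Sum.inl ⟨v, fun ⟨ν, e⟩ => h ν (by rw [e])⟩, rfl⟩
    · exact ⟨Sum.inr i, rfl⟩
  choose u hu hu' using hL.upper_named
  choose d hd hd' using hL.lower_named
  have h₁ : ∀ e : {e // e ∉ Set.range fe}, ∃ y : {v // v ∉ Set.range fv} ⊕ I,
      Sum.map Subtype.val id y = A.up e.1 := fun e => lift _ fun ν h => by
    obtain ⟨ε, hε, -⟩ := up' _ _ h
    exact e.2 ⟨ε, hε⟩
  have h₂ : ∀ e : {e // e ∉ Set.range fe}, ∃ y : {v // v ∉ Set.range fv} ⊕ J,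
      Sum.map Subtype.val id y = A.lo e.1 := fun e => lift _ fun ν h => by
    obtain ⟨ε, hε, -⟩ := lo' _ _ h
    exact e.2 ⟨ε, hε⟩
  have h₃ : ∀ p : P, ∃ y : {v // v ∉ Set.range fv} ⊕ I,
      Sum.map Subtype.val id y = A.up (fe (u p)) := fun p => lift _ fun ν h => by
    obtain ⟨ε, hε, h'⟩ := up' _ _ h
    rw [hfe hε, hu] at h'
    cases h'
  have h₄ : ∀ q : Q, ∃ y : {v // v ∉ Set.range fv} ⊕ J,
      Sum.map Subtype.val id y = A.lo (fe (d q)) := fun p => lift _ fun ν h => by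
    obtain ⟨ε, hε, h'⟩ := lo' _ _ h
    rw [hfe hε, hd] at h'
    cases h'
  choose kup hkup using h₁
  choose klo hklo using h₂
  choose aup haup using h₃
  choose alo halo using h₄
  have bij : ∀ {S T : Type} (f : S → T), Function.Injective f →
      Function.Bijective (Sum.elim f (Subtype.val : {t // t ∉ Set.range f} → T)) := by
    intro S T f hf
    refine ⟨hf.sumElim Subtype.val_injective fun s t e => t.2 ⟨s, e⟩, fun t => ?_⟩
    by_cases ht : t ∈ Set.range f
    · obtain ⟨s, rfl⟩ := ht
      exact ⟨Sum.inl s, rfl⟩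
    · exact ⟨Sum.inr ⟨t, ht⟩, rfl⟩
  have comp : ∀ {M : Type} (y : {v // v ∉ Set.range fv} ⊕ M),
      Sum.map (Sum.elim fv Subtype.val) id (Sum.map (Sum.inr : _ → L.V ⊕ _) id y) =
        Sum.map Subtype.val id y := by
    rintro M (y | y) <;> rfl
  -- the context consists of the vertices and edges of `A` that are not images
  let K : FlowContext P Q I J :=
    ⟨{v // v ∉ Set.range fv}, {e // e ∉ Set.range fe}, fun v => A.label v.1, kup, klo, aup, alo⟩
  let f : (K.plug L).Iso A :=
    { vert := Equiv.ofBijective _ (bij fv hfv)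
      edge := Equiv.ofBijective _ (bij fe hfe)
      label_vert := by
        rintro (ν | ν)
        · exact hl ν
        · rfl
      up_edge := by
        rintro (ε | ε)
        · change A.up (fe ε) = Sum.map (Sum.elim fv Subtype.val) id ((K.plug L).up (Sum.inl ε))
          rcases h : L.up ε with ν | p
          · rw [hup _ _ h, K.plug_up_inl_inl.2 h]
            rfl
          · rw [K.plug_up_of_inr h, hu' _ _ h]
            exact ((comp _).trans (haup p)).symm
        · exact ((comp _).trans (hkup ε)).symm
      lo_edge := by
        rintro (ε | ε)
        · change A.lo (fe ε) = Sum.map (Sum.elim fv Subtype.val) id ((K.plug L).lo (Sum.inl ε))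
          rcases h : L.lo ε with ν | p
          · rw [hlo _ _ h, K.plug_lo_inl_inl.2 h]
            rfl
          · rw [K.plug_lo_of_inr h, hd' _ _ h]
            exact ((comp _).trans (halo p)).symm
        · exact ((comp _).trans (hklo ε)).symm }
  exact ⟨K, f, fun ν => rfl⟩

end Context

section Progress

variable {I J : Type} {A : PolarizedFlow I J}

/-- An occurrence of a left-hand side can be reduced: the right-hand side has a polarity assignment
with the same values on the boundary. -/
theorem exists_negativeCStep_of_redex {P Q : Type} {L R : FlowGraph P Q} {K : FlowContext P Q I J}
    (h : CRule L R) (f : (K.plug L).Iso A.toFlowGraph)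
    (hν : ∃ ν : L.V, A.IsNegativeOnCycle (f.vert (Sum.inl ν))) : ∃ B, NegativeCStep A B := by
  have hr := h.replaces
  have hK : (K.plug L).IsFlow := A.isFlow.of_iso f.symm
  have hπ := A.isPolarity.comp_iso f
  have e : (A.polarity ∘ f.edge : (K.plug L).E → Polarity) =
      Sum.elim (fun ε => A.polarity (f.edge (Sum.inl ε)))
        (fun ε => A.polarity (f.edge (Sum.inr ε))) := by
    funext ε
    rcases ε with ε | ε <;> rfl
  rw [e] at hπ
  obtain ⟨π', hπ', hb⟩ := hr.polarity _ (K.isPolarity_of_plug hπ)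
  have hB := K.isPolarity_plug hr.left hr.right hb hπ' hπ
  let B : PolarizedFlow I J :=
    { toAtomicFlow := (K.isFlow_plug hr hK).toAtomicFlow ⟨_, hB⟩
      polarity := _
      isPolarity := hB }
  exact ⟨B, P, Q, L, R, K, f, FlowGraph.Iso.refl _, h, hν, fun _ => rfl, hb.1, hb.2⟩

/-- A contraction whose lower edge enters a cointeraction or a cocontraction, or dually, is an
instance of a rule of the system c. -/
theorem exists_negativeCStep_of_edge {v w : A.V} {e : A.E} (hv : A.up e = Sum.inl v)
    (hw : A.lo e = Sum.inl w)
    (hl : (A.label v = .acDown ∧ (A.label w = .aiUp ∨ A.label w = .acUp)) ∨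
      (A.label v = .aiDown ∧ A.label w = .acUp))
    (hn : A.IsNegativeOnCycle v ∨ A.IsNegativeOnCycle w) : ∃ B, NegativeCStep A B := by
  have hA := A.isFlow
  have hvw : v ≠ w := by
    rintro rfl
    exact hA.not_below_self e ⟨v, hw, hv⟩
  have hinj : Function.Injective ![v, w] := List.nodup_ofFn.1 (by simp [hvw])
  have hinj' : Function.Injective ![w, v] := List.nodup_ofFn.1 (by simp [hvw.symm])
  rcases hl with ⟨hlv, hlw | hlw⟩ | ⟨hlv, hlw⟩
  · -- contraction over cointeraction
    obtain ⟨e₀, e₁, hne, h₀⟩ := hA.exists_upper_pair (ν := v) (by rw [hlv]; rfl)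
    obtain ⟨e₂, hne', h₂⟩ : ∃ e₂, e₂ ≠ e ∧ A.lo e₂ = Sum.inl w := by
      obtain ⟨a, b, hab, h⟩ := hA.exists_upper_pair (ν := w) (by rw [hlw]; rfl)
      rcases (h e).1 hw with rfl | rfl
      · exact ⟨b, hab.symm, (h b).2 (.inr rfl)⟩
      · exact ⟨a, hab, (h a).2 (.inl rfl)⟩
    have l₀ := (h₀ e₀).2 (.inl rfl)
    have l₁ := (h₀ e₁).2 (.inr rfl)
    have ne : ∀ {x y}, A.lo x = Sum.inl v → A.lo y = Sum.inl w → x ≠ y := by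
      rintro x y hx hy rfl
      exact hvw (Sum.inl_injective (hx.symm.trans hy))
    have hfe : Function.Injective ![e₀, e₁, e₂, e] := List.nodup_ofFn.1 (by
      simp [hne, ne l₀ h₂, ne l₀ hw, ne l₁ h₂, ne l₁ hw, hne'])
    obtain ⟨K, f, hf⟩ := exists_context hA ciLeft_isFlow ![v, w] ![e₀, e₁, e₂, e] hinj hfe
      (show ∀ ν : Fin 2, _ from Fin.forall_fin_two.2 ⟨hlv, hlw⟩)
      (fun ε ν h => by
        have key : ∀ (ε : Fin 4) (ν : Fin 2), ciLeftUp ε = Sum.inl ν → ε = 3 ∧ ν = 0 := by decide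
        obtain ⟨rfl, rfl⟩ := key ε ν h
        exact hv)
      (fun ε ν h => by
        have key : ∀ (ε : Fin 4) (ν : Fin 2), ciLeftLo ε = Sum.inl ν →
            ν = 0 ∧ (ε = 0 ∨ ε = 1) ∨ ν = 1 ∧ (ε = 2 ∨ ε = 3) := by decide
        obtain ⟨rfl, rfl | rfl⟩ | ⟨rfl, rfl | rfl⟩ := key ε ν h
        exacts [l₀, l₁, h₂, hw])
    refine exists_negativeCStep_of_redex .ci f ?_
    rcases hn with hn | hn
    · exact ⟨(0 : Fin 2), (hf (0 : Fin 2)).symm ▸ hn⟩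
    · exact ⟨(1 : Fin 2), (hf (1 : Fin 2)).symm ▸ hn⟩
  · -- contraction over cocontraction
    obtain ⟨e₀, e₁, hne, h₀⟩ := hA.exists_upper_pair (ν := v) (by rw [hlv]; rfl)
    obtain ⟨e₂, e₃, hne', h₂⟩ := hA.exists_lower_pair (ν := w) (by rw [hlw]; rfl)
    have l₀ := (h₀ e₀).2 (.inl rfl)
    have l₁ := (h₀ e₁).2 (.inr rfl)
    have l₂ := (h₂ e₂).2 (.inl rfl)
    have l₃ := (h₂ e₃).2 (.inr rfl)
    have ne : ∀ {x}, A.lo x = Sum.inl v → x ≠ e := by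
      rintro x hx rfl
      exact hvw (Sum.inl_injective (hx.symm.trans hw))
    have ne' : ∀ {x}, A.up x = Sum.inl w → x ≠ e := by
      rintro x hx rfl
      exact hvw (Sum.inl_injective (hv.symm.trans hx))
    have ne'' : ∀ {x y}, A.lo x = Sum.inl v → A.up y = Sum.inl w → x ≠ y := by
      rintro x y hx hy rfl
      exact hA.acyclic x (.tail (.single ⟨v, hx, hv⟩) ⟨w, hw, hy⟩)
    have hfe : Function.Injective ![e₀, e₁, e₂, e₃, e] := List.nodup_ofFn.1 (by
      simp [hne, hne', ne l₀, ne l₁, ne' l₂, ne' l₃, ne'' l₀ l₂, ne'' l₀ l₃, ne'' l₁ l₂,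
        ne'' l₁ l₃])
    obtain ⟨K, f, hf⟩ := exists_context hA ccLeft_isFlow ![v, w] ![e₀, e₁, e₂, e₃, e] hinj hfe
      (show ∀ ν : Fin 2, _ from Fin.forall_fin_two.2 ⟨hlv, hlw⟩)
      (fun ε ν h => by
        have key : ∀ (ε : Fin 5) (ν : Fin 2), ccLeftUp ε = Sum.inl ν →
            ν = 0 ∧ ε = 4 ∨ ν = 1 ∧ (ε = 2 ∨ ε = 3) := by decide
        obtain ⟨rfl, rfl⟩ | ⟨rfl, rfl | rfl⟩ := key ε ν h
        exacts [hv, l₂, l₃])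
      (fun ε ν h => by
        have key : ∀ (ε : Fin 5) (ν : Fin 2), ccLeftLo ε = Sum.inl ν →
            ν = 0 ∧ (ε = 0 ∨ ε = 1) ∨ ν = 1 ∧ ε = 4 := by decide
        obtain ⟨rfl, rfl | rfl⟩ | ⟨rfl, rfl⟩ := key ε ν h
        exacts [l₀, l₁, hw])
    refine exists_negativeCStep_of_redex .cc f ?_
    rcases hn with hn | hn
    · exact ⟨(0 : Fin 2), (hf (0 : Fin 2)).symm ▸ hn⟩
    · exact ⟨(1 : Fin 2), (hf (1 : Fin 2)).symm ▸ hn⟩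
  · -- interaction over cocontraction
    obtain ⟨e₀, e₁, hne, h₀⟩ := hA.exists_lower_pair (ν := w) (by rw [hlw]; rfl)
    obtain ⟨e₂, hne', h₂⟩ : ∃ e₂, e₂ ≠ e ∧ A.up e₂ = Sum.inl v := by
      obtain ⟨a, b, hab, h⟩ := hA.exists_lower_pair (ν := v) (by rw [hlv]; rfl)
      rcases (h e).1 hv with rfl | rfl
      · exact ⟨b, hab.symm, (h b).2 (.inr rfl)⟩
      · exact ⟨a, hab, (h a).2 (.inl rfl)⟩
    have l₀ := (h₀ e₀).2 (.inl rfl)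
    have l₁ := (h₀ e₁).2 (.inr rfl)
    have ne : ∀ {x y}, A.up x = Sum.inl w → A.up y = Sum.inl v → x ≠ y := by
      rintro x y hx hy rfl
      exact hvw (Sum.inl_injective (hy.symm.trans hx))
    have hfe : Function.Injective ![e₀, e₁, e₂, e] := List.nodup_ofFn.1 (by
      simp [hne, ne l₀ h₂, ne l₀ hv, ne l₁ h₂, ne l₁ hv, hne'])
    obtain ⟨K, f, hf⟩ := exists_context hA ciLeft_isFlow.flip ![w, v] ![e₀, e₁, e₂, e] hinj' hfe
      (show ∀ ν : Fin 2, _ from Fin.forall_fin_two.2 ⟨hlw, hlv⟩)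
      (fun ε ν h => by
        have key : ∀ (ε : Fin 4) (ν : Fin 2), ciLeftLo ε = Sum.inl ν →
            ν = 0 ∧ (ε = 0 ∨ ε = 1) ∨ ν = 1 ∧ (ε = 2 ∨ ε = 3) := by decide
        obtain ⟨rfl, rfl | rfl⟩ | ⟨rfl, rfl | rfl⟩ := key ε ν h
        exacts [l₀, l₁, h₂, hv])
      (fun ε ν h => by
        have key : ∀ (ε : Fin 4) (ν : Fin 2), ciLeftUp ε = Sum.inl ν → ε = 3 ∧ ν = 0 := by decide
        obtain ⟨rfl, rfl⟩ := key ε ν h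
        exact hw)
    refine exists_negativeCStep_of_redex .ic f ?_
    rcases hn with hn | hn
    · exact ⟨(1 : Fin 2), (hf (1 : Fin 2)).symm ▸ hn⟩
    · exact ⟨(0 : Fin 2), (hf (0 : Fin 2)).symm ▸ hn⟩

/-- A lowest negative contraction on a cycle is above a cocontraction or a cointeraction; if there
is no negative contraction on a cycle, then a highest negative cocontraction on a cycle is below an
interaction. -/
theorem PolarizedFlow.exists_negativeCStep (h : ∃ ν, A.IsNegativeOnCycle ν) :
    ∃ B, NegativeCStep A B := by
  have hA := A.isFlow
  have := hA.finite_E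
  have hπ := A.isPolarity
  obtain ⟨r, hr⟩ := hA.exists_rank
  let On : A.E → Prop := fun e => A.polarity e = .neg ∧ Relation.TransGen (A.Next A.polarity) e e
  have neg : ∀ {e ν}, On e → e ∈ A.edgesAt ν → (A.label ν).IsContraction →
      A.IsNegativeOnCycle ν := fun he hν hc =>
    ⟨hc, fun e' he' => (hπ.eq_of_isContraction hc he' hν).trans he.1, _, hν,
      (edgeOnCycle_iff hA hπ).2 he.2⟩
  -- cycles pass through negative contractions and cocontractions from below
  have down : ∀ {e ν}, On e → A.lo e = Sum.inl ν → (A.label ν).IsContraction →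
      ∃ e', On e' ∧ A.up e' = Sum.inl ν := by
    intro e ν he hν hc
    obtain ⟨e', h, h'⟩ := exists_prev_of_transGen he.2
    rcases h with ⟨-, hp, -⟩ | ⟨hn, -, μ, h₁, h₂⟩ | ⟨-, hp, -⟩ | ⟨-, -, μ, hμ, -, h₂⟩
    · rw [he.1] at hp; cases hp
    · exact ⟨e', ⟨hn, h'⟩, h₂.trans (congrArg _ (Sum.inl_injective (h₁.symm.trans hν)))⟩
    · rw [he.1] at hp; cases hp
    · obtain rfl := Sum.inl_injective (hν.symm.trans h₂)
      simp [hμ, Label.IsContraction] at hc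
  have up : ∀ {e ν}, On e → A.up e = Sum.inl ν → (A.label ν).IsContraction →
      ∃ e', On e' ∧ A.lo e' = Sum.inl ν := by
    intro e ν he hν hc
    obtain ⟨e', h, h'⟩ := exists_next_of_transGen he.2
    rcases h with ⟨hp, -⟩ | ⟨-, hn, μ, h₁, h₂⟩ | ⟨-, -, μ, hμ, h₁, -⟩ | ⟨hp, -⟩
    · rw [he.1] at hp; cases hp
    · exact ⟨e', ⟨hn, h'⟩, h₁.trans (congrArg _ (Sum.inl_injective (h₂.symm.trans hν)))⟩
    · obtain rfl := Sum.inl_injective (hν.symm.trans h₁)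
      simp [hμ, Label.IsContraction] at hc
    · rw [he.1] at hp; cases hp
  by_cases hS : ∃ e, On e ∧ ∃ ν, A.up e = Sum.inl ν ∧ A.label ν = .acDown
  · -- a negative contraction on a cycle with its lower edge `e` as low as possible
    obtain ⟨e, ⟨he, ν, hν, hl⟩, hmax⟩ := Set.exists_max_image
      {e | On e ∧ ∃ ν, A.up e = Sum.inl ν ∧ A.label ν = .acDown} r (Set.toFinite _) hS
    have hneg := neg he (.inl hν) (.inl hl)
    obtain ⟨w, hw, (hlw | hlw) | hlw⟩ := lo_of_transGen hA he.2 he.1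
    · obtain ⟨e', he', h'⟩ := down he hw (.inl hlw)
      have h₁ := hmax e' ⟨he', w, h', hlw⟩
      have h₂ := hr e e' ⟨w, hw, h'⟩
      omega
    · exact exists_negativeCStep_of_edge hν hw (.inl ⟨hl, .inr hlw⟩) (.inl hneg)
    · exact exists_negativeCStep_of_edge hν hw (.inl ⟨hl, .inl hlw⟩) (.inl hneg)
  · -- no contraction: a negative cocontraction with its upper edge `e` as high as possible
    have hS' : ∃ e, On e ∧ ∃ ν, A.lo e = Sum.inl ν ∧ A.label ν = .acUp := by
      obtain ⟨ν, hc, hn, e, he, hcyc⟩ := h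
      have he' : On e := ⟨hn e he, (edgeOnCycle_iff hA hπ).1 hcyc⟩
      rcases hc with hc | hc
      · rcases he with he | he
        · exact (hS ⟨e, he', ν, he, hc⟩).elim
        · obtain ⟨e₁, h₁, h₂⟩ := down he' he (.inl hc)
          exact (hS ⟨e₁, h₁, ν, h₂, hc⟩).elim
      · rcases he with he | he
        · obtain ⟨e₁, h₁, h₂⟩ := up he' he (.inr hc)
          exact ⟨e₁, h₁, ν, h₂, hc⟩
        · exact ⟨e, he', ν, he, hc⟩
    obtain ⟨e, ⟨he, ν, hν, hl⟩, hmin⟩ := Set.exists_min_image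
      {e | On e ∧ ∃ ν, A.lo e = Sum.inl ν ∧ A.label ν = .acUp} r (Set.toFinite _) hS'
    have hneg := neg he (.inr hν) (.inr hl)
    obtain ⟨w, hw, (hlw | hlw) | hlw⟩ := up_of_transGen hA he.2 he.1
    · exact (hS ⟨e, he, w, hw, hlw⟩).elim
    · obtain ⟨e', he', h'⟩ := up he hw (.inr hlw)
      have h₁ := hmin e' ⟨he', w, h', hlw⟩
      have h₂ := hr e' e ⟨w, h', hw⟩
      omega
    · exact exists_negativeCStep_of_edge hw hν (.inr ⟨hlw, hl⟩) (.inr hneg)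

end Progress

/-! ### Termination -/

namespace FlowGraph

variable {I J : Type}

/-- The edge starts at a vertex with the label `l`. -/
def UpIs (A : FlowGraph I J) (l : Label) (ε : A.E) : Prop := ∃ ν, A.up ε = Sum.inl ν ∧ A.label ν = l

/-- The edge ends in a vertex with the label `l`. -/
def LoIs (A : FlowGraph I J) (l : Label) (ε : A.E) : Prop := ∃ ν, A.lo ε = Sum.inl ν ∧ A.label ν = l

/-- `D` bounds, for every negative edge, the number of paths that go down from this edge to a
cocontraction. -/
structure IsPotential (A : FlowGraph I J) (π : A.E → Polarity) (D : A.E → ℕ) : Prop where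
  contraction : ∀ ε ε' ν, π ε = .neg → A.label ν = .acDown → A.lo ε = Sum.inl ν →
    A.up ε' = Sum.inl ν → D ε' ≤ D ε
  cocontraction : ∀ ε ε₁ ε₂ ν, π ε = .neg → A.label ν = .acUp → A.lo ε = Sum.inl ν →
    A.up ε₁ = Sum.inl ν → A.up ε₂ = Sum.inl ν → ε₁ ≠ ε₂ → 1 + D ε₁ + D ε₂ ≤ D ε

open Classical in
/-- The contribution to the termination measure of an edge with polarity `p` and potential `d`,
where `u` says that its upper end is a contraction and `l` that its lower end is a cocontraction. -/
noncomputable def endWeight (p : Polarity) (u l : Prop) (d : ℕ) : ℕ :=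
  if p = .neg then (if u then 3 * d + 1 else 0) + (if l then 1 else 0) else 0

section EndWeight

variable {p p' : Polarity} {u u' l l' : Prop} {d d' : ℕ}

theorem endWeight_congr (hp : p = p') (hu : u ↔ u') (hl : l ↔ l') (hd : d = d') :
    endWeight p u l d = endWeight p' u' l' d' := by
  obtain rfl := propext hu
  obtain rfl := propext hl
  rw [hp, hd]

theorem endWeight_pos : endWeight .pos u l d = 0 := if_neg nofun

theorem endWeight_eq_zero (hu : ¬ u) (hl : ¬ l) : endWeight p u l d = 0 := by
  simp [endWeight, hu, hl]

theorem endWeight_neg (hu : u) (hl : l) : endWeight .neg u l d = 3 * d + 2 := by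
  simp [endWeight, hu, hl]

theorem one_le_endWeight (h : u ∨ l) : 1 ≤ endWeight .neg u l d := by
  rcases h with h | h
  · simp only [endWeight, h, if_true]; omega
  · simp only [endWeight, h, if_true]; omega

theorem endWeight_le_add_one (hp : p = p') (hu : u ↔ u') (hd : d = d') :
    endWeight p u l d ≤ endWeight p' u' l' d' + 1 := by
  obtain rfl := propext hu
  subst hp hd
  simp only [endWeight]
  split_ifs <;> omega

theorem endWeight_le_add (hp : p = p') (hl : l ↔ l') :
    endWeight p u l d ≤ endWeight p' u' l' d' + (3 * d + 1) := by
  obtain rfl := propext hl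
  subst hp
  simp only [endWeight]
  split_ifs <;> omega

end EndWeight

/-- The contribution of an edge to the termination measure. It counts negative contractions (at
their lower edges) and negative cocontractions (at their upper edges) once, and in addition three
times every path from a negative contraction to a negative cocontraction: contraction over
cocontraction destroys one such path and creates one new contraction and one new cocontraction,
whereas the other rules destroy a contraction or cocontraction and create no path. -/
noncomputable def weight (A : FlowGraph I J) (π : A.E → Polarity) (D : A.E → ℕ) (ε : A.E) : ℕ :=
  endWeight (π ε) (A.UpIs .acDown ε) (A.LoIs .acUp ε) (D ε)

/-- The number `n` is the measure of `A` for some potential. -/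
def HasMeasure (A : FlowGraph I J) (π : A.E → Polarity) (n : ℕ) : Prop :=
  ∃ D, A.IsPotential π D ∧ ∑ᶠ ε, A.weight π D ε = n

/-- A potential exists: a function that triples along every edge exceeds the number of paths. -/
theorem IsFlow.exists_hasMeasure {A : FlowGraph I J} (hA : A.IsFlow) (π : A.E → Polarity) :
    ∃ n, A.HasMeasure π n := by
  have := hA.finite_E
  obtain ⟨r, hr⟩ := AtomicFlows.exists_rank (R := fun a b => A.Below b a) fun ε h =>
    hA.acyclic ε (Relation.transGen_swap.1 h)
  refine ⟨_, fun ε => 3 ^ r ε, ⟨fun ε ε' ν _ _ h h' => ?_, fun ε ε₁ ε₂ ν _ _ h h₁ h₂ _ => ?_⟩, rfl⟩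
  · exact Nat.pow_le_pow_right (by norm_num) (hr _ _ ⟨ν, h, h'⟩).le
  · have key : ∀ ε', A.up ε' = Sum.inl ν → 3 * 3 ^ r ε' ≤ 3 ^ r ε := fun ε' h' => by
      rw [← pow_succ']
      exact Nat.pow_le_pow_right (by norm_num) (hr _ _ ⟨ν, h, h'⟩)
    have k₁ := key _ h₁
    have k₂ := key _ h₂
    have := Nat.one_le_pow (r ε₁) 3 (by norm_num)
    have := Nat.one_le_pow (r ε₂) 3 (by norm_num)
    omega

theorem upIs_iso {A B : FlowGraph I J} (f : A.Iso B) {l : Label} {ε : A.E} :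
    B.UpIs l (f.edge ε) ↔ A.UpIs l ε := by
  constructor
  · rintro ⟨ν, h, h'⟩
    obtain ⟨ν, rfl⟩ := f.vert.surjective ν
    exact ⟨ν, f.up_inl.1 h, (f.label_vert ν).symm.trans h'⟩
  · rintro ⟨ν, h, h'⟩
    exact ⟨_, f.up_inl.2 h, (f.label_vert ν).trans h'⟩

theorem loIs_iso {A B : FlowGraph I J} (f : A.Iso B) {l : Label} {ε : A.E} :
    B.LoIs l (f.edge ε) ↔ A.LoIs l ε := by
  constructor
  · rintro ⟨ν, h, h'⟩
    obtain ⟨ν, rfl⟩ := f.vert.surjective ν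
    exact ⟨ν, f.lo_inl.1 h, (f.label_vert ν).symm.trans h'⟩
  · rintro ⟨ν, h, h'⟩
    exact ⟨_, f.lo_inl.2 h, (f.label_vert ν).trans h'⟩

theorem HasMeasure.comp_iso {A B : FlowGraph I J} {π : B.E → Polarity} {n : ℕ}
    (h : B.HasMeasure π n) (f : A.Iso B) : A.HasMeasure (π ∘ f.edge) n := by
  obtain ⟨D, hD, rfl⟩ := h
  refine ⟨D ∘ f.edge, ⟨fun ε ε' ν h hl h₁ h₂ => ?_, fun ε ε₁ ε₂ ν h hl h₀ h₁ h₂ hne => ?_⟩, ?_⟩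
  · exact hD.contraction _ _ (f.vert ν) h ((f.label_vert ν).trans hl) (f.lo_inl.2 h₁)
      (f.up_inl.2 h₂)
  · exact hD.cocontraction _ _ _ (f.vert ν) h ((f.label_vert ν).trans hl) (f.lo_inl.2 h₀)
      (f.up_inl.2 h₁) (f.up_inl.2 h₂) (f.edge.injective.ne hne)
  · rw [← finsum_comp_equiv f.edge]
    exact finsum_congr fun ε => endWeight_congr rfl (upIs_iso f).symm (loIs_iso f).symm rfl

end FlowGraph

namespace FlowContext

variable {P Q I J : Type} (K : FlowContext P Q I J) {L R : FlowGraph P Q}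

theorem upIs_plug_of_inl {l : Label} {ε : L.E} {ν : L.V} (h : L.up ε = Sum.inl ν) :
    (K.plug L).UpIs l (Sum.inl ε) ↔ L.label ν = l := by
  have h := K.plug_up_inl_inl.2 h
  exact ⟨fun ⟨μ, h₁, h₂⟩ => by obtain rfl := Sum.inl_injective (h.symm.trans h₁); exact h₂,
    fun h' => ⟨_, h, h'⟩⟩

theorem loIs_plug_of_inl {l : Label} {ε : L.E} {ν : L.V} (h : L.lo ε = Sum.inl ν) :
    (K.plug L).LoIs l (Sum.inl ε) ↔ L.label ν = l := by
  have h := K.plug_lo_inl_inl.2 h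
  exact ⟨fun ⟨μ, h₁, h₂⟩ => by obtain rfl := Sum.inl_injective (h.symm.trans h₁); exact h₂,
    fun h' => ⟨_, h, h'⟩⟩

/-- An end outside of the subgraph is a vertex with the given label. -/
def EndIs {M : Type} (l : Label) (x : K.V ⊕ M) : Prop := ∃ ν, x = Sum.inl ν ∧ K.label ν = l

theorem upIs_plug_of_map {l : Label} {ε : (K.plug L).E} {x : K.V ⊕ I}
    (h : (K.plug L).up ε = Sum.map Sum.inr id x) : (K.plug L).UpIs l ε ↔ K.EndIs l x := by
  constructor
  · rintro ⟨μ, h₁, h₂⟩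
    rcases x with ν | i
    · obtain rfl := Sum.inl_injective (h.symm.trans h₁)
      exact ⟨ν, rfl, h₂⟩
    · cases h.symm.trans h₁
  · rintro ⟨ν, rfl, h'⟩
    exact ⟨_, h, h'⟩

theorem loIs_plug_of_map {l : Label} {ε : (K.plug L).E} {x : K.V ⊕ J}
    (h : (K.plug L).lo ε = Sum.map Sum.inr id x) : (K.plug L).LoIs l ε ↔ K.EndIs l x := by
  constructor
  · rintro ⟨μ, h₁, h₂⟩
    rcases x with ν | i
    · obtain rfl := Sum.inl_injective (h.symm.trans h₁)
      exact ⟨ν, rfl, h₂⟩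
    · cases h.symm.trans h₁
  · rintro ⟨ν, rfl, h'⟩
    exact ⟨_, h, h'⟩

/-- Two edges with the same upper end outside of the subgraph have different counterparts. -/
theorem exists_up_counterparts (hL : L.IsFlow) (hR : R.IsFlow) {α : Type*} {f : L.E → α}
    {g : R.E → α} {k : K.E → α} (hfg : SameBoundary f g) {ε₁ ε₂ : (K.plug R).E} {x : K.V ⊕ I}
    (h₁ : (K.plug R).up ε₁ = Sum.map Sum.inr id x) (h₂ : (K.plug R).up ε₂ = Sum.map Sum.inr id x)
    (hne : ε₁ ≠ ε₂) :
    ∃ ε₁' ε₂' : (K.plug L).E, ε₁' ≠ ε₂' ∧ (K.plug L).up ε₁' = Sum.map Sum.inr id x ∧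
      (K.plug L).up ε₂' = Sum.map Sum.inr id x ∧ Sum.elim f k ε₁' = Sum.elim g k ε₁ ∧
      Sum.elim f k ε₂' = Sum.elim g k ε₂ := by
  have inner : ∀ {ε p}, R.up ε = Sum.inr p → K.attachUp p = x → ∃ ε', L.up ε' = Sum.inr p ∧
      (K.plug L).up (Sum.inl ε') = Sum.map Sum.inr id x ∧ f ε' = g ε := by
    intro ε p h h'
    obtain ⟨ε', h'', -⟩ := hL.upper_named p
    exact ⟨ε', h'', by rw [K.plug_up_of_inr h'', h'], (hfg.1 _ _ _ h'' h).symm⟩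
  rcases K.exists_of_plug_up h₁ with ⟨a, p, rfl, ha, hp⟩ | ⟨a, rfl, ha⟩ <;>
    rcases K.exists_of_plug_up h₂ with ⟨b, q, rfl, hb, hq⟩ | ⟨b, rfl, hb⟩
  · obtain ⟨a', h₃, h₄, h₅⟩ := inner ha hp
    obtain ⟨b', h₆, h₇, h₈⟩ := inner hb hq
    refine ⟨Sum.inl a', Sum.inl b', fun e => hne ?_, h₄, h₇, h₅, h₈⟩
    obtain rfl := Sum.inl_injective e
    obtain rfl := Sum.inr_injective (h₃.symm.trans h₆)
    rw [(hR.upper_named p).unique ha hb]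
  · obtain ⟨a', h₃, h₄, h₅⟩ := inner ha hp
    exact ⟨Sum.inl a', Sum.inr b, nofun, h₄, congrArg (Sum.map Sum.inr id) hb, h₅, rfl⟩
  · obtain ⟨b', h₃, h₄, h₅⟩ := inner hb hq
    exact ⟨Sum.inr a, Sum.inl b', nofun, congrArg (Sum.map Sum.inr id) ha, h₄, rfl, h₅⟩
  · exact ⟨Sum.inr a, Sum.inr b, fun e => hne (congrArg Sum.inr (Sum.inr_injective e)),
      congrArg (Sum.map Sum.inr id) ha, congrArg (Sum.map Sum.inr id) hb, rfl, rfl⟩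

/-- The conditions on a potential outside of the subgraph carry over. -/
theorem isPotential_plug (hL : L.IsFlow) (hR : R.IsFlow) {π : L.E → Polarity}
    {π' : R.E → Polarity} {k : K.E → Polarity} (hπ : SameBoundary π π') {D : L.E → ℕ}
    {D' : R.E → ℕ} {d : K.E → ℕ} (hD : SameBoundary D D')
    (h : (K.plug L).IsPotential (Sum.elim π k) (Sum.elim D d)) (h' : R.IsPotential π' D') :
    (K.plug R).IsPotential (Sum.elim π' k) (Sum.elim D' d) := by
  have hb : SameBoundary (fun ε => (π ε, D ε)) (fun ε => (π' ε, D' ε)) :=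
    ⟨fun p ε ε' e e' => Prod.ext (hπ.1 p ε ε' e e') (hD.1 p ε ε' e e'),
      fun p ε ε' e e' => Prod.ext (hπ.2 p ε ε' e e') (hD.2 p ε ε' e e')⟩
  have splitL : ∀ ε : (K.plug L).E, Sum.elim (fun ε => (π ε, D ε)) (fun ε => (k ε, d ε)) ε =
      (Sum.elim π k ε, Sum.elim D d ε) := by rintro (ε | ε) <;> rfl
  have splitR : ∀ ε : (K.plug R).E, Sum.elim (fun ε => (π' ε, D' ε)) (fun ε => (k ε, d ε)) ε =
      (Sum.elim π' k ε, Sum.elim D' d ε) := by rintro (ε | ε) <;> rfl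
  constructor
  · rintro ε ε' (ν | ν) hn hl h₁ h₂
    · obtain ⟨ε, rfl, h₁'⟩ := K.exists_inl_of_plug_lo h₁
      obtain ⟨ε', rfl, h₂'⟩ := K.exists_inl_of_plug_up h₂
      exact h'.contraction ε ε' ν hn hl h₁' h₂'
    · obtain ⟨a, ha, ea⟩ := K.exists_lo_counterpart hL (k := fun ε => (k ε, d ε)) hb
        (x := Sum.inl ν) h₁
      obtain ⟨b, hb, eb⟩ := K.exists_up_counterpart hL (k := fun ε => (k ε, d ε)) hb
        (x := Sum.inl ν) h₂
      rw [splitL, splitR, Prod.mk.injEq] at ea eb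
      rw [← ea.2, ← eb.2]
      exact h.contraction a b (Sum.inr ν) (ea.1.trans hn) hl ha hb
  · rintro ε ε₁ ε₂ (ν | ν) hn hl h₀ h₁ h₂ hne
    · obtain ⟨ε, rfl, h₀'⟩ := K.exists_inl_of_plug_lo h₀
      obtain ⟨ε₁, rfl, h₁'⟩ := K.exists_inl_of_plug_up h₁
      obtain ⟨ε₂, rfl, h₂'⟩ := K.exists_inl_of_plug_up h₂
      exact h'.cocontraction ε ε₁ ε₂ ν hn hl h₀' h₁' h₂' fun e => hne (congrArg _ e)
    · obtain ⟨a, ha, ea⟩ := K.exists_lo_counterpart hL (k := fun ε => (k ε, d ε)) hb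
        (x := Sum.inl ν) h₀
      obtain ⟨b₁, b₂, hne', h₁', h₂', e₁, e₂⟩ := K.exists_up_counterparts hL hR
        (k := fun ε => (k ε, d ε)) hb (x := Sum.inl ν) h₁ h₂ hne
      rw [splitL, splitR, Prod.mk.injEq] at ea e₁ e₂
      rw [← ea.2, ← e₁.2, ← e₂.2]
      exact h.cocontraction a b₁ b₂ (Sum.inr ν) (ea.1.trans hn) hl ha h₁' h₂' hne'

theorem finsum_sum {α β : Type} [Finite α] [Finite β] (w : α ⊕ β → ℕ) :
    ∑ᶠ x, w x = ∑ᶠ a, w (Sum.inl a) + ∑ᶠ b, w (Sum.inr b) := by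
  have := Fintype.ofFinite α
  have := Fintype.ofFinite β
  rw [finsum_eq_sum_of_fintype, finsum_eq_sum_of_fintype, finsum_eq_sum_of_fintype,
    Fintype.sum_sum_type]

/-- The change of the measure is determined by the edges of the subgraph. -/
theorem exists_hasMeasure_lt (hK : (K.plug L).IsFlow) (hL : L.IsFlow) (hR : R.IsFlow)
    {π : L.E → Polarity} {π' : R.E → Polarity} {k : K.E → Polarity} (hπ : SameBoundary π π')
    {n : ℕ} (h : (K.plug L).HasMeasure (Sum.elim π k) n)
    (H : ∀ (D : L.E → ℕ) (d : K.E → ℕ), (K.plug L).IsPotential (Sum.elim π k) (Sum.elim D d) →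
      ∃ D' : R.E → ℕ, SameBoundary D D' ∧ R.IsPotential π' D' ∧
        ∑ᶠ ε, (K.plug R).weight (Sum.elim π' k) (Sum.elim D' d) (Sum.inl ε) <
          ∑ᶠ ε, (K.plug L).weight (Sum.elim π k) (Sum.elim D d) (Sum.inl ε)) :
    ∃ m < n, (K.plug R).HasMeasure (Sum.elim π' k) m := by
  obtain ⟨D, hD, rfl⟩ := h
  have e : D = Sum.elim (fun ε => D (Sum.inl ε)) (fun ε => D (Sum.inr ε)) := by
    funext ε
    rcases ε with ε | ε <;> rfl
  generalize (fun ε => D (Sum.inl ε) : L.E → ℕ) = D₀ at e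
  generalize (fun ε => D (Sum.inr ε) : K.E → ℕ) = d at e
  subst e
  obtain ⟨D', h₁, h₂, h₃⟩ := H D₀ d hD
  refine ⟨_, ?_, _, K.isPotential_plug hL hR hπ h₁ hD h₂, rfl⟩
  have fK : Finite (L.E ⊕ K.E) := hK.finite_E
  have := Finite.of_injective (Sum.inr : K.E → L.E ⊕ K.E) Sum.inr_injective
  have := hL.finite_E
  have := hR.finite_E
  refine ((finsum_sum (α := R.E) (β := K.E) _).trans_lt ?_).trans_eq
    (finsum_sum (α := L.E) (β := K.E) _).symm
  refine Nat.add_lt_add_of_lt_of_le h₃ (le_of_eq (finsum_congr fun ε => ?_))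
  have up : (K.plug R).UpIs .acDown (Sum.inr ε) ↔ (K.plug L).UpIs .acDown (Sum.inr ε) :=
    (K.upIs_plug_of_map (x := K.up ε) rfl).trans (K.upIs_plug_of_map (x := K.up ε) rfl).symm
  have lo : (K.plug R).LoIs .acUp (Sum.inr ε) ↔ (K.plug L).LoIs .acUp (Sum.inr ε) :=
    (K.loIs_plug_of_map (x := K.lo ε) rfl).trans (K.loIs_plug_of_map (x := K.lo ε) rfl).symm
  exact endWeight_congr rfl up lo rfl

end FlowContext

section Decrease

variable {I J : Type}

/-- Contraction over cointeraction: a negative contraction disappears, and the new cocontraction is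
positive. -/
theorem exists_lt_ci {K : FlowContext (Fin 3) (Fin 0) I J} {π : ciLeft.E → Polarity}
    {π' : ciRight.E → Polarity} {k : K.E → Polarity} (hπ : SameBoundary π π')
    (h₃ : π (3 : Fin 4) = .neg) (h₂ : π (2 : Fin 4) = .pos) (D : ciLeft.E → ℕ) (d : K.E → ℕ) :
    ∃ D' : ciRight.E → ℕ, SameBoundary D D' ∧ ciRight.IsPotential π' D' ∧
      ∑ᶠ ε, (K.plug ciRight).weight (Sum.elim π' k) (Sum.elim D' d) (Sum.inl ε) <
        ∑ᶠ ε, (K.plug ciLeft).weight (Sum.elim π k) (Sum.elim D d) (Sum.inl ε) := by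
  have p₀ : π' (0 : Fin 5) = π (0 : Fin 4) := hπ.1 (0 : Fin 3) (0 : Fin 4) (0 : Fin 5) rfl rfl
  have p₁ : π' (1 : Fin 5) = π (1 : Fin 4) := hπ.1 (1 : Fin 3) (1 : Fin 4) (1 : Fin 5) rfl rfl
  have p₂ : π' (2 : Fin 5) = π (2 : Fin 4) := hπ.1 (2 : Fin 3) (2 : Fin 4) (2 : Fin 5) rfl rfl
  obtain ⟨D', hD'⟩ : ∃ D' : ciRight.E → ℕ, D' = (![D (0 : Fin 4), D (1 : Fin 4), D (2 : Fin 4),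
    0, 0] : Fin 5 → ℕ) := ⟨_, rfl⟩
  have e₀ : D' (0 : Fin 5) = D (0 : Fin 4) := congrFun hD' _
  have e₁ : D' (1 : Fin 5) = D (1 : Fin 4) := congrFun hD' _
  have e₂ : D' (2 : Fin 5) = D (2 : Fin 4) := congrFun hD' _
  refine ⟨D', ci_boundary e₀ e₁ e₂, ⟨?_, ?_⟩, ?_⟩
  · intro ε ε' ν _ hl
    have key : ∀ ν : Fin 3, (![.acUp, .aiUp, .aiUp] : Fin 3 → Label) ν ≠ .acDown := by decide
    exact (key ν hl).elim
  · intro ε ε₁ ε₂ ν hn hl h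
    have key : ∀ (ε : Fin 5) (ν : Fin 3), (![.acUp, .aiUp, .aiUp] : Fin 3 → Label) ν = .acUp →
        ciRightLo ε = Sum.inl ν → ε = 2 := by decide
    obtain rfl := key ε ν hl h
    rw [p₂, h₂] at hn
    cases hn
  · have u₀ : (K.plug ciRight).UpIs .acDown (Sum.inl (0 : Fin 5)) ↔
        (K.plug ciLeft).UpIs .acDown (Sum.inl (0 : Fin 4)) :=
      (K.upIs_plug_of_map (x := K.attachUp 0) rfl).trans
        (K.upIs_plug_of_map (x := K.attachUp 0) rfl).symm
    have u₁ : (K.plug ciRight).UpIs .acDown (Sum.inl (1 : Fin 5)) ↔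
        (K.plug ciLeft).UpIs .acDown (Sum.inl (1 : Fin 4)) :=
      (K.upIs_plug_of_map (x := K.attachUp 1) rfl).trans
        (K.upIs_plug_of_map (x := K.attachUp 1) rfl).symm
    have u₃ : (K.plug ciLeft).UpIs .acDown (Sum.inl (3 : Fin 4)) :=
      (K.upIs_plug_of_inl (L := ciLeft) (ν := (0 : Fin 2)) rfl).2 rfl
    have u₃' : ¬ (K.plug ciRight).UpIs .acDown (Sum.inl (3 : Fin 5)) := fun h => by
      cases (K.upIs_plug_of_inl (L := ciRight) (ν := (0 : Fin 3)) rfl).1 h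
    have u₄' : ¬ (K.plug ciRight).UpIs .acDown (Sum.inl (4 : Fin 5)) := fun h => by
      cases (K.upIs_plug_of_inl (L := ciRight) (ν := (0 : Fin 3)) rfl).1 h
    have l₀' : ¬ (K.plug ciRight).LoIs .acUp (Sum.inl (0 : Fin 5)) := fun h => by
      cases (K.loIs_plug_of_inl (L := ciRight) (ν := (1 : Fin 3)) rfl).1 h
    have l₁' : ¬ (K.plug ciRight).LoIs .acUp (Sum.inl (1 : Fin 5)) := fun h => by
      cases (K.loIs_plug_of_inl (L := ciRight) (ν := (2 : Fin 3)) rfl).1 h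
    have l₃' : ¬ (K.plug ciRight).LoIs .acUp (Sum.inl (3 : Fin 5)) := fun h => by
      cases (K.loIs_plug_of_inl (L := ciRight) (ν := (1 : Fin 3)) rfl).1 h
    have l₄' : ¬ (K.plug ciRight).LoIs .acUp (Sum.inl (4 : Fin 5)) := fun h => by
      cases (K.loIs_plug_of_inl (L := ciRight) (ν := (2 : Fin 3)) rfl).1 h
    have l₀ : ¬ (K.plug ciLeft).LoIs .acUp (Sum.inl (0 : Fin 4)) := fun h => by
      cases (K.loIs_plug_of_inl (L := ciLeft) (ν := (0 : Fin 2)) rfl).1 h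
    have l₁ : ¬ (K.plug ciLeft).LoIs .acUp (Sum.inl (1 : Fin 4)) := fun h => by
      cases (K.loIs_plug_of_inl (L := ciLeft) (ν := (0 : Fin 2)) rfl).1 h
    have l₃ : ¬ (K.plug ciLeft).LoIs .acUp (Sum.inl (3 : Fin 4)) := fun h => by
      cases (K.loIs_plug_of_inl (L := ciLeft) (ν := (1 : Fin 2)) rfl).1 h
    have w₀ : (K.plug ciRight).weight (Sum.elim π' k) (Sum.elim D' d) (Sum.inl (0 : Fin 5)) =
        (K.plug ciLeft).weight (Sum.elim π k) (Sum.elim D d) (Sum.inl (0 : Fin 4)) :=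
      endWeight_congr p₀ u₀ ⟨fun h => (l₀' h).elim, fun h => (l₀ h).elim⟩ e₀
    have w₁ : (K.plug ciRight).weight (Sum.elim π' k) (Sum.elim D' d) (Sum.inl (1 : Fin 5)) =
        (K.plug ciLeft).weight (Sum.elim π k) (Sum.elim D d) (Sum.inl (1 : Fin 4)) :=
      endWeight_congr p₁ u₁ ⟨fun h => (l₁' h).elim, fun h => (l₁ h).elim⟩ e₁
    have w₂ : (K.plug ciRight).weight (Sum.elim π' k) (Sum.elim D' d) (Sum.inl (2 : Fin 5)) = 0 :=
      (congrArg (endWeight · _ _ _) (p₂.trans h₂)).trans endWeight_pos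
    have w₃ : (K.plug ciRight).weight (Sum.elim π' k) (Sum.elim D' d) (Sum.inl (3 : Fin 5)) = 0 :=
      endWeight_eq_zero u₃' l₃'
    have w₄ : (K.plug ciRight).weight (Sum.elim π' k) (Sum.elim D' d) (Sum.inl (4 : Fin 5)) = 0 :=
      endWeight_eq_zero u₄' l₄'
    have w₃' : 1 ≤ (K.plug ciLeft).weight (Sum.elim π k) (Sum.elim D d) (Sum.inl (3 : Fin 4)) :=
      (one_le_endWeight (.inl u₃)).trans_eq (congrArg (endWeight · _ _ _) h₃.symm)
    refine ((finsum_eq_sum_of_fintype (α := Fin 5) _).trans (Fin.sum_univ_five _)).trans_lt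
      (lt_of_lt_of_eq ?_ ((finsum_eq_sum_of_fintype (α := Fin 4) _).trans
        (Fin.sum_univ_four _)).symm)
    omega

/-- Interaction over cocontraction: a negative cocontraction disappears, and the new contraction is
positive. -/
theorem exists_lt_ic {K : FlowContext (Fin 0) (Fin 3) I J} {π : ciLeft.flip.E → Polarity}
    {π' : ciRight.flip.E → Polarity} {k : K.E → Polarity} (hπ : SameBoundary π π')
    (h₃ : π (3 : Fin 4) = .neg) (h₂ : π (2 : Fin 4) = .pos) (D : ciLeft.flip.E → ℕ) (d : K.E → ℕ) :
    ∃ D' : ciRight.flip.E → ℕ, SameBoundary D D' ∧ ciRight.flip.IsPotential π' D' ∧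
      ∑ᶠ ε, (K.plug ciRight.flip).weight (Sum.elim π' k) (Sum.elim D' d) (Sum.inl ε) <
        ∑ᶠ ε, (K.plug ciLeft.flip).weight (Sum.elim π k) (Sum.elim D d) (Sum.inl ε) := by
  have p₀ : π' (0 : Fin 5) = π (0 : Fin 4) := hπ.2 (0 : Fin 3) (0 : Fin 4) (0 : Fin 5) rfl rfl
  have p₁ : π' (1 : Fin 5) = π (1 : Fin 4) := hπ.2 (1 : Fin 3) (1 : Fin 4) (1 : Fin 5) rfl rfl
  have p₂ : π' (2 : Fin 5) = π (2 : Fin 4) := hπ.2 (2 : Fin 3) (2 : Fin 4) (2 : Fin 5) rfl rfl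
  obtain ⟨D', hD'⟩ : ∃ D' : ciRight.flip.E → ℕ, D' = (![D (0 : Fin 4), D (1 : Fin 4), D (2 : Fin 4),
    D (2 : Fin 4), D (2 : Fin 4)] : Fin 5 → ℕ) := ⟨_, rfl⟩
  have e₀ : D' (0 : Fin 5) = D (0 : Fin 4) := congrFun hD' _
  have e₁ : D' (1 : Fin 5) = D (1 : Fin 4) := congrFun hD' _
  have e₂ : D' (2 : Fin 5) = D (2 : Fin 4) := congrFun hD' _
  have e₃ : D' (3 : Fin 5) = D (2 : Fin 4) := congrFun hD' _
  have e₄ : D' (4 : Fin 5) = D (2 : Fin 4) := congrFun hD' _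
  have hb : SameBoundary (L := ciLeft) (R := ciRight) D D' := ci_boundary e₀ e₁ e₂
  refine ⟨D', ⟨hb.2, hb.1⟩, ⟨?_, ?_⟩, ?_⟩
  · intro ε ε' ν _ hl h h'
    have key : ∀ (ε ε' : Fin 5) (ν : Fin 3), ciRightUp ε = Sum.inl ν → ciRightLo ε' = Sum.inl ν →
        ε' = 2 ∧ (ε = 3 ∨ ε = 4) := by decide
    obtain ⟨rfl, rfl | rfl⟩ := key ε ε' ν h h'
    · exact (e₂.trans e₃.symm).le
    · exact (e₂.trans e₄.symm).le
  · intro ε ε₁ ε₂ ν hn hl h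
    have key : ∀ ν : Fin 3, (![.acUp, .aiUp, .aiUp] : Fin 3 → Label) ν ≠ .acDown := by decide
    have hl' : ((![.acUp, .aiUp, .aiUp] : Fin 3 → Label) ν).flip = .acUp := hl
    have : ∀ l : Label, l.flip = .acUp → l = .acDown := fun l => by cases l <;> simp [Label.flip]
    exact (key ν (this _ hl')).elim
  · have l₀ : (K.plug ciRight.flip).LoIs .acUp (Sum.inl (0 : Fin 5)) ↔
        (K.plug ciLeft.flip).LoIs .acUp (Sum.inl (0 : Fin 4)) :=
      (K.loIs_plug_of_map (x := K.attachLo 0) rfl).trans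
        (K.loIs_plug_of_map (x := K.attachLo 0) rfl).symm
    have l₁ : (K.plug ciRight.flip).LoIs .acUp (Sum.inl (1 : Fin 5)) ↔
        (K.plug ciLeft.flip).LoIs .acUp (Sum.inl (1 : Fin 4)) :=
      (K.loIs_plug_of_map (x := K.attachLo 1) rfl).trans
        (K.loIs_plug_of_map (x := K.attachLo 1) rfl).symm
    have l₃ : (K.plug ciLeft.flip).LoIs .acUp (Sum.inl (3 : Fin 4)) :=
      (K.loIs_plug_of_inl (L := ciLeft.flip) (ν := (0 : Fin 2)) rfl).2 rfl
    have u₀ : ¬ (K.plug ciLeft.flip).UpIs .acDown (Sum.inl (0 : Fin 4)) := fun h => by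
      cases (K.upIs_plug_of_inl (L := ciLeft.flip) (ν := (0 : Fin 2)) rfl).1 h
    have u₁ : ¬ (K.plug ciLeft.flip).UpIs .acDown (Sum.inl (1 : Fin 4)) := fun h => by
      cases (K.upIs_plug_of_inl (L := ciLeft.flip) (ν := (0 : Fin 2)) rfl).1 h
    have u₀' : ¬ (K.plug ciRight.flip).UpIs .acDown (Sum.inl (0 : Fin 5)) := fun h => by
      cases (K.upIs_plug_of_inl (L := ciRight.flip) (ν := (1 : Fin 3)) rfl).1 h
    have u₁' : ¬ (K.plug ciRight.flip).UpIs .acDown (Sum.inl (1 : Fin 5)) := fun h => by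
      cases (K.upIs_plug_of_inl (L := ciRight.flip) (ν := (2 : Fin 3)) rfl).1 h
    have u₃' : ¬ (K.plug ciRight.flip).UpIs .acDown (Sum.inl (3 : Fin 5)) := fun h => by
      cases (K.upIs_plug_of_inl (L := ciRight.flip) (ν := (1 : Fin 3)) rfl).1 h
    have u₄' : ¬ (K.plug ciRight.flip).UpIs .acDown (Sum.inl (4 : Fin 5)) := fun h => by
      cases (K.upIs_plug_of_inl (L := ciRight.flip) (ν := (2 : Fin 3)) rfl).1 h
    have l₃' : ¬ (K.plug ciRight.flip).LoIs .acUp (Sum.inl (3 : Fin 5)) := fun h => by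
      cases (K.loIs_plug_of_inl (L := ciRight.flip) (ν := (0 : Fin 3)) rfl).1 h
    have l₄' : ¬ (K.plug ciRight.flip).LoIs .acUp (Sum.inl (4 : Fin 5)) := fun h => by
      cases (K.loIs_plug_of_inl (L := ciRight.flip) (ν := (0 : Fin 3)) rfl).1 h
    have w₀ : (K.plug ciRight.flip).weight (Sum.elim π' k) (Sum.elim D' d) (Sum.inl (0 : Fin 5)) =
        (K.plug ciLeft.flip).weight (Sum.elim π k) (Sum.elim D d) (Sum.inl (0 : Fin 4)) :=
      endWeight_congr p₀ ⟨fun h => (u₀' h).elim, fun h => (u₀ h).elim⟩ l₀ e₀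
    have w₁ : (K.plug ciRight.flip).weight (Sum.elim π' k) (Sum.elim D' d) (Sum.inl (1 : Fin 5)) =
        (K.plug ciLeft.flip).weight (Sum.elim π k) (Sum.elim D d) (Sum.inl (1 : Fin 4)) :=
      endWeight_congr p₁ ⟨fun h => (u₁' h).elim, fun h => (u₁ h).elim⟩ l₁ e₁
    have w₂ : (K.plug ciRight.flip).weight (Sum.elim π' k) (Sum.elim D' d) (Sum.inl (2 : Fin 5)) =
        0 := (congrArg (endWeight · _ _ _) (p₂.trans h₂)).trans endWeight_pos
    have w₃ : (K.plug ciRight.flip).weight (Sum.elim π' k) (Sum.elim D' d) (Sum.inl (3 : Fin 5)) =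
        0 := endWeight_eq_zero u₃' l₃'
    have w₄ : (K.plug ciRight.flip).weight (Sum.elim π' k) (Sum.elim D' d) (Sum.inl (4 : Fin 5)) =
        0 := endWeight_eq_zero u₄' l₄'
    have w₃' : 1 ≤ (K.plug ciLeft.flip).weight (Sum.elim π k) (Sum.elim D d)
        (Sum.inl (3 : Fin 4)) :=
      (one_le_endWeight (.inr l₃)).trans_eq (congrArg (endWeight · _ _ _) h₃.symm)
    refine ((finsum_eq_sum_of_fintype (α := Fin 5) _).trans (Fin.sum_univ_five _)).trans_lt
      (lt_of_lt_of_eq ?_ ((finsum_eq_sum_of_fintype (α := Fin 4) _).trans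
        (Fin.sum_univ_four _)).symm)
    omega

/-- Contraction over cocontraction: the numbers of contractions and of cocontractions increase by
one each, and the path between the two vertices, which counts three times, disappears. In terms of
potentials, the outer edges keep their values, and the inner edges get those of the edges below. -/
theorem exists_lt_cc {K : FlowContext (Fin 2) (Fin 2) I J} {π : ccLeft.E → Polarity}
    {π' : ccRight.E → Polarity} {k : K.E → Polarity} (hπ : SameBoundary π π')
    (hn : ∀ ε, π ε = .neg) (D : ccLeft.E → ℕ) (d : K.E → ℕ)
    (hD : (K.plug ccLeft).IsPotential (Sum.elim π k) (Sum.elim D d)) :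
    ∃ D' : ccRight.E → ℕ, SameBoundary D D' ∧ ccRight.IsPotential π' D' ∧
      ∑ᶠ ε, (K.plug ccRight).weight (Sum.elim π' k) (Sum.elim D' d) (Sum.inl ε) <
        ∑ᶠ ε, (K.plug ccLeft).weight (Sum.elim π k) (Sum.elim D d) (Sum.inl ε) := by
  have p₀ : π' (0 : Fin 8) = π (0 : Fin 5) := hπ.1 (0 : Fin 2) (0 : Fin 5) (0 : Fin 8) rfl rfl
  have p₁ : π' (1 : Fin 8) = π (1 : Fin 5) := hπ.1 (1 : Fin 2) (1 : Fin 5) (1 : Fin 8) rfl rfl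
  have p₂ : π' (2 : Fin 8) = π (2 : Fin 5) := hπ.2 (0 : Fin 2) (2 : Fin 5) (2 : Fin 8) rfl rfl
  have p₃ : π' (3 : Fin 8) = π (3 : Fin 5) := hπ.2 (1 : Fin 2) (3 : Fin 5) (3 : Fin 8) rfl rfl
  have d₀ : D (4 : Fin 5) ≤ D (0 : Fin 5) :=
    hD.contraction (Sum.inl (0 : Fin 5)) (Sum.inl (4 : Fin 5)) (Sum.inl (0 : Fin 2)) (hn _) rfl rfl
      rfl
  have d₁ : D (4 : Fin 5) ≤ D (1 : Fin 5) :=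
    hD.contraction (Sum.inl (1 : Fin 5)) (Sum.inl (4 : Fin 5)) (Sum.inl (0 : Fin 2)) (hn _) rfl rfl
      rfl
  have d₄ : 1 + D (2 : Fin 5) + D (3 : Fin 5) ≤ D (4 : Fin 5) :=
    hD.cocontraction (Sum.inl (4 : Fin 5)) (Sum.inl (2 : Fin 5)) (Sum.inl (3 : Fin 5))
      (Sum.inl (1 : Fin 2)) (hn _) rfl rfl rfl rfl
      fun e => absurd (Sum.inl_injective e) (by decide : (2 : Fin 5) ≠ 3)
  obtain ⟨D', hD'⟩ : ∃ D' : ccRight.E → ℕ, D' = (![D (0 : Fin 5), D (1 : Fin 5), D (2 : Fin 5),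
    D (3 : Fin 5), D (2 : Fin 5), D (3 : Fin 5), D (2 : Fin 5), D (3 : Fin 5)] : Fin 8 → ℕ) :=
    ⟨_, rfl⟩
  have e₀ : D' (0 : Fin 8) = D (0 : Fin 5) := congrFun hD' _
  have e₁ : D' (1 : Fin 8) = D (1 : Fin 5) := congrFun hD' _
  have e₂ : D' (2 : Fin 8) = D (2 : Fin 5) := congrFun hD' _
  have e₃ : D' (3 : Fin 8) = D (3 : Fin 5) := congrFun hD' _
  have e₄ : D' (4 : Fin 8) = D (2 : Fin 5) := congrFun hD' _
  have e₅ : D' (5 : Fin 8) = D (3 : Fin 5) := congrFun hD' _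
  have e₆ : D' (6 : Fin 8) = D (2 : Fin 5) := congrFun hD' _
  have e₇ : D' (7 : Fin 8) = D (3 : Fin 5) := congrFun hD' _
  refine ⟨D', cc_boundary e₀ e₁ e₂ e₃, ⟨?_, ?_⟩, ?_⟩
  · intro ε ε' ν _ hl h h'
    have key : ∀ (ε ε' : Fin 8) (ν : Fin 4), (![.acUp, .acUp, .acDown, .acDown] :
        Fin 4 → Label) ν = .acDown → ccRightLo ε = Sum.inl ν → ccRightUp ε' = Sum.inl ν →
        ε' = 2 ∧ (ε = 4 ∨ ε = 6) ∨ ε' = 3 ∧ (ε = 5 ∨ ε = 7) := by decide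
    obtain ⟨rfl, rfl | rfl⟩ | ⟨rfl, rfl | rfl⟩ := key ε ε' ν hl h h'
    · exact (e₂.trans e₄.symm).le
    · exact (e₂.trans e₆.symm).le
    · exact (e₃.trans e₅.symm).le
    · exact (e₃.trans e₇.symm).le
  · intro ε ε₁ ε₂ ν _ hl h h₁ h₂ hne
    have key : ∀ (ε ε₁ ε₂ : Fin 8) (ν : Fin 4), (![.acUp, .acUp, .acDown, .acDown] :
        Fin 4 → Label) ν = .acUp → ccRightLo ε = Sum.inl ν → ccRightUp ε₁ = Sum.inl ν →
        ccRightUp ε₂ = Sum.inl ν → ε₁ ≠ ε₂ →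
        ε = 0 ∧ (ε₁ = 4 ∧ ε₂ = 5 ∨ ε₁ = 5 ∧ ε₂ = 4) ∨
        ε = 1 ∧ (ε₁ = 6 ∧ ε₂ = 7 ∨ ε₁ = 7 ∧ ε₂ = 6) := by decide
    obtain ⟨rfl, ⟨rfl, rfl⟩ | ⟨rfl, rfl⟩⟩ | ⟨rfl, ⟨rfl, rfl⟩ | ⟨rfl, rfl⟩⟩ :=
      key ε ε₁ ε₂ ν hl h h₁ h₂ hne <;> omega
  · have w₀ : (K.plug ccRight).weight (Sum.elim π' k) (Sum.elim D' d) (Sum.inl (0 : Fin 8)) ≤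
        (K.plug ccLeft).weight (Sum.elim π k) (Sum.elim D d) (Sum.inl (0 : Fin 5)) + 1 :=
      endWeight_le_add_one p₀ ((K.upIs_plug_of_map (x := K.attachUp 0) rfl).trans
        (K.upIs_plug_of_map (x := K.attachUp 0) rfl).symm) e₀
    have w₁ : (K.plug ccRight).weight (Sum.elim π' k) (Sum.elim D' d) (Sum.inl (1 : Fin 8)) ≤
        (K.plug ccLeft).weight (Sum.elim π k) (Sum.elim D d) (Sum.inl (1 : Fin 5)) + 1 :=
      endWeight_le_add_one p₁ ((K.upIs_plug_of_map (x := K.attachUp 1) rfl).trans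
        (K.upIs_plug_of_map (x := K.attachUp 1) rfl).symm) e₁
    have w₂ : (K.plug ccRight).weight (Sum.elim π' k) (Sum.elim D' d) (Sum.inl (2 : Fin 8)) ≤
        (K.plug ccLeft).weight (Sum.elim π k) (Sum.elim D d) (Sum.inl (2 : Fin 5)) +
          (3 * D' (2 : Fin 8) + 1) :=
      endWeight_le_add p₂ ((K.loIs_plug_of_map (x := K.attachLo 0) rfl).trans
        (K.loIs_plug_of_map (x := K.attachLo 0) rfl).symm)
    have w₃ : (K.plug ccRight).weight (Sum.elim π' k) (Sum.elim D' d) (Sum.inl (3 : Fin 8)) ≤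
        (K.plug ccLeft).weight (Sum.elim π k) (Sum.elim D d) (Sum.inl (3 : Fin 5)) +
          (3 * D' (3 : Fin 8) + 1) :=
      endWeight_le_add p₃ ((K.loIs_plug_of_map (x := K.attachLo 1) rfl).trans
        (K.loIs_plug_of_map (x := K.attachLo 1) rfl).symm)
    have inner : ∀ (ε : Fin 8) (ν μ : Fin 4), ccRightUp ε = Sum.inl ν → ccRightLo ε = Sum.inl μ →
        (![.acUp, .acUp, .acDown, .acDown] : Fin 4 → Label) ν = .acUp →
        (![.acUp, .acUp, .acDown, .acDown] : Fin 4 → Label) μ = .acDown →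
        (K.plug ccRight).weight (Sum.elim π' k) (Sum.elim D' d) (Sum.inl ε) = 0 := by
      intro ε ν μ h h' hν hμ
      refine endWeight_eq_zero (fun hu => ?_) (fun hl => ?_)
      · have hν' := (K.upIs_plug_of_inl (L := ccRight) h).1 hu
        cases hν.symm.trans hν'
      · have hμ' := (K.loIs_plug_of_inl (L := ccRight) h').1 hl
        cases hμ.symm.trans hμ'
    have w₄ := inner 4 0 2 rfl rfl rfl rfl
    have w₅ := inner 5 0 3 rfl rfl rfl rfl
    have w₆ := inner 6 1 2 rfl rfl rfl rfl
    have w₇ := inner 7 1 3 rfl rfl rfl rfl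
    have w₄' : (K.plug ccLeft).weight (Sum.elim π k) (Sum.elim D d) (Sum.inl (4 : Fin 5)) =
        3 * D (4 : Fin 5) + 2 :=
      (congrArg (endWeight · _ _ _) (hn _)).trans (endWeight_neg
        ((K.upIs_plug_of_inl (L := ccLeft) (ν := (0 : Fin 2)) rfl).2 rfl)
        ((K.loIs_plug_of_inl (L := ccLeft) (ν := (1 : Fin 2)) rfl).2 rfl))
    refine ((finsum_eq_sum_of_fintype (α := Fin 8) _).trans (Fin.sum_univ_eight _)).trans_lt
      (lt_of_lt_of_eq ?_ ((finsum_eq_sum_of_fintype (α := Fin 5) _).trans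
        (Fin.sum_univ_five _)).symm)
    omega

/-- Every reduction of a negative vertex decreases the measure. -/
theorem NegativeCStep.exists_hasMeasure_lt {A B : PolarizedFlow I J} (h : NegativeCStep A B) {n : ℕ}
    (hn : A.HasMeasure A.polarity n) : ∃ m < n, B.HasMeasure B.polarity m := by
  obtain ⟨P, Q, L, R, K, f, g, hr, ⟨ν, hν⟩, hK, hP, hQ⟩ := h
  have h' := hn.comp_iso f
  have hA : (K.plug L).IsPolarity (A.polarity ∘ f.edge) := A.isPolarity.comp_iso f
  have eA : A.polarity ∘ f.edge = Sum.elim (fun ε => A.polarity (f.edge (Sum.inl ε)))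
      (fun ε => A.polarity (f.edge (Sum.inr ε))) := by
    funext ε
    rcases ε with ε | ε <;> rfl
  have eB : B.polarity ∘ g.edge = Sum.elim (fun ε => B.polarity (g.edge (Sum.inl ε)))
      (fun ε => A.polarity (f.edge (Sum.inr ε))) := by
    funext ε
    rcases ε with ε | ε
    · rfl
    · exact hK ε
  have hb : SameBoundary (fun ε : L.E => A.polarity (f.edge (Sum.inl ε)))
      (fun ε : R.E => B.polarity (g.edge (Sum.inl ε))) := ⟨hP, hQ⟩
  have hneg : ∀ ε ∈ L.edgesAt ν, A.polarity (f.edge (Sum.inl ε)) = .neg := fun ε hε => by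
    refine hν.2.1 _ ((f.edgesAt_vert _).symm ▸ ⟨_, ?_, rfl⟩)
    exact (K.plug_edgesAt_inl ν).symm ▸ ⟨ε, hε, rfl⟩
  rw [eA] at h' hA
  have hL := FlowContext.isPolarity_of_plug K hA
  have hlab : (L.label ν).IsContraction := (f.label_vert (Sum.inl ν)).subst
    (motive := fun l => l.IsContraction) hν.1
  have hF : (K.plug L).IsFlow := A.isFlow.of_iso f.symm
  suffices ∃ m < n, (K.plug R).HasMeasure (B.polarity ∘ g.edge) m by
    obtain ⟨m, hm, h⟩ := this
    have e : (B.polarity ∘ g.edge) ∘ g.symm.edge = B.polarity :=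
      funext fun ε => congrArg B.polarity (g.edge.apply_symm_apply ε)
    exact ⟨m, hm, e ▸ h.comp_iso g.symm⟩
  rw [eB]
  refine K.exists_hasMeasure_lt hF hr.replaces.left hr.replaces.right hb h' fun D d hD => ?_
  have pos : ∀ p : Polarity, p ≠ .neg → p = .pos := fun p => by cases p <;> simp
  cases hr with
  | ci =>
    have hν0 : ν = (0 : Fin 2) := by
      revert ν
      show ∀ ν : Fin 2, _
      intro ν _ _ hlab
      fin_cases ν
      · rfl
      · simp [ciLeft, Label.IsContraction] at hlab
    subst hν0
    have h₃ := hneg (3 : Fin 4) (.inl rfl)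
    exact exists_lt_ci hb h₃ (pos _ fun e => absurd (hL.eq_of_aiUp ciLeft_isFlow
      (ν := (1 : Fin 2)) rfl rfl rfl (e.trans h₃.symm)) (by decide : (2 : Fin 4) ≠ 3)) D d
  | ic =>
    have hν0 : ν = (0 : Fin 2) := by
      revert ν
      show ∀ ν : Fin 2, _
      intro ν _ _ hlab
      fin_cases ν
      · rfl
      · simp [ciLeft, FlowGraph.flip, Label.flip, Label.IsContraction] at hlab
    subst hν0
    have h₃ := hneg (3 : Fin 4) (.inr rfl)
    exact exists_lt_ic hb h₃ (pos _ fun e => absurd (hL.eq_of_aiDown ciLeft_isFlow.flip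
      (ν := (1 : Fin 2)) rfl rfl rfl (e.trans h₃.symm)) (by decide : (2 : Fin 4) ≠ 3)) D d
  | cc =>
    have c : ∀ ε : Fin 5, A.polarity (f.edge (Sum.inl (4 : Fin 5))) = .neg →
        A.polarity (f.edge (Sum.inl ε)) = .neg := by
      intro ε h
      refine .trans ?_ h
      fin_cases ε
      · exact hL.eq_of_isContraction (ν := (0 : Fin 2)) (.inl rfl) (.inr rfl) (.inl rfl)
      · exact hL.eq_of_isContraction (ν := (0 : Fin 2)) (.inl rfl) (.inr rfl) (.inl rfl)
      · exact hL.eq_of_isContraction (ν := (1 : Fin 2)) (.inr rfl) (.inl rfl) (.inr rfl)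
      · exact hL.eq_of_isContraction (ν := (1 : Fin 2)) (.inr rfl) (.inl rfl) (.inr rfl)
      · rfl
    refine exists_lt_cc hb (fun ε => c ε (hneg (4 : Fin 5) ?_)) D d hD
    have key : ∀ ν : Fin 2, ccLeftUp 4 = Sum.inl ν ∨ ccLeftLo 4 = Sum.inl ν := by decide
    exact key ν

/-- The system c, restricted to negative vertices that belong to cycles, terminates. -/
theorem not_exists_chain_negativeCStep (A : PolarizedFlow I J) :
    ¬ ∃ s : ℕ → PolarizedFlow I J, s 0 = A ∧ ∀ n, NegativeCStep (s n) (s (n + 1)) := by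
  rintro ⟨s, -, hs⟩
  obtain ⟨m, hm⟩ := (s 0).isFlow.exists_hasMeasure (s 0).polarity
  suffices ∀ m n, ¬ (s n).HasMeasure (s n).polarity m from this m 0 hm
  intro m
  induction m using Nat.strong_induction_on with
  | _ m ih =>
    intro n hn
    obtain ⟨k, hk, h⟩ := (hs n).exists_hasMeasure_lt hn
    exact ih k hk (n + 1) h

end Decrease

/-! ### Reductions of flows lift to derivations -/

theorem Formula.map_subst {X : Type u} {Y : Type v} {Z : Type w} (σ : X → Formula Y) (f : Y → Z)
    (α : Formula X) : (α.subst σ).map f = α.subst fun a => (σ a).map f := by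
  induction α with
  | ff => rfl
  | tt => rfl
  | atom a => rfl
  | or α β iα iβ | and α β iα iβ => simp only [subst, map, iα, iβ]

/-- If the new vertices are distributed over the old ones, then a derivation that uses every old
vertex once becomes one that uses every new vertex once. -/
theorem nodup_bind_of_fiber {V W : Type} {m : Multiset V} (hn : m.Nodup) (hm : ∀ ν, ν ∈ m)
    {T : V → Multiset W} (g : W → V) (hT : ∀ ν, (T ν).Nodup) (hg : ∀ x ν, x ∈ T ν ↔ g x = ν) :
    (m.bind T).Nodup ∧ ∀ x, x ∈ m.bind T := by
  refine ⟨Multiset.nodup_bind.2 ⟨fun ν _ => hT ν, ?_⟩,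
    fun x => Multiset.mem_bind.2 ⟨g x, hm _, (hg _ _).2 rfl⟩⟩
  induction m using Quotient.inductionOn with
  | _ l =>
    refine ⟨l, rfl, List.Pairwise.imp (fun hab => ?_) hn⟩
    exact Multiset.disjoint_left.2 fun {x} hx hx' =>
    hab (((hg _ _).1 hx).symm.trans ((hg _ _).1 hx'))

section Soundness

variable {X : Type u} [DualAtoms X] {I J P Q : Type}

namespace VertexStep

variable {A : FlowGraph I J} {κ : A.E → X} {ν : A.V} {φ ψ : Formula A.E} {a b c : A.E}

theorem of_aiDown (h : VertexStep A κ ν φ ψ) (hν : A.label ν = .aiDown)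
    (hup : ∀ ε, A.up ε = Sum.inl ν → ε = a ∨ ε = b) :
    φ = tt ∧ (ψ = or (atom a) (atom b) ∨ ψ = or (atom b) (atom a)) ∧ κ b = bar (κ a) := by
  cases h with
  | aiDown ε₁ ε₂ _ hne h₁ h₂ hκ =>
    obtain rfl | rfl := hup _ h₁ <;> obtain rfl | rfl := hup _ h₂
    · exact (hne rfl).elim
    · exact ⟨rfl, .inl rfl, hκ⟩
    · exact ⟨rfl, .inr rfl, by rw [hκ, DualAtoms.bar_bar]⟩
    · exact (hne rfl).elim
  | _ => simp_all

theorem of_aiUp (h : VertexStep A κ ν φ ψ) (hν : A.label ν = .aiUp)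
    (hlo : ∀ ε, A.lo ε = Sum.inl ν → ε = a ∨ ε = b) :
    (φ = and (atom a) (atom b) ∨ φ = and (atom b) (atom a)) ∧ ψ = ff ∧ κ b = bar (κ a) := by
  cases h with
  | aiUp ε₁ ε₂ _ hne h₁ h₂ hκ =>
    obtain rfl | rfl := hlo _ h₁ <;> obtain rfl | rfl := hlo _ h₂
    · exact (hne rfl).elim
    · exact ⟨.inl rfl, rfl, hκ⟩
    · exact ⟨.inr rfl, rfl, by rw [hκ, DualAtoms.bar_bar]⟩
    · exact (hne rfl).elim
  | _ => simp_all

theorem of_acDown (h : VertexStep A κ ν φ ψ) (hν : A.label ν = .acDown)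
    (hlo : ∀ ε, A.lo ε = Sum.inl ν → ε = a ∨ ε = b) (hup : ∀ ε, A.up ε = Sum.inl ν → ε = c) :
    (φ = or (atom a) (atom b) ∨ φ = or (atom b) (atom a)) ∧ ψ = atom c ∧ κ a = κ c ∧ κ b = κ c := by
  cases h with
  | acDown ε₁ ε₂ ε₃ _ hne h₁ h₂ h₃ k₁ k₂ =>
    obtain rfl := hup _ h₃
    obtain rfl | rfl := hlo _ h₁ <;> obtain rfl | rfl := hlo _ h₂
    · exact (hne rfl).elim
    · exact ⟨.inl rfl, rfl, k₁, k₂⟩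
    · exact ⟨.inr rfl, rfl, k₂, k₁⟩
    · exact (hne rfl).elim
  | _ => simp_all

theorem of_acUp (h : VertexStep A κ ν φ ψ) (hν : A.label ν = .acUp)
    (hlo : ∀ ε, A.lo ε = Sum.inl ν → ε = c) (hup : ∀ ε, A.up ε = Sum.inl ν → ε = a ∨ ε = b) :
    φ = atom c ∧ (ψ = and (atom a) (atom b) ∨ ψ = and (atom b) (atom a)) ∧
      κ a = κ c ∧ κ b = κ c := by
  cases h with
  | acUp ε₁ ε₂ ε₃ _ hne h₁ h₂ h₃ k₁ k₂ =>
    obtain rfl := hlo _ h₁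
    obtain rfl | rfl := hup _ h₂ <;> obtain rfl | rfl := hup _ h₃
    · exact (hne rfl).elim
    · exact ⟨rfl, .inl rfl, k₁, k₂⟩
    · exact ⟨rfl, .inr rfl, k₂, k₁⟩
    · exact (hne rfl).elim
  | _ => simp_all

end VertexStep

theorem Der.map {I' J' : Type} {A : FlowGraph I J} {κ : A.E → X} {B : FlowGraph I' J'}
    {κ' : B.E → X} {φ ψ : Formula A.E} {m : Multiset A.V} (h : Der A κ φ m ψ) (f : A.E → B.E)
    (g : A.V → B.V) (hf : Function.Injective f) (hκ : ∀ ε, κ' (f ε) = κ ε)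
    (hl : ∀ ν, B.label (g ν) = A.label ν)
    (hup : ∀ ε ν, A.up ε = Sum.inl ν → B.up (f ε) = Sum.inl (g ν))
    (hlo : ∀ ε ν, A.lo ε = Sum.inl ν → B.lo (f ε) = Sum.inl (g ν)) :
    Der B κ' (φ.map f) (m.map g) (ψ.map f) := by
  have := h.subst (σ := fun ε => atom (f ε)) (τ := fun ν => {g ν}) fun ν _ φ ψ r =>
    .structural (κ := κ') (r.subst (hl ν) f (fun ε h => ⟨rfl, hup _ _ h, hκ ε⟩)
      (fun ε h => ⟨rfl, hlo _ _ h, hκ ε⟩) hf.injOn)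
  rwa [Formula.subst_atom, Formula.subst_atom, Multiset.bind_singleton] at this

theorem FlowGraph.Derivable.of_iso {A B : FlowGraph I J} {kI : I → X} {α : Formula I} {kJ : J → X}
    {β : Formula J} (h : A.Derivable kI α kJ β) (f : A.Iso B) : B.Derivable kI α kJ β := by
  obtain ⟨κ, u, d, m, hu, hd, hκI, hκJ, hn, hm, h⟩ := h
  have hκ : ∀ ε, (κ ∘ f.edge.symm) (f.edge ε) = κ ε := fun ε =>
    congrArg κ (f.edge.symm_apply_apply ε)
  refine ⟨κ ∘ f.edge.symm, f.edge ∘ u, f.edge ∘ d, m.map f.vert, fun i => f.up_inr.2 (hu i),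
    fun j => f.lo_inr.2 (hd j), fun i => (hκ _).trans (hκI i), fun j => (hκ _).trans (hκJ j),
    hn.map f.vert.injective, fun ν => Multiset.mem_map.2 ⟨_, hm _, f.vert.apply_symm_apply ν⟩, ?_⟩
  have := h.map f.edge f.vert f.edge.injective hκ f.label_vert (fun ε ν => f.up_inl.2)
    fun ε ν => f.lo_inl.2
  rwa [Formula.map_map, Formula.map_map] at this

/-- Derivations over `L` can be simulated by derivations over `R`: the edges of `L` are replaced by
formulae over the edges of `R`, the upper and lower edges by the corresponding ones of `R`. The step
at one vertex becomes a derivation with all vertices of `R`, the steps at the other vertices become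
derivations without structural steps. -/
def FlowGraph.Simulates (X : Type u) [DualAtoms X] (L R : FlowGraph P Q) : Prop :=
  ∀ κ : L.E → X, (∀ ν, ∃ φ ψ, VertexStep L κ ν φ ψ) →
    ∃ (κ' : R.E → X) (σ : L.E → Formula R.E) (f : L.E → R.E) (μ : L.V) (m : Multiset R.V),
      (∀ ε p, L.up ε = Sum.inr p → R.up (f ε) = Sum.inr p ∧ σ ε = atom (f ε) ∧ κ' (f ε) = κ ε) ∧
      (∀ ε q, L.lo ε = Sum.inr q → R.lo (f ε) = Sum.inr q ∧ σ ε = atom (f ε) ∧ κ' (f ε) = κ ε) ∧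
      Set.InjOn f {ε | σ ε = atom (f ε)} ∧ m.Nodup ∧ (∀ ν, ν ∈ m) ∧
      (∀ φ ψ, VertexStep L κ μ φ ψ → Der R κ' (φ.subst σ) m (ψ.subst σ)) ∧
      ∀ ν, ν ≠ μ → ∀ φ ψ, VertexStep L κ ν φ ψ → Der R κ' (φ.subst σ) 0 (ψ.subst σ)

namespace FlowContext

variable {L R : FlowGraph P Q} (K : FlowContext P Q I J)

/-- The steps at the vertices of a subgraph are steps on the edges of this subgraph. -/
theorem exists_vertexStep_of_plug {κ : (K.plug L).E → X} {ν : L.V} {φ ψ : Formula (K.plug L).E}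
    (h : VertexStep (K.plug L) κ (Sum.inl ν) φ ψ) :
    ∃ φ₀ ψ₀ : Formula L.E, φ = φ₀.map Sum.inl ∧ ψ = ψ₀.map Sum.inl ∧
      VertexStep L (fun ε => κ (Sum.inl ε)) ν φ₀ ψ₀ := by
  cases h with
  | aiDown ε₁ ε₂ hl hne h₁ h₂ hκ =>
    obtain ⟨ε₁, rfl, h₁'⟩ := K.exists_inl_of_plug_up h₁
    obtain ⟨ε₂, rfl, h₂'⟩ := K.exists_inl_of_plug_up h₂
    exact ⟨tt, or (atom ε₁) (atom ε₂), rfl, rfl,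
      .aiDown _ _ hl (fun e => hne (congrArg _ e)) h₁' h₂' hκ⟩
  | aiUp ε₁ ε₂ hl hne h₁ h₂ hκ =>
    obtain ⟨ε₁, rfl, h₁'⟩ := K.exists_inl_of_plug_lo h₁
    obtain ⟨ε₂, rfl, h₂'⟩ := K.exists_inl_of_plug_lo h₂
    exact ⟨and (atom ε₁) (atom ε₂), ff, rfl, rfl,
      .aiUp _ _ hl (fun e => hne (congrArg _ e)) h₁' h₂' hκ⟩
  | awDown ε hl h =>
    obtain ⟨ε, rfl, h'⟩ := K.exists_inl_of_plug_up h
    exact ⟨ff, atom ε, rfl, rfl, .awDown _ hl h'⟩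
  | awUp ε hl h =>
    obtain ⟨ε, rfl, h'⟩ := K.exists_inl_of_plug_lo h
    exact ⟨atom ε, tt, rfl, rfl, .awUp _ hl h'⟩
  | acDown ε₁ ε₂ ε₃ hl hne h₁ h₂ h₃ k₁ k₂ =>
    obtain ⟨ε₁, rfl, h₁'⟩ := K.exists_inl_of_plug_lo h₁
    obtain ⟨ε₂, rfl, h₂'⟩ := K.exists_inl_of_plug_lo h₂
    obtain ⟨ε₃, rfl, h₃'⟩ := K.exists_inl_of_plug_up h₃
    exact ⟨or (atom ε₁) (atom ε₂), atom ε₃, rfl, rfl,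
      .acDown _ _ _ hl (fun e => hne (congrArg _ e)) h₁' h₂' h₃' k₁ k₂⟩
  | acUp ε₁ ε₂ ε₃ hl hne h₁ h₂ h₃ k₁ k₂ =>
    obtain ⟨ε₁, rfl, h₁'⟩ := K.exists_inl_of_plug_lo h₁
    obtain ⟨ε₂, rfl, h₂'⟩ := K.exists_inl_of_plug_up h₂
    obtain ⟨ε₃, rfl, h₃'⟩ := K.exists_inl_of_plug_up h₃
    exact ⟨atom ε₁, and (atom ε₂) (atom ε₃), rfl, rfl,
      .acUp _ _ _ hl (fun e => hne (congrArg _ e)) h₁' h₂' h₃' k₁ k₂⟩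

/-- Simulations are compatible with contexts. -/
theorem derivable_plug (H : L.Simulates X R) {kI : I → X} {α : Formula I} {kJ : J → X}
    {β : Formula J} (h : (K.plug L).Derivable kI α kJ β) : (K.plug R).Derivable kI α kJ β := by
  obtain ⟨κ, u, d, m, hu, hd, hκI, hκJ, hn, hm, h⟩ := h
  obtain ⟨κ', σ, f, μ, mR, hup, hlo, hf, hmR, hmR', hμ, hν⟩ :=
    H (fun ε => κ (Sum.inl ε)) fun ν => by
      obtain ⟨_, _, r⟩ := h.exists_vertexStep (hm (Sum.inl ν))
      obtain ⟨φ₀, ψ₀, -, -, r⟩ := K.exists_vertexStep_of_plug r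
      exact ⟨φ₀, ψ₀, r⟩
  -- the substitution `σ` on the edges of `L`, and the identity on those of the context; `F` is the
  -- renaming to which it amounts on the edges at vertices of the context
  obtain ⟨κR, hκR⟩ : ∃ κR : (K.plug R).E → X, κR = Sum.elim κ' fun ε => κ (Sum.inr ε) := ⟨_, rfl⟩
  let F : (K.plug L).E → (K.plug R).E := Sum.map f id
  let S : (K.plug L).E → Formula (K.plug R).E :=
    Sum.elim (fun ε => (σ ε).map Sum.inl) (fun ε => atom (Sum.inr ε))
  have up : ∀ ε x, (K.plug L).up ε = Sum.map Sum.inr id x →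
      S ε = atom (F ε) ∧ (K.plug R).up (F ε) = Sum.map Sum.inr id x ∧ κR (F ε) = κ ε := by
    intro ε x hx
    subst hκR
    rcases K.exists_of_plug_up hx with ⟨ε, p, rfl, h₁, rfl⟩ | ⟨ε, rfl, rfl⟩
    · obtain ⟨e₁, e₂, e₃⟩ := hup ε p h₁
      exact ⟨congrArg (Formula.map Sum.inl) e₂, K.plug_up_of_inr e₁, e₃⟩
    · exact ⟨rfl, rfl, rfl⟩
  have lo : ∀ ε x, (K.plug L).lo ε = Sum.map Sum.inr id x →
      S ε = atom (F ε) ∧ (K.plug R).lo (F ε) = Sum.map Sum.inr id x ∧ κR (F ε) = κ ε := by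
    intro ε x hx
    subst hκR
    rcases K.exists_of_plug_lo hx with ⟨ε, p, rfl, h₁, rfl⟩ | ⟨ε, rfl, rfl⟩
    · obtain ⟨e₁, e₂, e₃⟩ := hlo ε p h₁
      exact ⟨congrArg (Formula.map Sum.inl) e₂, K.plug_lo_of_inr e₁, e₃⟩
    · exact ⟨rfl, rfl, rfl⟩
  have inj : ∀ a b, S a = atom (F a) → S b = atom (F b) → F a = F b → a = b := by
    have key : ∀ ε : L.E, S (Sum.inl ε) = atom (F (Sum.inl ε)) → σ ε = atom (f ε) := by
      intro ε h
      change (σ ε).map Sum.inl = atom (Sum.inl (f ε)) at h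
      cases e : σ ε <;> rw [e] at h <;> cases h
      rfl
    rintro (a | a) (b | b) ha hb e
    · exact congrArg _ (hf (key a ha) (key b hb) (Sum.inl_injective e))
    · cases e
    · cases e
    · exact congrArg _ (Sum.inr_injective e)
  have lift : ∀ {m : Multiset R.V} {φ ψ : Formula L.E}, Der R κ' (φ.subst σ) m (ψ.subst σ) →
      Der (K.plug R) κR ((φ.map Sum.inl).subst S) (m.map Sum.inl) ((ψ.map Sum.inl).subst S) := by
    intro m φ ψ h
    have := h.map (B := K.plug R) (κ' := κR) Sum.inl Sum.inl Sum.inl_injective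
      (fun ε => congrFun hκR _) (fun _ => rfl) (fun ε ν => K.plug_up_inl_inl.2)
      (fun ε ν => K.plug_lo_inl_inl.2)
    have e : ∀ φ : Formula L.E, (φ.subst σ).map Sum.inl = (φ.map Sum.inl).subst S := fun φ =>
      (Formula.map_subst _ _ _).trans
        (Formula.subst_map (Sum.inl : L.E → (K.plug L).E) S φ).symm
    exact (congrArg₂ (fun a b => Der (K.plug R) κR a _ b) (e φ) (e ψ)).mp this
  classical
  let mR' : Multiset (K.plug R).V := mR.map (Sum.inl : R.V → R.V ⊕ K.V)
  let T : (K.plug L).V → Multiset (K.plug R).V :=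
    Sum.elim (fun ν => if ν = μ then mR' else 0) (fun ν => {(Sum.inr ν : R.V ⊕ K.V)})
  have hder := h.subst (B := K.plug R) (κ' := κR) (σ := S) (τ := T) (by
    rintro (ν | ν) - φ ψ r
    · obtain ⟨φ, ψ, rfl, rfl, r'⟩ := K.exists_vertexStep_of_plug r
      change Der _ _ _ (if ν = μ then mR' else 0) _
      split_ifs with e
      · subst e
        exact lift (hμ _ _ r')
      · exact lift (hν ν e _ _ r')
    · refine .structural (A := K.plug R) (κ := κR) (ν := Sum.inr ν) (VertexStep.subst
        (B := K.plug R) (κ' := κR) (σ := S) (ν' := Sum.inr ν) (by rfl) F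
        (fun ε hε => up ε (Sum.inl ν) hε) (fun ε hε => lo ε (Sum.inl ν) hε) ?_ r)
      have : ∀ ε ∈ (K.plug L).edgesAt (Sum.inr ν), S ε = atom (F ε) := fun ε hε =>
        hε.elim (fun hε => (up ε (Sum.inl ν) hε).1) fun hε => (lo ε (Sum.inl ν) hε).1
      exact fun a ha b hb => inj a b (this a ha) (this b hb))
  have hT := nodup_bind_of_fiber hn hm (T := T)
    (g := (Sum.map (fun _ => μ) id : R.V ⊕ K.V → L.V ⊕ K.V)) (by
      rintro (ν | ν)
      · change (if ν = μ then mR' else 0).Nodup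
        split_ifs
        · exact hmR.map Sum.inl_injective
        · exact Multiset.nodup_zero
      · exact Multiset.nodup_singleton _) (by
      rintro x (ν | ν)
      · change x ∈ (if ν = μ then mR' else 0) ↔ _
        split_ifs with e
        · subst e
          rcases x with x | x
          · exact iff_of_true (Multiset.mem_map_of_mem _ (hmR' x)) rfl
          · refine iff_of_false (fun h => ?_) nofun
            obtain ⟨y, -, h⟩ := Multiset.mem_map.1 h
            cases h
        · refine iff_of_false (Multiset.notMem_zero _) ?_
          rcases x with x | x
          · exact fun h => e (Sum.inl_injective h).symm
          · nofun
      · refine Multiset.mem_singleton.trans ?_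
        rcases x with x | x
        · exact iff_of_false nofun nofun
        · exact ⟨fun h => congrArg Sum.inr (Sum.inr_injective h),
            fun h => congrArg Sum.inr (Sum.inr_injective h)⟩)
  refine ⟨κR, F ∘ u, F ∘ d, _, fun i => (up _ (Sum.inr i) (hu i)).2.1,
    fun j => (lo _ (Sum.inr j) (hd j)).2.1, fun i => (up _ (Sum.inr i) (hu i)).2.2.trans (hκI i),
    fun j => (lo _ (Sum.inr j) (hd j)).2.2.trans (hκJ j), hT.1, hT.2, ?_⟩
  have e₁ : (α.map u).subst S = α.map (F ∘ u) := by
    rw [Formula.subst_map, ← Formula.subst_atom]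
    exact Formula.subst_congr fun i _ => (up _ (Sum.inr i) (hu i)).1
  have e₂ : (β.map d).subst S = β.map (F ∘ d) := by
    rw [Formula.subst_map, ← Formula.subst_atom]
    exact Formula.subst_congr fun i _ => (lo _ (Sum.inr i) (hd i)).1
  rwa [e₁, e₂] at hder

end FlowContext

namespace Der

variable {A : FlowGraph I J} {κ : A.E → X} {φ φ' ψ ψ' : Formula A.E}

theorem and_and_or : Der A κ (and (and φ φ') (or ψ ψ')) 0 (or (and φ ψ) (and φ' ψ')) :=
  .logical_trans (.andAssoc _ _ _) <| .zero_trans (.andRight _ <|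
    .zero_trans (.andRight _ (.logical (.orComm _ _))) <| .logical_trans (.switch _ _ _) <|
    .logical (.orComm _ _)) <| .logical (.switch _ _ _)

theorem or_and_or : Der A κ (and (or φ ψ) (or φ' ψ')) 0 (or (and φ φ') (or ψ ψ')) :=
  .logical_trans (.switch _ _ _) <| .zero_trans (.orLeft and_or_left _) <|
    .logical (.orAssoc _ _ _)

end Der

/-- The lower edge of the contraction is replaced by the disjunction of its upper edges; the step at
the cointeraction becomes `(2.[0.1]) → ((3.4).[0.1]) → [(3.0).(4.1)] → f`, and the contraction
becomes empty. -/
theorem ci_simulates : ciLeft.Simulates X ciRight := by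
  intro κ hκ
  have lo₀ : ∀ ε : Fin 4, ciLeftLo ε = Sum.inl 0 → ε = 0 ∨ ε = 1 := by decide
  have up₀ : ∀ ε : Fin 4, ciLeftUp ε = Sum.inl 0 → ε = 3 := by decide
  have lo₁ : ∀ ε : Fin 4, ciLeftLo ε = Sum.inl 1 → ε = 2 ∨ ε = 3 := by decide
  obtain ⟨_, _, r₀⟩ := hκ (0 : Fin 2)
  obtain ⟨-, -, k₀, k₁⟩ := r₀.of_acDown rfl lo₀ up₀
  obtain ⟨_, _, r₁⟩ := hκ (1 : Fin 2)
  obtain ⟨-, -, k₂⟩ := r₁.of_aiUp rfl lo₁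
  obtain ⟨κ', hκ'⟩ : ∃ κ' : ciRight.E → X, κ' = (![κ (0 : Fin 4), κ (1 : Fin 4), κ (2 : Fin 4),
    κ (2 : Fin 4), κ (2 : Fin 4)] : Fin 5 → X) := ⟨_, rfl⟩
  have v₀ : κ' (0 : Fin 5) = κ (0 : Fin 4) := congrFun hκ' _
  have v₁ : κ' (1 : Fin 5) = κ (1 : Fin 4) := congrFun hκ' _
  have v₂ : κ' (2 : Fin 5) = κ (2 : Fin 4) := congrFun hκ' _
  have v₃ : κ' (3 : Fin 5) = κ (2 : Fin 4) := congrFun hκ' _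
  have v₄ : κ' (4 : Fin 5) = κ (2 : Fin 4) := congrFun hκ' _
  have d₁ : Der ciRight κ' (and (atom (2 : Fin 5)) (or (atom (0 : Fin 5)) (atom (1 : Fin 5))))
      ({(0 : Fin 3)} + ({(1 : Fin 3)} + {(2 : Fin 3)})) ff := by
    have s₀ : VertexStep ciRight κ' (0 : Fin 3) (atom (2 : Fin 5))
        (and (atom (3 : Fin 5)) (atom (4 : Fin 5))) := by
      exact .acUp (A := ciRight) (κ := κ') (ν := (0 : Fin 3)) (2 : Fin 5) (3 : Fin 5) (4 : Fin 5)
        rfl (by decide : (3 : Fin 5) ≠ 4) rfl rfl rfl (v₃.trans v₂.symm)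
          (v₄.trans v₂.symm)
    have s₁ : VertexStep ciRight κ' (1 : Fin 3) (and (atom (3 : Fin 5)) (atom (0 : Fin 5))) ff := by
      exact .aiUp (A := ciRight) (κ := κ') (ν := (1 : Fin 3)) (3 : Fin 5) (0 : Fin 5) rfl
        (by decide : (3 : Fin 5) ≠ 0) rfl rfl
        (v₀.trans (k₀.trans (k₂.trans (congrArg bar v₃.symm))))
    have s₂ : VertexStep ciRight κ' (2 : Fin 3) (and (atom (4 : Fin 5)) (atom (1 : Fin 5))) ff := by
      exact .aiUp (A := ciRight) (κ := κ') (ν := (2 : Fin 3)) (4 : Fin 5) (1 : Fin 5) rfl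
        (by decide : (4 : Fin 5) ≠ 1) rfl rfl
        (v₁.trans (k₁.trans (k₂.trans (congrArg bar v₄.symm))))
    exact .trans (.andLeft (.structural s₀) _) <| .zero_trans .and_and_or <|
      .trans_logical (.or_mono (.structural s₁) (.structural s₂)) (.orFalse _)
  refine ⟨κ', (![atom (0 : Fin 5), atom (1 : Fin 5), atom (2 : Fin 5), or (atom (0 : Fin 5))
    (atom (1 : Fin 5))] : Fin 4 → Formula (Fin 5)), (![0, 1, 2, 0] : Fin 4 → Fin 5), (1 : Fin 2),
    ({(0 : Fin 3)} + ({(1 : Fin 3)} + {(2 : Fin 3)})), ?_, ?_, ?_,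
    (by decide : ({0} + ({1} + {2}) : Multiset (Fin 3)).Nodup),
    (by decide : ∀ ν : Fin 3, ν ∈ ({0} + ({1} + {2}) : Multiset (Fin 3))), ?_, ?_⟩
  · intro ε p h
    have key : ∀ (ε : Fin 4) (p : Fin 3), ciLeftUp ε = Sum.inr p →
        ε = 0 ∧ p = 0 ∨ ε = 1 ∧ p = 1 ∨ ε = 2 ∧ p = 2 := by decide
    subst hκ'
    obtain ⟨rfl, rfl⟩ | ⟨rfl, rfl⟩ | ⟨rfl, rfl⟩ := key ε p h <;> exact ⟨rfl, rfl, rfl⟩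
  · exact fun ε q => q.elim0
  · have key : ∀ a b : Fin 4, a ≠ 3 → b ≠ 3 → (![0, 1, 2, 0] : Fin 4 → Fin 5) a =
      (![0, 1, 2, 0] : Fin 4 → Fin 5) b → a = b := by decide
    exact fun a ha b hb e => key a b (by rintro rfl; cases ha) (by rintro rfl; cases hb) e
  · intro φ ψ r
    obtain ⟨rfl | rfl, rfl, -⟩ := r.of_aiUp rfl lo₁
    · exact d₁
    · exact .logical_trans (.andComm _ _) d₁
  · have key : ∀ ν : Fin 2, ν ≠ 1 → ν = 0 := by decide
    intro ν hν φ ψ r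
    obtain rfl := key ν hν
    obtain ⟨rfl | rfl, rfl, -⟩ := r.of_acDown rfl lo₀ up₀
    · exact .refl _
    · exact .logical (.orComm _ _)

/-- The dual of `ci_simulates`: the upper edge of the cocontraction is replaced by the conjunction
of its lower edges, and the interaction becomes `t → ([0.3].[1.4]) → [(0.1).[3.4]] → [(0.1).2]`. -/
theorem ic_simulates : ciLeft.flip.Simulates X ciRight.flip := by
  intro κ hκ
  have lo₀ : ∀ ε : Fin 4, ciLeftLo ε = Sum.inl 0 → ε = 0 ∨ ε = 1 := by decide
  have up₀ : ∀ ε : Fin 4, ciLeftUp ε = Sum.inl 0 → ε = 3 := by decide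
  have lo₁ : ∀ ε : Fin 4, ciLeftLo ε = Sum.inl 1 → ε = 2 ∨ ε = 3 := by decide
  obtain ⟨_, _, r₀⟩ := hκ (0 : Fin 2)
  obtain ⟨-, -, k₀, k₁⟩ := r₀.of_acUp rfl up₀ lo₀
  obtain ⟨_, _, r₁⟩ := hκ (1 : Fin 2)
  obtain ⟨-, -, k₂⟩ := r₁.of_aiDown rfl lo₁
  obtain ⟨κ', hκ'⟩ : ∃ κ' : ciRight.flip.E → X, κ' = (![κ (0 : Fin 4), κ (1 : Fin 4),
    κ (2 : Fin 4), κ (2 : Fin 4), κ (2 : Fin 4)] : Fin 5 → X) := ⟨_, rfl⟩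
  have k₀' : κ (2 : Fin 4) = bar (κ (0 : Fin 4)) := by rw [k₀, k₂, DualAtoms.bar_bar]
  have k₁' : κ (2 : Fin 4) = bar (κ (1 : Fin 4)) := by rw [k₁, k₂, DualAtoms.bar_bar]
  have v₀ : κ' (0 : Fin 5) = κ (0 : Fin 4) := congrFun hκ' _
  have v₁ : κ' (1 : Fin 5) = κ (1 : Fin 4) := congrFun hκ' _
  have v₂ : κ' (2 : Fin 5) = κ (2 : Fin 4) := congrFun hκ' _
  have v₃ : κ' (3 : Fin 5) = κ (2 : Fin 4) := congrFun hκ' _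
  have v₄ : κ' (4 : Fin 5) = κ (2 : Fin 4) := congrFun hκ' _
  have d₁ : Der ciRight.flip κ' tt ({(1 : Fin 3)} + {(2 : Fin 3)} + {(0 : Fin 3)})
      (or (and (atom (0 : Fin 5)) (atom (1 : Fin 5))) (atom (2 : Fin 5))) := by
    have s₀ : VertexStep ciRight.flip κ' (0 : Fin 3)
        (or (atom (3 : Fin 5)) (atom (4 : Fin 5))) (atom (2 : Fin 5)) := by
      exact .acDown (A := ciRight.flip) (κ := κ') (ν := (0 : Fin 3)) (3 : Fin 5) (4 : Fin 5)
        (2 : Fin 5) rfl (by decide : (3 : Fin 5) ≠ 4) rfl rfl rfl (v₃.trans v₂.symm)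
          (v₄.trans v₂.symm)
    have s₁ : VertexStep ciRight.flip κ' (1 : Fin 3) tt
        (or (atom (0 : Fin 5)) (atom (3 : Fin 5))) := by
      exact .aiDown (A := ciRight.flip) (κ := κ') (ν := (1 : Fin 3)) (0 : Fin 5) (3 : Fin 5) rfl
        (by decide : (0 : Fin 5) ≠ 3) rfl rfl (v₃.trans (k₀'.trans (congrArg bar v₀.symm)))
    have s₂ : VertexStep ciRight.flip κ' (2 : Fin 3) tt
        (or (atom (1 : Fin 5)) (atom (4 : Fin 5))) := by
      exact .aiDown (A := ciRight.flip) (κ := κ') (ν := (2 : Fin 3)) (1 : Fin 5) (4 : Fin 5) rfl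
        (by decide : (1 : Fin 5) ≠ 4) rfl rfl (v₄.trans (k₁'.trans (congrArg bar v₁.symm)))
    exact .trans (.logical_trans (.andTrueInv _) <| .trans_zero
      (.and_mono (.structural s₁) (.structural s₂)) .or_and_or) <| .orRight _ (.structural s₀)
  refine ⟨κ', (![atom (0 : Fin 5), atom (1 : Fin 5), atom (2 : Fin 5), and (atom (0 : Fin 5))
    (atom (1 : Fin 5))] : Fin 4 → Formula (Fin 5)), (![0, 1, 2, 0] : Fin 4 → Fin 5), (1 : Fin 2),
    ({(1 : Fin 3)} + {(2 : Fin 3)} + {(0 : Fin 3)}), ?_, ?_, ?_,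
    (by decide : ({1} + {2} + {0} : Multiset (Fin 3)).Nodup),
    (by decide : ∀ ν : Fin 3, ν ∈ ({1} + {2} + {0} : Multiset (Fin 3))), ?_, ?_⟩
  · exact fun ε q => q.elim0
  · intro ε p h
    have key : ∀ (ε : Fin 4) (p : Fin 3), ciLeftUp ε = Sum.inr p →
        ε = 0 ∧ p = 0 ∨ ε = 1 ∧ p = 1 ∨ ε = 2 ∧ p = 2 := by decide
    subst hκ'
    obtain ⟨rfl, rfl⟩ | ⟨rfl, rfl⟩ | ⟨rfl, rfl⟩ := key ε p h <;> exact ⟨rfl, rfl, rfl⟩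
  · have key : ∀ a b : Fin 4, a ≠ 3 → b ≠ 3 → (![0, 1, 2, 0] : Fin 4 → Fin 5) a =
      (![0, 1, 2, 0] : Fin 4 → Fin 5) b → a = b := by decide
    exact fun a ha b hb e => key a b (by rintro rfl; cases ha) (by rintro rfl; cases hb) e
  · intro φ ψ r
    obtain ⟨rfl, rfl | rfl, -⟩ := r.of_aiDown rfl lo₁
    · exact d₁.trans_logical (.orComm _ _)
    · exact d₁
  · have key : ∀ ν : Fin 2, ν ≠ 1 → ν = 0 := by decide
    intro ν hν φ ψ r
    obtain rfl := key ν hν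
    obtain ⟨rfl, rfl | rfl, -⟩ := r.of_acUp rfl up₀ lo₀
    · exact .refl _
    · exact .logical (.andComm _ _)

/-- The edge between the two vertices is replaced by the disjunction of the upper edges of the
contraction, and the cocontraction becomes `[0.1] → [(4.5).(6.7)] → ([4.6].[5.7]) → (2.3)` by
medial. -/
theorem cc_simulates : ccLeft.Simulates X ccRight := by
  intro κ hκ
  have lo₀ : ∀ ε : Fin 5, ccLeftLo ε = Sum.inl 0 → ε = 0 ∨ ε = 1 := by decide
  have up₀ : ∀ ε : Fin 5, ccLeftUp ε = Sum.inl 0 → ε = 4 := by decide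
  have lo₁ : ∀ ε : Fin 5, ccLeftLo ε = Sum.inl 1 → ε = 4 := by decide
  have up₁ : ∀ ε : Fin 5, ccLeftUp ε = Sum.inl 1 → ε = 2 ∨ ε = 3 := by decide
  obtain ⟨_, _, r₀⟩ := hκ (0 : Fin 2)
  obtain ⟨-, -, k₀, k₁⟩ := r₀.of_acDown rfl lo₀ up₀
  obtain ⟨_, _, r₁⟩ := hκ (1 : Fin 2)
  obtain ⟨-, -, k₂, k₃⟩ := r₁.of_acUp rfl lo₁ up₁
  have d₁ : Der ccRight (fun _ => κ (4 : Fin 5)) (or (atom (0 : Fin 8)) (atom (1 : Fin 8)))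
      ({(0 : Fin 4)} + {(1 : Fin 4)} + ({(2 : Fin 4)} + {(3 : Fin 4)}))
      (and (atom (2 : Fin 8)) (atom (3 : Fin 8))) := by
    have s₀ : VertexStep ccRight (fun _ => κ (4 : Fin 5)) (0 : Fin 4)
        (atom (0 : Fin 8)) (and (atom (4 : Fin 8)) (atom (5 : Fin 8))) :=
      .acUp (A := ccRight) (κ := fun _ => κ (4 : Fin 5)) (ν := (0 : Fin 4))
        (0 : Fin 8) (4 : Fin 8) (5 : Fin 8) rfl (by decide : (4 : Fin 8) ≠ 5) rfl
        rfl rfl rfl rfl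
    have s₁ : VertexStep ccRight (fun _ => κ (4 : Fin 5)) (1 : Fin 4)
        (atom (1 : Fin 8)) (and (atom (6 : Fin 8)) (atom (7 : Fin 8))) :=
      .acUp (A := ccRight) (κ := fun _ => κ (4 : Fin 5)) (ν := (1 : Fin 4))
        (1 : Fin 8) (6 : Fin 8) (7 : Fin 8) rfl (by decide : (6 : Fin 8) ≠ 7) rfl
        rfl rfl rfl rfl
    have s₂ : VertexStep ccRight (fun _ => κ (4 : Fin 5)) (2 : Fin 4)
        (or (atom (4 : Fin 8)) (atom (6 : Fin 8))) (atom (2 : Fin 8)) :=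
      .acDown (A := ccRight) (κ := fun _ => κ (4 : Fin 5)) (ν := (2 : Fin 4))
        (4 : Fin 8) (6 : Fin 8) (2 : Fin 8) rfl (by decide : (4 : Fin 8) ≠ 6) rfl
        rfl rfl rfl rfl
    have s₃ : VertexStep ccRight (fun _ => κ (4 : Fin 5)) (3 : Fin 4)
        (or (atom (5 : Fin 8)) (atom (7 : Fin 8))) (atom (3 : Fin 8)) :=
      .acDown (A := ccRight) (κ := fun _ => κ (4 : Fin 5)) (ν := (3 : Fin 4))
        (5 : Fin 8) (7 : Fin 8) (3 : Fin 8) rfl (by decide : (5 : Fin 8) ≠ 7) rfl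
        rfl rfl rfl rfl
    exact .trans (.trans_logical (.or_mono (.structural s₀) (.structural s₁)) (.medial _ _ _ _)) <|
      .and_mono (.structural s₂) (.structural s₃)
  refine ⟨fun _ => κ (4 : Fin 5), (![atom (0 : Fin 8), atom (1 : Fin 8), atom (2 : Fin 8),
    atom (3 : Fin 8), or (atom (0 : Fin 8)) (atom (1 : Fin 8))] : Fin 5 → Formula (Fin 8)),
    (![0, 1, 2, 3, 0] : Fin 5 → Fin 8), (1 : Fin 2),
    ({(0 : Fin 4)} + {(1 : Fin 4)} + ({(2 : Fin 4)} + {(3 : Fin 4)})), ?_, ?_, ?_,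
    (by decide : ({0} + {1} + ({2} + {3}) : Multiset (Fin 4)).Nodup),
    (by decide : ∀ ν : Fin 4, ν ∈ ({0} + {1} + ({2} + {3}) : Multiset (Fin 4))), ?_, ?_⟩
  · intro ε p h
    have key : ∀ (ε : Fin 5) (p : Fin 2), ccLeftUp ε = Sum.inr p →
        ε = 0 ∧ p = 0 ∨ ε = 1 ∧ p = 1 := by decide
    obtain ⟨rfl, rfl⟩ | ⟨rfl, rfl⟩ := key ε p h
    exacts [⟨rfl, rfl, k₀.symm⟩, ⟨rfl, rfl, k₁.symm⟩]
  · intro ε p h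
    have key : ∀ (ε : Fin 5) (p : Fin 2), ccLeftLo ε = Sum.inr p →
        ε = 2 ∧ p = 0 ∨ ε = 3 ∧ p = 1 := by decide
    obtain ⟨rfl, rfl⟩ | ⟨rfl, rfl⟩ := key ε p h
    exacts [⟨rfl, rfl, k₂.symm⟩, ⟨rfl, rfl, k₃.symm⟩]
  · have key : ∀ a b : Fin 5, a ≠ 4 → b ≠ 4 → (![0, 1, 2, 3, 0] : Fin 5 → Fin 8) a =
      (![0, 1, 2, 3, 0] : Fin 5 → Fin 8) b → a = b := by decide
    exact fun a ha b hb e => key a b (by rintro rfl; cases ha) (by rintro rfl; cases hb) e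
  · intro φ ψ r
    obtain ⟨rfl, rfl | rfl, -⟩ := r.of_acUp rfl lo₁ up₁
    · exact d₁
    · exact d₁.trans_logical (.andComm _ _)
  · have key : ∀ ν : Fin 2, ν ≠ 1 → ν = 0 := by decide
    intro ν hν φ ψ r
    obtain rfl := key ν hν
    obtain ⟨rfl | rfl, rfl, -⟩ := r.of_acDown rfl lo₀ up₀
    · exact .refl _
    · exact .logical (.orComm _ _)

theorem CRule.simulates {L R : FlowGraph P Q} (h : CRule L R) : L.Simulates X R := by
  cases h with
  | ci => exact ci_simulates
  | ic => exact ic_simulates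
  | cc => exact cc_simulates

/-- Soundness of the system c for derivations. -/
theorem NegativeCStep.derivable {A B : PolarizedFlow I J} (h : NegativeCStep A B) {kI : I → X}
    {α : Formula I} {kJ : J → X} {β : Formula J} (hA : A.Derivable kI α kJ β) :
    B.Derivable kI α kJ β := by
  obtain ⟨P, Q, L, R, K, f, g, hr, -⟩ := h
  exact (K.derivable_plug hr.simulates (hA.of_iso f.symm)).of_iso g

end Soundness

/-! ### Breaking a simple edge -/

namespace FlowGraph

variable {I J : Type}

/-- The number of edges that a vertex or a named end must have below (or above, for `upperCard`). -/
theorem IsFlow.ncard_up {A : FlowGraph I J} (h : A.IsFlow) (x : A.V ⊕ I) :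
    {ε | A.up ε = x}.ncard = Sum.elim (fun ν => (A.label ν).lowerCard) (fun _ => 1) x := by
  rcases x with ν | i
  · exact h.card_lower ν
  · exact FlowContext.existsUnique_iff_ncard.1 (h.upper_named i)

theorem IsFlow.ncard_lo {A : FlowGraph I J} (h : A.IsFlow) (x : A.V ⊕ J) :
    {ε | A.lo ε = x}.ncard = Sum.elim (fun ν => (A.label ν).upperCard) (fun _ => 1) x := by
  rcases x with ν | i
  · exact h.card_upper ν
  · exact FlowContext.existsUnique_iff_ncard.1 (h.lower_named i)

theorem IsFlow.of_ncard {A : FlowGraph I J} (hV : Finite A.V) (hE : Finite A.E)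
    (hup : ∀ x : A.V ⊕ I, {ε | A.up ε = x}.ncard =
      Sum.elim (fun ν => (A.label ν).lowerCard) (fun _ => 1) x)
    (hlo : ∀ x : A.V ⊕ J, {ε | A.lo ε = x}.ncard =
      Sum.elim (fun ν => (A.label ν).upperCard) (fun _ => 1) x)
    (h : ∀ ε, ¬ Relation.TransGen A.Below ε ε) : A.IsFlow where
  finite_V := hV
  finite_E := hE
  upper_named i := FlowContext.existsUnique_iff_ncard.2 (hup (Sum.inr i))
  lower_named i := FlowContext.existsUnique_iff_ncard.2 (hlo (Sum.inr i))
  card_lower ν := hup (Sum.inl ν)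
  card_upper ν := hlo (Sum.inl ν)
  acyclic := h

section SimpleEdge

variable {A : FlowGraph (Option I) (Option J)}

/-- The ends of the edges of the rest of a flow as ends in the whole flow, where `b` is the end
`none`. -/
def simpleEnd {V N : Type} (b : Bool) : V ⊕ Option N → (V ⊕ Bool) ⊕ N :=
  Sum.elim (fun ν => Sum.inl (Sum.inl ν)) fun o => o.elim (Sum.inl (Sum.inr b)) Sum.inr

theorem simpleEnd_injective {V N : Type} (b : Bool) :
    Function.Injective (simpleEnd b : V ⊕ Option N → (V ⊕ Bool) ⊕ N) := by
  rintro (ν | _ | i) (ν' | _ | i') h <;> simp_all [simpleEnd]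

theorem withSimpleEdge_up {ε : A.E} {x : A.V ⊕ Option I} :
    A.up ε = x ↔ A.withSimpleEdge.up (Sum.inl ε) = simpleEnd false x :=
  (simpleEnd_injective false).eq_iff.symm

theorem withSimpleEdge_lo {ε : A.E} {x : A.V ⊕ Option J} :
    A.lo ε = x ↔ A.withSimpleEdge.lo (Sum.inl ε) = simpleEnd true x :=
  (simpleEnd_injective true).eq_iff.symm

theorem ncard_fiber_of_ne {E W : Type} {u : E ⊕ Unit → W} {w : W} (h : u (Sum.inr ()) ≠ w) :
    {ε | u (Sum.inl ε) = w}.ncard = {ε | u ε = w}.ncard := by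
  rw [← Set.ncard_image_of_injective _ (Sum.inl_injective (β := Unit))]
  congr 1
  ext (ε | ε) <;> simp [h]

theorem ncard_fiber_of_eq {E W : Type} [Finite E] {u : E ⊕ Unit → W} {w : W}
    (h : u (Sum.inr ()) = w) :
    {ε | u (Sum.inl ε) = w}.ncard + 1 = {ε | u ε = w}.ncard := by
  rw [← Set.ncard_image_of_injective _ (Sum.inl_injective (β := Unit)),
    ← Set.ncard_insert_of_notMem (a := Sum.inr ()) (by simp) (Set.toFinite _)]
  congr 1
  ext (ε | ε) <;> simp [h]

/-- The rest of a flow without a simple edge and the two vertices of this edge. -/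
theorem IsFlow.of_withSimpleEdge (h : A.withSimpleEdge.IsFlow) : A.IsFlow := by
  have hV : Finite (A.V ⊕ Bool) := h.finite_V
  have hE : Finite (A.E ⊕ Unit) := h.finite_E
  have hE' : Finite A.E := Finite.of_injective (Sum.inl : A.E → A.E ⊕ Unit) Sum.inl_injective
  refine .of_ncard (.of_injective (Sum.inl : A.V → A.V ⊕ Bool) Sum.inl_injective) hE' ?_ ?_ ?_
  · intro x
    refine (congrArg Set.ncard (Set.ext fun ε => withSimpleEdge_up)).trans ?_
    have e := h.ncard_up (simpleEnd false x)
    rcases x with ν | _ | i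
    · exact (ncard_fiber_of_ne (E := A.E)
      (u := A.withSimpleEdge.up) (w := simpleEnd false (Sum.inl ν))
        nofun).trans e
    · exact Nat.succ_injective ((ncard_fiber_of_eq (E := A.E) rfl).trans e)
    · exact (ncard_fiber_of_ne (E := A.E)
      (u := A.withSimpleEdge.up) (w := simpleEnd false (Sum.inr (some i)))
        nofun).trans e
  · intro x
    refine (congrArg Set.ncard (Set.ext fun ε => withSimpleEdge_lo)).trans ?_
    have e := h.ncard_lo (simpleEnd true x)
    rcases x with ν | _ | i
    · exact (ncard_fiber_of_ne (E := A.E)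
      (u := A.withSimpleEdge.lo) (w := simpleEnd true (Sum.inl ν))
        nofun).trans e
    · exact Nat.succ_injective ((ncard_fiber_of_eq (E := A.E) rfl).trans e)
    · exact (ncard_fiber_of_ne (E := A.E)
      (u := A.withSimpleEdge.lo) (w := simpleEnd true (Sum.inr (some i)))
        nofun).trans e
  · obtain ⟨r, hr⟩ := h.exists_rank
    exact not_transGen_self (fun ε => r (Sum.inl ε)) fun a b ⟨ν, h₁, h₂⟩ =>
      hr _ _ ⟨Sum.inl ν, withSimpleEdge_lo.1 h₁, withSimpleEdge_up.1 h₂⟩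

theorem elim_eq_iff {V N : Type} {y : V ⊕ Option N} {x : (V ⊕ Unit) ⊕ N} :
    Sum.elim (fun ν => Sum.inl (Sum.inl ν)) (fun o => o.elim (Sum.inl (Sum.inr ())) Sum.inr) y = x ↔
      y = Sum.elim (Sum.elim Sum.inl fun _ => Sum.inr none) (fun i => Sum.inr (some i)) x := by
  rcases y with ν | _ | i <;> rcases x with (ν' | _) | i' <;> simp

theorem map_inl_eq_inl {V W N : Type} {y : V ⊕ N} {ν : V} :
    Sum.map (Sum.inl : V → V ⊕ W) id y = Sum.inl (Sum.inl ν) ↔ y = Sum.inl ν := by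
  cases y <;> simp

theorem map_inl_eq_inr {V W N : Type} {y : V ⊕ N} {n : N} :
    Sum.map (Sum.inl : V → V ⊕ W) id y = Sum.inr n ↔ y = Sum.inr n := by
  cases y <;> simp

theorem map_inl_ne {V W N : Type} {y : V ⊕ N} {ν : W} :
    Sum.map (Sum.inl : V → V ⊕ W) id y ≠ Sum.inl (Sum.inr ν) := by
  cases y <;> simp

theorem withWeakening_up {ε : A.E} {x : (A.V ⊕ Unit) ⊕ I} : A.withWeakening.up ε = x ↔
    A.up ε = Sum.elim (Sum.elim Sum.inl fun _ => Sum.inr none) (fun i => Sum.inr (some i)) x :=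
  elim_eq_iff

theorem withWeakening_lo_inl {ε : A.E} {ν : A.V} :
    A.withWeakening.lo ε = Sum.inl (Sum.inl ν) ↔ A.lo ε = Sum.inl ν := map_inl_eq_inl

theorem withWeakening_lo_inr {ε : A.E} {j : Option J} :
    A.withWeakening.lo ε = Sum.inr j ↔ A.lo ε = Sum.inr j := map_inl_eq_inr

theorem withWeakening_lo_ne {ε : A.E} {ν : Unit} : A.withWeakening.lo ε ≠ Sum.inl (Sum.inr ν) :=
  map_inl_ne

theorem IsFlow.withWeakening (h : A.IsFlow) : A.withWeakening.IsFlow := by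
  have := h.finite_V
  refine .of_ncard (inferInstanceAs (Finite (A.V ⊕ Unit))) h.finite_E ?_ ?_ ?_
  · intro x
    refine (congrArg Set.ncard (Set.ext fun ε => withWeakening_up)).trans ((h.ncard_up _).trans ?_)
    rcases x with (ν | _) | i <;> rfl
  · rintro ((ν | ν) | j)
    · exact (congrArg Set.ncard (Set.ext fun ε => withWeakening_lo_inl)).trans (h.ncard_lo _)
    · refine (congrArg Set.ncard (Set.eq_empty_of_forall_notMem fun ε => ?_)).trans
        (Set.ncard_empty _)
      exact withWeakening_lo_ne
    · exact (congrArg Set.ncard (Set.ext fun ε => withWeakening_lo_inr)).trans (h.ncard_lo _)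
  · obtain ⟨r, hr⟩ := h.exists_rank
    refine not_transGen_self r ?_
    rintro a b ⟨ν | ν, h₁, h₂⟩
    · exact hr _ _ ⟨ν, withWeakening_lo_inl.1 h₁, withWeakening_up.1 h₂⟩
    · exact (withWeakening_lo_ne h₁).elim

/-- Coweakening is dual to weakening. -/
def flipWithWeakening (A : FlowGraph (Option I) (Option J)) :
    A.flip.withWeakening.flip.Iso A.withCoweakening where
  vert := Equiv.refl _
  edge := Equiv.refl _
  label_vert ν := by
    rcases ν with ν | _
    · change A.label ν = (A.label ν).flip.flip
      cases A.label ν <;> rfl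
    · rfl
  up_edge ε := by
    change Sum.map _ _ (A.up ε) = Sum.map _ _ (Sum.map _ _ (A.up ε))
    cases A.up ε <;> rfl
  lo_edge ε := by
    change Sum.elim _ _ (A.lo ε) = Sum.map _ _ (Sum.elim _ _ (A.lo ε))
    rcases A.lo ε with ν | _ | j <;> rfl

theorem IsFlow.withCoweakening (h : A.IsFlow) : A.withCoweakening.IsFlow :=
  h.flip.withWeakening.flip.of_iso (flipWithWeakening A)

theorem withCoweakening_lo {ε : A.E} {x : (A.V ⊕ Unit) ⊕ J} : A.withCoweakening.lo ε = x ↔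
    A.lo ε = Sum.elim (Sum.elim Sum.inl fun _ => Sum.inr none) (fun i => Sum.inr (some i)) x :=
  withWeakening_up (A := A.flip)

theorem withCoweakening_up_inl {ε : A.E} {ν : A.V} :
    A.withCoweakening.up ε = Sum.inl (Sum.inl ν) ↔ A.up ε = Sum.inl ν :=
  withWeakening_lo_inl (A := A.flip)

theorem withCoweakening_up_inr {ε : A.E} {i : Option I} :
    A.withCoweakening.up ε = Sum.inr i ↔ A.up ε = Sum.inr i :=
  withWeakening_lo_inr (A := A.flip)

theorem withCoweakening_up_ne {ε : A.E} {ν : Unit} :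
    A.withCoweakening.up ε ≠ Sum.inl (Sum.inr ν) := withWeakening_lo_ne (A := A.flip)

theorem IsPolarity.of_withSimpleEdge {π : A.withSimpleEdge.E → Polarity}
    (h : A.withSimpleEdge.IsPolarity π) : A.IsPolarity fun ε => π (Sum.inl ε) := by
  intro ν
  have e : π '' A.withSimpleEdge.edgesAt (Sum.inl ν) = (fun ε => π (Sum.inl ε)) '' A.edgesAt ν := by
    ext p
    constructor
    · rintro ⟨ε | ε, hε | hε, rfl⟩
      · exact ⟨ε, .inl (withSimpleEdge_up.2 hε), rfl⟩
      · exact ⟨ε, .inr (withSimpleEdge_lo.2 hε), rfl⟩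
      · cases hε
      · cases hε
    · rintro ⟨ε, hε | hε, rfl⟩
      · exact ⟨Sum.inl ε, .inl (withSimpleEdge_up.1 hε), rfl⟩
      · exact ⟨Sum.inl ε, .inr (withSimpleEdge_lo.1 hε), rfl⟩
  exact (congrArg (Label.Admits (A.label ν)) e).mp (h (Sum.inl ν))

theorem IsPolarity.withWeakening {π : A.E → Polarity} (h : A.IsPolarity π) :
    A.withWeakening.IsPolarity π := by
  rintro (ν | ν)
  · have e : A.withWeakening.edgesAt (Sum.inl ν) = A.edgesAt ν :=
      Set.ext fun ε => or_congr withWeakening_up withWeakening_lo_inl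
    exact (congrArg (fun s => Label.Admits (A.label ν) (π '' s)) e).mpr (h ν)
  · refine ⟨fun h => ?_, fun h => ?_⟩ <;> rcases h with h | h <;> cases h

theorem IsPolarity.withCoweakening {π : A.E → Polarity} (h : A.IsPolarity π) :
    A.withCoweakening.IsPolarity π := by
  have h' := (isPolarity_flip.2 (isPolarity_flip.2 h).withWeakening).comp_iso
    (flipWithWeakening A).symm
  exact h'

end SimpleEdge

end FlowGraph

namespace FlowGraph

variable {I J : Type}

/-- Every simple edge of a flow can be evidenced. -/
theorem IsFlow.exists_withSimpleEdge {B : FlowGraph I J} (hB : B.IsFlow) {ε : B.E}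
    (h : B.IsSimpleEdge ε) :
    ∃ (A : FlowGraph (Option I) (Option J)) (f : A.withSimpleEdge.Iso B),
      f.edge (Sum.inr ()) = ε := by
  classical
  obtain ⟨ν, ν', hu, hν, hl, hν'⟩ := h
  have hne : ν ≠ ν' := fun e => by rw [e, hν'] at hν; cases hν
  let V := {x : B.V // x ≠ ν ∧ x ≠ ν'}
  let E := {e : B.E // e ≠ ε}
  let vert : V ⊕ Bool → B.V := Sum.elim Subtype.val fun b => if b then ν' else ν
  let edge : E ⊕ Unit → B.E := Sum.elim Subtype.val fun _ => ε
  have hvert : vert.Bijective := by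
    constructor
    · rintro (⟨x, hx⟩ | b) (⟨y, hy⟩ | b') e
      · obtain rfl : x = y := e
        rfl
      · cases b'
        · exact (hx.1 e).elim
        · exact (hx.2 e).elim
      · cases b
        · exact (hy.1 e.symm).elim
        · exact (hy.2 e.symm).elim
      · cases b <;> cases b'
        · rfl
        · exact (hne e).elim
        · exact (hne e.symm).elim
        · rfl
    · intro x
      by_cases h : x = ν
      · exact ⟨Sum.inr false, h.symm⟩
      by_cases h' : x = ν'
      · exact ⟨Sum.inr true, h'.symm⟩
      exact ⟨Sum.inl ⟨x, h, h'⟩, rfl⟩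
  have hedge : edge.Bijective := by
    constructor
    · rintro (⟨x, hx⟩ | b) (⟨y, hy⟩ | b') e
      · obtain rfl : x = y := e
        rfl
      · exact (hx e).elim
      · exact (hy e.symm).elim
      · rfl
    · intro x
      by_cases h : x = ε
      · exact ⟨Sum.inr (), h.symm⟩
      exact ⟨Sum.inl ⟨x, h⟩, rfl⟩
  have hup : ∀ e : B.E, ∃ y : V ⊕ Option I, B.up e = Sum.map vert id (simpleEnd false y) := by
    intro e
    rcases h : B.up e with x | i
    · by_cases h₁ : x = ν
      · exact ⟨Sum.inr none, congrArg Sum.inl h₁⟩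
      · have h₂ : x ≠ ν' := fun h₂ => hB.up_ne (by rw [hν']; rfl) e (h.trans (congrArg _ h₂))
        exact ⟨Sum.inl ⟨x, h₁, h₂⟩, rfl⟩
    · exact ⟨Sum.inr (some i), rfl⟩
  have hlo : ∀ e : B.E, ∃ y : V ⊕ Option J, B.lo e = Sum.map vert id (simpleEnd true y) := by
    intro e
    rcases h : B.lo e with x | i
    · by_cases h₁ : x = ν'
      · exact ⟨Sum.inr none, congrArg Sum.inl h₁⟩
      · have h₂ : x ≠ ν := fun h₂ => hB.lo_ne (by rw [hν]; rfl) e (h.trans (congrArg _ h₂))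
        exact ⟨Sum.inl ⟨x, h₂, h₁⟩, rfl⟩
    · exact ⟨Sum.inr (some i), rfl⟩
  -- the rest of the flow, in which the other edges of the two vertices are named `none`
  choose up hup using hup
  choose lo hlo using hlo
  refine ⟨⟨V, E, fun x => B.label x.1, fun e => up e.1, fun e => lo e.1⟩,
    ⟨.ofBijective vert hvert, .ofBijective edge hedge, ?_, ?_, ?_⟩, rfl⟩
  · rintro (x | _ | _)
    · rfl
    · exact hν
    · exact hν'
  · rintro (e | _)
    · exact hup e.1
    · exact hu
  · rintro (e | _)
    · exact hlo e.1
    · exact hl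

/-- The edges on cycles end in vertices that lie on the cycle, hence not in weakenings. -/
theorem EdgeOnCycle.exists_up {A : FlowGraph I J} (hA : A.IsFlow) {π : A.E → Polarity}
    (hπ : A.IsPolarity π) {ε : A.E} (h : A.EdgeOnCycle ε) :
    ∃ ν, A.up ε = Sum.inl ν ∧ ((A.label ν).IsContraction ∨ A.label ν = .aiDown) := by
  have ht := (edgeOnCycle_iff hA hπ).1 h
  rcases e : π ε with _ | _
  · exact up_of_transGen hA ht e
  · obtain ⟨ε', h', -⟩ := exists_prev_of_transGen ht
    rcases h' with ⟨-, -, ν, h₁, h₂⟩ | ⟨-, e', -⟩ | ⟨-, -, ν, h₁, -, h₂⟩ | ⟨-, e', -⟩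
    · exact ⟨ν, h₂, .inl (hA.isContraction h₁ h₂)⟩
    · cases e.symm.trans e'
    · exact ⟨ν, h₂, .inr h₁⟩
    · cases e.symm.trans e'

/-- Dually, the edges on cycles do not end in coweakenings. -/
theorem EdgeOnCycle.exists_lo {A : FlowGraph I J} (hA : A.IsFlow) {π : A.E → Polarity}
    (hπ : A.IsPolarity π) {ε : A.E} (h : A.EdgeOnCycle ε) :
    ∃ ν, A.lo ε = Sum.inl ν ∧ ((A.label ν).IsContraction ∨ A.label ν = .aiUp) := by
  have ht := (edgeOnCycle_iff hA hπ).1 h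
  rcases e : π ε with _ | _
  · exact lo_of_transGen hA ht e
  · obtain ⟨ε', h', -⟩ := exists_next_of_transGen ht
    rcases h' with ⟨-, -, ν, h₁, h₂⟩ | ⟨e', -, -⟩ | ⟨e', -, -⟩ | ⟨-, -, ν, h₁, h₂, -⟩
    · exact ⟨ν, h₁, .inl (hA.isContraction h₁ h₂)⟩
    · cases e.symm.trans e'
    · cases e.symm.trans e'
    · exact ⟨ν, h₂, .inr h₁⟩

section Fragile

theorem isSimpleEdge_iso {A B : FlowGraph I J} (f : A.Iso B) {ε : A.E}
    (h : B.IsSimpleEdge (f.edge ε)) : A.IsSimpleEdge ε := by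
  obtain ⟨ν, ν', h₁, h₂, h₃, h₄⟩ := h
  obtain ⟨ν, rfl⟩ := f.vert.surjective ν
  obtain ⟨ν', rfl⟩ := f.vert.surjective ν'
  exact ⟨ν, ν', f.up_inl.1 h₁, (f.label_vert ν).symm.trans h₂, f.lo_inl.1 h₃,
    (f.label_vert ν').symm.trans h₄⟩

theorem IsAiCycle.map_iso {A B : FlowGraph I J} (f : A.Iso B) {l : List A.E} (h : A.IsAiCycle l) :
    B.IsAiCycle (l.map f.edge) :=
  h.map f.vert f.edge f.edge.injective (fun ν hν => (f.label_vert ν).symm ▸ hν)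
    (fun _ _ => f.up_inl.2) (fun _ _ => f.lo_inl.2)

theorem cycleFree_iso {A B : FlowGraph I J} (f : A.Iso B) (h : A.CycleFree) : B.CycleFree :=
  fun _ hl => h _ (hl.map_iso f.symm)

/-- All ai-cycles are fragile. -/
def AllFragile (A : FlowGraph I J) : Prop := ∀ l, A.IsAiCycle l → ∃ ε ∈ l, A.IsSimpleEdge ε

theorem AllFragile.of_iso {A B : FlowGraph I J} (h : B.AllFragile) (f : A.Iso B) :
    A.AllFragile := by
  intro l hl
  obtain ⟨ε, hε, hs⟩ := h _ (hl.map_iso f)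
  obtain ⟨ε, hε', rfl⟩ := List.mem_map.1 hε
  exact ⟨ε, hε', isSimpleEdge_iso f hs⟩

variable {A : FlowGraph (Option I) (Option J)}

/-- The cycles of a flow in which a simple edge has been broken by a weakening are old cycles. -/
theorem AllFragile.withWeakening (h : A.withSimpleEdge.AllFragile) (hA : A.withWeakening.IsFlow)
    {π : A.withWeakening.E → Polarity} (hπ : A.withWeakening.IsPolarity π) :
    A.withWeakening.AllFragile := by
  intro l hl
  have hl' : A.withSimpleEdge.IsAiCycle (l.map (Sum.inl : A.E → A.E ⊕ Unit)) := by
    refine IsAiCycle.map (A := A.withWeakening) (B := A.withSimpleEdge)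
      (Sum.map id fun _ => false : A.V ⊕ Unit → A.V ⊕ Bool) (Sum.inl : A.E → A.E ⊕ Unit)
      Sum.inl_injective ?_ ?_ ?_ hl
    · rintro (ν | ν) hν
      · exact hν
      · rcases hν with hν | hν <;> cases hν
    · rintro ε (ν | ν) hε <;> exact withSimpleEdge_up.1 (withWeakening_up.1 hε)
    · rintro ε (ν | ν) hε
      · exact withSimpleEdge_lo.1 (withWeakening_lo_inl.1 hε)
      · exact (withWeakening_lo_ne hε).elim
  obtain ⟨ε, hε, ν, ν', h₁, h₂, h₃, h₄⟩ := h _ hl'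
  obtain ⟨ε, hmem, rfl⟩ := List.mem_map.1 hε
  obtain ⟨μ, hμ, hμl⟩ := EdgeOnCycle.exists_up hA hπ ⟨l, hl, hmem⟩
  obtain ⟨μ', hμ', hμl'⟩ := EdgeOnCycle.exists_lo hA hπ ⟨l, hl, hmem⟩
  refine ⟨ε, hmem, μ, μ', hμ, ?_, hμ', ?_⟩
  · rcases μ with μ | μ
    · obtain rfl := Sum.inl_injective ((withSimpleEdge_up.1 (withWeakening_up.1 hμ)).symm.trans h₁)
      exact h₂
    · rcases hμl with (h | h) | h <;> cases h
  · rcases μ' with μ | μ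
    · obtain rfl := Sum.inl_injective
        ((withSimpleEdge_lo.1 (withWeakening_lo_inl.1 hμ')).symm.trans h₃)
      exact h₄
    · exact (withWeakening_lo_ne hμ').elim

/-- The dual of `AllFragile.withWeakening`. -/
theorem AllFragile.withCoweakening (h : A.withSimpleEdge.AllFragile)
    (hA : A.withCoweakening.IsFlow) {π : A.withCoweakening.E → Polarity}
    (hπ : A.withCoweakening.IsPolarity π) : A.withCoweakening.AllFragile := by
  intro l hl
  have hl' : A.withSimpleEdge.IsAiCycle (l.map (Sum.inl : A.E → A.E ⊕ Unit)) := by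
    refine IsAiCycle.map (A := A.withCoweakening) (B := A.withSimpleEdge)
      (Sum.map id fun _ => true : A.V ⊕ Unit → A.V ⊕ Bool) (Sum.inl : A.E → A.E ⊕ Unit)
      Sum.inl_injective ?_ ?_ ?_ hl
    · rintro (ν | ν) hν
      · exact hν
      · rcases hν with hν | hν <;> cases hν
    · rintro ε (ν | ν) hε
      · exact withSimpleEdge_up.1 (withCoweakening_up_inl.1 hε)
      · exact (withCoweakening_up_ne hε).elim
    · rintro ε (ν | ν) hε <;> exact withSimpleEdge_lo.1 (withCoweakening_lo.1 hε)
  obtain ⟨ε, hε, ν, ν', h₁, h₂, h₃, h₄⟩ := h _ hl'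
  obtain ⟨ε, hmem, rfl⟩ := List.mem_map.1 hε
  obtain ⟨μ, hμ, hμl⟩ := EdgeOnCycle.exists_up hA hπ ⟨l, hl, hmem⟩
  obtain ⟨μ', hμ', hμl'⟩ := EdgeOnCycle.exists_lo hA hπ ⟨l, hl, hmem⟩
  refine ⟨ε, hmem, μ, μ', hμ, ?_, hμ', ?_⟩
  · rcases μ with μ | μ
    · obtain rfl := Sum.inl_injective
        ((withSimpleEdge_up.1 (withCoweakening_up_inl.1 hμ)).symm.trans h₁)
      exact h₂
    · exact (withCoweakening_up_ne hμ).elim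
  · rcases μ' with μ | μ
    · obtain rfl := Sum.inl_injective
        ((withSimpleEdge_lo.1 (withCoweakening_lo.1 hμ')).symm.trans h₃)
      exact h₄
    · rcases hμl' with (h | h) | h <;> cases h

end Fragile

end FlowGraph

/-! ### Composition of the two flows without the simple edge -/

namespace AtomicFlow

variable {I J : Type} (D₁ : AtomicFlow I (Option J)) (D₂ : AtomicFlow (Option I) J)

/-- The edges of the upper flow as edges of the composition. -/
def stackUpper (ε : D₁.E) : (D₁.stack D₂).E := (Sum.inl (Sum.inl ε) :
  (D₁.E ⊕ {ε : D₂.E // D₂.up ε ≠ Sum.inr none}) ⊕ (I ⊕ J))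

open Classical in
/-- The edges of the lower flow as edges of the composition: the upper edge `none` is identified
with the lower edge `none` of the upper flow. -/
noncomputable def stackLower (ε : D₂.E) : (D₁.stack D₂).E :=
  if h : D₂.up ε = Sum.inr none then stackUpper D₁ D₂ (D₁.lower_named none).choose
  else (Sum.inl (Sum.inr ⟨ε, h⟩) : (D₁.E ⊕ {ε : D₂.E // D₂.up ε ≠ Sum.inr none}) ⊕ (I ⊕ J))

/-- The new upper and lower edges of the composition. -/
def stackNew (n : I ⊕ J) : (D₁.stack D₂).E :=
  (Sum.inr n : (D₁.E ⊕ {ε : D₂.E // D₂.up ε ≠ Sum.inr none}) ⊕ (I ⊕ J))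

variable {D₁ D₂}

theorem stackLower_of_up {ε : D₂.E} {ε' : D₁.E} (h : D₂.up ε = Sum.inr none)
    (h' : D₁.lo ε' = Sum.inr none) : stackLower D₁ D₂ ε = stackUpper D₁ D₂ ε' := by
  exact (dif_pos h).trans (congrArg _
    ((D₁.lower_named none).unique (D₁.lower_named none).choose_spec.1 h'))

theorem stackLower_of_ne {ε : D₂.E} (h : D₂.up ε ≠ Sum.inr none) :
    stackLower D₁ D₂ ε = Sum.inl (Sum.inr ⟨ε, h⟩) := dif_neg h

theorem stackUpper_injective : Function.Injective (stackUpper D₁ D₂) := fun _ _ h =>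
  Sum.inl_injective (Sum.inl_injective h)

theorem eq_of_stackLower_eq_stackUpper {ε : D₂.E} {ε' : D₁.E}
    (h : stackLower D₁ D₂ ε = stackUpper D₁ D₂ ε') :
    D₂.up ε = Sum.inr none ∧ D₁.lo ε' = Sum.inr none := by
  by_cases hε : D₂.up ε = Sum.inr none
  · obtain ⟨ε₀, h₀, -⟩ := D₁.lower_named none
    rw [stackLower_of_up hε h₀] at h
    exact ⟨hε, stackUpper_injective h ▸ h₀⟩
  · rw [stackLower_of_ne hε] at h
    cases Sum.inl_injective h

theorem stackLower_injective : Function.Injective (stackLower D₁ D₂) := by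
  obtain ⟨ε₀, h₀, -⟩ := D₁.lower_named none
  intro a b h
  by_cases hb : D₂.up b = Sum.inr none
  · rw [stackLower_of_up hb h₀] at h
    exact (D₂.upper_named none).unique (eq_of_stackLower_eq_stackUpper h).1 hb
  · by_cases ha : D₂.up a = Sum.inr none
    · rw [stackLower_of_up ha h₀] at h
      exact (D₂.upper_named none).unique ha (eq_of_stackLower_eq_stackUpper h.symm).1
    · rw [stackLower_of_ne ha, stackLower_of_ne hb] at h
      exact congrArg Subtype.val (Sum.inr_injective (Sum.inl_injective h))

/-- The upper ends of the edges of the composition. -/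
theorem stack_up_cases (x : (D₁.stack D₂).E) :
    (∃ ε ν, x = stackUpper D₁ D₂ ε ∧ D₁.up ε = Sum.inl ν ∧
      (D₁.stack D₂).up x = Sum.inl (Sum.inl (Sum.inl ν))) ∨
    (∃ ε i, x = stackUpper D₁ D₂ ε ∧ D₁.up ε = Sum.inr i ∧
      (D₁.stack D₂).up x = Sum.inl (Sum.inr (Sum.inl i))) ∨
    (∃ ε ν, x = stackLower D₁ D₂ ε ∧ D₂.up ε = Sum.inl ν ∧
      (D₁.stack D₂).up x = Sum.inl (Sum.inl (Sum.inr ν))) ∨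
    (∃ ε i, x = stackLower D₁ D₂ ε ∧ D₂.up ε = Sum.inr (some i) ∧
      (D₁.stack D₂).up x = Sum.inl (Sum.inr (Sum.inl i))) ∨
    (∃ i, x = stackNew D₁ D₂ (Sum.inl i) ∧ (D₁.stack D₂).up x = Sum.inr i) ∨
    (∃ j, x = stackNew D₁ D₂ (Sum.inr j) ∧
      (D₁.stack D₂).up x = Sum.inl (Sum.inr (Sum.inr j))) := by
  obtain (ε | ⟨ε, hε⟩) | (i | j) := x
  · rcases h : D₁.up ε with ν | i
    · exact .inl ⟨ε, ν, rfl, h, by simp only [stack, h]⟩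
    · exact .inr (.inl ⟨ε, i, rfl, h, by simp only [stack, h]⟩)
  · rcases h : D₂.up ε with ν | _ | i
    · refine .inr (.inr (.inl ⟨ε, ν, (stackLower_of_ne hε).symm, h, ?_⟩))
      simp only [stack]
      split <;> simp_all
    · exact (hε h).elim
    · refine .inr (.inr (.inr (.inl ⟨ε, i, (stackLower_of_ne hε).symm, h, ?_⟩)))
      simp only [stack]
      split <;> simp_all
  · exact .inr (.inr (.inr (.inr (.inl ⟨i, rfl, rfl⟩))))
  · exact .inr (.inr (.inr (.inr (.inr ⟨j, rfl, rfl⟩))))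

/-- The lower ends of the edges of the composition. -/
theorem stack_lo_cases (x : (D₁.stack D₂).E) :
    (∃ ε ν, x = stackUpper D₁ D₂ ε ∧ D₁.lo ε = Sum.inl ν ∧
      (D₁.stack D₂).lo x = Sum.inl (Sum.inl (Sum.inl ν))) ∨
    (∃ ε j, x = stackUpper D₁ D₂ ε ∧ D₁.lo ε = Sum.inr (some j) ∧
      (D₁.stack D₂).lo x = Sum.inl (Sum.inr (Sum.inr j))) ∨
    (∃ ε ν, x = stackLower D₁ D₂ ε ∧ D₂.lo ε = Sum.inl ν ∧
      (D₁.stack D₂).lo x = Sum.inl (Sum.inl (Sum.inr ν))) ∨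
    (∃ ε j, x = stackLower D₁ D₂ ε ∧ D₂.lo ε = Sum.inr j ∧
      (D₁.stack D₂).lo x = Sum.inl (Sum.inr (Sum.inr j))) ∨
    (∃ i, x = stackNew D₁ D₂ (Sum.inl i) ∧
      (D₁.stack D₂).lo x = Sum.inl (Sum.inr (Sum.inl i))) ∨
    (∃ j, x = stackNew D₁ D₂ (Sum.inr j) ∧ (D₁.stack D₂).lo x = Sum.inr j) := by
  obtain (ε | ⟨ε, hε⟩) | (i | j) := x
  · rcases h : D₁.lo ε with ν | _ | j
    · exact .inl ⟨ε, ν, rfl, h, by simp only [stack, h]⟩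
    · have h' := stackLower_of_up (D₂.upper_named none).choose_spec.1 h
      rcases h₂ : D₂.lo (D₂.upperEdge none) with ν | j
      · exact .inr (.inr (.inl ⟨_, ν, h'.symm, h₂, by simp only [stack, h, h₂]⟩))
      · exact .inr (.inr (.inr (.inl ⟨_, j, h'.symm, h₂, by simp only [stack, h, h₂]⟩)))
    · exact .inr (.inl ⟨ε, j, rfl, h, by simp only [stack, h]⟩)
  · rcases h : D₂.lo ε with ν | j
    · exact .inr (.inr (.inl ⟨ε, ν, (stackLower_of_ne hε).symm, h, by simp only [stack, h]⟩))
    · exact .inr (.inr (.inr (.inl ⟨ε, j, (stackLower_of_ne hε).symm, h, by simp only [stack, h]⟩)))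
  · exact .inr (.inr (.inr (.inr (.inl ⟨i, rfl, rfl⟩))))
  · exact .inr (.inr (.inr (.inr (.inr ⟨j, rfl, rfl⟩))))

theorem stack_up_upper {x : (D₁.stack D₂).E} {ν : D₁.V} :
    (D₁.stack D₂).up x = Sum.inl (Sum.inl (Sum.inl ν)) ↔
      x ∈ stackUpper D₁ D₂ '' D₁.lowerEdges ν := by
  constructor
  · intro h
    rcases stack_up_cases x with ⟨ε, μ, rfl, h₁, h₂⟩ | ⟨ε, i, rfl, h₁, h₂⟩ | ⟨ε, μ, rfl, h₁, h₂⟩ |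
      ⟨ε, i, rfl, h₁, h₂⟩ | ⟨i, rfl, h₂⟩ | ⟨i, rfl, h₂⟩ <;> cases h₂.symm.trans h
    exact ⟨ε, h₁, rfl⟩
  · rintro ⟨ε, h, rfl⟩
    change D₁.up ε = _ at h
    simp only [stack, stackUpper, h]

theorem stack_up_lower {x : (D₁.stack D₂).E} {ν : D₂.V} :
    (D₁.stack D₂).up x = Sum.inl (Sum.inl (Sum.inr ν)) ↔
      x ∈ stackLower D₁ D₂ '' D₂.lowerEdges ν := by
  constructor
  · intro h
    rcases stack_up_cases x with ⟨ε, μ, rfl, h₁, h₂⟩ | ⟨ε, i, rfl, h₁, h₂⟩ | ⟨ε, μ, rfl, h₁, h₂⟩ |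
      ⟨ε, i, rfl, h₁, h₂⟩ | ⟨i, rfl, h₂⟩ | ⟨i, rfl, h₂⟩ <;> cases h₂.symm.trans h
    exact ⟨ε, h₁, rfl⟩
  · rintro ⟨ε, h, rfl⟩
    change D₂.up ε = _ at h
    have hne : D₂.up ε ≠ Sum.inr none := by rw [h]; nofun
    rw [stackLower_of_ne hne]
    simp only [stack]
    split <;> simp_all

theorem stack_up_new {x : (D₁.stack D₂).E} {i : I} {ε₁ : D₁.E} {ε₂ : D₂.E}
    (h₁ : D₁.up ε₁ = Sum.inr i) (h₂ : D₂.up ε₂ = Sum.inr (some i)) :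
    (D₁.stack D₂).up x = Sum.inl (Sum.inr (Sum.inl i)) ↔
      x = stackUpper D₁ D₂ ε₁ ∨ x = stackLower D₁ D₂ ε₂ := by
  constructor
  · intro h
    rcases stack_up_cases x with ⟨ε, μ, rfl, h₃, h₄⟩ | ⟨ε, i, rfl, h₃, h₄⟩ | ⟨ε, μ, rfl, h₃, h₄⟩ |
      ⟨ε, i, rfl, h₃, h₄⟩ | ⟨i, rfl, h₄⟩ | ⟨i, rfl, h₄⟩ <;> cases h₄.symm.trans h
    · exact .inl (congrArg _ ((D₁.upper_named _).unique h₃ h₁))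
    · exact .inr (congrArg _ ((D₂.upper_named _).unique h₃ h₂))
  · rintro (rfl | rfl)
    · simp only [stack, stackUpper, h₁]
    · have hne : D₂.up ε₂ ≠ Sum.inr none := by rw [h₂]; nofun
      rw [stackLower_of_ne hne]
      simp only [stack]
      split <;> simp_all

theorem stack_up_new' {x : (D₁.stack D₂).E} {j : J} :
    (D₁.stack D₂).up x = Sum.inl (Sum.inr (Sum.inr j)) ↔ x = stackNew D₁ D₂ (Sum.inr j) := by
  constructor
  · intro h
    rcases stack_up_cases x with ⟨ε, μ, rfl, h₁, h₂⟩ | ⟨ε, i, rfl, h₁, h₂⟩ | ⟨ε, μ, rfl, h₁, h₂⟩ |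
      ⟨ε, i, rfl, h₁, h₂⟩ | ⟨i, rfl, h₂⟩ | ⟨i, rfl, h₂⟩ <;> cases h₂.symm.trans h
    rfl
  · rintro rfl
    rfl

theorem stack_up_named {x : (D₁.stack D₂).E} {i : I} :
    (D₁.stack D₂).up x = Sum.inr i ↔ x = stackNew D₁ D₂ (Sum.inl i) := by
  constructor
  · intro h
    rcases stack_up_cases x with ⟨ε, μ, rfl, h₁, h₂⟩ | ⟨ε, i, rfl, h₁, h₂⟩ | ⟨ε, μ, rfl, h₁, h₂⟩ |
      ⟨ε, i, rfl, h₁, h₂⟩ | ⟨i, rfl, h₂⟩ | ⟨i, rfl, h₂⟩ <;> cases h₂.symm.trans h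
    rfl
  · rintro rfl
    rfl

theorem stack_lo_upper {x : (D₁.stack D₂).E} {ν : D₁.V} :
    (D₁.stack D₂).lo x = Sum.inl (Sum.inl (Sum.inl ν)) ↔
      x ∈ stackUpper D₁ D₂ '' D₁.upperEdges ν := by
  constructor
  · intro h
    rcases stack_lo_cases x with ⟨ε, μ, rfl, h₁, h₂⟩ | ⟨ε, i, rfl, h₁, h₂⟩ | ⟨ε, μ, rfl, h₁, h₂⟩ |
      ⟨ε, i, rfl, h₁, h₂⟩ | ⟨i, rfl, h₂⟩ | ⟨i, rfl, h₂⟩ <;> cases h₂.symm.trans h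
    exact ⟨ε, h₁, rfl⟩
  · rintro ⟨ε, h, rfl⟩
    change D₁.lo ε = _ at h
    simp only [stack, stackUpper, h]

theorem stack_lo_stackLower (ε : D₂.E) : (D₁.stack D₂).lo (stackLower D₁ D₂ ε) =
    Sum.elim (fun ν => Sum.inl (Sum.inl (Sum.inr ν))) (fun j => Sum.inl (Sum.inr (Sum.inr j)))
      (D₂.lo ε) := by
  by_cases hε : D₂.up ε = Sum.inr none
  · obtain ⟨ε₀, h₀, -⟩ := D₁.lower_named none
    have e : D₂.upperEdge none = ε :=
      (D₂.upper_named none).unique (D₂.upper_named none).choose_spec.1 hε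
    rw [stackLower_of_up hε h₀, ← e]
    rcases h : D₂.lo (D₂.upperEdge none) with ν | j <;> simp only [stack, stackUpper, h₀, h] <;> rfl
  · rw [stackLower_of_ne hε]
    rcases h : D₂.lo ε with ν | j <;> simp only [stack, h] <;> rfl

theorem stack_lo_lower {x : (D₁.stack D₂).E} {ν : D₂.V} :
    (D₁.stack D₂).lo x = Sum.inl (Sum.inl (Sum.inr ν)) ↔
      x ∈ stackLower D₁ D₂ '' D₂.upperEdges ν := by
  constructor
  · intro h
    rcases stack_lo_cases x with ⟨ε, μ, rfl, h₁, h₂⟩ | ⟨ε, i, rfl, h₁, h₂⟩ | ⟨ε, μ, rfl, h₁, h₂⟩ |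
      ⟨ε, i, rfl, h₁, h₂⟩ | ⟨i, rfl, h₂⟩ | ⟨i, rfl, h₂⟩ <;> cases h₂.symm.trans h
    exact ⟨ε, h₁, rfl⟩
  · rintro ⟨ε, h, rfl⟩
    exact (stack_lo_stackLower ε).trans (congrArg _ h)

theorem stack_lo_new {x : (D₁.stack D₂).E} {j : J} {ε₁ : D₁.E} {ε₂ : D₂.E}
    (h₁ : D₁.lo ε₁ = Sum.inr (some j)) (h₂ : D₂.lo ε₂ = Sum.inr j) :
    (D₁.stack D₂).lo x = Sum.inl (Sum.inr (Sum.inr j)) ↔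
      x = stackUpper D₁ D₂ ε₁ ∨ x = stackLower D₁ D₂ ε₂ := by
  constructor
  · intro h
    rcases stack_lo_cases x with ⟨ε, μ, rfl, h₃, h₄⟩ | ⟨ε, i, rfl, h₃, h₄⟩ | ⟨ε, μ, rfl, h₃, h₄⟩ |
      ⟨ε, i, rfl, h₃, h₄⟩ | ⟨i, rfl, h₄⟩ | ⟨i, rfl, h₄⟩ <;> cases h₄.symm.trans h
    · exact .inl (congrArg _ ((D₁.lower_named _).unique h₃ h₁))
    · exact .inr (congrArg _ ((D₂.lower_named _).unique h₃ h₂))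
  · rintro (rfl | rfl)
    · simp only [stack, stackUpper, h₁]
    · exact (stack_lo_stackLower _).trans (congrArg _ h₂)

theorem stack_lo_new' {x : (D₁.stack D₂).E} {i : I} :
    (D₁.stack D₂).lo x = Sum.inl (Sum.inr (Sum.inl i)) ↔ x = stackNew D₁ D₂ (Sum.inl i) := by
  constructor
  · intro h
    rcases stack_lo_cases x with ⟨ε, μ, rfl, h₁, h₂⟩ | ⟨ε, i, rfl, h₁, h₂⟩ | ⟨ε, μ, rfl, h₁, h₂⟩ |
      ⟨ε, i, rfl, h₁, h₂⟩ | ⟨i, rfl, h₂⟩ | ⟨i, rfl, h₂⟩ <;> cases h₂.symm.trans h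
    rfl
  · rintro rfl
    rfl

theorem stack_lo_named {x : (D₁.stack D₂).E} {j : J} :
    (D₁.stack D₂).lo x = Sum.inr j ↔ x = stackNew D₁ D₂ (Sum.inr j) := by
  constructor
  · intro h
    rcases stack_lo_cases x with ⟨ε, μ, rfl, h₁, h₂⟩ | ⟨ε, i, rfl, h₁, h₂⟩ | ⟨ε, μ, rfl, h₁, h₂⟩ |
      ⟨ε, i, rfl, h₁, h₂⟩ | ⟨i, rfl, h₂⟩ | ⟨i, rfl, h₂⟩ <;> cases h₂.symm.trans h
    rfl
  · rintro rfl
    rfl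

/-- The values of `f` on the new edges, of `f₁` on the upper flow and of `f₂` on the lower flow. -/
noncomputable def stackFun {α : Type*} (f₁ : D₁.E → α) (f₂ : D₂.E → α) (f : I ⊕ J → α) :
    (D₁.stack D₂).E → α :=
  Sum.elim (Sum.elim f₁ fun ε => f₂ ε.1) f

theorem stackFun_stackLower {α : Type*} {f₁ : D₁.E → α} {f₂ : D₂.E → α} {f : I ⊕ J → α}
    (h : ∀ ε₁ ε₂, D₁.lo ε₁ = Sum.inr none → D₂.up ε₂ = Sum.inr none → f₁ ε₁ = f₂ ε₂) (ε : D₂.E) :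
    stackFun f₁ f₂ f (stackLower D₁ D₂ ε) = f₂ ε := by
  by_cases hε : D₂.up ε = Sum.inr none
  · obtain ⟨ε₀, h₀, -⟩ := D₁.lower_named none
    rw [stackLower_of_up hε h₀]
    exact h _ _ h₀ hε
  · rw [stackLower_of_ne hε]
    rfl

theorem stack_finite [Finite I] [Finite J] : Finite (D₁.stack D₂).V ∧ Finite (D₁.stack D₂).E := by
  have := D₁.finite_V
  have := D₂.finite_V
  have := D₁.finite_E
  have := D₂.finite_E
  exact ⟨inferInstanceAs (Finite ((D₁.V ⊕ D₂.V) ⊕ (I ⊕ J))), inferInstanceAs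
    (Finite ((D₁.E ⊕ {ε : D₂.E // D₂.up ε ≠ Sum.inr none}) ⊕ (I ⊕ J)))⟩

end AtomicFlow

namespace AtomicFlow

variable {I J : Type} {D₁ : AtomicFlow I (Option J)} {D₂ : AtomicFlow (Option I) J}

/-- Since the two flows share only one edge, rank functions for them can be shifted so that they
agree on it, and the new edges can be put first or last. -/
theorem exists_stack_rank (r₁ : D₁.E → ℕ) (r₂ : D₂.E → ℕ) (f : I ⊕ J → WithBot (WithTop ℤ)) :
    ∃ r : (D₁.stack D₂).E → WithBot (WithTop ℤ),
      (∀ a b, r₁ a < r₁ b → r (stackUpper D₁ D₂ a) < r (stackUpper D₁ D₂ b)) ∧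
      (∀ a b, r₂ a < r₂ b → r (stackLower D₁ D₂ a) < r (stackLower D₁ D₂ b)) ∧
      (∀ n, r (stackNew D₁ D₂ n) = f n) ∧
      (∀ a, ⊥ < r (stackUpper D₁ D₂ a) ∧ r (stackUpper D₁ D₂ a) < ⊤) ∧
      (∀ a, ⊥ < r (stackLower D₁ D₂ a) ∧ r (stackLower D₁ D₂ a) < ⊤) := by
  obtain ⟨c₁, h₁, h₁'⟩ := D₁.lower_named none
  obtain ⟨c₂, h₂, h₂'⟩ := D₂.upper_named none
  let g : ℤ → WithBot (WithTop ℤ) := fun z => ((z : WithTop ℤ) : WithBot (WithTop ℤ))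
  have hg : ∀ z, ⊥ < g z ∧ g z < ⊤ := fun z =>
    ⟨WithBot.bot_lt_coe _, WithBot.coe_lt_coe.2 (WithTop.coe_lt_top _)⟩
  have hg' : ∀ {y z}, y < z → g y < g z := fun h =>
    WithBot.coe_lt_coe.2 (WithTop.coe_lt_coe.2 h)
  have e : ∀ ε, stackFun (D₁ := D₁) (fun ε => g (r₁ ε - r₁ c₁)) (fun ε => g (r₂ ε - r₂ c₂)) f
      (stackLower D₁ D₂ ε) = g (r₂ ε - r₂ c₂) := by
    refine stackFun_stackLower fun a b ha hb => ?_
    rw [h₁' a ha, h₂' b hb, sub_self, sub_self]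
  refine ⟨stackFun (fun ε => g (r₁ ε - r₁ c₁)) (fun ε => g (r₂ ε - r₂ c₂)) f, fun a b h => ?_,
    fun a b h => ?_, fun n => rfl, fun a => hg _, fun a => ?_⟩
  · exact hg' (by omega)
  · rw [e, e]
    exact hg' (by omega)
  · rw [e]
    exact hg _

/-- At a new vertex, one of the edges is new and the other ones are not. -/
theorem stack_below_new {n : I ⊕ J} {a b : (D₁.stack D₂).E}
    (ha : (D₁.stack D₂).lo a = Sum.inl (Sum.inr n))
    (hb : (D₁.stack D₂).up b = Sum.inl (Sum.inr n)) :
    (∃ i, a = stackNew D₁ D₂ (Sum.inl i) ∧ ((∃ ε, b = stackUpper D₁ D₂ ε) ∨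
      ∃ ε, b = stackLower D₁ D₂ ε)) ∨
    ∃ j, b = stackNew D₁ D₂ (Sum.inr j) ∧ ((∃ ε, a = stackUpper D₁ D₂ ε) ∨
      ∃ ε, a = stackLower D₁ D₂ ε) := by
  rcases n with i | j
  · obtain ⟨ε₁, h₁, -⟩ := D₁.upper_named i
    obtain ⟨ε₂, h₂, -⟩ := D₂.upper_named (some i)
    exact .inl ⟨i, stack_lo_new'.1 ha, ((stack_up_new h₁ h₂).1 hb).imp (⟨_, ·⟩) (⟨_, ·⟩)⟩
  · obtain ⟨ε₁, h₁, -⟩ := D₁.lower_named (some j)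
    obtain ⟨ε₂, h₂, -⟩ := D₂.lower_named j
    exact .inr ⟨j, stack_up_new'.1 hb, ((stack_lo_new h₁ h₂).1 ha).imp (⟨_, ·⟩) (⟨_, ·⟩)⟩

/-- The new upper edges get the lowest rank and the new lower edges the highest one. -/
theorem stack_acyclic (x : (D₁.stack D₂).E) : ¬ Relation.TransGen (D₁.stack D₂).Below x x := by
  obtain ⟨r₁, hr₁⟩ := D₁.isFlow.exists_rank
  obtain ⟨r₂, hr₂⟩ := D₂.isFlow.exists_rank
  obtain ⟨r, h₁, h₂, hn, hb₁, hb₂⟩ := exists_stack_rank (D₁ := D₁) (D₂ := D₂) r₁ r₂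
    (Sum.elim (fun _ => ⊥) (fun _ => ⊤))
  refine not_transGen_self r ?_ x
  rintro a b ⟨(ν | ν) | n, ha, hb⟩
  · obtain ⟨a, ha', rfl⟩ := stack_lo_upper.1 ha
    obtain ⟨b, hb', rfl⟩ := stack_up_upper.1 hb
    exact h₁ _ _ (hr₁ _ _ ⟨ν, ha', hb'⟩)
  · obtain ⟨a, ha', rfl⟩ := stack_lo_lower.1 ha
    obtain ⟨b, hb', rfl⟩ := stack_up_lower.1 hb
    exact h₂ _ _ (hr₂ _ _ ⟨ν, ha', hb'⟩)
  · rcases stack_below_new ha hb with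
      ⟨i, rfl, ⟨ε, rfl⟩ | ⟨ε, rfl⟩⟩ | ⟨i, rfl, ⟨ε, rfl⟩ | ⟨ε, rfl⟩⟩ <;>
      rw [hn]
    exacts [(hb₁ _).1, (hb₂ _).1, (hb₁ _).2, (hb₂ _).2]

theorem isFlow_stack [Finite I] [Finite J] : (D₁.stack D₂).IsFlow := by
  obtain ⟨hV, hE⟩ := stack_finite (D₁ := D₁) (D₂ := D₂)
  have pair : ∀ ε₁ ε₂, D₂.up ε₂ ≠ Sum.inr none ∨ D₁.lo ε₁ ≠ Sum.inr none →
      stackUpper D₁ D₂ ε₁ ≠ stackLower D₁ D₂ ε₂ := by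
    intro ε₁ ε₂ h e
    obtain ⟨h₁, h₂⟩ := eq_of_stackLower_eq_stackUpper e.symm
    exact h.elim (fun h => h h₁) fun h => h h₂
  refine .of_ncard hV hE ?_ ?_ stack_acyclic
  · rintro (((ν | ν) | (i | j)) | i)
    · exact (congrArg Set.ncard (Set.ext fun x => stack_up_upper)).trans
        ((Set.ncard_image_of_injective _ stackUpper_injective).trans (D₁.card_lower ν))
    · exact (congrArg Set.ncard (Set.ext fun x => stack_up_lower)).trans
        ((Set.ncard_image_of_injective _ stackLower_injective).trans (D₂.card_lower ν))
    · obtain ⟨ε₁, h₁, -⟩ := D₁.upper_named i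
      obtain ⟨ε₂, h₂, -⟩ := D₂.upper_named (some i)
      exact (congrArg Set.ncard (Set.ext fun x => stack_up_new h₁ h₂)).trans
        (Set.ncard_pair (pair _ _ (.inl (by rw [h₂]; nofun))))
    · exact (congrArg Set.ncard (Set.ext fun x => stack_up_new')).trans (Set.ncard_singleton _)
    · exact (congrArg Set.ncard (Set.ext fun x => stack_up_named)).trans (Set.ncard_singleton _)
  · rintro (((ν | ν) | (i | j)) | i)
    · exact (congrArg Set.ncard (Set.ext fun x => stack_lo_upper)).trans
        ((Set.ncard_image_of_injective _ stackUpper_injective).trans (D₁.card_upper ν))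
    · exact (congrArg Set.ncard (Set.ext fun x => stack_lo_lower)).trans
        ((Set.ncard_image_of_injective _ stackLower_injective).trans (D₂.card_upper ν))
    · exact (congrArg Set.ncard (Set.ext fun x => stack_lo_new')).trans (Set.ncard_singleton _)
    · obtain ⟨ε₁, h₁, -⟩ := D₁.lower_named (some j)
      obtain ⟨ε₂, h₂, -⟩ := D₂.lower_named j
      exact (congrArg Set.ncard (Set.ext fun x => stack_lo_new h₁ h₂)).trans
        (Set.ncard_pair (pair _ _ (.inr (by rw [h₁]; nofun))))
    · exact (congrArg Set.ncard (Set.ext fun x => stack_lo_named)).trans (Set.ncard_singleton _)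

theorem stack_edgesAt_upper (ν : D₁.V) :
    (D₁.stack D₂).edgesAt (Sum.inl (Sum.inl ν)) = stackUpper D₁ D₂ '' D₁.edgesAt ν :=
  (Set.ext fun _ => or_congr stack_up_upper stack_lo_upper).trans (Set.image_union _ _ _).symm

theorem stack_edgesAt_lower (ν : D₂.V) :
    (D₁.stack D₂).edgesAt (Sum.inl (Sum.inr ν)) = stackLower D₁ D₂ '' D₂.edgesAt ν :=
  (Set.ext fun _ => or_congr stack_up_lower stack_lo_lower).trans (Set.image_union _ _ _).symm

theorem isPolarity_stackUpper {π : (D₁.stack D₂).E → Polarity} (h : (D₁.stack D₂).IsPolarity π) :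
    D₁.IsPolarity fun ε => π (stackUpper D₁ D₂ ε) := by
  intro ν
  have e : π '' (D₁.stack D₂).edgesAt (Sum.inl (Sum.inl ν)) =
      (fun ε => π (stackUpper D₁ D₂ ε)) '' D₁.edgesAt ν := by
    rw [stack_edgesAt_upper, Set.image_image]
  exact e ▸ h (Sum.inl (Sum.inl ν))

theorem isPolarity_stackLower {π : (D₁.stack D₂).E → Polarity} (h : (D₁.stack D₂).IsPolarity π) :
    D₂.IsPolarity fun ε => π (stackLower D₁ D₂ ε) := by
  intro ν
  have e : π '' (D₁.stack D₂).edgesAt (Sum.inl (Sum.inr ν)) =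
      (fun ε => π (stackLower D₁ D₂ ε)) '' D₂.edgesAt ν := by
    rw [stack_edgesAt_lower, Set.image_image]
  exact e ▸ h (Sum.inl (Sum.inr ν))

/-- An ai-cycle of the composition cannot use the new edges, and it cannot pass from one of the two
flows to the other and back again, because they share only one edge. -/
theorem stack_cycleFree (hS : (D₁.stack D₂).IsFlow) {π : (D₁.stack D₂).E → Polarity}
    (hπ : (D₁.stack D₂).IsPolarity π) (h₁ : D₁.CycleFree) (h₂ : D₂.CycleFree) :
    (D₁.stack D₂).CycleFree := by
  have := D₁.finite_E
  have := D₂.finite_E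
  -- ranks along directed walks in the two flows
  obtain ⟨r₁, hr₁⟩ := exists_rank
    ((cycleFree_iff D₁.isFlow (isPolarity_stackUpper hπ)).1 h₁)
  obtain ⟨r₂, hr₂⟩ := exists_rank
    ((cycleFree_iff D₂.isFlow (isPolarity_stackLower hπ)).1 h₂)
  obtain ⟨r, h₁, h₂, hn, hb₁, hb₂⟩ := exists_stack_rank (D₁ := D₁) (D₂ := D₂) r₁ r₂
    -- a new edge comes first or last in the order of traversal
    (Sum.elim (fun i => match π (stackNew D₁ D₂ (Sum.inl i)) with | .pos => ⊥ | .neg => ⊤)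
      (fun j => match π (stackNew D₁ D₂ (Sum.inr j)) with | .pos => ⊤ | .neg => ⊥))
  refine (cycleFree_iff hS hπ).2 (not_transGen_self r ?_)
  rintro a b (⟨pa, pb, (ν | ν) | n, ha, hb⟩ | ⟨pa, pb, (ν | ν) | n, ha, hb⟩ |
    ⟨pa, pb, (ν | ν) | (n | n), hl, ha, hb⟩ | ⟨pa, pb, (ν | ν) | (n | n), hl, ha, hb⟩)
  · obtain ⟨a, ha', rfl⟩ := stack_lo_upper.1 ha
    obtain ⟨b, hb', rfl⟩ := stack_up_upper.1 hb
    exact h₁ _ _ (hr₁ _ _ (.inl ⟨pa, pb, ν, ha', hb'⟩))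
  · obtain ⟨a, ha', rfl⟩ := stack_lo_lower.1 ha
    obtain ⟨b, hb', rfl⟩ := stack_up_lower.1 hb
    exact h₂ _ _ (hr₂ _ _ (.inl ⟨pa, pb, ν, ha', hb'⟩))
  · rcases stack_below_new ha hb with
      ⟨i, rfl, ⟨ε, rfl⟩ | ⟨ε, rfl⟩⟩ | ⟨i, rfl, ⟨ε, rfl⟩ | ⟨ε, rfl⟩⟩ <;>
      simp only [hn, Sum.elim_inl, Sum.elim_inr, pa, pb]
    exacts [(hb₁ _).1, (hb₂ _).1, (hb₁ _).2, (hb₂ _).2]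
  · obtain ⟨b, ha', rfl⟩ := stack_lo_upper.1 ha
    obtain ⟨a, hb', rfl⟩ := stack_up_upper.1 hb
    exact h₁ _ _ (hr₁ _ _ (.inr (.inl ⟨pa, pb, ν, ha', hb'⟩)))
  · obtain ⟨b, ha', rfl⟩ := stack_lo_lower.1 ha
    obtain ⟨a, hb', rfl⟩ := stack_up_lower.1 hb
    exact h₂ _ _ (hr₂ _ _ (.inr (.inl ⟨pa, pb, ν, ha', hb'⟩)))
  · rcases stack_below_new ha hb with
      ⟨i, rfl, ⟨ε, rfl⟩ | ⟨ε, rfl⟩⟩ | ⟨i, rfl, ⟨ε, rfl⟩ | ⟨ε, rfl⟩⟩ <;>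
      simp only [hn, Sum.elim_inl, Sum.elim_inr, pa, pb]
    exacts [(hb₁ _).2, (hb₂ _).2, (hb₁ _).1, (hb₂ _).1]
  · obtain ⟨a, ha', rfl⟩ := stack_up_upper.1 ha
    obtain ⟨b, hb', rfl⟩ := stack_up_upper.1 hb
    exact h₁ _ _ (hr₁ _ _ (.inr (.inr (.inl ⟨pa, pb, ν, hl, ha', hb'⟩))))
  · obtain ⟨a, ha', rfl⟩ := stack_up_lower.1 ha
    obtain ⟨b, hb', rfl⟩ := stack_up_lower.1 hb
    exact h₂ _ _ (hr₂ _ _ (.inr (.inr (.inl ⟨pa, pb, ν, hl, ha', hb'⟩))))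
  · cases hl
  · cases hl
  · obtain ⟨a, ha', rfl⟩ := stack_lo_upper.1 ha
    obtain ⟨b, hb', rfl⟩ := stack_lo_upper.1 hb
    exact h₁ _ _ (hr₁ _ _ (.inr (.inr (.inr ⟨pa, pb, ν, hl, ha', hb'⟩))))
  · obtain ⟨a, ha', rfl⟩ := stack_lo_lower.1 ha
    obtain ⟨b, hb', rfl⟩ := stack_lo_lower.1 hb
    exact h₂ _ _ (hr₂ _ _ (.inr (.inr (.inr ⟨pa, pb, ν, hl, ha', hb'⟩))))
  · cases hl
  · cases hl

end AtomicFlow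

/-- Breaking the fragile cycles of a flow all of whose cycles are fragile leaves no cycle. -/
theorem BreakCycles.cycleFree {I J : Type} {B C : AtomicFlow I J} (h : BreakCycles B C)
    (hB : B.AllFragile) : C.CycleFree := by
  induction h with
  | done h f => exact cycleFree_iso f fun l hl => h l ⟨hl, hB l hl⟩
  | @step I J B C A B₁ D₁ B₂ D₂ f hcycle f₁ f₂ h₁ h₂ g ih₁ ih₂ =>
    have hA := hB.of_iso f
    have flow₁ := B₁.isFlow.of_iso f₁.symm
    have flow₂ := B₂.isFlow.of_iso f₂.symm
    obtain ⟨π₁, hπ₁⟩ := B₁.polarizable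
    obtain ⟨π₂, hπ₂⟩ := B₂.polarizable
    obtain ⟨π, hπ⟩ := C.polarizable
    exact cycleFree_iso g <| AtomicFlow.stack_cycleFree (C.isFlow.of_iso g.symm) (hπ.comp_iso g)
      (ih₁ ((hA.withWeakening flow₁ (hπ₁.comp_iso f₁)).of_iso f₁.symm))
      (ih₂ ((hA.withCoweakening flow₂ (hπ₂.comp_iso f₂)).of_iso f₂.symm))

/-! ### Existence of reductions that break the cycles -/

namespace FlowGraph

variable {I J : Type}

/-- Polarity assignments with given values on the upper and on the lower edges. -/
structure IsPolarityOn (A : FlowGraph I J) (kI : I → Polarity) (kJ : J → Polarity)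
    (π : A.E → Polarity) : Prop where
  isPolarity : A.IsPolarity π
  up : ∀ ε i, A.up ε = Sum.inr i → π ε = kI i
  lo : ∀ ε j, A.lo ε = Sum.inr j → π ε = kJ j

/-- Polarity assignments of the two flows combine if they agree on the shared edge and on the two
copies of every upper and of every lower edge. -/
theorem IsPolarityOn.stack {D₁ : AtomicFlow I (Option J)} {D₂ : AtomicFlow (Option I) J}
    {kI : I → Polarity} {kJ : J → Polarity} {p : Polarity} {π₁ : D₁.E → Polarity}
    {π₂ : D₂.E → Polarity} (h₁ : D₁.IsPolarityOn kI (fun o => o.elim p kJ) π₁)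
    (h₂ : D₂.IsPolarityOn (fun o => o.elim p kI) kJ π₂) :
    (D₁.stack D₂).IsPolarityOn kI kJ (AtomicFlow.stackFun π₁ π₂ (Sum.elim kI kJ)) := by
  set π := AtomicFlow.stackFun (D₁ := D₁) (D₂ := D₂) π₁ π₂ (Sum.elim kI kJ) with hπ
  have eu : ∀ ε, π (AtomicFlow.stackUpper D₁ D₂ ε) = π₁ ε := fun ε => rfl
  have el : ∀ ε, π (AtomicFlow.stackLower D₁ D₂ ε) = π₂ ε :=
    AtomicFlow.stackFun_stackLower fun a b ha hb => (h₁.lo a _ ha).trans (h₂.up b _ hb).symm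
  have single : ∀ {ν : (D₁.stack D₂).V} {q : Polarity}, ((D₁.stack D₂).edgesAt ν).Nonempty →
      (∀ x ∈ (D₁.stack D₂).edgesAt ν, π x = q) → π '' (D₁.stack D₂).edgesAt ν = {q} := by
    intro ν q hne h
    refine Set.Subset.antisymm ?_ ?_
    · rintro _ ⟨x, hx, rfl⟩
      exact h x hx
    · rintro _ rfl
      obtain ⟨x, hx⟩ := hne
      exact ⟨x, hx, h x hx⟩
  have either : ∀ {s : Set Polarity} {q : Polarity}, s = {q} →
      s = {Polarity.neg} ∨ s = {Polarity.pos} := by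
    rintro s (_ | _) h
    exacts [.inl h, .inr h]
  refine ⟨?_, fun ε i h => ?_, fun ε j h => ?_⟩
  · rintro ((ν | ν) | (i | j))
    · have e : π '' (D₁.stack D₂).edgesAt (Sum.inl (Sum.inl ν)) = π₁ '' D₁.edgesAt ν := by
        rw [AtomicFlow.stack_edgesAt_upper, Set.image_image]
        exact Set.image_congr fun ε _ => eu ε
      exact e.symm ▸ h₁.isPolarity ν
    · have e : π '' (D₁.stack D₂).edgesAt (Sum.inl (Sum.inr ν)) = π₂ '' D₂.edgesAt ν := by
        rw [AtomicFlow.stack_edgesAt_lower, Set.image_image]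
        exact Set.image_congr fun ε _ => el ε
      exact e.symm ▸ h₂.isPolarity ν
    · refine ⟨fun _ => either (q := kI i) (single ⟨_, .inr (AtomicFlow.stack_lo_new'.2 rfl)⟩ ?_),
        fun h => by rcases h with h | h <;> cases h⟩
      obtain ⟨ε₁, hε₁, -⟩ := D₁.upper_named i
      obtain ⟨ε₂, hε₂, -⟩ := D₂.upper_named (some i)
      rintro x (hx | hx)
      · rcases (AtomicFlow.stack_up_new hε₁ hε₂).1 hx with rfl | rfl
        · exact (eu _).trans (h₁.up _ _ hε₁)
        · exact (el _).trans (h₂.up _ _ hε₂)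
      · obtain rfl := AtomicFlow.stack_lo_new'.1 hx
        rfl
    · refine ⟨fun _ => either (q := kJ j) (single ⟨_, .inl (AtomicFlow.stack_up_new'.2 rfl)⟩ ?_),
        fun h => by rcases h with h | h <;> cases h⟩
      obtain ⟨ε₁, hε₁, -⟩ := D₁.lower_named (some j)
      obtain ⟨ε₂, hε₂, -⟩ := D₂.lower_named j
      rintro x (hx | hx)
      · obtain rfl := AtomicFlow.stack_up_new'.1 hx
        rfl
      · rcases (AtomicFlow.stack_lo_new hε₁ hε₂).1 hx with rfl | rfl
        · exact (eu _).trans (h₁.lo _ _ hε₁)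
        · exact (el _).trans (h₂.lo _ _ hε₂)
  · obtain rfl := AtomicFlow.stack_up_named.1 h
    rfl
  · obtain rfl := AtomicFlow.stack_lo_named.1 h
    rfl

end FlowGraph

variable {I J : Type}

/-- The recursion of bc ends because every call deletes an edge. The two flows without the simple
edge can be composed to a flow because the polarities on their upper and lower edges are kept. -/
theorem exists_breakCycles_of_isPolarityOn (n : ℕ) {I J : Type} (B : AtomicFlow I J)
    (hn : Nat.card B.E ≤ n) {kI : I → Polarity} {kJ : J → Polarity} {π : B.E → Polarity}
    (hπ : B.IsPolarityOn kI kJ π) :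
    ∃ (C : AtomicFlow I J) (π' : C.E → Polarity), C.IsPolarityOn kI kJ π' ∧ BreakCycles B C := by
  induction n generalizing I J with
  | zero =>
    refine ⟨B, π, hπ, .done (fun l hl => ?_) (.refl _)⟩
    obtain ⟨ε, -, -⟩ := hl.2
    have := B.finite_E
    exact Nat.ne_of_gt (Nat.card_pos_iff.2 ⟨⟨ε⟩, this⟩) (Nat.le_zero.1 hn)
  | succ n ih =>
    by_cases h : ∀ l, ¬ B.IsFragileCycle l
    · exact ⟨B, π, hπ, .done h (.refl _)⟩
    push Not at h
    obtain ⟨l, hl, ε, hε, hs⟩ := h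
    obtain ⟨A, f, rfl⟩ := B.isFlow.exists_withSimpleEdge hs
    have hS := B.isFlow.of_iso f.symm
    have hA : A.IsFlow := .of_withSimpleEdge hS
    have hSπ := hπ.isPolarity.comp_iso f
    have hAπ : A.IsPolarity fun ε => π (f.edge (Sum.inl ε)) := .of_withSimpleEdge hSπ
    have := B.finite_E
    have : Finite A.E := hA.finite_E
    have hcard : Nat.card A.E ≤ n := by
      have e : Nat.card (A.E ⊕ Unit) = Nat.card B.E := Nat.card_congr f.edge
      have e' := Nat.card_sum (α := A.E) (β := Unit)
      rw [e, Nat.card_unique (α := Unit)] at e'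
      omega
    obtain ⟨ε₂, h₂, h₂'⟩ := hA.upper_named none
    obtain ⟨ε₃, h₃, h₃'⟩ := hA.lower_named none
    have eq_of_ne : ∀ p q r : Polarity, p ≠ r → q ≠ r → p = q := by
      rintro (_ | _) (_ | _) (_ | _) h h' <;> first | rfl | exact (h rfl).elim | exact (h' rfl).elim
    have ne₂ : π (f.edge (Sum.inl ε₂)) ≠ π (f.edge (Sum.inr ())) := fun e => by
      have e' := hSπ.eq_of_aiDown (ν := Sum.inr false) (ε := Sum.inl ε₂) (ε' := Sum.inr ()) hS rfl
        (withSimpleEdge_up.1 h₂) rfl e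
      cases e'
    have ne₃ : π (f.edge (Sum.inl ε₃)) ≠ π (f.edge (Sum.inr ())) := fun e => by
      have e' := hSπ.eq_of_aiUp (ν := Sum.inr true) (ε := Sum.inl ε₃) (ε' := Sum.inr ()) hS rfl
        (withSimpleEdge_lo.1 h₃) rfl e
      cases e'
    -- the edges `2` and `3` are both dual to the simple edge, and can be identified
    have e₂₃ : π (f.edge (Sum.inl ε₂)) = π (f.edge (Sum.inl ε₃)) :=
      eq_of_ne _ _ _ ne₂ ne₃
    have up : ∀ ε i, A.up ε = Sum.inr (some i) → π (f.edge (Sum.inl ε)) = kI i := fun ε i h =>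
      hπ.up _ _ (f.up_inr.2 (withSimpleEdge_up.1 h))
    have lo : ∀ ε j, A.lo ε = Sum.inr (some j) → π (f.edge (Sum.inl ε)) = kJ j := fun ε j h =>
      hπ.lo _ _ (f.lo_inr.2 (withSimpleEdge_lo.1 h))
    let B₁ := hA.withWeakening.toAtomicFlow ⟨_, hAπ.withWeakening⟩
    let B₂ := hA.withCoweakening.toAtomicFlow ⟨_, hAπ.withCoweakening⟩
    obtain ⟨D₁, π₁, hπ₁, hD₁⟩ := ih B₁ hcard (kI := kI)
      (kJ := fun o => o.elim (π (f.edge (Sum.inl ε₂))) kJ) ⟨hAπ.withWeakening, fun ε i h =>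
        up ε i (withWeakening_up.1 h), by
        rintro ε (_ | j) h
        · obtain rfl := h₃' ε (withWeakening_lo_inr.1 h)
          exact e₂₃.symm
        · exact lo ε j (withWeakening_lo_inr.1 h)⟩
    obtain ⟨D₂, π₂, hπ₂, hD₂⟩ := ih B₂ hcard (kJ := kJ)
      (kI := fun o => o.elim (π (f.edge (Sum.inl ε₂))) kI) ⟨hAπ.withCoweakening, by
        rintro ε (_ | i) h
        · obtain rfl := h₂' ε (withCoweakening_up_inr.1 h)
          rfl
        · exact up ε i (withCoweakening_up_inr.1 h), fun ε j h =>
        lo ε j (withCoweakening_lo.1 h)⟩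
    have hI : Finite I := by
      choose u hu hu' using B.upper_named
      exact .of_injective u fun i i' e => Sum.inr_injective ((hu i).symm.trans (e ▸ hu i'))
    have hJ : Finite J := by
      choose u hu hu' using B.lower_named
      exact .of_injective u fun i i' e => Sum.inr_injective ((hu i).symm.trans (e ▸ hu i'))
    have hC := hπ₁.stack hπ₂
    exact ⟨AtomicFlow.isFlow_stack.toAtomicFlow ⟨_, hC.isPolarity⟩, _, hC,
      .step A f ⟨l, hl, hε⟩ (.refl _) (.refl _) hD₁ hD₂ (.refl _)⟩

theorem exists_breakCycles (B : AtomicFlow I J) : ∃ C, BreakCycles B C := by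
  obtain ⟨π, hπ⟩ := B.polarizable
  choose u hu hu' using B.upper_named
  choose d hd hd' using B.lower_named
  obtain ⟨C, -, -, hC⟩ := exists_breakCycles_of_isPolarityOn _ B le_rfl (kI := fun i => π (u i))
    (kJ := fun j => π (d j)) ⟨hπ, fun ε i h => congrArg π (hu' i ε h),
      fun ε j h => congrArg π (hd' j ε h)⟩
  exact ⟨C, hC⟩

/-! ### Derivations for the reduction bc -/

variable {X : Type u} [DualAtoms X] {I J : Type}

theorem Der.congr {A : FlowGraph I J} {κ : A.E → X} {φ φ' ψ ψ' : Formula A.E} {m : Multiset A.V}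
    (h : Der A κ φ m ψ) (e : φ = φ') (e' : ψ = ψ') : Der A κ φ' m ψ' := e ▸ e' ▸ h

namespace FlowGraph

variable {A : FlowGraph (Option I) (Option J)}

/-- The vertices that are left of those of a flow with an evidenced simple edge, when the vertex `b`
of the simple edge is replaced and the other one is deleted. -/
def simpleRest {V : Type} (b : Bool) : V ⊕ Bool → Multiset (V ⊕ Unit) :=
  Sum.elim (fun ν => {Sum.inl ν}) fun c => if c = b then {Sum.inr ()} else 0

theorem nodup_simpleRest {V : Type} (b : Bool) (ν : V ⊕ Bool) : (simpleRest b ν).Nodup := by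
  rcases ν with ν | _ | _ <;> cases b <;> simp [simpleRest]

theorem mem_simpleRest {V : Type} (b : Bool) (x : V ⊕ Unit) (ν : V ⊕ Bool) :
    x ∈ simpleRest b ν ↔ Sum.map id (fun _ => b) x = ν := by
  rcases x with x | x <;> rcases ν with ν | _ | _ <;> cases b <;> simp [simpleRest]

/-- Replacing the simple edge by a unit turns a derivation into one for the flow that has a
weakening instead of the interaction, and into one for the flow that has a coweakening instead of
the cointeraction. The unit is true in the first and false in the second case; the remaining atom of
the vertex that disappears is moved by switch into the conclusion or into the premiss. -/
theorem Derivable.withSimpleEdge (hS : A.withSimpleEdge.IsFlow) {kI : I → X} {α : Formula I}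
    {kJ : J → X} {β : Formula J} (h : A.withSimpleEdge.Derivable kI α kJ β) :
    ∃ a : X, A.withWeakening.Derivable kI α (fun o => o.elim a kJ) (or (β.map some) (atom none)) ∧
      A.withCoweakening.Derivable (fun o => o.elim a kI) (and (α.map some) (atom none)) kJ β := by
  obtain ⟨κ, u, d, m, hu, hd, hκI, hκJ, hn, hm, h⟩ := h
  have hA : A.IsFlow := .of_withSimpleEdge hS
  choose u' hu' hu'' using hA.upper_named
  choose d' hd' hd'' using hA.lower_named
  have eu : ∀ i, u i = Sum.inl (u' (some i)) := fun i =>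
    (hS.upper_named i).unique (hu i) (withSimpleEdge_up.1 (hu' (some i)))
  have ed : ∀ j, d j = Sum.inl (d' (some j)) := fun j =>
    (hS.lower_named j).unique (hd j) (withSimpleEdge_lo.1 (hd' (some j)))
  have hup : ∀ ε : A.withSimpleEdge.E, A.withSimpleEdge.up ε = Sum.inl (Sum.inr false) →
      ε = Sum.inr () ∨ ε = Sum.inl (u' none) := by
    rintro (ε | _) h
    · exact .inr (congrArg _ (hu'' _ _ (withSimpleEdge_up.2 h)))
    · exact .inl rfl
  have hlo : ∀ ε : A.withSimpleEdge.E, A.withSimpleEdge.lo ε = Sum.inl (Sum.inr true) →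
      ε = Sum.inr () ∨ ε = Sum.inl (d' none) := by
    rintro (ε | _) h
    · exact .inr (congrArg _ (hd'' _ _ (withSimpleEdge_lo.2 h)))
    · exact .inl rfl
  have k₂ : κ (Sum.inl (u' none)) = bar (κ (Sum.inr ())) := by
    obtain ⟨_, _, r⟩ := h.exists_vertexStep (hm (Sum.inr false))
    exact (r.of_aiDown rfl hup).2.2
  have k₃ : κ (Sum.inl (d' none)) = bar (κ (Sum.inr ())) := by
    obtain ⟨_, _, r⟩ := h.exists_vertexStep (hm (Sum.inr true))
    exact (r.of_aiUp rfl hlo).2.2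
  refine ⟨bar (κ (Sum.inr ())), ?_, ?_⟩
  · -- the simple edge is true: the interaction becomes `t → [t.f] → [t.2]`, and the cointeraction
    -- becomes `(t.3) → [f.3]`, where the disjunct `3` is kept until the end
    let σ : A.withSimpleEdge.E → Formula A.E := Sum.elim atom fun _ => tt
    let τ : A.withSimpleEdge.V → Multiset A.withWeakening.V := simpleRest false
    have key : Der A.withWeakening (fun ε => κ (Sum.inl ε)) ((α.map u).subst σ) (m.bind τ)
        (or ((β.map d).subst σ) (atom (d' none))) := by
      refine h.subst_or (B := A.withWeakening) (σ := σ) (τ := τ) (μ := Sum.inr true) hn (hm _) ?_ ?_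
      · rintro (ν | _ | _) - hν φ ψ r
        · refine .structural (VertexStep.subst (A := A.withSimpleEdge) (B := A.withWeakening)
            (ν' := Sum.inl ν) rfl (Sum.elim (fun ε => ε) fun _ => d' none) ?_ ?_ ?_ r)
          · rintro (ε | ε) h
            · exact ⟨rfl, withWeakening_up.2 (withSimpleEdge_up.2 h), rfl⟩
            · cases h
          · rintro (ε | ε) h
            · exact ⟨rfl, withWeakening_lo_inl.2 (withSimpleEdge_lo.2 h), rfl⟩
            · cases h
          · rintro (ε | ε) (h | h) (ε' | ε') (h' | h') e <;> first | cases h | cases h' | skip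
            all_goals exact congrArg Sum.inl e
        · have s : VertexStep A.withWeakening (fun ε => κ (Sum.inl ε)) (Sum.inr ()) ff
              (atom (u' none)) := .awDown _ rfl (withWeakening_up.2 (hu' none))
          obtain ⟨rfl, rfl | rfl, -⟩ := r.of_aiDown rfl hup
          · exact .logical_trans (.orFalseInv _) (.orRight _ (.structural s))
          · exact .logical_trans (.orFalseInv _) <| .logical_trans (.orComm _ _) <|
              .orLeft (.structural s) _
        · exact (hν rfl).elim
      · intro φ ψ r
        obtain ⟨rfl | rfl, rfl, -⟩ := r.of_aiUp rfl hlo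
        · exact .logical_trans (.andComm _ _) <| .logical_trans (.andTrue _) <|
            .logical_trans (.orFalseInv _) <| .logical (.orComm _ _)
        · exact .logical_trans (.andTrue _) <|
            .logical_trans (.orFalseInv _) <| .logical (.orComm _ _)
    obtain ⟨hn', hm'⟩ := nodup_bind_of_fiber hn hm (T := τ)
      (Sum.map id (fun _ => false) : A.V ⊕ Unit → A.V ⊕ Bool) (nodup_simpleRest false)
      (mem_simpleRest false)
    refine ⟨fun ε => κ (Sum.inl ε), fun i => u' (some i), d', m.bind τ,
      fun i => withWeakening_up.2 (hu' _), fun j => withWeakening_lo_inr.2 (hd' j),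
      fun i => (congrArg κ (eu i)).symm.trans (hκI i), ?_, hn', hm', ?_⟩
    · rintro (_ | j)
      · exact k₃
      · exact (congrArg κ (ed j)).symm.trans (hκJ j)
    · have e₁ : (α.map u).subst σ = α.map fun i => u' (some i) :=
        (Formula.subst_map _ _ _).trans <| (Formula.subst_congr fun i _ => congrArg σ (eu i)).trans
          (Formula.subst_atom _ _)
      have e₂ : (β.map d).subst σ = (β.map some).map d' :=
        (Formula.subst_map _ _ _).trans <|
          (Formula.subst_congr fun i _ => congrArg σ (ed i)).trans <|
          (Formula.subst_atom _ _).trans (Formula.map_map _ _ _).symm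
      exact key.congr (A := A.withWeakening) e₁ (congrArg (or · (atom (d' none))) e₂)
  · -- the simple edge is false: the interaction becomes `(t.2) → [f.2]`, where the conjunct `2` is
    -- added to the premiss, and the cointeraction becomes `(f.3) → (f.t) → f`
    let σ : A.withSimpleEdge.E → Formula A.E := Sum.elim atom fun _ => ff
    let τ : A.withSimpleEdge.V → Multiset A.withCoweakening.V := simpleRest true
    have key : Der A.withCoweakening (fun ε => κ (Sum.inl ε))
        (and ((α.map u).subst σ) (atom (u' none))) (m.bind τ) ((β.map d).subst σ) := by
      refine h.and_subst (B := A.withCoweakening) (σ := σ) (τ := τ) (μ := Sum.inr false) hn (hm _)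
        ?_ ?_
      · rintro (ν | _ | _) - hν φ ψ r
        · refine .structural (VertexStep.subst (A := A.withSimpleEdge) (B := A.withCoweakening)
            (ν' := Sum.inl ν) rfl (Sum.elim (fun ε => ε) fun _ => d' none) ?_ ?_ ?_ r)
          · rintro (ε | ε) h
            · exact ⟨rfl, withCoweakening_up_inl.2 (withSimpleEdge_up.2 h), rfl⟩
            · cases h
          · rintro (ε | ε) h
            · exact ⟨rfl, withCoweakening_lo.2 (withSimpleEdge_lo.2 h), rfl⟩
            · cases h
          · rintro (ε | ε) (h | h) (ε' | ε') (h' | h') e <;> first | cases h | cases h' | skip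
            all_goals exact congrArg Sum.inl e
        · exact (hν rfl).elim
        · have s : VertexStep A.withCoweakening (fun ε => κ (Sum.inl ε)) (Sum.inr ())
              (atom (d' none)) tt := .awUp _ rfl (withCoweakening_lo.2 (hd' none))
          obtain ⟨rfl | rfl, rfl, -⟩ := r.of_aiUp rfl hlo
          · exact ((Der.structural s).andRight _).trans_logical (.andTrue _)
          · exact (((Der.structural s).andLeft _).trans_logical (.andComm _ _)).trans_logical
              (.andTrue _)
      · intro φ ψ r
        obtain ⟨rfl, rfl | rfl, -⟩ := r.of_aiDown rfl hup
        · exact .logical_trans (.andComm _ _) <| .logical_trans (.andTrue _) <|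
            .logical_trans (.orFalseInv _) <| .logical (.orComm _ _)
        · exact .logical_trans (.andComm _ _) <| .logical_trans (.andTrue _) <|
            .logical (.orFalseInv _)
    obtain ⟨hn', hm'⟩ := nodup_bind_of_fiber hn hm (T := τ)
      (Sum.map id (fun _ => true) : A.V ⊕ Unit → A.V ⊕ Bool) (nodup_simpleRest true)
      (mem_simpleRest true)
    refine ⟨fun ε => κ (Sum.inl ε), u', fun j => d' (some j), m.bind τ,
      fun i => withCoweakening_up_inr.2 (hu' i), fun j => withCoweakening_lo.2 (hd' _), ?_,
      fun j => (congrArg κ (ed j)).symm.trans (hκJ j), hn', hm', ?_⟩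
    · rintro (_ | j)
      · exact k₂
      · exact (congrArg κ (eu j)).symm.trans (hκI j)
    · have e₁ : (α.map u).subst σ = (α.map some).map u' :=
        (Formula.subst_map _ _ _).trans <|
          (Formula.subst_congr fun i _ => congrArg σ (eu i)).trans <|
          (Formula.subst_atom _ _).trans (Formula.map_map _ _ _).symm
      have e₂ : (β.map d).subst σ = β.map fun i => d' (some i) :=
        (Formula.subst_map _ _ _).trans <| (Formula.subst_congr fun i _ => congrArg σ (ed i)).trans
          (Formula.subst_atom _ _)
      exact key.congr (A := A.withCoweakening) (congrArg (and · (atom (u' none))) e₁) e₂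

end FlowGraph

namespace Der

variable {A : FlowGraph I J} {κ : A.E → X} {φ φ' ψ ψ' : Formula A.E} {N : Type} {n a b : N → A.E}
  {ν : N → A.V}

theorem or_or_or_comm : Der A κ (or (or φ φ') (or ψ ψ')) 0 (or (or φ ψ) (or φ' ψ')) :=
  .logical_trans (.orAssocInv _ _ _) <| .zero_trans (or_right_comm.orLeft _) <|
    .logical (.orAssoc _ _ _)

theorem and_and_and_comm : Der A κ (and (and φ φ') (and ψ ψ')) 0 (and (and φ ψ) (and φ' ψ')) :=
  .logical_trans (.andAssocInv _ _ _) <| .zero_trans (and_right_comm.andLeft _) <|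
    .logical (.andAssoc _ _ _)

/-- Cocontraction of a formula; it is reduced to atomic cocontractions by medial. -/
theorem cocontract (h : ∀ i, VertexStep A κ (ν i) (atom (n i)) (and (atom (a i)) (atom (b i))))
    (α : Formula N) :
    Der A κ (α.map n) ((α.atoms : Multiset N).map ν) (and (α.map a) (α.map b)) := by
  induction α with
  | ff => exact .logical .andFalseFalseInv
  | tt => exact .logical (.andTrueInv _)
  | atom i => exact .structural (h i)
  | or α β ihα ihβ =>
    rw [Formula.atoms, ← Multiset.coe_add, Multiset.map_add]
    exact (ihα.or_mono ihβ).trans_logical (.medial _ _ _ _)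
  | and α β ihα ihβ =>
    rw [Formula.atoms, ← Multiset.coe_add, Multiset.map_add]
    exact (ihα.and_mono ihβ).trans_zero and_and_and_comm

/-- Contraction of a formula; it is reduced to atomic contractions by medial. -/
theorem contract (h : ∀ i, VertexStep A κ (ν i) (or (atom (a i)) (atom (b i))) (atom (n i)))
    (α : Formula N) :
    Der A κ (or (α.map a) (α.map b)) ((α.atoms : Multiset N).map ν) (α.map n) := by
  induction α with
  | ff => exact .logical (.orFalse _)
  | tt => exact .logical .orTrueTrue
  | atom i => exact .structural (h i)
  | or α β ihα ihβ =>
    rw [Formula.atoms, ← Multiset.coe_add, Multiset.map_add]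
    exact or_or_or_comm.zero_trans (ihα.or_mono ihβ)
  | and α β ihα ihβ =>
    rw [Formula.atoms, ← Multiset.coe_add, Multiset.map_add]
    exact .logical_trans (.medial _ _ _ _) (ihα.and_mono ihβ)

end Der

/-- The vertices of the composition are the ones of the two flows, a cocontraction for each upper
edge and a contraction for each lower edge. -/
theorem nodup_stack {V W : Type} {l : Multiset I} (hl : l.Nodup) (hl' : ∀ i, i ∈ l)
    {m : Multiset V} (hm : m.Nodup) (hm' : ∀ ν, ν ∈ m) {n : Multiset W} (hn : n.Nodup)
    (hn' : ∀ ν, ν ∈ n) {k : Multiset J} (hk : k.Nodup) (hk' : ∀ j, j ∈ k)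
    {M : Multiset ((V ⊕ W) ⊕ (I ⊕ J))}
    (hM : M = l.map (fun i => Sum.inr (Sum.inl i)) + (m.map (fun ν => Sum.inl (Sum.inl ν)) +
      (n.map (fun ν => Sum.inl (Sum.inr ν)) + k.map fun j => Sum.inr (Sum.inr j)))) :
    M.Nodup ∧ ∀ x, x ∈ M := by
  subst hM
  constructor
  · refine Multiset.nodup_add.2 ⟨?_, Multiset.nodup_add.2
      ⟨?_, Multiset.nodup_add.2 ⟨?_, ?_, ?_⟩, ?_⟩, ?_⟩
    · exact hl.map fun _ _ h => Sum.inl_injective (Sum.inr_injective h)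
    · exact hm.map fun _ _ h => Sum.inl_injective (Sum.inl_injective h)
    · exact hn.map fun _ _ h => Sum.inr_injective (Sum.inl_injective h)
    · exact hk.map fun _ _ h => Sum.inr_injective (Sum.inr_injective h)
    all_goals
      refine Multiset.disjoint_left.2 fun {x} h h' => ?_
      simp only [Multiset.mem_add, Multiset.mem_map] at h h'
      obtain ⟨_, _, rfl⟩ := h
      simp at h'
  · rintro ((ν | ν) | (i | j)) <;> simp [hl', hm', hn', hk']

open AtomicFlow in
/-- The premiss is cocontracted, the first derivation is applied to one copy, its additional
disjunct `none` is joined by switch to the other copy as the conjunct `none` of the premiss of the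
second derivation, and the two copies of the conclusion are contracted. -/
theorem FlowGraph.Derivable.stack {D₁ : AtomicFlow I (Option J)} {D₂ : AtomicFlow (Option I) J}
    {kI : I → X} {kJ : J → X} {a : X} {α : Formula I} {β : Formula J} (hα : α.IsLinear)
    (hβ : β.IsLinear)
    (h₁ : D₁.Derivable kI α (fun o => o.elim a kJ) (or (β.map some) (atom none)))
    (h₂ : D₂.Derivable (fun o => o.elim a kI) (and (α.map some) (atom none)) kJ β) :
    (D₁.stack D₂).Derivable kI α kJ β := by
  obtain ⟨κ₁, u₁, d₁, m₁, hu₁, hd₁, hκI₁, hκJ₁, hn₁, hm₁, h₁⟩ := h₁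
  obtain ⟨κ₂, u₂, d₂, m₂, hu₂, hd₂, hκI₂, hκJ₂, hn₂, hm₂, h₂⟩ := h₂
  let κ := stackFun (D₁ := D₁) (D₂ := D₂) κ₁ κ₂ (Sum.elim kI kJ)
  have eκ : ∀ ε, κ (stackLower D₁ D₂ ε) = κ₂ ε := stackFun_stackLower fun a b ha hb => by
    rw [(D₁.lower_named none).unique ha (hd₁ none), (D₂.upper_named none).unique hb (hu₂ none),
      hκJ₁, hκI₂]
    rfl
  have ec : stackLower D₁ D₂ (u₂ none) = stackUpper D₁ D₂ (d₁ none) :=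
    stackLower_of_up (hu₂ none) (hd₁ none)
  have H₁ := h₁.map (B := D₁.stack D₂) (κ' := κ) (stackUpper D₁ D₂) (fun ν => Sum.inl (Sum.inl ν))
    stackUpper_injective (fun ε => rfl) (fun ν => rfl) (fun ε ν h => stack_up_upper.2 ⟨ε, h, rfl⟩)
    (fun ε ν h => stack_lo_upper.2 ⟨ε, h, rfl⟩)
  have H₂ := h₂.map (B := D₁.stack D₂) (κ' := κ) (stackLower D₁ D₂) (fun ν => Sum.inl (Sum.inr ν))
    stackLower_injective eκ (fun ν => rfl) (fun ε ν h => stack_up_lower.2 ⟨ε, h, rfl⟩)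
    (fun ε ν h => stack_lo_lower.2 ⟨ε, h, rfl⟩)
  -- cocontraction of the premiss and contraction of the conclusion
  have H₀ := Der.cocontract (A := D₁.stack D₂) (κ := κ) (n := fun i => stackNew D₁ D₂ (Sum.inl i))
    (a := fun i => stackUpper D₁ D₂ (u₁ i)) (b := fun i => stackLower D₁ D₂ (u₂ (some i)))
    (ν := fun i => Sum.inr (Sum.inl i)) (fun i => .acUp _ _ _ rfl (fun e => by
        have h := (eq_of_stackLower_eq_stackUpper e.symm).1
        rw [hu₂] at h
        cases h)
      (stack_lo_new'.2 rfl) ((stack_up_new (hu₁ i) (hu₂ (some i))).2 (.inl rfl))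
      ((stack_up_new (hu₁ i) (hu₂ (some i))).2 (.inr rfl)) (hκI₁ i)
      ((eκ _).trans (hκI₂ (some i)))) α
  have H₃ := Der.contract (A := D₁.stack D₂) (κ := κ) (n := fun j => stackNew D₁ D₂ (Sum.inr j))
    (a := fun j => stackUpper D₁ D₂ (d₁ (some j))) (b := fun j => stackLower D₁ D₂ (d₂ j))
    (ν := fun i => Sum.inr (Sum.inr i)) (fun j => .acDown _ _ _ rfl (fun e => by
        have h := (eq_of_stackLower_eq_stackUpper e.symm).2
        rw [hd₁] at h
        cases h)
      ((stack_lo_new (hd₁ (some j)) (hd₂ j)).2 (.inl rfl))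
      ((stack_lo_new (hd₁ (some j)) (hd₂ j)).2 (.inr rfl)) (stack_up_new'.2 rfl) (hκJ₁ (some j))
      ((eκ _).trans (hκJ₂ j))) β
  simp only [Formula.map, Formula.map_map, ec] at H₁ H₂
  obtain ⟨hn, hm⟩ := nodup_stack (Multiset.coe_nodup.2 hα.1) hα.2 hn₁ hm₁ hn₂ hm₂
    (Multiset.coe_nodup.2 hβ.1) hβ.2 rfl
  exact ⟨κ, fun i => stackNew D₁ D₂ (Sum.inl i), fun j => stackNew D₁ D₂ (Sum.inr j), _,
    fun i => rfl, fun j => rfl, fun i => rfl, fun j => rfl, hn, hm,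
    H₀.trans <| (H₁.andLeft _).trans <|
      Der.zero_trans (.andLeft (.logical (.orComm _ _)) _) <| Der.and_or_left.zero_trans <|
      Der.zero_trans (.orLeft (.logical (.andComm _ _)) _) <| (H₂.orLeft _).trans <|
      .logical_trans (.orComm _ _) H₃⟩

/-- Adding the name `none` as a further conjunct or disjunct keeps a formula linear. -/
theorem Formula.IsLinear.option {α : Formula I} (h : α.IsLinear) :
    ((α.map some).atoms ++ [none]).Nodup ∧ ∀ o : Option I, o ∈ (α.map some).atoms ++ [none] := by
  rw [Formula.atoms_map]
  refine ⟨List.nodup_append.2 ⟨h.1.map (Option.some_injective _), List.nodup_singleton _, ?_⟩, ?_⟩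
  · rintro _ h _ h' rfl
    obtain ⟨_, _, rfl⟩ := List.mem_map.1 h
    cases List.mem_singleton.1 h'
  · rintro (_ | i)
    · simp
    · simpa using h.2 i

/-- Soundness of the reduction bc for derivations. -/
theorem BreakCycles.derivable {B C : AtomicFlow I J} (h : BreakCycles B C) {kI : I → X}
    {α : Formula I} {kJ : J → X} {β : Formula J} (hα : α.IsLinear) (hβ : β.IsLinear)
    (hB : B.Derivable kI α kJ β) : C.Derivable kI α kJ β := by
  induction h with
  | done h f => exact hB.of_iso f
  | @step I J B C A B₁ D₁ B₂ D₂ f hcycle f₁ f₂ h₁ h₂ g ih₁ ih₂ =>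
    obtain ⟨a, H₁, H₂⟩ := (hB.of_iso f.symm).withSimpleEdge (B.isFlow.of_iso f.symm)
    exact (Derivable.stack hα hβ (ih₁ hα hβ.option (H₁.of_iso f₁))
      (ih₂ hα.option hβ (H₂.of_iso f₂))).of_iso g

/-! ### Lifting undecorated steps to decorated ones -/

section Bundles

variable {X : Type u}

/-- A renaming of the edges in a decorated formula. -/
def Formula.rename {E F : Type} (f : E → F) (φ : Formula (X × E)) : Formula (X × F) :=
  φ.map fun x => (x.1, f x.2)

theorem Formula.erase_rename {E F : Type} (f : E → F) (φ : Formula (X × E)) :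
    (φ.rename f).erase = φ.erase := Formula.map_map _ _ _

theorem Formula.atoms_rename {E F : Type} (f : E → F) (φ : Formula (X × E)) :
    (φ.rename f).atoms = φ.atoms.map fun x => (x.1, f x.2) := Formula.atoms_map _ _

theorem Formula.eq_or_of_erase {E : Type} {φ : Formula (X × E)} {α β : Formula X}
    (h : φ.erase = or α β) : ∃ φ₁ φ₂, φ = or φ₁ φ₂ ∧ φ₁.erase = α ∧ φ₂.erase = β := by
  cases φ <;> cases h
  exact ⟨_, _, rfl, rfl, rfl⟩

theorem Formula.eq_and_of_erase {E : Type} {φ : Formula (X × E)} {α β : Formula X}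
    (h : φ.erase = and α β) : ∃ φ₁ φ₂, φ = and φ₁ φ₂ ∧ φ₁.erase = α ∧ φ₂.erase = β := by
  cases φ <;> cases h
  exact ⟨_, _, rfl, rfl, rfl⟩

theorem Formula.eq_ff_of_erase {E : Type} {φ : Formula (X × E)} (h : φ.erase = ff) : φ = ff := by
  cases φ <;> cases h
  rfl

theorem Formula.eq_tt_of_erase {E : Type} {φ : Formula (X × E)} (h : φ.erase = tt) : φ = tt := by
  cases φ <;> cases h
  rfl

theorem Formula.eq_atom_of_erase {E : Type} {φ : Formula (X × E)} {a : X} (h : φ.erase = atom a) :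
    ∃ ε, φ = atom (a, ε) := by
  cases φ <;> cases h
  exact ⟨_, rfl⟩

/-- An instance of a logical rule can be decorated from its conclusion. -/
theorem Logical.exists_erase {E : Type} {α β : Formula X} (r : Logical α β) (φ : Formula (X × E))
    (h : φ.erase = β) : ∃ (φ' : Formula (X × E)) (r' : Logical φ' φ),
      (⟨_, _, r'.erase⟩ : Σ α β : Formula X, Logical α β) = ⟨α, β, r⟩ := by
  cases r
  case switch =>
    obtain ⟨_, _, rfl, h₁, rfl⟩ := Formula.eq_or_of_erase h
    obtain ⟨_, _, rfl, rfl, rfl⟩ := Formula.eq_and_of_erase h₁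
    exact ⟨_, .switch _ _ _, rfl⟩
  case medial =>
    obtain ⟨_, _, rfl, h₁, h₂⟩ := Formula.eq_and_of_erase h
    obtain ⟨_, _, rfl, rfl, rfl⟩ := Formula.eq_or_of_erase h₁
    obtain ⟨_, _, rfl, rfl, rfl⟩ := Formula.eq_or_of_erase h₂
    exact ⟨_, .medial _ _ _ _, rfl⟩
  case orComm =>
    obtain ⟨_, _, rfl, rfl, rfl⟩ := Formula.eq_or_of_erase h
    exact ⟨_, .orComm _ _, rfl⟩
  case andComm =>
    obtain ⟨_, _, rfl, rfl, rfl⟩ := Formula.eq_and_of_erase h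
    exact ⟨_, .andComm _ _, rfl⟩
  case orAssoc =>
    obtain ⟨_, _, rfl, rfl, h₁⟩ := Formula.eq_or_of_erase h
    obtain ⟨_, _, rfl, rfl, rfl⟩ := Formula.eq_or_of_erase h₁
    exact ⟨_, .orAssoc _ _ _, rfl⟩
  case orAssocInv =>
    obtain ⟨_, _, rfl, h₁, rfl⟩ := Formula.eq_or_of_erase h
    obtain ⟨_, _, rfl, rfl, rfl⟩ := Formula.eq_or_of_erase h₁
    exact ⟨_, .orAssocInv _ _ _, rfl⟩
  case andAssoc =>
    obtain ⟨_, _, rfl, rfl, h₁⟩ := Formula.eq_and_of_erase h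
    obtain ⟨_, _, rfl, rfl, rfl⟩ := Formula.eq_and_of_erase h₁
    exact ⟨_, .andAssoc _ _ _, rfl⟩
  case andAssocInv =>
    obtain ⟨_, _, rfl, h₁, rfl⟩ := Formula.eq_and_of_erase h
    obtain ⟨_, _, rfl, rfl, rfl⟩ := Formula.eq_and_of_erase h₁
    exact ⟨_, .andAssocInv _ _ _, rfl⟩
  case orFalse =>
    subst h
    exact ⟨_, .orFalse _, rfl⟩
  case orFalseInv =>
    obtain ⟨_, _, rfl, rfl, h₁⟩ := Formula.eq_or_of_erase h
    obtain rfl := Formula.eq_ff_of_erase h₁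
    exact ⟨_, .orFalseInv _, rfl⟩
  case andTrue =>
    subst h
    exact ⟨_, .andTrue _, rfl⟩
  case andTrueInv =>
    obtain ⟨_, _, rfl, rfl, h₁⟩ := Formula.eq_and_of_erase h
    obtain rfl := Formula.eq_tt_of_erase h₁
    exact ⟨_, .andTrueInv _, rfl⟩
  case orTrueTrue =>
    obtain rfl := Formula.eq_tt_of_erase h
    exact ⟨_, .orTrueTrue, rfl⟩
  case orTrueTrueInv =>
    obtain ⟨_, _, rfl, h₁, h₂⟩ := Formula.eq_or_of_erase h
    obtain rfl := Formula.eq_tt_of_erase h₁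
    obtain rfl := Formula.eq_tt_of_erase h₂
    exact ⟨_, .orTrueTrueInv, rfl⟩
  case andFalseFalse =>
    obtain rfl := Formula.eq_ff_of_erase h
    exact ⟨_, .andFalseFalse, rfl⟩
  case andFalseFalseInv =>
    obtain ⟨_, _, rfl, h₁, h₂⟩ := Formula.eq_and_of_erase h
    obtain rfl := Formula.eq_ff_of_erase h₁
    obtain rfl := Formula.eq_ff_of_erase h₂
    exact ⟨_, .andFalseFalseInv, rfl⟩

/-- Renaming the edges in an instance of a logical rule does not change the underlying instance. -/
theorem Logical.erase_map {E F : Type} (f : E → F) {φ ψ : Formula (X × E)} (r : Logical φ ψ) :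
    (⟨_, _, (r.map fun x => (x.1, f x.2)).erase⟩ : Σ α β : Formula X, Logical α β) =
      ⟨_, _, r.erase⟩ := by
  have one : ∀ (F : Formula X → Σ α β : Formula X, Logical α β) {a a'}, a = a' → F a = F a' := by
    rintro F a _ rfl
    rfl
  have two : ∀ (F : Formula X → Formula X → Σ α β : Formula X, Logical α β) {a a' b b'},
      a = a' → b = b' → F a b = F a' b' := by
    rintro F a _ b _ rfl rfl
    rfl
  have three : ∀ (F : Formula X → Formula X → Formula X → Σ α β : Formula X, Logical α β)
      {a a' b b' c c'}, a = a' → b = b' → c = c' → F a b c = F a' b' c' := by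
    rintro F a _ b _ c _ rfl rfl rfl
    rfl
  have four : ∀ (F : Formula X → Formula X → Formula X → Formula X → Σ α β : Formula X, Logical α β)
      {a a' b b' c c' d d'}, a = a' → b = b' → c = c' → d = d' → F a b c d = F a' b' c' d' := by
    rintro F a _ b _ c _ d _ rfl rfl rfl rfl
    rfl
  have e := fun φ : Formula (X × E) => Formula.erase_rename f φ
  cases r with
  | switch α β γ => exact three (fun a b c => ⟨_, _, .switch a b c⟩) (e α) (e β) (e γ)
  | medial α β γ δ => exact four (fun a b c d => ⟨_, _, .medial a b c d⟩) (e α) (e β) (e γ) (e δ)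
  | orComm α β => exact two (fun a b => ⟨_, _, .orComm a b⟩) (e α) (e β)
  | andComm α β => exact two (fun a b => ⟨_, _, .andComm a b⟩) (e α) (e β)
  | orAssoc α β γ => exact three (fun a b c => ⟨_, _, .orAssoc a b c⟩) (e α) (e β) (e γ)
  | orAssocInv α β γ => exact three (fun a b c => ⟨_, _, .orAssocInv a b c⟩) (e α) (e β) (e γ)
  | andAssoc α β γ => exact three (fun a b c => ⟨_, _, .andAssoc a b c⟩) (e α) (e β) (e γ)
  | andAssocInv α β γ => exact three (fun a b c => ⟨_, _, .andAssocInv a b c⟩) (e α) (e β) (e γ)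
  | orFalse => exact one (fun a => ⟨_, _, .orFalse a⟩) (e ψ)
  | orFalseInv => exact one (fun a => ⟨_, _, .orFalseInv a⟩) (e φ)
  | andTrue => exact one (fun a => ⟨_, _, .andTrue a⟩) (e ψ)
  | andTrueInv => exact one (fun a => ⟨_, _, .andTrueInv a⟩) (e φ)
  | orTrueTrue => rfl
  | orTrueTrueInv => rfl
  | andFalseFalse => rfl
  | andFalseFalseInv => rfl

/-- Inference steps with arbitrary premiss and conclusion. -/
abbrev AnyStep (X : Type u) [DualAtoms X] := Σ α β : Formula X, Step (Structural (X := X)) α β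

/-- Chains with arbitrary premiss and conclusion. -/
abbrev AnyChain (X : Type u) [DualAtoms X] := Σ α β : Formula X, Chain (Structural (X := X)) α β

variable [DualAtoms X] {I J I' J' : Type} {A : FlowGraph I J} {B : FlowGraph I' J'}

/-- The decorated steps that lift the step `s`. -/
def StepLift (A : FlowGraph I J) (s : AnyStep X) (φ ψ : Formula (X × A.E)) (l : List A.V) : Prop :=
  ∃ s' : Step (Decorated X A) φ ψ, (⟨_, _, s'.erase⟩ : AnyStep X) = s ∧ s'.vertices = l

/-- The decorated chains that lift the chain `c`. -/
def ChainLift (A : FlowGraph I J) (c : AnyChain X) (φ ψ : Formula (X × A.E)) (l : List A.V) :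
    Prop :=
  ∃ c' : Chain (Decorated X A) φ ψ, (⟨_, _, c'.erase⟩ : AnyChain X) = c ∧ c'.vertices = l

section

variable {s : AnyStep X} {φ ψ χ : Formula (X × A.E)} {γ : Formula X} {l l' : List A.V}

theorem StepLift.logical {α β : Formula X} {r : Logical α β} {r' : Logical φ ψ}
    (h : (⟨_, _, r'.erase⟩ : Σ α β : Formula X, Logical α β) = ⟨α, β, r⟩) :
    StepLift A ⟨α, β, .logical r⟩ φ ψ [] :=
  ⟨.logical r', congrArg (fun r : Σ α β : Formula X, Logical α β =>
    (⟨r.1, r.2.1, .logical r.2.2⟩ : AnyStep X)) h, rfl⟩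

theorem StepLift.structural {α β : Formula X} {r : Structural α β} {r' : Decorated X A φ ψ}
    (h : (⟨_, _, r'.erase⟩ : Σ α β : Formula X, Structural α β) = ⟨α, β, r⟩) :
    StepLift A ⟨α, β, .structural r⟩ φ ψ [r'.vertex] :=
  ⟨.structural r', congrArg (fun r : Σ α β : Formula X, Structural α β =>
    (⟨r.1, r.2.1, .structural r.2.2⟩ : AnyStep X)) h, rfl⟩

theorem StepLift.orLeft (h : StepLift A s φ ψ l) (hγ : χ.erase = γ) :
    StepLift A ⟨_, _, s.2.2.orLeft γ⟩ (or φ χ) (or ψ χ) l := by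
  obtain ⟨s', rfl, rfl⟩ := h
  subst hγ
  exact ⟨s'.orLeft χ, rfl, rfl⟩

theorem StepLift.orRight (h : StepLift A s φ ψ l) (hγ : χ.erase = γ) :
    StepLift A ⟨_, _, s.2.2.orRight γ⟩ (or χ φ) (or χ ψ) l := by
  obtain ⟨s', rfl, rfl⟩ := h
  subst hγ
  exact ⟨s'.orRight χ, rfl, rfl⟩

theorem StepLift.andLeft (h : StepLift A s φ ψ l) (hγ : χ.erase = γ) :
    StepLift A ⟨_, _, s.2.2.andLeft γ⟩ (and φ χ) (and ψ χ) l := by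
  obtain ⟨s', rfl, rfl⟩ := h
  subst hγ
  exact ⟨s'.andLeft χ, rfl, rfl⟩

theorem StepLift.andRight (h : StepLift A s φ ψ l) (hγ : χ.erase = γ) :
    StepLift A ⟨_, _, s.2.2.andRight γ⟩ (and χ φ) (and χ ψ) l := by
  obtain ⟨s', rfl, rfl⟩ := h
  subst hγ
  exact ⟨s'.andRight χ, rfl, rfl⟩

theorem ChainLift.cons {α β γ : Formula X} {s : Step (Structural (X := X)) α β}
    {c : Chain (Structural (X := X)) β γ} (h : StepLift A ⟨α, β, s⟩ φ ψ l)
    (h' : ChainLift A ⟨β, γ, c⟩ ψ χ l') : ChainLift A ⟨α, γ, .cons s c⟩ φ χ (l ++ l') := by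
  obtain ⟨s', e, rfl⟩ := h
  obtain ⟨c', e', rfl⟩ := h'
  cases e
  cases e'
  exact ⟨.cons s' c', rfl, rfl⟩

/-- Lifts are preserved by maps between flows. -/
theorem Decorated.exists_map (f : A.E → B.E) (g : A.V → B.V) (hf : Function.Injective f)
    (hl : ∀ ν, B.label (g ν) = A.label ν)
    (hup : ∀ ε ν, A.up ε = Sum.inl ν → B.up (f ε) = Sum.inl (g ν))
    (hlo : ∀ ε ν, A.lo ε = Sum.inl ν → B.lo (f ε) = Sum.inl (g ν)) (r : Decorated X A φ ψ) :
    ∃ r' : Decorated X B (φ.rename f) (ψ.rename f),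
      (⟨_, _, r'.erase⟩ : Σ α β : Formula X, Structural α β) = ⟨_, _, r.erase⟩ ∧
        r'.vertex = g r.vertex := by
  cases r with
  | aiDown ν a ε₁ ε₂ hν hne h₁ h₂ =>
    exact ⟨.aiDown (g ν) a (f ε₁) (f ε₂) ((hl ν).trans hν) (hf.ne hne) (hup _ _ h₁) (hup _ _ h₂),
      rfl, rfl⟩
  | aiUp ν a ε₁ ε₂ hν hne h₁ h₂ =>
    exact ⟨.aiUp (g ν) a (f ε₁) (f ε₂) ((hl ν).trans hν) (hf.ne hne) (hlo _ _ h₁) (hlo _ _ h₂),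
      rfl, rfl⟩
  | awDown ν a ε hν h => exact ⟨.awDown (g ν) a (f ε) ((hl ν).trans hν) (hup _ _ h), rfl, rfl⟩
  | awUp ν a ε hν h => exact ⟨.awUp (g ν) a (f ε) ((hl ν).trans hν) (hlo _ _ h), rfl, rfl⟩
  | acDown ν a ε₁ ε₂ ε₃ hν hne h₁ h₂ h₃ =>
    exact ⟨.acDown (g ν) a (f ε₁) (f ε₂) (f ε₃) ((hl ν).trans hν) (hf.ne hne) (hlo _ _ h₁)
      (hlo _ _ h₂) (hup _ _ h₃), rfl, rfl⟩
  | acUp ν a ε₁ ε₂ ε₃ hν hne h₁ h₂ h₃ =>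
    exact ⟨.acUp (g ν) a (f ε₁) (f ε₂) (f ε₃) ((hl ν).trans hν) (hf.ne hne) (hlo _ _ h₁)
      (hup _ _ h₂) (hup _ _ h₃), rfl, rfl⟩

/-- Decorations can be transferred along embeddings of flows. -/
theorem StepLift.map (f : A.E → B.E) (g : A.V → B.V) (hf : Function.Injective f)
    (hl : ∀ ν, B.label (g ν) = A.label ν)
    (hup : ∀ ε ν, A.up ε = Sum.inl ν → B.up (f ε) = Sum.inl (g ν))
    (hlo : ∀ ε ν, A.lo ε = Sum.inl ν → B.lo (f ε) = Sum.inl (g ν)) (h : StepLift A s φ ψ l) :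
    StepLift B s (φ.rename f) (ψ.rename f) (l.map g) := by
  obtain ⟨s', rfl, rfl⟩ := h
  induction s' with
  | structural r =>
    obtain ⟨r', e, hv⟩ := r.exists_map f g hf hl hup hlo
    have := StepLift.structural e
    rw [hv] at this
    exact this
  | logical r => exact StepLift.logical (Logical.erase_map f r)
  | orLeft s γ ih => exact ih.orLeft (Formula.erase_rename f γ)
  | orRight γ s ih => exact ih.orRight (Formula.erase_rename f γ)
  | andLeft s γ ih => exact ih.andLeft (Formula.erase_rename f γ)
  | andRight γ s ih => exact ih.andRight (Formula.erase_rename f γ)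

theorem ChainLift.map {c : AnyChain X} (f : A.E → B.E) (g : A.V → B.V) (hf : Function.Injective f)
    (hl : ∀ ν, B.label (g ν) = A.label ν)
    (hup : ∀ ε ν, A.up ε = Sum.inl ν → B.up (f ε) = Sum.inl (g ν))
    (hlo : ∀ ε ν, A.lo ε = Sum.inl ν → B.lo (f ε) = Sum.inl (g ν)) (h : ChainLift A c φ ψ l) :
    ChainLift B c (φ.rename f) (ψ.rename f) (l.map g) := by
  obtain ⟨c', rfl, rfl⟩ := h
  induction c' with
  | nil α =>
    refine ⟨.nil _, ?_, rfl⟩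
    exact congrArg (fun α : Formula X => (⟨α, α, .nil α⟩ : AnyChain X)) (Formula.erase_rename f α)
  | cons s c ih =>
    have hs := StepLift.map (B := B) f g hf hl hup hlo ⟨s, rfl, rfl⟩
    exact List.map_append (f := g) ▸ ChainLift.cons hs ih

end

/-- A step can be decorated from its conclusion: this is immediate for logical steps, and for a
structural step it reduces to decorating the rule instance. -/
theorem Step.exists_lift {A : FlowGraph I J} {α β : Formula X} (s : Step (Structural (X := X)) α β)
    (φ : Formula (X × A.E)) (hφ : φ.erase = β) :
    (∃ φ', φ'.atoms.Perm φ.atoms ∧ StepLift A ⟨α, β, s⟩ φ' φ []) ∨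
    ∃ (α₀ β₀ : Formula X) (r : Structural α₀ β₀) (φ₀ : Formula (X × A.E)) (l : List (X × A.E)),
      φ₀.erase = β₀ ∧ φ.atoms.Perm (φ₀.atoms ++ l) ∧
      ∀ (B : FlowGraph I J) (f : A.E → B.E) (θ : Formula (X × B.E))
        (d : Decorated X B θ (φ₀.rename f)),
        (⟨_, _, d.erase⟩ : Σ α β : Formula X, Structural α β) = ⟨α₀, β₀, r⟩ →
        ∃ φ' : Formula (X × B.E), φ'.atoms.Perm (θ.atoms ++ l.map fun x => (x.1, f x.2)) ∧
          StepLift B ⟨α, β, s⟩ φ' (φ.rename f) [d.vertex] := by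
  have right : ∀ {Y : Type u} {a b c d : List Y}, a.Perm (b ++ c) →
      (a ++ d).Perm (b ++ (c ++ d)) := fun h => (h.append_right _).trans (by rw [List.append_assoc])
  have left : ∀ {Y : Type u} {a b c d : List Y}, a.Perm (b ++ c) →
      (d ++ a).Perm (b ++ (c ++ d)) := fun h => List.perm_append_comm.trans (right h)
  induction s generalizing φ with
  | structural r =>
    refine .inr ⟨_, _, r, φ, [], hφ, by rw [List.append_nil],
      fun B f θ d hd => ⟨θ, ?_, .structural hd⟩⟩
    rw [List.map_nil, List.append_nil]
  | logical r =>
    obtain ⟨φ', r', h⟩ := r.exists_erase φ hφ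
    exact .inl ⟨φ', r'.atoms_perm, .logical h⟩
  | orLeft s γ ih =>
    obtain ⟨φ, χ, rfl, hφ, hχ⟩ := Formula.eq_or_of_erase hφ
    rcases ih φ hφ with ⟨φ', h, h'⟩ | ⟨α₀, β₀, r, φ₀, l, e, h, H⟩
    · exact .inl ⟨or φ' χ, h.append_right _, h'.orLeft hχ⟩
    · refine .inr ⟨α₀, β₀, r, φ₀, l ++ χ.atoms, e, right h, fun B f θ d hd => ?_⟩
      obtain ⟨φ', h₁, h₂⟩ := H B f θ d hd
      refine ⟨or φ' (χ.rename f), ?_, h₂.orLeft ((Formula.erase_rename f χ).trans hχ)⟩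
      rw [List.map_append, ← Formula.atoms_rename]
      exact right h₁
  | orRight γ s ih =>
    obtain ⟨χ, φ, rfl, hχ, hφ⟩ := Formula.eq_or_of_erase hφ
    rcases ih φ hφ with ⟨φ', h, h'⟩ | ⟨α₀, β₀, r, φ₀, l, e, h, H⟩
    · exact .inl ⟨or χ φ', h.append_left _, h'.orRight hχ⟩
    · refine .inr ⟨α₀, β₀, r, φ₀, l ++ χ.atoms, e, left h, fun B f θ d hd => ?_⟩
      obtain ⟨φ', h₁, h₂⟩ := H B f θ d hd
      refine ⟨or (χ.rename f) φ', ?_, h₂.orRight ((Formula.erase_rename f χ).trans hχ)⟩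
      rw [List.map_append, ← Formula.atoms_rename]
      exact left h₁
  | andLeft s γ ih =>
    obtain ⟨φ, χ, rfl, hφ, hχ⟩ := Formula.eq_and_of_erase hφ
    rcases ih φ hφ with ⟨φ', h, h'⟩ | ⟨α₀, β₀, r, φ₀, l, e, h, H⟩
    · exact .inl ⟨and φ' χ, h.append_right _, h'.andLeft hχ⟩
    · refine .inr ⟨α₀, β₀, r, φ₀, l ++ χ.atoms, e, right h, fun B f θ d hd => ?_⟩
      obtain ⟨φ', h₁, h₂⟩ := H B f θ d hd
      refine ⟨and φ' (χ.rename f), ?_, h₂.andLeft ((Formula.erase_rename f χ).trans hχ)⟩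
      rw [List.map_append, ← Formula.atoms_rename]
      exact right h₁
  | andRight γ s ih =>
    obtain ⟨χ, φ, rfl, hχ, hφ⟩ := Formula.eq_and_of_erase hφ
    rcases ih φ hφ with ⟨φ', h, h'⟩ | ⟨α₀, β₀, r, φ₀, l, e, h, H⟩
    · exact .inl ⟨and χ φ', h.append_left _, h'.andRight hχ⟩
    · refine .inr ⟨α₀, β₀, r, φ₀, l ++ χ.atoms, e, left h, fun B f θ d hd => ?_⟩
      obtain ⟨φ', h₁, h₂⟩ := H B f θ d hd
      refine ⟨and (χ.rename f) φ', ?_, h₂.andRight ((Formula.erase_rename f χ).trans hχ)⟩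
      rw [List.map_append, ← Formula.atoms_rename]
      exact left h₁

end Bundles

/-! ### The flow of a derivation -/

/-- For every atom, it and its dual have different polarities. -/
theorem exists_atomPolarity (X : Type u) [DualAtoms X] :
    ∃ pol : X → Polarity, ∀ a, pol (bar a) ≠ pol a := by
  classical
  -- some linear order on the atoms decides which atom of a dual pair is positive
  let : LinearOrder X := linearOrderOfSTO WellOrderingRel
  refine ⟨fun a => if a < bar a then .pos else .neg, fun a => ?_⟩
  simp only [DualAtoms.bar_bar]
  rcases lt_trichotomy a (bar a) with h | h | h
  · rw [if_pos h, if_neg h.asymm]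
    nofun
  · exact (DualAtoms.bar_ne a h.symm).elim
  · rw [if_pos h, if_neg h.asymm]
    nofun

namespace FlowGraph

/-- A new vertex with label `l` is put on top of the upper edges in `T`; its upper edges are new,
they are the elements of `N`. -/
noncomputable def addTop (A : FlowGraph Unit Unit) (l : Label) (T : Set A.E) (N : Type) :
    FlowGraph Unit Unit where
  V := A.V ⊕ Unit
  E := A.E ⊕ N
  label := Sum.elim A.label fun _ => l
  up := Sum.elim (fun ε => open Classical in
    if ε ∈ T then Sum.inl (Sum.inr ()) else Sum.map Sum.inl id (A.up ε)) fun _ => Sum.inr ()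
  lo := Sum.elim (fun ε => Sum.map Sum.inl id (A.lo ε)) fun _ => Sum.inl (Sum.inr ())

section AddTop

variable {A : FlowGraph Unit Unit} {l : Label} {T : Set A.E} {N : Type}

theorem addTop_up_inl (hT : ∀ ε ∈ T, A.up ε = Sum.inr ()) {x : A.E ⊕ N} {ν : A.V} :
    (A.addTop l T N).up x = Sum.inl (Sum.inl ν) ↔ x ∈ Sum.inl '' A.lowerEdges ν := by
  rcases x with ε | n
  · refine Iff.trans ?_ ((Function.Injective.mem_set_image Sum.inl_injective).symm)
    classical
    change (if ε ∈ T then _ else Sum.map _ _ _) = _ ↔ A.up ε = _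
    split_ifs with h
    · rw [hT ε h]
      simp
    · exact FlowGraph.map_inl_eq_inl
  · exact ⟨nofun, nofun⟩

theorem addTop_up_new {x : A.E ⊕ N} :
    (A.addTop l T N).up x = Sum.inl (Sum.inr ()) ↔ x ∈ Sum.inl '' T := by
  rcases x with ε | n
  · refine Iff.trans ?_ ((Function.Injective.mem_set_image Sum.inl_injective).symm)
    classical
    change (if ε ∈ T then _ else Sum.map _ _ _) = _ ↔ _
    split_ifs with h
    · exact ⟨fun _ => h, fun _ => rfl⟩
    · exact ⟨fun e => (FlowGraph.map_inl_ne e).elim, fun e => (h e).elim⟩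
  · exact ⟨nofun, nofun⟩

theorem addTop_up_inr {ε : A.E} :
    (A.addTop l T N).up (Sum.inl ε) = Sum.inr () ↔ ε ∉ T ∧ A.up ε = Sum.inr () := by
  classical
  change (if ε ∈ T then _ else Sum.map _ _ _) = _ ↔ _
  split_ifs with h
  · exact ⟨nofun, fun e => (e.1 h).elim⟩
  · exact FlowGraph.map_inl_eq_inr.trans (and_iff_right h).symm

theorem addTop_lo_inl {x : A.E ⊕ N} {ν : A.V} :
    (A.addTop l T N).lo x = Sum.inl (Sum.inl ν) ↔ x ∈ Sum.inl '' A.upperEdges ν := by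
  rcases x with ε | n
  · exact FlowGraph.map_inl_eq_inl.trans
      (Function.Injective.mem_set_image (s := A.upperEdges ν) Sum.inl_injective).symm
  · exact ⟨nofun, nofun⟩

theorem addTop_lo_new {x : A.E ⊕ N} :
    (A.addTop l T N).lo x = Sum.inl (Sum.inr ()) ↔ x ∈ Set.range Sum.inr := by
  rcases x with ε | n
  · exact ⟨fun e => (FlowGraph.map_inl_ne e).elim, nofun⟩
  · exact ⟨fun _ => ⟨n, rfl⟩, fun _ => rfl⟩

theorem addTop_lo_inr {x : A.E ⊕ N} :
    (A.addTop l T N).lo x = Sum.inr () ↔ ∃ ε, x = Sum.inl ε ∧ A.lo ε = Sum.inr () := by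
  rcases x with ε | n
  · refine FlowGraph.map_inl_eq_inr.trans ⟨fun h => ⟨ε, rfl, h⟩, ?_⟩
    rintro ⟨_, e, h⟩
    exact Sum.inl_injective e ▸ h
  · exact ⟨nofun, nofun⟩

end AddTop

/-- The properties of a flow that do not depend on the names of the upper and lower edges. -/
structure IsPreflow (A : FlowGraph Unit Unit) : Prop where
  finite_V : Finite A.V
  finite_E : Finite A.E
  card_lower : ∀ ν, (A.lowerEdges ν).ncard = (A.label ν).lowerCard
  card_upper : ∀ ν, (A.upperEdges ν).ncard = (A.label ν).upperCard
  acyclic : ∀ ε, ¬ Relation.TransGen A.Below ε ε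

/-- The new edges are put before all others in the rank. -/
theorem IsPreflow.addTop {A : FlowGraph Unit Unit} (hA : A.IsPreflow) {l : Label} {T : Set A.E}
    {N : Type} [Finite N] (hT : ∀ ε ∈ T, A.up ε = Sum.inr ()) (hTc : T.ncard = l.lowerCard)
    (hN : Nat.card N = l.upperCard) : (A.addTop l T N).IsPreflow where
  finite_V := have := hA.finite_V; inferInstanceAs (Finite (A.V ⊕ Unit))
  finite_E := have := hA.finite_E; inferInstanceAs (Finite (A.E ⊕ N))
  card_lower := by
    rintro (ν | ν)
    · exact (congrArg Set.ncard (Set.ext fun x => addTop_up_inl hT)).trans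
        ((Set.ncard_image_of_injective _ Sum.inl_injective).trans (hA.card_lower ν))
    · exact (congrArg Set.ncard (Set.ext fun x => addTop_up_new)).trans
        ((Set.ncard_image_of_injective _ Sum.inl_injective).trans hTc)
  card_upper := by
    rintro (ν | ν)
    · exact (congrArg Set.ncard (Set.ext fun x => addTop_lo_inl)).trans
        ((Set.ncard_image_of_injective _ Sum.inl_injective).trans (hA.card_upper ν))
    · refine (congrArg Set.ncard (Set.ext fun x => addTop_lo_new)).trans ?_
      rw [← Set.image_univ, Set.ncard_image_of_injective _ Sum.inr_injective, Set.ncard_univ]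
      exact hN
  acyclic := by
    have := hA.finite_E
    obtain ⟨r, hr⟩ := exists_rank hA.acyclic
    refine not_transGen_self (Sum.elim (fun ε => r ε + 1) fun _ => 0 : A.E ⊕ N → ℕ) ?_
    rintro a b ⟨ν | ν, h₁, h₂⟩
    · obtain ⟨a, ha, rfl⟩ := addTop_lo_inl.1 h₁
      obtain ⟨b, hb, rfl⟩ := (addTop_up_inl hT).1 h₂
      exact Nat.succ_lt_succ (hr _ _ ⟨ν, ha, hb⟩)
    · obtain ⟨a, rfl⟩ := addTop_lo_new.1 h₁
      obtain ⟨b, hb, rfl⟩ := addTop_up_new.1 h₂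
      exact Nat.succ_pos _

theorem IsPolarity.addTop {A : FlowGraph Unit Unit} {π : A.E → Polarity} (hπ : A.IsPolarity π)
    {l : Label} {T : Set A.E} {N : Type} (hT : ∀ ε ∈ T, A.up ε = Sum.inr ()) {q : N → Polarity}
    (hc : l.IsContraction → π '' T ∪ Set.range q = {.neg} ∨ π '' T ∪ Set.range q = {.pos})
    (hi : l.IsInteraction → π '' T ∪ Set.range q = {.neg, .pos}) :
    (A.addTop l T N).IsPolarity (Sum.elim π q) := by
  rintro (ν | ν)
  · have e : Sum.elim π q '' (A.addTop l T N).edgesAt (Sum.inl ν) = π '' A.edgesAt ν := by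
      have h : (A.addTop l T N).edgesAt (Sum.inl ν) = Sum.inl '' A.edgesAt ν :=
        (Set.ext fun x => or_congr (addTop_up_inl hT) addTop_lo_inl).trans
          (Set.image_union _ _ _).symm
      exact (congrArg _ h).trans (Set.image_image _ _ _)
    exact e.symm ▸ hπ ν
  · have e : Sum.elim π q '' (A.addTop l T N).edgesAt (Sum.inr ν) = π '' T ∪ Set.range q := by
      have h : (A.addTop l T N).edgesAt (Sum.inr ν) = Sum.inl '' T ∪ Set.range Sum.inr :=
        Set.ext fun x => or_congr addTop_up_new addTop_lo_new
      refine (congrArg _ h).trans ((Set.image_union _ _ _).trans ?_)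
      exact congrArg₂ _ (Set.image_image _ _ _) (Set.range_comp _ _).symm
    exact ⟨fun h => e.symm ▸ hc h, fun h => e.symm ▸ hi h⟩

end FlowGraph

/-- The atom occurrences of a formula can be told apart by a decoration. -/
theorem Formula.exists_erase {X : Type u} (α : Formula X) :
    ∃ (E : Type) (φ : Formula (X × E)), Finite E ∧ φ.erase = α ∧
      (φ.atoms.map Prod.snd).Nodup ∧ ∀ ε, ε ∈ φ.atoms.map Prod.snd := by
  have two : ∀ {E F : Type} {φ : Formula (X × E)} {ψ : Formula (X × F)},
      (φ.atoms.map Prod.snd).Nodup → (∀ ε, ε ∈ φ.atoms.map Prod.snd) →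
      (ψ.atoms.map Prod.snd).Nodup → (∀ ε, ε ∈ ψ.atoms.map Prod.snd) →
      (((φ.rename (Sum.inl : E → E ⊕ F)).atoms ++ (ψ.rename (Sum.inr : F → E ⊕ F)).atoms).map
        Prod.snd).Nodup ∧ ∀ ε, ε ∈ ((φ.rename (Sum.inl : E → E ⊕ F)).atoms ++
          (ψ.rename (Sum.inr : F → E ⊕ F)).atoms).map Prod.snd := by
    intro E F φ ψ h₁ h₂ h₃ h₄
    have e : ((φ.rename (Sum.inl : E → E ⊕ F)).atoms ++
        (ψ.rename (Sum.inr : F → E ⊕ F)).atoms).map Prod.snd =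
        (φ.atoms.map Prod.snd).map Sum.inl ++ (ψ.atoms.map Prod.snd).map Sum.inr := by
      simp only [Formula.atoms_rename, List.map_append, List.map_map]
      rfl
    rw [e]
    refine ⟨List.nodup_append.2 ⟨h₁.map Sum.inl_injective, h₃.map Sum.inr_injective, ?_⟩, ?_⟩
    · rintro _ h _ h' rfl
      obtain ⟨_, -, rfl⟩ := List.mem_map.1 h
      obtain ⟨_, -, e⟩ := List.mem_map.1 h'
      cases e
    · rintro (ε | ε)
      · exact List.mem_append_left _ (List.mem_map_of_mem (h₂ ε))
      · exact List.mem_append_right _ (List.mem_map_of_mem (h₄ ε))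
  induction α with
  | ff => exact ⟨Empty, ff, inferInstance, rfl, List.nodup_nil, nofun⟩
  | tt => exact ⟨Empty, tt, inferInstance, rfl, List.nodup_nil, nofun⟩
  | atom a => exact ⟨Unit, atom (a, ()), inferInstance, rfl, List.nodup_singleton _,
      fun _ => List.mem_singleton.2 rfl⟩
  | or α β ihα ihβ =>
    obtain ⟨E, φ, _, rfl, h₁, h₂⟩ := ihα
    obtain ⟨F, ψ, _, rfl, h₃, h₄⟩ := ihβ
    exact ⟨E ⊕ F, or (φ.rename Sum.inl) (ψ.rename Sum.inr), inferInstance,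
      congrArg₂ or (Formula.erase_rename _ _) (Formula.erase_rename _ _), two h₁ h₂ h₃ h₄⟩
  | and α β ihα ihβ =>
    obtain ⟨E, φ, _, rfl, h₁, h₂⟩ := ihα
    obtain ⟨F, ψ, _, rfl, h₃, h₄⟩ := ihβ
    exact ⟨E ⊕ F, and (φ.rename Sum.inl) (ψ.rename Sum.inr), inferInstance,
      congrArg₂ and (Formula.erase_rename _ _) (Formula.erase_rename _ _), two h₁ h₂ h₃ h₄⟩

/-- `FlowOf pol c A φ ψ`: the flow `A`, whose upper and lower edges have no names yet, is associated
with the chain `c` by the decoration `φ` of its premiss and `ψ` of its conclusion. The polarity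
assignment given by `pol` on the premiss is kept for the induction. -/
structure FlowOf {X : Type u} [DualAtoms X] (pol : X → Polarity) (c : AnyChain X)
    (A : FlowGraph Unit Unit) (φ ψ : Formula (X × A.E)) : Prop where
  lift : ∃ l, ChainLift A c φ ψ l ∧ l.Nodup ∧ ∀ ν, ν ∈ l
  isPreflow : A.IsPreflow
  nodup_upper : (φ.atoms.map Prod.snd).Nodup
  mem_upper : ∀ ε, ε ∈ φ.atoms.map Prod.snd ↔ A.up ε = Sum.inr ()
  nodup_lower : (ψ.atoms.map Prod.snd).Nodup
  mem_lower : ∀ ε, ε ∈ ψ.atoms.map Prod.snd ↔ A.lo ε = Sum.inr ()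
  polarity : ∃ π, A.IsPolarity π ∧ ∀ x ∈ φ.atoms, π x.2 = pol x.1

section FlowOf

variable {X : Type u} [DualAtoms X] {pol : X → Polarity}

/-- The flow of a derivation without steps has an edge for each atom occurrence and no vertex. -/
theorem exists_flowOf_nil (α : Formula X) :
    ∃ A φ ψ, FlowOf pol ⟨α, α, .nil α⟩ A φ ψ := by
  obtain ⟨E, φ, _, rfl, hn, hm⟩ := α.exists_erase
  have h : ∀ ε, ∃ x ∈ φ.atoms, x.2 = ε := fun ε => List.mem_map.1 (hm ε)
  choose x hx hx' using h
  refine ⟨⟨Empty, E, nofun, fun _ => .inr (), fun _ => .inr ()⟩, φ, φ,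
    ⟨[], ⟨.nil φ, rfl, rfl⟩, List.nodup_nil, nofun⟩,
    ⟨inferInstanceAs (Finite Empty), ‹_›, nofun, nofun, ?_⟩, hn, fun ε => iff_of_true (hm ε) rfl,
    hn, fun ε => iff_of_true (hm ε) rfl, fun ε => pol (x ε).1, nofun, fun y hy => ?_⟩
  · exact not_transGen_self (fun _ => 0) fun a b h => by obtain ⟨ν, -⟩ := h; cases ν
  · exact congrArg (fun z => pol z.1) (List.inj_on_of_nodup_map hn (hx y.2) hy (hx' y.2))

/-- A structural step on top of a derivation adds a vertex on top of the flow. -/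
theorem FlowOf.exists_cons_structural {α β γ α₀ β₀ : Formula X} {s : Step (Structural (X := X)) α β}
    {c : Chain (Structural (X := X)) β γ} {A : FlowGraph Unit Unit} {φ ψ : Formula (X × A.E)}
    (h : FlowOf pol ⟨β, γ, c⟩ A φ ψ) {r : Structural α₀ β₀} {φ₀ : Formula (X × A.E)}
    {l : List (X × A.E)} (hl : φ.atoms.Perm (φ₀.atoms ++ l))
    (H : ∀ (B : FlowGraph Unit Unit) (f : A.E → B.E) (θ : Formula (X × B.E))
        (d : Decorated X B θ (φ₀.rename f)),
        (⟨_, _, d.erase⟩ : Σ α β : Formula X, Structural α β) = ⟨α₀, β₀, r⟩ →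
        ∃ φ' : Formula (X × B.E), φ'.atoms.Perm (θ.atoms ++ l.map fun x => (x.1, f x.2)) ∧
          StepLift B ⟨α, β, s⟩ φ' (φ.rename f) [d.vertex])
    (a : Label) {N : Type} [Finite N] (hN : Nat.card N = a.upperCard)
    {T : Set A.E} (hTdef : T = {ε | ε ∈ φ₀.atoms.map Prod.snd})
    (hT : φ₀.atoms.length = a.lowerCard) {θ : Formula (X × (A.E ⊕ N))} (q : N → Polarity)
    (hθ : (θ.atoms.map Prod.snd).Nodup)
    (hθ' : ∀ x, x ∈ θ.atoms.map Prod.snd ↔ x ∈ Set.range Sum.inr)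
    (hq : ∀ x ∈ θ.atoms, ∀ n, x.2 = Sum.inr n → q n = pol x.1)
    (hc : a.IsContraction → ∃ p, (∀ x ∈ φ₀.erase.atoms, pol x = p) ∧ ∀ n, q n = p)
    (hi : a.IsInteraction → ∃ p p', p ≠ p' ∧ p ∈ pol '' {x | x ∈ φ₀.erase.atoms} ∪ Set.range q ∧
      p' ∈ pol '' {x | x ∈ φ₀.erase.atoms} ∪ Set.range q)
    (d : Decorated X (A.addTop a T N) θ
      (φ₀.rename (Sum.inl : A.E → A.E ⊕ N)))
    (hd : (⟨_, _, d.erase⟩ : Σ α β : Formula X, Structural α β) = ⟨α₀, β₀, r⟩)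
    (hv : d.vertex = Sum.inr ()) :
    ∃ A φ ψ, FlowOf pol ⟨α, γ, .cons s c⟩ A φ ψ := by
  -- the old decoration is renamed into the new flow, and the new rule instance is `d`
  obtain ⟨φ', hφ', hs⟩ := H (A.addTop a T N) Sum.inl θ d hd
  obtain ⟨L, hL, hLn, hLm⟩ := h.lift
  obtain ⟨π, hπ, hπφ⟩ := h.polarity
  have hmem : ∀ ε, ε ∈ φ.atoms.map Prod.snd ↔ ε ∈ φ₀.atoms.map Prod.snd ∨ ε ∈ l.map Prod.snd := by
    intro ε
    rw [(hl.map Prod.snd).mem_iff, List.map_append, List.mem_append]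
  have hnd : ((φ₀.atoms.map Prod.snd) ++ l.map Prod.snd).Nodup := by
    rw [← List.map_append]
    exact (hl.map Prod.snd).nodup_iff.1 h.nodup_upper
  obtain ⟨hn₀, hnl, hdis⟩ := List.nodup_append.1 hnd
  have hTm : ∀ ε, ε ∈ T ↔ ε ∈ φ₀.atoms.map Prod.snd := fun ε => by rw [hTdef]; rfl
  have hTup : ∀ ε ∈ T, A.up ε = Sum.inr () := fun ε hε =>
    (h.mem_upper ε).1 ((hmem ε).2 (.inl ((hTm ε).1 hε)))
  have hTc : T.ncard = a.lowerCard := by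
    classical
    have e : T = ((φ₀.atoms.map Prod.snd).toFinset : Set A.E) := by
      ext ε
      simp [hTdef]
    rw [e, Set.ncard_coe_finset, List.toFinset_card_of_nodup hn₀, List.length_map, hT]
  have hπT : π '' T = pol '' {x | x ∈ φ₀.erase.atoms} := by
    ext p
    constructor
    · rintro ⟨ε, hε, rfl⟩
      obtain ⟨x, hx, rfl⟩ := List.mem_map.1 ((hTm ε).1 hε)
      refine ⟨x.1, ?_, (hπφ x (hl.mem_iff.2 (List.mem_append_left _ hx))).symm⟩
      exact (Formula.atoms_map _ _ : φ₀.erase.atoms = _) ▸ List.mem_map_of_mem hx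
    · rintro ⟨b, hb, rfl⟩
      obtain ⟨x, hx, rfl⟩ := List.mem_map.1
        ((Formula.atoms_map _ _ : φ₀.erase.atoms = _) ▸ hb : b ∈ φ₀.atoms.map Prod.fst)
      exact ⟨x.2, (hTm _).2 (List.mem_map_of_mem hx),
        hπφ x (hl.mem_iff.2 (List.mem_append_left _ hx))⟩
  have el : (l.map fun x => (x.1, (Sum.inl x.2 : A.E ⊕ N))).map Prod.snd =
      (l.map Prod.snd).map Sum.inl := by simp
  have eφ' : (φ'.atoms.map Prod.snd).Perm
      (θ.atoms.map Prod.snd ++ (l.map Prod.snd).map (Sum.inl : A.E → A.E ⊕ N)) :=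
    (hφ'.map _).trans (.of_eq (List.map_append.trans (congrArg _ el)))
  have eψ : (ψ.rename (Sum.inl : A.E → A.E ⊕ N)).atoms.map Prod.snd =
      (ψ.atoms.map Prod.snd).map Sum.inl := by
    rw [Formula.atoms_rename, List.map_map, List.map_map]
    rfl
  refine ⟨A.addTop a T N, φ', ψ.rename Sum.inl, ⟨_, ChainLift.cons hs
    (hL.map (B := A.addTop a T N) Sum.inl Sum.inl Sum.inl_injective (fun ν => rfl)
      (fun ε ν h => (addTop_up_inl hTup).2 ⟨ε, h, rfl⟩) (fun ε ν h => addTop_lo_inl.2 ⟨ε, h, rfl⟩)),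
    ?_, ?_⟩, h.isPreflow.addTop hTup hTc hN, ?_, ?_, ?_, ?_,
    ⟨Sum.elim π q, hπ.addTop hTup (fun ha => ?_) (fun ha => ?_), ?_⟩⟩
  · rw [hv]
    refine List.nodup_cons.2 ⟨fun h => ?_, hLn.map Sum.inl_injective⟩
    obtain ⟨_, -, e⟩ := List.mem_map.1 h
    cases e
  · rw [hv]
    rintro (ν | ν)
    · exact List.mem_cons_of_mem _ (List.mem_map_of_mem (hLm ν))
    · exact List.mem_cons_self
  · refine eφ'.nodup_iff.2 (List.nodup_append.2 ⟨hθ, hnl.map Sum.inl_injective, ?_⟩)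
    rintro _ h _ h' rfl
    obtain ⟨_, rfl⟩ := (hθ' _).1 h
    obtain ⟨_, -, e⟩ := List.mem_map.1 h'
    cases e
  · intro x
    refine eφ'.mem_iff.trans (List.mem_append.trans ?_)
    rcases x with ε | n
    · refine Iff.trans ?_ addTop_up_inr.symm
      refine (or_congr (hθ' (Sum.inl ε))
        (List.mem_map_of_injective (f := (Sum.inl : A.E → A.E ⊕ N)) Sum.inl_injective)).trans ?_
      rw [← h.mem_upper, hmem]
      constructor
      · rintro (⟨_, e⟩ | h)
        · cases e
        · exact ⟨fun h' => hdis _ ((hTm _).1 h') _ h rfl, .inr h⟩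
      · rintro ⟨h, h' | h'⟩
        · exact (h ((hTm _).2 h')).elim
        · exact .inr h'
    · exact iff_of_true (.inl ((hθ' _).2 ⟨n, rfl⟩)) rfl
  · exact (List.Perm.of_eq eψ).nodup_iff.2 (h.nodup_lower.map Sum.inl_injective)
  · intro x
    refine (List.Perm.of_eq eψ).mem_iff.trans <|
      List.mem_map.trans (Iff.trans ?_ addTop_lo_inr.symm)
    exact exists_congr fun ε => ⟨fun e => ⟨e.2.symm, (h.mem_lower ε).1 e.1⟩,
      fun e => ⟨(h.mem_lower ε).2 e.2, e.1.symm⟩⟩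
  · obtain ⟨p, h₁, h₂⟩ := hc ha
    have hpos : 0 < Nat.card N := by rcases ha with rfl | rfl <;> rw [hN] <;> decide
    obtain ⟨n⟩ := (Nat.card_pos_iff.1 hpos).1
    have e : π '' T ∪ Set.range q = {p} := by
      rw [hπT]
      refine Set.Subset.antisymm ?_ (Set.singleton_subset_iff.2 (.inr ⟨n, h₂ n⟩))
      rintro _ (⟨x, hx, rfl⟩ | ⟨n, rfl⟩)
      exacts [h₁ x hx, h₂ n]
    rw [e]
    cases p
    exacts [.inl rfl, .inr rfl]
  · obtain ⟨p, p', hne, h₁, h₂⟩ := hi ha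
    rw [hπT]
    refine Set.ext fun r => iff_of_true ?_ (by cases r <;> simp)
    cases r <;> cases p <;> cases p' <;> first | exact (hne rfl).elim | exact h₁ | exact h₂
  · intro x hx
    rcases List.mem_append.1 (hφ'.mem_iff.1 hx) with hx | hx
    · obtain ⟨n, hn⟩ := (hθ' _).1 (List.mem_map_of_mem hx)
      rw [← hn]
      exact hq x hx n hn.symm
    · obtain ⟨y, hy, rfl⟩ := List.mem_map.1 hx
      exact hπφ y (hl.mem_iff.2 (List.mem_append_right _ hy))

/-- A logical step on top of a derivation permutes the atom occurrences and keeps the flow; the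
other steps are dealt with by `FlowOf.exists_cons_structural`. -/
theorem FlowOf.exists_cons (hpol : ∀ a, pol (bar a) ≠ pol a) {α β γ : Formula X}
    (s : Step (Structural (X := X)) α β) {c : Chain (Structural (X := X)) β γ}
    {A : FlowGraph Unit Unit} {φ ψ : Formula (X × A.E)} (h : FlowOf pol ⟨β, γ, c⟩ A φ ψ) :
    ∃ A φ ψ, FlowOf pol ⟨α, γ, .cons s c⟩ A φ ψ := by
  have hφ : φ.erase = β := by
    obtain ⟨_, ⟨c', e, -⟩, -⟩ := h.lift
    exact congrArg (fun c : AnyChain X => c.1) e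
  rcases s.exists_lift φ hφ with ⟨φ', hp, hs⟩ | ⟨α₀, β₀, r, φ₀, l, rfl, hl, H⟩
  · obtain ⟨L, hL, hn, hm⟩ := h.lift
    obtain ⟨π, hπ, hπφ⟩ := h.polarity
    exact ⟨A, φ', ψ, ⟨L, .cons hs hL, hn, hm⟩, h.isPreflow, (hp.map _).nodup_iff.2 h.nodup_upper,
      fun ε => (hp.map _).mem_iff.trans (h.mem_upper ε), h.nodup_lower, h.mem_lower, π, hπ,
      fun x hx => hπφ x (hp.mem_iff.1 hx)⟩
  have hn₀ : (φ₀.atoms.map Prod.snd).Nodup := by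
    have := (hl.map Prod.snd).nodup_iff.1 h.nodup_upper
    rw [List.map_append] at this
    exact (List.nodup_append.1 this).1
  generalize hβ : φ₀.erase = β₀ at r H
  cases r with
  | aiDown a =>
    obtain ⟨_, _, rfl, h₁, h₂⟩ := Formula.eq_or_of_erase hβ
    obtain ⟨ε₁, rfl⟩ := Formula.eq_atom_of_erase h₁
    obtain ⟨ε₂, rfl⟩ := Formula.eq_atom_of_erase h₂
    have hne : ε₁ ≠ ε₂ := fun e => (List.nodup_cons.1 hn₀).1 (List.mem_singleton.2 e)
    let d := Decorated.aiDown (A := A.addTop .aiDown {ε₁, ε₂} (Fin 0)) (Sum.inr ()) a (Sum.inl ε₁)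
      (Sum.inl ε₂) rfl (Sum.inl_injective.ne hne)
      (addTop_up_new.2 ⟨ε₁, .inl rfl, rfl⟩) (addTop_up_new.2 ⟨ε₂, .inr rfl, rfl⟩)
    exact h.exists_cons_structural hl H .aiDown (N := Fin 0) (T := {ε₁, ε₂}) (θ := tt) (q := nofun)
      (by simp; rfl) (by ext; simp [Formula.atoms]) rfl List.nodup_nil (by simp [Formula.atoms])
      (by simp [Formula.atoms]) (fun e => by rcases e with e | e <;> cases e)
      (fun _ => ⟨_, _, hpol a, .inl ⟨_, List.mem_cons_of_mem _ List.mem_cons_self, rfl⟩,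
        .inl ⟨_, List.mem_cons_self, rfl⟩⟩) d rfl rfl
  | aiUp a =>
    obtain rfl := Formula.eq_ff_of_erase hβ
    let d := Decorated.aiUp (A := A.addTop .aiUp ∅ (Fin 2)) (Sum.inr ()) a (Sum.inr 0) (Sum.inr 1)
      rfl (Sum.inr_injective.ne (show (0 : Fin 2) ≠ 1 by decide))
      (addTop_lo_new.2 ⟨0, rfl⟩) (addTop_lo_new.2 ⟨1, rfl⟩)
    exact h.exists_cons_structural hl H .aiUp (N := Fin 2) (T := ∅)
      (θ := and (atom (a, Sum.inr 0)) (atom (bar a, Sum.inr 1))) (q := ![pol a, pol (bar a)])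
      (by simp; rfl) (by ext; simp [Formula.atoms]) rfl (by simp [Formula.atoms])
      (by simp [Formula.atoms, Fin.exists_fin_two, eq_comm])
      (by simp [Formula.atoms, Fin.forall_fin_two]) (fun e => by rcases e with e | e <;> cases e)
      (fun _ => ⟨_, _, hpol a, .inr ⟨1, rfl⟩, .inr ⟨0, rfl⟩⟩) d rfl rfl
  | awDown a =>
    obtain ⟨ε, rfl⟩ := Formula.eq_atom_of_erase hβ
    let d := Decorated.awDown (A := A.addTop .awDown {ε} (Fin 0)) (Sum.inr ()) a (Sum.inl ε) rfl
      (addTop_up_new.2 ⟨ε, rfl, rfl⟩)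
    exact h.exists_cons_structural hl H .awDown (N := Fin 0) (T := {ε}) (θ := ff) (q := nofun)
      (by simp; rfl) (by ext; simp [Formula.atoms]) rfl List.nodup_nil (by simp [Formula.atoms])
      (by simp [Formula.atoms]) (fun e => by rcases e with e | e <;> cases e)
      (fun e => by rcases e with e | e <;> cases e) d rfl rfl
  | awUp a =>
    obtain rfl := Formula.eq_tt_of_erase hβ
    let d := Decorated.awUp (A := A.addTop .awUp ∅ (Fin 1)) (Sum.inr ()) a (Sum.inr 0) rfl
      (addTop_lo_new.2 ⟨0, rfl⟩)
    exact h.exists_cons_structural hl H .awUp (N := Fin 1) (T := ∅) (θ := atom (a, Sum.inr 0))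
      (q := fun _ => pol a) (by simp; rfl) (by ext; simp [Formula.atoms]) rfl
      (by simp [Formula.atoms]) (by simp [Formula.atoms, eq_comm])
      (by simp [Formula.atoms]) (fun e => by rcases e with e | e <;> cases e)
      (fun e => by rcases e with e | e <;> cases e) d rfl rfl
  | acDown a =>
    obtain ⟨ε, rfl⟩ := Formula.eq_atom_of_erase hβ
    let d := Decorated.acDown (A := A.addTop .acDown {ε} (Fin 2)) (Sum.inr ()) a (Sum.inr 0)
      (Sum.inr 1)
      (Sum.inl ε) rfl (Sum.inr_injective.ne (show (0 : Fin 2) ≠ 1 by decide))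
      (addTop_lo_new.2 ⟨0, rfl⟩) (addTop_lo_new.2 ⟨1, rfl⟩) (addTop_up_new.2 ⟨ε, rfl, rfl⟩)
    exact h.exists_cons_structural hl H .acDown (N := Fin 2) (T := {ε})
      (θ := or (atom (a, Sum.inr 0)) (atom (a, Sum.inr 1))) (q := fun _ => pol a)
      (by simp; rfl) (by ext; simp [Formula.atoms]) rfl (by simp [Formula.atoms])
      (by simp [Formula.atoms, Fin.exists_fin_two, eq_comm])
      (by simp [Formula.atoms])
      (fun _ => ⟨pol a, fun x hx => congrArg pol (List.mem_singleton.1 hx), fun _ => rfl⟩)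
      (fun e => by rcases e with e | e <;> cases e) d rfl rfl
  | acUp a =>
    obtain ⟨_, _, rfl, h₁, h₂⟩ := Formula.eq_and_of_erase hβ
    obtain ⟨ε₁, rfl⟩ := Formula.eq_atom_of_erase h₁
    obtain ⟨ε₂, rfl⟩ := Formula.eq_atom_of_erase h₂
    have hne : ε₁ ≠ ε₂ := fun e => (List.nodup_cons.1 hn₀).1 (List.mem_singleton.2 e)
    let d := Decorated.acUp (A := A.addTop .acUp {ε₁, ε₂} (Fin 1)) (Sum.inr ()) a (Sum.inr 0)
      (Sum.inl ε₁) (Sum.inl ε₂) rfl (Sum.inl_injective.ne hne)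
      (addTop_lo_new.2 ⟨0, rfl⟩) (addTop_up_new.2 ⟨ε₁, .inl rfl, rfl⟩)
      (addTop_up_new.2 ⟨ε₂, .inr rfl, rfl⟩)
    exact h.exists_cons_structural hl H .acUp (N := Fin 1) (T := {ε₁, ε₂})
      (θ := atom (a, Sum.inr 0)) (q := fun _ => pol a)
      (by simp; rfl) (by ext; simp [Formula.atoms]) rfl (by simp [Formula.atoms])
      (by simp [Formula.atoms, eq_comm]) (by simp [Formula.atoms])
      (fun _ => ⟨pol a, fun x hx => by
        rcases List.mem_pair.1 hx with rfl | rfl <;> rfl, fun _ => rfl⟩)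
      (fun e => by rcases e with e | e <;> cases e) d rfl rfl

theorem exists_flowOf (hpol : ∀ a, pol (bar a) ≠ pol a) {α β : Formula X}
    (c : Chain (Structural (X := X)) α β) : ∃ A φ ψ, FlowOf pol ⟨α, β, c⟩ A φ ψ := by
  induction c with
  | nil α => exact exists_flowOf_nil α
  | cons s c ih =>
    obtain ⟨A, φ, ψ, h⟩ := ih
    exact h.exists_cons hpol s

end FlowOf

/-- The end of an edge; if it is not a vertex, then the edge is made its own name. -/
def nameEnd {E V : Type} (f : E → V ⊕ Unit) (ε : E) : V ⊕ {ε // f ε = Sum.inr ()} :=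
  match h : f ε with
  | .inl ν => .inl ν
  | .inr _ => .inr ⟨ε, h⟩

theorem nameEnd_inl {E V : Type} {f : E → V ⊕ Unit} {ε : E} {ν : V} :
    nameEnd f ε = Sum.inl ν ↔ f ε = Sum.inl ν := by
  unfold nameEnd
  split <;> simp_all

theorem nameEnd_inr {E V : Type} {f : E → V ⊕ Unit} {ε : E} {i : {ε // f ε = Sum.inr ()}} :
    nameEnd f ε = Sum.inr i ↔ ε = i := by
  unfold nameEnd
  split
  next h =>
    refine iff_of_false nofun ?_
    rintro rfl
    cases h.symm.trans i.2
  next h => exact Sum.inr_injective.eq_iff.trans Subtype.ext_iff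

/-- The upper and lower edges become their own names. -/
def FlowGraph.named (A : FlowGraph Unit Unit) :
    FlowGraph {ε // A.up ε = Sum.inr ()} {ε // A.lo ε = Sum.inr ()} where
  V := A.V
  E := A.E
  label := A.label
  up := nameEnd A.up
  lo := nameEnd A.lo

theorem FlowGraph.IsPreflow.named {A : FlowGraph Unit Unit} (h : A.IsPreflow) : A.named.IsFlow where
  finite_V := h.finite_V
  finite_E := h.finite_E
  upper_named i := ⟨i.1, nameEnd_inr.2 rfl, fun _ => nameEnd_inr.1⟩
  lower_named i := ⟨i.1, nameEnd_inr.2 rfl, fun _ => nameEnd_inr.1⟩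
  card_lower ν := (congrArg Set.ncard (Set.ext fun _ => nameEnd_inl)).trans (h.card_lower ν)
  card_upper ν := (congrArg Set.ncard (Set.ext fun _ => nameEnd_inl)).trans (h.card_upper ν)
  acyclic := by
    have := h.finite_E
    obtain ⟨r, hr⟩ := exists_rank h.acyclic
    refine not_transGen_self r ?_
    rintro a b ⟨ν, h₁, h₂⟩
    exact hr _ _ ⟨ν, nameEnd_inl.1 h₁, nameEnd_inl.1 h₂⟩

theorem FlowGraph.IsPolarity.named {A : FlowGraph Unit Unit} {π : A.E → Polarity}
    (h : A.IsPolarity π) : A.named.IsPolarity π := by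
  intro ν
  have e : A.named.edgesAt ν = A.edgesAt ν := Set.ext fun _ => or_congr nameEnd_inl nameEnd_inl
  rw [e]
  exact h ν

variable {X : Type u} [DualAtoms X]

/-- Every derivation has an associated flow. -/
theorem SKSDerivation.exists_hasFlow (Φ : SKSDerivation X) :
    ∃ (I J : Type) (A : PolarizedFlow I J), Φ.HasFlow A.toAtomicFlow := by
  obtain ⟨pol, hpol⟩ := exists_atomPolarity X
  obtain ⟨A, φ, ψ, h⟩ := exists_flowOf hpol Φ.steps
  obtain ⟨l, hl, hn, hm⟩ := h.lift
  obtain ⟨π, hπ, -⟩ := h.polarity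
  obtain ⟨c, hc, hcl⟩ := ChainLift.map (A := A) (B := A.named) (fun ε => ε) (fun ν => ν)
    Function.injective_id (fun _ => rfl) (fun _ _ h => nameEnd_inl.2 h)
    (fun _ _ h => nameEnd_inl.2 h) hl
  have hrename : ∀ χ : Formula (X × A.E), (χ.rename fun ε : A.E => ε) = χ := Formula.map_id
  refine ⟨_, _, ⟨h.isPreflow.named.toAtomicFlow ⟨π, hπ.named⟩, π, hπ.named⟩, φ.rename (fun ε => ε),
    ψ.rename (fun ε => ε), c, ?_, ?_, ?_, ?_, ?_, ?_, ?_⟩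
  · exact (congrArg (fun c : AnyChain X => (⟨c.1, c.2.1, c.2.2⟩ : SKSDerivation X)) hc).symm
  · exact hcl.symm ▸ hn.map Function.injective_id
  · exact fun ν => hcl.symm ▸ List.mem_map_of_mem (f := fun ν => ν) (hm ν)
  · exact (congrArg (fun χ => (χ.atoms.map Prod.snd).Nodup) (hrename φ)).mpr h.nodup_upper
  · exact fun ε => (iff_of_eq (congrArg (fun χ => ε ∈ χ.atoms.map Prod.snd) (hrename φ))).trans <|
      (h.mem_upper ε).trans ⟨fun e => ⟨⟨ε, e⟩, nameEnd_inr.2 rfl⟩,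
        fun ⟨i, hi⟩ => nameEnd_inr.1 hi ▸ i.2⟩
  · exact (congrArg (fun χ => (χ.atoms.map Prod.snd).Nodup) (hrename ψ)).mpr h.nodup_lower
  · exact fun ε => (iff_of_eq (congrArg (fun χ => ε ∈ χ.atoms.map Prod.snd) (hrename ψ))).trans <|
      (h.mem_lower ε).trans ⟨fun e => ⟨⟨ε, e⟩, nameEnd_inr.2 rfl⟩,
        fun ⟨i, hi⟩ => nameEnd_inr.1 hi ▸ i.2⟩

end AtomicFlows

theorem mainTheorem4 {X : Type*} [DualAtoms X] (Φ₀ : SKSDerivation X) :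
    (∃ (I J : Type) (A₀ : PolarizedFlow I J), Φ₀.HasFlow A₀.toAtomicFlow) ∧
    ∀ (I J : Type) (A₀ : PolarizedFlow I J), Φ₀.HasFlow A₀.toAtomicFlow →
      (¬ ∃ s : ℕ → PolarizedFlow I J, s 0 = A₀ ∧ ∀ n, NegativeCStep (s n) (s (n + 1))) ∧
      ∀ A₁ : PolarizedFlow I J, Relation.ReflTransGen NegativeCStep A₀ A₁ →
        ((∃ ν, A₁.IsNegativeOnCycle ν) → ∃ A, NegativeCStep A₁ A) ∧
        ((¬ ∃ ν, A₁.IsNegativeOnCycle ν) →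
          (∀ l, A₁.IsAiCycle l → A₁.IsFragileCycle l) ∧
          (∃ Φ₁ : SKSDerivation X, Φ₁.SameEnds Φ₀ ∧ Φ₁.HasFlow A₁.toAtomicFlow) ∧
          (∃ A₂ : AtomicFlow I J, BreakCycles A₁.toAtomicFlow A₂) ∧
          ∀ A₂ : AtomicFlow I J, BreakCycles A₁.toAtomicFlow A₂ →
            A₂.CycleFree ∧
            ∀ Φ₁ : SKSDerivation X, Φ₁.SameEnds Φ₀ → Φ₁.HasFlow A₁.toAtomicFlow →
              ∃ Φ₂ : SKSDerivation X, Φ₂.SameEnds Φ₀ ∧ Φ₂.HasFlow A₂) := by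
  refine ⟨Φ₀.exists_hasFlow, fun I J A₀ h₀ => ⟨not_exists_chain_negativeCStep A₀, fun A₁ h =>
    ⟨A₁.exists_negativeCStep, fun hA₁ => ?_⟩⟩⟩
  have fragile : ∀ l, A₁.IsAiCycle l → A₁.IsFragileCycle l := fun _ => A₁.isFragileCycle hA₁
  refine ⟨fragile, ?_, exists_breakCycles _, fun A₂ h₂ =>
    ⟨h₂.cycleFree fun l hl => (fragile l hl).2, fun Φ₁ he h₁ => ?_⟩⟩
  · obtain ⟨α, β, kI, kJ, hα, hβ, eα, eβ, hd⟩ := h₀.derivable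
    have hd₁ : A₁.Derivable kI α kJ β := by
      clear hA₁ fragile
      induction h with
      | refl => exact hd
      | tail _ h ih => exact h.derivable ih
    obtain ⟨Φ₁, e, e', hΦ⟩ := hd₁.exists_hasFlow hα hβ
    exact ⟨Φ₁, ⟨e.trans eα.symm, e'.trans eβ.symm⟩, hΦ⟩
  · obtain ⟨α, β, kI, kJ, hα, hβ, eα, eβ, hd⟩ := h₁.derivable
    obtain ⟨Φ₂, e, e', hΦ⟩ := (h₂.derivable hα hβ hd).exists_hasFlow hα hβ
    exact ⟨Φ₂, ⟨e.trans (eα.symm.trans he.1), e'.trans (eβ.symm.trans he.2)⟩, hΦ⟩
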